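/- **The calculus.** Names are natural numbers. Processes of the asynchronous polyadic $\pi$-calculus are $P ::= 0 \mid a(\tilde b).P \mid \overline a\langle\tilde b\rangle \mid P_1|P_2 \mid (\nu a{:}L)P \mid\, !a(\tilde b).P \mid ((a)P)\langle b\rangle$ (an inert, untypable process $\mathsf{wrong}$ is admitted as well); an *agent* is a process or an abstraction $(a)P$; agents are identified up to $\alpha$-conversion. Transitions $P\xrightarrow{\mu}P'$ are the usual late ones (input $a(\tilde b)$, output $(\nu\tilde d)\overline a\langle\tilde b\rangle$, $\tau$), with $((a)P)\langle b\rangle\xrightarrow{\mu}P'$ whenever $P\{b/a\}\xrightarrow{\mu}P'$; $\Rightarrow$ is $\xrightarrow{\tau}{}^{*}$, $\xRightarrow{\mu}$ is $\Rightarrow\xrightarrow{\mu}\Rightarrow$, $\xRightarrow{\hat\mu}$ is $\xRightarrow{\mu}$ for $\mu\neq\tau$ and $\Rightarrow$ for $\mu=\tau$, and $\xrightarrow{\hat\mu}$ is $\xrightarrow{\mu}$ or, for $\mu=\tau$, possibly no step. **Types.** $T ::= \mathsf{unit} \mid c\,T \mid (T_1,\dots,T_k)\ (k\ge 2) \mid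 X \mid \mu X.T$ with capabilities $c\in\{\sharp, i, o, l_\sharp, l_i, l_o\}$ (connection, input, output, and their linear versions). Type equality is the congruence generated by $\mu X.T = T\{\mu X.T/X\}$; a type is *linear* if it equals some $l_\sharp T$, $l_iT$ or $l_oT$. Subtyping is generated by reflexivity, transitivity, $\sharp T\le iT$, $\sharp T\le oT$, covariance of $i$, contravariance of $o$, invariance of $\sharp$ and covariance of products. Combination of types: $l_iT\uplus l_oT=l_oT\uplus l_iT=l_\sharp T$, $T\uplus T=T$ for $T$ not linear, and undefined otherwise; it extends to finite environments $\Gamma$ name by name. $\Gamma\vdash x:T$ if this follows, by subtyping and type equality, from $\Gamma(x)$, no other name having a linear type in $\Gamma$. $\Gamma\vdash P:\diamond$ is given by the usual rules of linear typing: $0$ is typed when $\Gamma$ has no linear names; inputs use $iT$ or $l_iT$; outputs use $oT$ or $l_oT$; replicated inputs use $iT$, with a body typed without free linear names; parallel components, subjects and objects split the environment by $\uplus$; $(\nu a{:}L)P$ is typed under $\Gamma$ if $P$ is typed under $\Gamma,a{:}L$ or under $\Gamma$; $((a)P)\langle b\rangle$ is typed if $P$ is typed with $a:T$ and $b:T$.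 $\Gamma\vdash (a)P:T\to\diamond$ if $\Gamma,a{:}T\vdash P:\diamond$. Contexts, which are concrete syntax with process and abstraction holes and may capture names, are typed by the same rules, each hole having a specified environment and type. **Relations.** A *precongruence* on agents is a preorder preserved by all (polyadic) process and abstraction contexts; it is *plain* if it relates $((a)P)\langle b\rangle$ and $P\{b/a\}$ in both directions. $\le$ is an *expansion relation* if $P\le Q$ implies that each $P\xrightarrow{\mu}P'$ is matched by some $Q\xRightarrow{\mu}Q'$ with $P'\le Q'$, and each $Q\xrightarrow{\mu}Q'$ by some $P\xrightarrow{\hat\mu}P'$ with $P'\le Q'$ (bound names of $\mu$ fresh). A *typed congruence* $\asymp$ is a family of relations $\Gamma\Vdash A\asymp B:\tau$, with $\tau=\diamond$ or $\tau=T\to\diamond$, on agents with $\Gamma\vdash A,B:\tau$, each an equivalence on these, and preserved by all well-typed contexts. $\asymp\;\supseteq\;\ge$ means that $\Gamma\Vdash A\asymp B:\tau$ whenever $B\le A$ and $\Gamma\vdash A,B:\tau$. *Up-to technique.* $\asymp$ *validates the up-to-$\le$-and-contexts technique* if each family $\mathcal S_\Gamma$ of symmetric relations on processes typed under $\Gamma$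 satisfies $\mathcal S_\Gamma\subseteq\,\asymp$ (under $\Gamma$, for all $\Gamma$) provided that, whenever $(P,Q)\in\mathcal S_\Gamma$ and $P\xrightarrow{\mu}P'$ (bound names of $\mu$ fresh for $Q$ and $\Gamma$), there are $Q\xRightarrow{\hat\mu}Q'$, an environment $\Gamma'$ under which a process of $\Gamma$ may be typed after $\mu$, processes $\tilde P,\tilde Q$, environments $\tilde\Delta$, and a context $C$, typed under $\Gamma'$ with holes under $\tilde\Delta$, such that $P'\ge C[\tilde P]$, $Q'\ge C[\tilde Q]$ and, for each $i$, either $\Delta_i\Vdash P_i\asymp Q_i$, or $(P_i,Q_i)\in\mathcal S_{\Delta_i}$ and, if $[\cdot]_i$ occurs under an input in $C$, also $(P_i\sigma,Q_i\sigma)\in\mathcal S_\Theta$ for all well-typed substitutions $\sigma$ from $\Delta_i$ to $\Theta$. Here $\Gamma'$ is: after $\tau$, $\Gamma$ or $\Gamma$ without a name of type $l_\sharp S$; after $a(\tilde x)$, $\Gamma_2,\tilde x{:}\tilde T$ where $\Gamma=\Gamma_1\uplus\Gamma_2$ and $\Gamma_1$ gives to $a$ the input capability for $\tilde T$; after $(\nu\tilde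 d)\overline a\langle\tilde b\rangle$, $\Gamma_3$ where $\Gamma$, extended with types for $\tilde d$, is $\Gamma_1\uplus\Gamma_2\uplus\Gamma_3$, $\Gamma_1$ gives to $a$ the output capability for some $\tilde T$ and $\Gamma_2\vdash\tilde b:\tilde T$. *Rendez-vous.* An *observable rendez-vous* under $\Gamma$, with continuation environment $\Gamma'$ and object type $T$, is an operation $P\mapsto R[P]:=(\nu\tilde b{:}\tilde B)(\overline a\langle\tilde c\rangle\mid b(r).P)$ with $b\in\tilde b\subseteq\tilde c$, $b:\sharp T$, $a\notin\tilde b\cup\tilde c$, the names $\tilde b$ distinct and not in $\Gamma$, $r\neq a$, $r\notin\tilde b$ and $r$ not in $\Gamma'$; $\Gamma(a)$ is $\sharp U$, $oU$ or $l_oU$ (hence not $l_\sharp U$), where $U$ is the type of the tuple $\tilde c$; each $b'\in\tilde b$ whose type is not linear has a type $\sharp W$ and is sent at this type; and $\Gamma,\tilde b{:}\tilde B$ is the $\uplus$ of environments for the output capability of $a$, for the sent tuple $\tilde c$, for the input capability $iT$ of $b$, and of $\Gamma'$ (so that $\Gamma\vdash R[P]:\diamond$ if $\Gamma',r{:}T\vdash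 P:\diamond$). $\asymp$ has the *rendez-vous cancellation property* if for each such rendez-vous and all $P,Q$ typed under $\Gamma',r{:}T$ with $a,b\notin\mathrm{fn}(P,Q)$, $\Gamma\Vdash R[P]\asymp R[Q]:\diamond$ implies $\Gamma',r{:}T\Vdash P\asymp Q:\diamond$. **$\lambda$-terms.** The $\lambda$-variables form an infinite set $V$ of names. A term is *solvable* if head reduction leads to a head normal form; an unsolvable $M$ has *order* $n$ if $n$ is the largest number of outermost abstractions uncovered by head reduction, and order $\infty$ if there is no bound. $BT(M)$ is the B\"ohm tree of $M$, and $\Omega=(\lambda x.xx)(\lambda x.xx)$. **Encodings.** An *encoding* $[\![\cdot]\!]$ maps terms to abstractions and is compositional and uniform: there are agents $V^x$ and abstraction contexts $C_\lambda^x$, $C_{app}$ with $[\![x]\!]=V^x$, $[\![\lambda x.M]\!]=C_\lambda^x[[\![M]\!]]$ with $C^x_\lambda$ binding $x$, $[\![MN]\!]=C_{app}[[\![M]\!],[\![N]\!]]$; $[\![M\sigma]\!]=[\![M]\!]\sigma$ for all substitutions $\sigma$ of variables by variables, and the free names of $[\![M]\!]$ are free variables of $M$. The *abstraction contexts* are the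 $C^x_\lambda$, and the *variable contexts* are $C_{var}^{x,n}=[\![x[\cdot]_1\cdots[\cdot]_n]\!]$; a context is *guarded* if its holes occur only underneath prefixes. Let $T_v$, the type of variables, be a closed non-linear type and $T_b$, the type of addresses, a closed type. For a finite $X\subseteq V$ let $\Gamma_X$ assign $T_v$ to each $x\in X$. The encoding *respects* $T_v,T_b$ if the defining contexts are well-typed: $\Gamma_X\vdash V^x:T_b\to\diamond$ for $x\in X$; $C_{app}$ has type $T_b\to\diamond$ under $\Gamma_X$ when its holes are of type $T_b\to\diamond$ under $\Gamma_X$; and $C_\lambda^x$ ($x\notin X$) has type $T_b\to\diamond$ under $\Gamma_X$ when its hole is of type $T_b\to\diamond$ under $\Gamma_{X\cup\{x\}}$. (Hence every $[\![M]\!]$ has type $T_b\to\diamond$.) Write $M\asymp_X N$ for $\Gamma_X\Vdash[\![M]\!]\asymp[\![N]\!]:T_b\to\diamond$. A context $C$ (of type $T_b\to\diamond$ under $\Gamma_X$, with holes of that type under $\Gamma_Y$) *has inverse with respect to $\ge$* if for each hole $i$ there are a context $D$ and an observable rendez-vous $R$ under some $\Gamma$, with continuation environment $\Gamma_Y$,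 object $z$ of type $T_b$, and $a,b,z\notin Y$, such that $D$ is of type $\diamond$ under $\Gamma$ with a hole of type $T_b\to\diamond$ under $\Gamma_X$, and $D[C[[\![M_1]\!],\dots,[\![M_n]\!]]]\ge R[[\![M_i]\!]\langle z\rangle]$ for all terms $M_1,\dots,M_n$ with free variables in $Y$. **Theorem.** Let $[\![\cdot]\!]$ be an encoding that respects $T_v,T_b$, let $\asymp$ be a family of typed relations on agents and $\le$ a relation on agents. Below, $X$ ranges over the finite subsets of $V$ that contain the free variables of the terms involved. Suppose the *completeness conditions* hold: 1. $\asymp$ is a typed congruence and $\asymp\;\supseteq\;\ge$; 2. $\le$ is an expansion relation (on processes) and a plain precongruence; 3. $\asymp$ validates the up-to-$\le$-and-contexts technique; 4. the variable contexts of $[\![\cdot]\!]$ are guarded; 5. $[\![\cdot]\!]$ and $\ge$ validate rule $\beta$: $[\![(\lambda x.M)N]\!]\ge[\![M\{N/x\}]\!]$ for all $x,M,N$; 6. $M\asymp_X\Omega$ for all $X$ and all unsolvable $M$ of order $0$; 7. $M\asymp_X\Omega$ for all $X$ and all unsolvable $M$ of order $\infty$; and the *soundness conditions* hold: 1. $\asymp$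 is a typed congruence, $\le$ a plain precongruence; 2. $\asymp\;\supseteq\;\ge$; 3. $\asymp$ has the rendez-vous cancellation property; 4. $[\![\cdot]\!]$ and $\ge$ validate rule $\beta$; 5. $M\asymp_X\Omega$ for all $X$ and all unsolvable $M$ of order $0$; 6. $\Omega$, $x\tilde M$, $x\tilde M'$, $y\tilde M''$ are pairwise unrelated by $\asymp_X$, whenever $x\ne y$ and the tuples $\tilde M,\tilde M'$ have different lengths; 7. the abstraction contexts ($C_\lambda^x$, from $Y=X\cup\{x\}$ to $X\not\ni x$) and the variable contexts ($C_{var}^{x,n}$, from $Y=X$ to $X\ni x$) have inverse with respect to $\ge$; 8. $M\asymp_X\Omega$ for all $X$ and all unsolvable $M$ of order $\infty$; 9. if $M$ is solvable, then $\lambda x.M$ is unrelated by $\asymp_X$ to $\Omega$ and to any term $y\tilde M$. Then $[\![\cdot]\!]$ and $\asymp$ are fully abstract for B\"ohm trees: for all terms $M,N$ and every finite $X\subseteq V$ that contains their free variables, $$\Gamma_X\Vdash[\![M]\!]\asymp[\![N]\!]:T_b\to\diamond\iff BT(M)=BT(N).$$ -/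

import Mathlib

noncomputable section

/-! ## The untyped lambda-calculus and Boehm trees

Terms are taken modulo alpha-conversion: free variables are elements of `V`, and a variable bound by
one of the `n` enclosing abstractions is its level `i : Fin n` (outermost abstraction first). A
lambda-term in the usual sense is an element of `Lam V 0`. -/

inductive Lam (V : Set ℕ) : ℕ → Type
  | fvar {n : ℕ} (x : V) : Lam V n
  | bvar {n : ℕ} (i : Fin n) : Lam V n
  | app {n : ℕ} (M N : Lam V n) : Lam V n
  | lam {n : ℕ} (M : Lam V (n + 1)) : Lam V n

namespace Lam

variable {V : Set ℕ}

def liftFin {n m : ℕ} (f : Fin n → Fin m) : Fin (n + 1) → Fin (m + 1) :=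
  Fin.snoc (α := fun _ => Fin (m + 1)) (fun i => (f i).castSucc) (Fin.last m)

/-- Renaming of free variables (by `φ`) and of bound ones (by `f`). -/
def rename (φ : V → V) : {n m : ℕ} → (Fin n → Fin m) → Lam V n → Lam V m
  | _, _, _, fvar x => fvar (φ x)
  | _, _, f, bvar i => bvar (f i)
  | _, _, f, app M N => app (M.rename φ f) (N.rename φ f)
  | _, _, f, lam M => lam (M.rename φ (liftFin f))

def weaken {n : ℕ} (M : Lam V n) : Lam V (n + 1) := M.rename id Fin.castSucc

/-- Simultaneous capture-avoiding substitution for free and bound variables. -/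
def subst : {n m : ℕ} → (V → Lam V m) → (Fin n → Lam V m) → Lam V n → Lam V m
  | _, _, φ, _, fvar x => φ x
  | _, _, _, f, bvar i => f i
  | _, _, φ, f, app M N => app (M.subst φ f) (N.subst φ f)
  | _, m, φ, f, lam M =>
      lam (M.subst (fun x => (φ x).weaken)
        (Fin.snoc (α := fun _ => Lam V (m + 1)) (fun i => (f i).weaken) (bvar (Fin.last m))))

/-- Contraction of the redex `(λ. M) N`. -/
def inst {n : ℕ} (M : Lam V (n + 1)) (N : Lam V n) : Lam V n :=
  M.subst fvar (Fin.snoc (α := fun _ => Lam V n) bvar N)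

/-- `λ x. M` for a named variable `x`. -/
def abs (x : V) (M : Lam V 0) : Lam V 0 :=
  lam (M.subst (fun y => if y = x then bvar (Fin.last 0) else fvar y) (fun i => bvar i.castSucc))

/-- `M {N / x}`. -/
def substVar (x : V) (M N : Lam V 0) : Lam V 0 :=
  M.subst (fun y => if y = x then N else fvar y) bvar

/-- `M σ` for a renaming `σ` of the free variables. -/
def renameFree (σ : V → V) (M : Lam V 0) : Lam V 0 := M.rename σ id

/-- Free variables. -/
def fv : {n : ℕ} → Lam V n → Finset ℕ
  | _, fvar x => {x.1}
  | _, bvar _ => ∅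
  | _, app M N => M.fv ∪ N.fv
  | _, lam M => M.fv

/-- `h M₁ ⋯ Mₙ`. -/
def apps {n : ℕ} (h : Lam V n) (Ms : List (Lam V n)) : Lam V n := Ms.foldl app h

/-- `k` abstractions in front of a term. -/
def lams {n : ℕ} : (k : ℕ) → Lam V (n + k) → Lam V n
  | 0, M => M
  | k + 1, M => lams k (lam M)

/-- A variable, free or bound, as a term. -/
def ofVar {n : ℕ} : V ⊕ Fin n → Lam V n
  | .inl x => fvar x
  | .inr i => bvar i

def omegaTerm : Lam V 0 :=
  app (lam (app (bvar (Fin.last 0)) (bvar (Fin.last 0))))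
    (lam (app (bvar (Fin.last 0)) (bvar (Fin.last 0))))

/-- Contraction of the head redex of a term that is not an abstraction. -/
inductive SpineStep {n : ℕ} : Lam V n → Lam V n → Prop
  | beta (M : Lam V (n + 1)) (N : Lam V n) : SpineStep (app (lam M) N) (M.inst N)
  | app {M M' : Lam V n} (N : Lam V n) : SpineStep M M' → SpineStep (app M N) (app M' N)

/-- Contraction of the head redex. -/
inductive HeadStep : {n : ℕ} → Lam V n → Lam V n → Prop
  | spine {n : ℕ} {M M' : Lam V n} : SpineStep M M' → HeadStep M M'
  | lam {n : ℕ} {M M' : Lam V (n + 1)} : HeadStep M M' → HeadStep (lam M) (lam M')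

/-- Head reduction. -/
def HeadRed {n : ℕ} : Lam V n → Lam V n → Prop := Relation.ReflTransGen HeadStep

/-- The head normal form `λ x₁ ⋯ x_k. y M₁ ⋯ Mₘ`. -/
def hnf {n : ℕ} (k : ℕ) (y : V ⊕ Fin (n + k)) (Ms : List (Lam V (n + k))) : Lam V n :=
  lams k (apps (ofVar y) Ms)

def Solvable {n : ℕ} (M : Lam V n) : Prop := ∃ k y Ms, HeadRed M (hnf k y Ms)

/-- Head reduction of `M` uncovers at least `k` abstractions. -/
def Uncovers (M : Lam V 0) (k : ℕ) : Prop := ∃ N : Lam V (0 + k), HeadRed M (lams k N)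

/-- `M` is unsolvable of (finite) order `k`. -/
def UnsolvableOfOrder (M : Lam V 0) (k : ℕ) : Prop :=
  ¬ Solvable M ∧ Uncovers M k ∧ ∀ j, Uncovers M j → j ≤ k

/-- `M` is unsolvable of infinite order. -/
def UnsolvableInfinite (M : Lam V 0) : Prop := ¬ Solvable M ∧ ∀ k, Uncovers M k

/-- Node labels of Boehm trees: `⊥`, or `λ x₁ ⋯ x_k. y` (a bound `y` being given by its level,
counted from the root of the tree). -/
inductive BTLabel (V : Set ℕ) : Type
  | bot : BTLabel V
  | head (k : ℕ) (y : V ⊕ ℕ) : BTLabel V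

/-- `BTAt M p l`: the Boehm tree of `M` has at position `p` a node labelled `l`. -/
inductive BTAt : {n : ℕ} → Lam V n → List ℕ → BTLabel V → Prop
  | bot {n : ℕ} {M : Lam V n} : ¬ Solvable M → BTAt M [] BTLabel.bot
  | root {n : ℕ} {M : Lam V n} {k : ℕ} {y : V ⊕ Fin (n + k)} {Ms : List (Lam V (n + k))} :
      HeadRed M (hnf k y Ms) → BTAt M [] (BTLabel.head k (y.map id Fin.val))
  | child {n : ℕ} {M : Lam V n} {k : ℕ} {y : V ⊕ Fin (n + k)} {Ms : List (Lam V (n + k))}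
      {i : ℕ} {N : Lam V (n + k)} {p : List ℕ} {l : BTLabel V} :
      HeadRed M (hnf k y Ms) → Ms[i]? = some N → BTAt N p l → BTAt M (i :: p) l

/-- The Boehm tree of a term, as the set of its labelled positions. -/
def bohmTree (M : Lam V 0) : Set (List ℕ × BTLabel V) := {q | BTAt M q.1 q.2}

end Lam

/-! ## Types -/

/-- Capabilities: connection, input, output, and the linear versions. -/
inductive Cap
  | conn | inp | out | linConn | linInp | linOut

def Cap.IsLinear : Cap → Prop
  | .linConn | .linInp | .linOut => True
  | _ => False

/-- Link types with `n` free type variables (levels); a product has at least two components. -/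
inductive Ty : ℕ → Type
  | unit {n : ℕ} : Ty n
  | ch {n : ℕ} (c : Cap) (T : Ty n) : Ty n
  | prod {n : ℕ} (k : ℕ) (T : Fin (k + 2) → Ty n) : Ty n
  | tvar {n : ℕ} (i : Fin n) : Ty n
  | mu {n : ℕ} (T : Ty (n + 1)) : Ty n

namespace Ty

def rename : {n m : ℕ} → (Fin n → Fin m) → Ty n → Ty m
  | _, _, _, unit => unit
  | _, _, f, ch c T => ch c (T.rename f)
  | _, _, f, prod k T => prod k (fun i => (T i).rename f)
  | _, _, f, tvar i => tvar (f i)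
  | _, _, f, mu T => mu (T.rename (Lam.liftFin f))

def subst : {n m : ℕ} → (Fin n → Ty m) → Ty n → Ty m
  | _, _, _, unit => unit
  | _, _, f, ch c T => ch c (T.subst f)
  | _, _, f, prod k T => prod k (fun i => (T i).subst f)
  | _, _, f, tvar i => f i
  | _, m, f, mu T =>
      mu (T.subst (Fin.snoc (α := fun _ => Ty (m + 1)) (fun i => (f i).rename Fin.castSucc)
        (tvar (Fin.last m))))

/-- `T {μ X. T / X}`. -/
def unfold {n : ℕ} (T : Ty (n + 1)) : Ty n :=
  T.subst (Fin.snoc (α := fun _ => Ty n) tvar (mu T))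

/-- Type equality: the least congruence that contains unfolding of recursive types. -/
inductive Eqv : {n : ℕ} → Ty n → Ty n → Prop
  | refl {n : ℕ} (T : Ty n) : Eqv T T
  | symm {n : ℕ} {S T : Ty n} : Eqv S T → Eqv T S
  | trans {n : ℕ} {S T U : Ty n} : Eqv S T → Eqv T U → Eqv S U
  | ch {n : ℕ} (c : Cap) {S T : Ty n} : Eqv S T → Eqv (ch c S) (ch c T)
  | prod {n k : ℕ} {S T : Fin (k + 2) → Ty n} :
      (∀ i, Eqv (S i) (T i)) → Eqv (prod k S) (prod k T)
  | mu {n : ℕ} {S T : Ty (n + 1)} : Eqv S T → Eqv (mu S) (mu T)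
  | unfold {n : ℕ} (T : Ty (n + 1)) : Eqv (mu T) (unfold T)

inductive Sub : Ty 0 → Ty 0 → Prop
  | refl (T : Ty 0) : Sub T T
  | trans {S T U : Ty 0} : Sub S T → Sub T U → Sub S U
  | connInp (T : Ty 0) : Sub (ch .conn T) (ch .inp T)
  | connOut (T : Ty 0) : Sub (ch .conn T) (ch .out T)
  | inp {S T : Ty 0} : Sub S T → Sub (ch .inp S) (ch .inp T)
  | out {S T : Ty 0} : Sub T S → Sub (ch .out S) (ch .out T)
  | prod {k : ℕ} {S T : Fin (k + 2) → Ty 0} : (∀ i, Sub (S i) (T i)) → Sub (prod k S) (prod k T)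
  | conn {S T : Ty 0} : Sub S T → Sub T S → Sub (ch .conn S) (ch .conn T)

/-- Linear types (up to unfolding of recursive types). -/
def Linear (T : Ty 0) : Prop := ∃ c S, Cap.IsLinear c ∧ Eqv T (ch c S)

/-- Combination of types, as a relation: `Comb S T W` means that `S ⊎ T` is defined and is `W` (for
linear types, up to unfolding of recursive types). -/
inductive Comb : Ty 0 → Ty 0 → Ty 0 → Prop
  | inpOut {S T U W : Ty 0} : Eqv S (ch .linInp U) → Eqv T (ch .linOut U) →
      Eqv W (ch .linConn U) → Comb S T W
  | outInp {S T U W : Ty 0} : Eqv S (ch .linOut U) → Eqv T (ch .linInp U) →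
      Eqv W (ch .linConn U) → Comb S T W
  | same {T : Ty 0} : ¬ Linear T → Comb T T T

/-- The type carried by a channel along which tuples of names of types `Ts` are sent. -/
inductive Carried : List (Ty 0) → Ty 0 → Prop
  | one (T : Ty 0) : Carried [T] T
  | tuple {k : ℕ} (T : Fin (k + 2) → Ty 0) : Carried (List.ofFn T) (prod k T)

end Ty

/-! ## Type environments -/

/-- Finite type environments. Names are natural numbers, and all types are closed. -/
abbrev Env := Finmap (fun _ : ℕ => Ty 0)

namespace Env

/-- `Γ, x₁ : T₁, …, xₙ : Tₙ`. -/
def extend (Γ : Env) (l : List (ℕ × Ty 0)) : Env := l.foldr (fun p Δ => Δ.insert p.1 p.2) Γ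

/-- The environment that assigns `T` to the names in `X`. -/
def const (X : Finset ℕ) (T : Ty 0) : Env := extend ∅ (X.toList.map fun x => (x, T))

def LinearAt (Γ : Env) (x : ℕ) : Prop := ∃ T, Γ.lookup x = some T ∧ T.Linear

/-- `Lin(Γ) = ∅`. -/
def Unrestricted (Γ : Env) : Prop := ∀ x, ¬ Γ.LinearAt x

inductive JoinAt : Option (Ty 0) → Option (Ty 0) → Option (Ty 0) → Prop
  | none : JoinAt none none none
  | left (T : Ty 0) : JoinAt (some T) none (some T)
  | right (T : Ty 0) : JoinAt none (some T) (some T)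
  | both {S T U : Ty 0} : Ty.Comb S T U → JoinAt (some S) (some T) (some U)

/-- `Γ₁ ⊎ Γ₂` is defined and is `Γ`. -/
def Join (Γ₁ Γ₂ Γ : Env) : Prop := ∀ x, JoinAt (Γ₁.lookup x) (Γ₂.lookup x) (Γ.lookup x)

/-- `Γ ⊢ x : T` for a name `x`. -/
inductive HasTy (Γ : Env) (x : ℕ) : Ty 0 → Prop
  | name {T : Ty 0} : Γ.lookup x = some T → (∀ y, y ≠ x → ¬ Γ.LinearAt y) → HasTy Γ x T
  | sub {S T : Ty 0} : HasTy Γ x S → Ty.Sub S T → HasTy Γ x T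
  | eqv {S T : Ty 0} : HasTy Γ x S → Ty.Eqv S T → HasTy Γ x T

/-- `Γ ⊢ x₁ : T₁, …, xₙ : Tₙ` (tuples). -/
inductive HasTys : Env → List (ℕ × Ty 0) → Prop
  | nil {Γ : Env} : Γ.Unrestricted → HasTys Γ []
  | cons {Γ₁ Γ₂ Γ : Env} {x : ℕ} {T : Ty 0} {l : List (ℕ × Ty 0)} :
      HasTy Γ₁ x T → HasTys Γ₂ l → Join Γ₁ Γ₂ Γ → HasTys Γ ((x, T) :: l)

/-- `Θ` extends `Δ`: every name of `Δ` has, by its assignment in `Θ`, the type that `Δ` gives to it,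
and the remaining names of `Θ` are not linear. -/
def Extends (Θ Δ : Env) : Prop :=
  (∀ x T, Δ.lookup x = some T →
    ∃ S, Θ.lookup x = some S ∧ HasTy (Finmap.singleton x S) x T) ∧
  ∀ x, Δ.lookup x = none → ¬ Θ.LinearAt x

/-- `σ` is a `Δ`-to-`Γ` substitution: `Γ` splits into parts that give to each `σ x` the type
`Δ(x)`. -/
inductive IsSubst (σ : ℕ → ℕ) : Env → Env → Prop
  | nil {Γ : Env} : Γ.Unrestricted → IsSubst σ ∅ Γ
  | cons {Δ Γ₁ Γ₂ Γ : Env} {x : ℕ} {T : Ty 0} : Δ.lookup x = none → HasTy Γ₁ (σ x) T →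
      IsSubst σ Δ Γ₂ → Join Γ₁ Γ₂ Γ → IsSubst σ (Δ.insert x T) Γ

end Env

/-! ## The asynchronous pi-calculus with linear types

Agents are taken modulo alpha-conversion: a name is free, `fr x`, or bound by one of the `n`
enclosing binders, `bd i` (levels). Processes in the usual sense are elements of `Proc 0`; an
abstraction `(a) P` is an element of `Proc 1`. -/

inductive Nm (n : ℕ) : Type
  | fr (x : ℕ) : Nm n
  | bd (i : Fin n) : Nm n

namespace Nm

def weaken {n : ℕ} (k : ℕ) : Nm n → Nm (n + k)
  | fr x => fr x
  | bd i => bd (i.castAdd k)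

def lift {n m : ℕ} (k : ℕ) (f : Nm n → Nm m) : Nm (n + k) → Nm (m + k)
  | fr x => (f (fr x)).weaken k
  | bd i => Fin.addCases (fun i => (f (bd i)).weaken k) (fun j => bd (Fin.natAdd m j)) i

/-- Replace the last `k` bound names by the names in `xs`. -/
def inst {n k : ℕ} (xs : List ℕ) : Nm (n + k) → Nm n
  | fr x => fr x
  | bd i => Fin.addCases bd (fun j : Fin k => fr (xs.getD j 0)) i

/-- Bind the names in `xs`. -/
def bind {n : ℕ} (xs : List ℕ) : Nm n → Nm (n + xs.length)
  | fr x => if h : x ∈ xs then bd (Fin.natAdd n ⟨xs.idxOf x, List.idxOf_lt_length_of_mem h⟩)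
      else fr x
  | bd i => bd (i.castAdd xs.length)

def subst {n : ℕ} (σ : ℕ → ℕ) : Nm n → Nm n
  | fr x => fr (σ x)
  | bd i => bd i

def fn {n : ℕ} : Nm n → Finset ℕ
  | fr x => {x}
  | bd _ => ∅

end Nm

inductive Proc : ℕ → Type
  | nil {n : ℕ} : Proc n
  | wrong {n : ℕ} : Proc n
  | inp {n : ℕ} (a : Nm n) (k : ℕ) (P : Proc (n + k)) : Proc n
  | out {n : ℕ} (a : Nm n) (bs : List (Nm n)) : Proc n
  | par {n : ℕ} (P Q : Proc n) : Proc n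
  | res {n : ℕ} (L : Ty 0) (P : Proc (n + 1)) : Proc n
  | rep {n : ℕ} (a : Nm n) (k : ℕ) (P : Proc (n + k)) : Proc n
  | app {n : ℕ} (P : Proc (n + 1)) (b : Nm n) : Proc n

namespace Proc

def map : {n m : ℕ} → (Nm n → Nm m) → Proc n → Proc m
  | _, _, _, nil => nil
  | _, _, _, wrong => wrong
  | _, _, f, inp a k P => inp (f a) k (P.map (Nm.lift k f))
  | _, _, f, out a bs => out (f a) (bs.map f)
  | _, _, f, par P Q => par (P.map f) (Q.map f)
  | _, _, f, res L P => res L (P.map (Nm.lift 1 f))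
  | _, _, f, rep a k P => rep (f a) k (P.map (Nm.lift k f))
  | _, _, f, app P b => app (P.map (Nm.lift 1 f)) (f b)

/-- Instantiate the last `k` bound names by `xs` (used only with `xs` of length `k`). -/
def inst {n k : ℕ} (P : Proc (n + k)) (xs : List ℕ) : Proc n := P.map (Nm.inst xs)

def inst1 {n : ℕ} (P : Proc (n + 1)) (x : ℕ) : Proc n := inst (k := 1) P [x]

/-- Bind the names `xs`. -/
def bind {n : ℕ} (xs : List ℕ) (P : Proc n) : Proc (n + xs.length) := P.map (Nm.bind xs)

def bind1 {n : ℕ} (x : ℕ) (P : Proc n) : Proc (n + 1) := bind [x] P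

/-- `P σ`. -/
def subst {n : ℕ} (σ : ℕ → ℕ) (P : Proc n) : Proc n := P.map (Nm.subst σ)

/-- Free names. -/
def fn : {n : ℕ} → Proc n → Finset ℕ
  | _, nil => ∅
  | _, wrong => ∅
  | _, inp a _ P => a.fn ∪ P.fn
  | _, out a bs => a.fn ∪ bs.foldr (fun b X => b.fn ∪ X) ∅
  | _, par P Q => P.fn ∪ Q.fn
  | _, res _ P => P.fn
  | _, rep a _ P => a.fn ∪ P.fn
  | _, app P b => P.fn ∪ b.fn

/-- `(ν d₁ : L₁) ⋯ (ν dₖ : Lₖ) P`. -/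
def resList (d : List (ℕ × Ty 0)) (P : Proc 0) : Proc 0 :=
  d.foldr (fun p Q => res p.2 (Q.bind1 p.1)) P

end Proc

/-- Agents: processes and abstractions. -/
inductive Agent
  | proc (P : Proc 0) : Agent
  | abs (F : Proc 1) : Agent

/-! ### Typing of agents -/

/-- `Γ ⊢ P : ◇`. -/
inductive Proc.Typed : Env → Proc 0 → Prop
  | nil {Γ : Env} : Γ.Unrestricted → Proc.Typed Γ Proc.nil
  | inp {Γ₁ Γ₂ Γ : Env} {a : ℕ} {k : ℕ} {P : Proc (0 + k)} {c : Cap} {T : Ty 0}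
      {l : List (ℕ × Ty 0)} :
      (c = .inp ∨ c = .linInp) → Γ₁.HasTy a (.ch c T) → Ty.Carried (l.map Prod.snd) T →
      l.length = k → (l.map Prod.fst).Nodup →
      (∀ x ∈ l.map Prod.fst, x ∉ P.fn ∧ Γ₂.lookup x = none) →
      Proc.Typed (Γ₂.extend l) (P.inst (l.map Prod.fst)) → Env.Join Γ₁ Γ₂ Γ →
      Proc.Typed Γ (Proc.inp (.fr a) k P)
  | out {Γ₁ Γ₂ Γ : Env} {a : ℕ} {c : Cap} {T : Ty 0} {l : List (ℕ × Ty 0)} :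
      (c = .out ∨ c = .linOut) → Γ₁.HasTy a (.ch c T) → Ty.Carried (l.map Prod.snd) T →
      Γ₂.HasTys l → Env.Join Γ₁ Γ₂ Γ →
      Proc.Typed Γ (Proc.out (.fr a) (l.map fun p => .fr p.1))
  | par {Γ₁ Γ₂ Γ : Env} {P Q : Proc 0} :
      Proc.Typed Γ₁ P → Proc.Typed Γ₂ Q → Env.Join Γ₁ Γ₂ Γ → Proc.Typed Γ (Proc.par P Q)
  | res {Γ : Env} {L : Ty 0} {P : Proc 1} {x : ℕ} :
      x ∉ P.fn → Γ.lookup x = none → Proc.Typed (Γ.insert x L) (P.inst1 x) →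
      Proc.Typed Γ (Proc.res L P)
  | res' {Γ : Env} {L : Ty 0} {P : Proc 1} {x : ℕ} :
      x ∉ P.fn → Γ.lookup x = none → Proc.Typed Γ (P.inst1 x) → Proc.Typed Γ (Proc.res L P)
  | rep {Γ₁ Γ₂ Γ : Env} {a : ℕ} {k : ℕ} {P : Proc (0 + k)} {T : Ty 0} {l : List (ℕ × Ty 0)} :
      Γ₁.HasTy a (.ch .inp T) → Ty.Carried (l.map Prod.snd) T →
      l.length = k → (l.map Prod.fst).Nodup →
      (∀ x ∈ l.map Prod.fst, x ∉ P.fn ∧ Γ₂.lookup x = none) →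
      Proc.Typed (Γ₂.extend l) (P.inst (l.map Prod.fst)) → Γ₂.Unrestricted → Env.Join Γ₁ Γ₂ Γ →
      Proc.Typed Γ (Proc.rep (.fr a) k P)
  | app {Γ₁ Γ₂ Γ : Env} {P : Proc 1} {b : ℕ} {T : Ty 0} {x : ℕ} :
      x ∉ P.fn → Γ₁.lookup x = none → Proc.Typed (Γ₁.insert x T) (P.inst1 x) →
      Γ₂.HasTy b T → Env.Join Γ₁ Γ₂ Γ → Proc.Typed Γ (Proc.app P (.fr b))

/-- Types of agents: `◇` and `T → ◇`. -/
inductive AgTy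
  | proc : AgTy
  | abs (T : Ty 0) : AgTy

/-- `Γ ⊢ A : τ`. -/
inductive Agent.Typed (Γ : Env) : Agent → AgTy → Prop
  | proc {P : Proc 0} : Proc.Typed Γ P → Agent.Typed Γ (.proc P) .proc
  | abs {P : Proc 1} {x : ℕ} {T : Ty 0} : x ∉ P.fn → Γ.lookup x = none →
      Proc.Typed (Γ.insert x T) (P.inst1 x) → Agent.Typed Γ (.abs P) (.abs T)

/-! ### Transitions -/

/-- Actions: `τ`, input `a(xs)`, and output `(ν d) a⟨bs⟩`. -/
inductive Act
  | tau : Act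
  | inp (a : ℕ) (xs : List ℕ) : Act
  | out (d : List (ℕ × Ty 0)) (a : ℕ) (bs : List ℕ) : Act

namespace Act

/-- Bound names. -/
def bn : Act → Finset ℕ
  | tau => ∅
  | inp _ xs => xs.toFinset
  | out d _ _ => (d.map Prod.fst).toFinset

/-- All names. -/
def names : Act → Finset ℕ
  | tau => ∅
  | inp a xs => {a} ∪ xs.toFinset
  | out d a bs => {a} ∪ bs.toFinset ∪ (d.map Prod.fst).toFinset

/-- Equality of actions, where the private names of an output form a set and their type
annotations are disregarded. -/
inductive Same : Act → Act → Prop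
  | tau : Same tau tau
  | inp (a : ℕ) (xs : List ℕ) : Same (inp a xs) (inp a xs)
  | out {d d' : List (ℕ × Ty 0)} (a : ℕ) (bs : List ℕ) :
      (d.map Prod.fst).Perm (d'.map Prod.fst) → Same (out d a bs) (out d' a bs)

end Act

/-- The substitution `{bs / xs}`. -/
def substOf (xs bs : List ℕ) (y : ℕ) : ℕ := if y ∈ xs then bs.getD (xs.idxOf y) y else y

inductive Step : Proc 0 → Act → Proc 0 → Prop
  | inp {a k : ℕ} {P : Proc (0 + k)} {xs : List ℕ} : xs.length = k → xs.Nodup →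
      (∀ x ∈ xs, x ∉ (Proc.inp (.fr a) k P).fn) →
      Step (.inp (.fr a) k P) (.inp a xs) (P.inst xs)
  | rep {a k : ℕ} {P : Proc (0 + k)} {xs : List ℕ} : xs.length = k → xs.Nodup →
      (∀ x ∈ xs, x ∉ (Proc.rep (.fr a) k P).fn) →
      Step (.rep (.fr a) k P) (.inp a xs) (.par (P.inst xs) (.rep (.fr a) k P))
  | out {a : ℕ} {bs : List ℕ} : Step (.out (.fr a) (bs.map .fr)) (.out [] a bs) .nil
  | parL {P P' Q : Proc 0} {μ : Act} : Step P μ P' → Disjoint μ.bn Q.fn →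
      Step (.par P Q) μ (.par P' Q)
  | parR {P Q Q' : Proc 0} {μ : Act} : Step Q μ Q' → Disjoint μ.bn P.fn →
      Step (.par P Q) μ (.par P Q')
  | comL {P P' Q Q' : Proc 0} {a : ℕ} {xs bs : List ℕ} {d : List (ℕ × Ty 0)} :
      Step P (.inp a xs) P' → Step Q (.out d a bs) Q' → xs.length = bs.length →
      Disjoint (d.map Prod.fst).toFinset P.fn →
      Step (.par P Q) .tau (.resList d (.par (P'.subst (substOf xs bs)) Q'))
  | comR {P P' Q Q' : Proc 0} {a : ℕ} {xs bs : List ℕ} {d : List (ℕ × Ty 0)} :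
      Step P (.out d a bs) P' → Step Q (.inp a xs) Q' → xs.length = bs.length →
      Disjoint (d.map Prod.fst).toFinset Q.fn →
      Step (.par P Q) .tau (.resList d (.par P' (Q'.subst (substOf xs bs))))
  | res {L : Ty 0} {P : Proc 1} {P' : Proc 0} {μ : Act} {x : ℕ} : x ∉ P.fn → x ∉ μ.names →
      Step (P.inst1 x) μ P' → Step (.res L P) μ (.res L (P'.bind1 x))
  | opn {L : Ty 0} {P : Proc 1} {P' : Proc 0} {d : List (ℕ × Ty 0)} {a : ℕ} {bs : List ℕ}
      {x : ℕ} : x ∉ P.fn → x ∈ bs → x ∉ d.map Prod.fst → a ≠ x →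
      Step (P.inst1 x) (.out d a bs) P' → Step (.res L P) (.out ((x, L) :: d) a bs) P'
  | app {P : Proc 1} {b : ℕ} {μ : Act} {P' : Proc 0} : Step (P.inst1 b) μ P' →
      Step (.app P (.fr b)) μ P'

def TauStar : Proc 0 → Proc 0 → Prop := Relation.ReflTransGen fun P Q => Step P .tau Q

/-- Weak transition `⟹ μ ⟹`. -/
def Weak (P : Proc 0) (μ : Act) (P' : Proc 0) : Prop :=
  ∃ Q Q', TauStar P Q ∧ Step Q μ Q' ∧ TauStar Q' P'

/-- Weak transition that may be empty for `τ`. -/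
def WeakHat (P : Proc 0) (μ : Act) (P' : Proc 0) : Prop :=
  (μ = .tau ∧ TauStar P P') ∨ (μ ≠ .tau ∧ Weak P μ P')

/-- Strong transition that may be empty for `τ`. -/
def StepHat (P : Proc 0) (μ : Act) (P' : Proc 0) : Prop := Step P μ P' ∨ (μ = .tau ∧ P' = P)

/-- Expansion relations on processes (with the convention that the bound names of an action are
fresh for the process that has to match it). -/
def IsExpansion (R : Proc 0 → Proc 0 → Prop) : Prop :=
  ∀ P Q, R P Q →
    (∀ μ P', Step P μ P' → Disjoint μ.bn Q.fn →
      ∃ μ' Q', Act.Same μ μ' ∧ Weak Q μ' Q' ∧ R P' Q') ∧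
    (∀ μ Q', Step Q μ Q' → Disjoint μ.bn P.fn →
      ∃ μ' P', Act.Same μ μ' ∧ StepHat P μ' P' ∧ R P' Q')

/-! ### Contexts

Contexts are concrete syntax with names, since filling a hole may capture names. The holes are
indexed; `π` indexes the process holes and `α` the abstraction holes. -/

inductive PCtx (π α : Type) : Type
  | hole (i : π) : PCtx π α
  | nil : PCtx π α
  | wrong : PCtx π α
  | inp (a : ℕ) (xs : List ℕ) (C : PCtx π α) : PCtx π α
  | out (a : ℕ) (bs : List ℕ) : PCtx π α
  | par (C D : PCtx π α) : PCtx π α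
  | res (x : ℕ) (L : Ty 0) (C : PCtx π α) : PCtx π α
  | rep (a : ℕ) (xs : List ℕ) (C : PCtx π α) : PCtx π α
  /-- `((x) C)⟨b⟩` -/
  | app (x : ℕ) (C : PCtx π α) (b : ℕ) : PCtx π α
  /-- `[·]ⱼ⟨b⟩` -/
  | appHole (j : α) (b : ℕ) : PCtx π α

/-- Abstraction contexts. -/
inductive ACtx (π α : Type) : Type
  | abs (x : ℕ) (C : PCtx π α) : ACtx π α
  | hole (j : α) : ACtx π α

namespace PCtx

variable {π α β : Type}

/-- The process obtained by filling the holes. -/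
def fill (ρ : π → Proc 0) (φ : α → Proc 1) : PCtx π α → Proc 0
  | hole i => ρ i
  | nil => .nil
  | wrong => .wrong
  | inp a xs C => .inp (.fr a) xs.length ((C.fill ρ φ).bind xs)
  | out a bs => .out (.fr a) (bs.map .fr)
  | par C D => .par (C.fill ρ φ) (D.fill ρ φ)
  | res x L C => .res L ((C.fill ρ φ).bind1 x)
  | rep a xs C => .rep (.fr a) xs.length ((C.fill ρ φ).bind xs)
  | app x C b => .app ((C.fill ρ φ).bind1 x) (.fr b)
  | appHole j b => .app (φ j) (.fr b)

/-- Free names of a context. -/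
def fn : PCtx π α → Finset ℕ
  | hole _ => ∅
  | nil => ∅
  | wrong => ∅
  | inp a xs C => {a} ∪ (C.fn \ xs.toFinset)
  | out a bs => {a} ∪ bs.toFinset
  | par C D => C.fn ∪ D.fn
  | res x _ C => C.fn \ {x}
  | rep a xs C => {a} ∪ (C.fn \ xs.toFinset)
  | app x C b => (C.fn \ {x}) ∪ {b}
  | appHole _ b => {b}

/-- Every hole lies in the scope of a binder for `y`. -/
def HolesInScope (y : ℕ) : PCtx π α → Prop
  | hole _ => False
  | inp _ xs C => y ∈ xs ∨ C.HolesInScope y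
  | par C D => C.HolesInScope y ∧ D.HolesInScope y
  | res x _ C => y = x ∨ C.HolesInScope y
  | rep _ xs C => y ∈ xs ∨ C.HolesInScope y
  | app x C _ => y = x ∨ C.HolesInScope y
  | appHole _ _ => False
  | _ => True

/-- The holes occur only underneath prefixes. -/
def Guarded : PCtx π α → Prop
  | hole _ => False
  | par C D => C.Guarded ∧ D.Guarded
  | res _ _ C => C.Guarded
  | app _ C _ => C.Guarded
  | appHole _ _ => False
  | _ => True

/-- The process hole `i` occurs. -/
def Occurs (i : π) : PCtx π α → Prop
  | hole j => i = j
  | inp _ _ C => C.Occurs i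
  | par C D => C.Occurs i ∨ D.Occurs i
  | res _ _ C => C.Occurs i
  | rep _ _ C => C.Occurs i
  | app _ C _ => C.Occurs i
  | _ => False

/-- The process hole `i` occurs underneath an input. -/
def OccursUnderInput (i : π) : PCtx π α → Prop
  | inp _ _ C => C.Occurs i
  | par C D => C.OccursUnderInput i ∨ D.OccursUnderInput i
  | res _ _ C => C.OccursUnderInput i
  | rep _ _ C => C.Occurs i
  | app _ C _ => C.OccursUnderInput i
  | _ => False

/-- Replace the abstraction holes by abstraction contexts. -/
def plug (f : α → ACtx π β) : PCtx π α → PCtx π β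
  | hole i => hole i
  | nil => nil
  | wrong => wrong
  | inp a xs C => inp a xs (C.plug f)
  | out a bs => out a bs
  | par C D => par (C.plug f) (D.plug f)
  | res x L C => res x L (C.plug f)
  | rep a xs C => rep a xs (C.plug f)
  | app x C b => app x (C.plug f) b
  | appHole j b =>
      match f j with
      | .abs x C => app x C b
      | .hole j' => appHole j' b

/-- `Typed Δ E Γ C`: `Γ ⊢ C : ◇`, where the process hole `i` stands for processes typed under `Δ i`,
and the abstraction hole `j` for abstractions of type `(E j).2 → ◇` under `(E j).1`. A binder may
shadow an assignment of the environment that is not linear. -/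
inductive Typed (Δ : π → Env) (E : α → Env × Ty 0) : Env → PCtx π α → Prop
  | hole {Θ : Env} {i : π} : Θ.Extends (Δ i) → Typed Δ E Θ (hole i)
  | nil {Γ : Env} : Γ.Unrestricted → Typed Δ E Γ nil
  | inp {Γ₁ Γ₂ Γ : Env} {a : ℕ} {C : PCtx π α} {c : Cap} {T : Ty 0} {l : List (ℕ × Ty 0)} :
      (c = .inp ∨ c = .linInp) → Γ₁.HasTy a (.ch c T) → Ty.Carried (l.map Prod.snd) T →
      (l.map Prod.fst).Nodup → (∀ x ∈ l.map Prod.fst, ¬ Γ₂.LinearAt x) →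
      Typed Δ E (Γ₂.extend l) C → Env.Join Γ₁ Γ₂ Γ → Typed Δ E Γ (inp a (l.map Prod.fst) C)
  | out {Γ₁ Γ₂ Γ : Env} {a : ℕ} {c : Cap} {T : Ty 0} {l : List (ℕ × Ty 0)} :
      (c = .out ∨ c = .linOut) → Γ₁.HasTy a (.ch c T) → Ty.Carried (l.map Prod.snd) T →
      Γ₂.HasTys l → Env.Join Γ₁ Γ₂ Γ → Typed Δ E Γ (out a (l.map Prod.fst))
  | par {Γ₁ Γ₂ Γ : Env} {C D : PCtx π α} :
      Typed Δ E Γ₁ C → Typed Δ E Γ₂ D → Env.Join Γ₁ Γ₂ Γ → Typed Δ E Γ (par C D)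
  | res {Γ : Env} {x : ℕ} {L : Ty 0} {C : PCtx π α} : ¬ Γ.LinearAt x →
      Typed Δ E (Γ.insert x L) C → Typed Δ E Γ (res x L C)
  | res' {Γ : Env} {x : ℕ} {L : Ty 0} {C : PCtx π α} : ¬ Γ.LinearAt x →
      Typed Δ E (Γ.erase x) C → Typed Δ E Γ (res x L C)
  | rep {Γ₁ Γ₂ Γ : Env} {a : ℕ} {C : PCtx π α} {T : Ty 0} {l : List (ℕ × Ty 0)} :
      Γ₁.HasTy a (.ch .inp T) → Ty.Carried (l.map Prod.snd) T → (l.map Prod.fst).Nodup →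
      Typed Δ E (Γ₂.extend l) C → Γ₂.Unrestricted → Env.Join Γ₁ Γ₂ Γ →
      Typed Δ E Γ (rep a (l.map Prod.fst) C)
  | app {Γ₁ Γ₂ Γ : Env} {x : ℕ} {C : PCtx π α} {b : ℕ} {T : Ty 0} : ¬ Γ₁.LinearAt x →
      Typed Δ E (Γ₁.insert x T) C → Γ₂.HasTy b T → Env.Join Γ₁ Γ₂ Γ → Typed Δ E Γ (app x C b)
  | appHole {Γ₁ Γ₂ Γ : Env} {j : α} {b : ℕ} : Γ₁.Extends (E j).1 → Γ₂.HasTy b (E j).2 →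
      Env.Join Γ₁ Γ₂ Γ → Typed Δ E Γ (appHole j b)

end PCtx

namespace ACtx

variable {π α β : Type}

def fill (ρ : π → Proc 0) (φ : α → Proc 1) : ACtx π α → Proc 1
  | abs x C => (C.fill ρ φ).bind1 x
  | hole j => φ j

def fn : ACtx π α → Finset ℕ
  | abs x C => C.fn \ {x}
  | hole _ => ∅

def HolesInScope (y : ℕ) : ACtx π α → Prop
  | abs x C => y = x ∨ C.HolesInScope y
  | hole _ => False

def Guarded : ACtx π α → Prop
  | abs _ C => C.Guarded
  | hole _ => False

def plug (f : α → ACtx π β) : ACtx π α → ACtx π β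
  | abs x C => abs x (C.plug f)
  | hole j => f j

/-- `Γ ⊢ C : T → ◇`. -/
inductive Typed (Δ : π → Env) (E : α → Env × Ty 0) (Γ : Env) : ACtx π α → Ty 0 → Prop
  | abs {x : ℕ} {C : PCtx π α} {T : Ty 0} : ¬ Γ.LinearAt x → PCtx.Typed Δ E (Γ.insert x T) C →
      Typed Δ E Γ (abs x C) T
  | hole {j : α} : Γ.Extends (E j).1 → Typed Δ E Γ (hole j) (E j).2

end ACtx

/-! ### Relations on agents -/

/-- Precongruences: preorders that are preserved by all contexts. -/
structure IsPrecongruence (R : Agent → Agent → Prop) : Prop where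
  refl : ∀ A, R A A
  trans : ∀ A B C, R A B → R B C → R A C
  proc : ∀ (m n : ℕ) (C : PCtx (Fin m) (Fin n)) (ρ ρ' : Fin m → Proc 0) (φ φ' : Fin n → Proc 1),
    (∀ i, R (.proc (ρ i)) (.proc (ρ' i))) → (∀ j, R (.abs (φ j)) (.abs (φ' j))) →
    R (.proc (C.fill ρ φ)) (.proc (C.fill ρ' φ'))
  abs : ∀ (m n : ℕ) (C : ACtx (Fin m) (Fin n)) (ρ ρ' : Fin m → Proc 0) (φ φ' : Fin n → Proc 1),
    (∀ i, R (.proc (ρ i)) (.proc (ρ' i))) → (∀ j, R (.abs (φ j)) (.abs (φ' j))) →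
    R (.abs (C.fill ρ φ)) (.abs (C.fill ρ' φ'))

/-- A relation is plain if it identifies `((a) P)⟨b⟩` and `P {b / a}`. -/
def IsPlain (R : Agent → Agent → Prop) : Prop :=
  ∀ (P : Proc 1) (b : ℕ),
    R (.proc (P.inst1 b)) (.proc (.app P (.fr b))) ∧
    R (.proc (.app P (.fr b))) (.proc (P.inst1 b))

/-- Relations on agents that are parametric on a type environment (and on the type at which the
agents are compared): `R Γ τ A B` is `Γ ⊩ A R B : τ`. -/
abbrev TypedRel := Env → AgTy → Agent → Agent → Prop

/-- Typed congruences: under each environment, equivalences on the well-typed agents that are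
preserved by all well-typed contexts. -/
structure IsTypedCongruence (R : TypedRel) : Prop where
  typed : ∀ Γ τ A B, R Γ τ A B → A.Typed Γ τ ∧ B.Typed Γ τ
  refl : ∀ Γ τ A, A.Typed Γ τ → R Γ τ A A
  symm : ∀ Γ τ A B, R Γ τ A B → R Γ τ B A
  trans : ∀ Γ τ A B C, R Γ τ A B → R Γ τ B C → R Γ τ A C
  proc : ∀ (m n : ℕ) (C : PCtx (Fin m) (Fin n)) (Δ : Fin m → Env) (E : Fin n → Env × Ty 0) (Γ : Env)
    (ρ ρ' : Fin m → Proc 0) (φ φ' : Fin n → Proc 1), C.Typed Δ E Γ →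
    (∀ i, R (Δ i) .proc (.proc (ρ i)) (.proc (ρ' i))) →
    (∀ j, R (E j).1 (.abs (E j).2) (.abs (φ j)) (.abs (φ' j))) →
    R Γ .proc (.proc (C.fill ρ φ)) (.proc (C.fill ρ' φ'))
  abs : ∀ (m n : ℕ) (C : ACtx (Fin m) (Fin n)) (Δ : Fin m → Env) (E : Fin n → Env × Ty 0) (Γ : Env)
    (T : Ty 0) (ρ ρ' : Fin m → Proc 0) (φ φ' : Fin n → Proc 1), C.Typed Δ E Γ T →
    (∀ i, R (Δ i) .proc (.proc (ρ i)) (.proc (ρ' i))) →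
    (∀ j, R (E j).1 (.abs (E j).2) (.abs (φ j)) (.abs (φ' j))) →
    R Γ (.abs T) (.abs (C.fill ρ φ)) (.abs (C.fill ρ' φ'))

/-- `≍ ⊇ ≥` (on well-typed agents). -/
def ContainsConverse (eqv : TypedRel) (le : Agent → Agent → Prop) : Prop :=
  ∀ Γ τ A B, A.Typed Γ τ → B.Typed Γ τ → le B A → eqv Γ τ A B

/-- `Residual Γ μ Γ'`: a process typed under `Γ` may be typed under `Γ'` after the action `μ`. -/
inductive Residual : Env → Act → Env → Prop
  | tau (Γ : Env) : Residual Γ .tau Γ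
  | tauLin {Γ : Env} {a : ℕ} {T S : Ty 0} : Γ.lookup a = some T → Ty.Eqv T (.ch .linConn S) →
      Residual Γ .tau (Γ.erase a)
  | inp {Γ₁ Γ₂ Γ : Env} {a : ℕ} {c : Cap} {T : Ty 0} {l : List (ℕ × Ty 0)} :
      Env.Join Γ₁ Γ₂ Γ → (c = .inp ∨ c = .linInp) → Γ₁.HasTy a (.ch c T) →
      Ty.Carried (l.map Prod.snd) T → (l.map Prod.fst).Nodup →
      (∀ x ∈ l.map Prod.fst, Γ.lookup x = none) →
      Residual Γ (.inp a (l.map Prod.fst)) (Γ₂.extend l)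
  | out {Γ₁ Γ₂ Γ₃ Γ₂₃ Γ : Env} {a : ℕ} {c : Cap} {T : Ty 0} {d e l : List (ℕ × Ty 0)} :
      (d.map Prod.fst).Perm (e.map Prod.fst) →
      (∀ x ∈ e.map Prod.fst, Γ.lookup x = none) →
      Env.Join Γ₂ Γ₃ Γ₂₃ → Env.Join Γ₁ Γ₂₃ (Γ.extend e) →
      (c = .out ∨ c = .linOut) → Γ₁.HasTy a (.ch c T) → Ty.Carried (l.map Prod.snd) T →
      Γ₂.HasTys l → Residual Γ (.out d a (l.map Prod.fst)) Γ₃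

/-- `≍` validates the up-to-`≤`-and-contexts technique. The relation `S` of the technique is typed
as well, `S Γ P Q` being `Γ ⊩ P S Q`; the context that is cut off after a transition is well-typed
under an environment that remains after that transition. -/
def ValidatesUpTo (eqv : TypedRel) (le : Agent → Agent → Prop) : Prop :=
  ∀ S : Env → Proc 0 → Proc 0 → Prop,
    (∀ Γ P Q, S Γ P Q → P.Typed Γ ∧ Q.Typed Γ) →
    (∀ Γ P Q, S Γ P Q → S Γ Q P) →
    (∀ Γ P Q, S Γ P Q → ∀ μ P', Step P μ P' →
      Disjoint μ.bn Q.fn → (∀ x ∈ μ.bn, Γ.lookup x = none) →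
      ∃ μ' Q', Act.Same μ μ' ∧ WeakHat Q μ' Q' ∧
        ∃ (n : ℕ) (C : PCtx (Fin n) (Fin 0)) (Ps Qs : Fin n → Proc 0) (Δ : Fin n → Env) (Γ' : Env),
          Residual Γ μ Γ' ∧ C.Typed Δ Fin.elim0 Γ' ∧
          le (.proc (C.fill Ps Fin.elim0)) (.proc P') ∧
          le (.proc (C.fill Qs Fin.elim0)) (.proc Q') ∧
          ∀ i, eqv (Δ i) .proc (.proc (Ps i)) (.proc (Qs i)) ∨
            (S (Δ i) (Ps i) (Qs i) ∧
              (C.OccursUnderInput i → ∀ (σ : ℕ → ℕ) (Θ : Env), Env.IsSubst σ (Δ i) Θ →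
                S Θ ((Ps i).subst σ) ((Qs i).subst σ)))) →
    ∀ Γ P Q, S Γ P Q → eqv Γ .proc (.proc P) (.proc Q)

/-- The process `(ν bs) (a⟨cs⟩ | b(r). P)`. -/
def rendezvous (bs cs : List (ℕ × Ty 0)) (a b r : ℕ) (P : Proc 0) : Proc 0 :=
  .resList bs (.par (.out (.fr a) (cs.map fun p => .fr p.1)) (.inp (.fr b) 1 (P.bind1 r)))

/-- The side conditions on `(ν bs) (a⟨cs⟩ | b(r). P)`: it is typed under `Γ` when its continuation
`P` is typed under `Γ', r : T`; we have `b ∈ bs ⊆ cs`; and the rendez-vous is observable: `a` is not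
of a linear connection type, `b` has the type `♯ T`, and the names in `bs` that are not linear are
connections that are communicated as such. -/
structure RendezvousTyping (Γ : Env) (bs cs : List (ℕ × Ty 0)) (a b r : ℕ) (T : Ty 0) (Γ' : Env) :
    Prop where
  nodup : (bs.map Prod.fst).Nodup
  fresh : ∀ x ∈ bs.map Prod.fst, Γ.lookup x = none
  b_mem : (b, Ty.ch .conn T) ∈ bs
  subset : ∀ x ∈ bs.map Prod.fst, x ∈ cs.map Prod.fst
  a_fresh : a ∉ bs.map Prod.fst ∧ a ∉ cs.map Prod.fst
  r_fresh : r ≠ a ∧ r ∉ bs.map Prod.fst ∧ Γ'.lookup r = none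
  exported : ∀ x S, (x, S) ∈ bs → ¬ S.Linear → (∃ U, S = .ch .conn U) ∧ (x, S) ∈ cs
  splits : ∃ (Γ₁ Γ₂ Γ₃ Γ₂' Γ₃' : Env) (c c' : Cap) (U : Ty 0),
    Ty.Carried (cs.map Prod.snd) U ∧
    (c = .conn ∨ c = .out ∨ c = .linOut) ∧ Γ.lookup a = some (.ch c U) ∧
    (c' = .out ∨ c' = .linOut) ∧ Γ₁.HasTy a (.ch c' U) ∧
    Γ₂.HasTys cs ∧
    Γ₃.HasTy b (.ch .inp T) ∧
    Env.Join Γ₃ Γ' Γ₃' ∧ Env.Join Γ₂ Γ₃' Γ₂' ∧ Env.Join Γ₁ Γ₂' (Γ.extend bs)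

/-- The rendez-vous cancellation property. -/
def RendezvousCancellation (eqv : TypedRel) : Prop :=
  ∀ (Γ : Env) (bs cs : List (ℕ × Ty 0)) (a b r : ℕ) (T : Ty 0) (Γ' : Env) (P Q : Proc 0),
    RendezvousTyping Γ bs cs a b r T Γ' →
    a ∉ P.fn → a ∉ Q.fn → b ∉ P.fn → b ∉ Q.fn →
    P.Typed (Γ'.insert r T) → Q.Typed (Γ'.insert r T) →
    eqv Γ .proc (.proc (rendezvous bs cs a b r P)) (.proc (rendezvous bs cs a b r Q)) →
    eqv (Γ'.insert r T) .proc (.proc P) (.proc Q)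

/-! ## Encodings -/

/-- The substitution on names induced by a renaming of variables. -/
def extendRenaming {V : Set ℕ} (σ : V → V) (y : ℕ) : ℕ :=
  open scoped Classical in if h : y ∈ V then (σ ⟨y, h⟩ : ℕ) else y

/-- Compositional and uniform encodings of the lambda-calculus; the set `V` of the variables of the
lambda-calculus is included in the set of names. -/
structure Encoding (V : Set ℕ) where
  enc : Lam V 0 → Proc 1
  varAgent : V → ACtx (Fin 0) (Fin 0)
  lamCtx : V → ACtx (Fin 0) (Fin 1)
  appCtx : ACtx (Fin 0) (Fin 2)
  enc_var : ∀ x, enc (.fvar x) = (varAgent x).fill Fin.elim0 Fin.elim0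
  enc_lam : ∀ x M, enc (.abs x M) = (lamCtx x).fill Fin.elim0 ![enc M]
  enc_app : ∀ M N, enc (.app M N) = appCtx.fill Fin.elim0 ![enc M, enc N]
  lamCtx_bound : ∀ x : V, (x : ℕ) ∉ (lamCtx x).fn ∧ (lamCtx x).HolesInScope x
  uniform : ∀ (σ : V → V) M, enc (M.renameFree σ) = (enc M).subst (extendRenaming σ)
  fn_subset : ∀ M, (enc M).fn ⊆ M.fv

namespace Encoding

variable {V : Set ℕ}

/-- The variable context, that is, the encoding of `x [·]₁ ⋯ [·]ₙ`. -/
def varCtx (E : Encoding V) (x : V) : (n : ℕ) → ACtx (Fin 0) (Fin n)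
  | 0 => E.varAgent x
  | n + 1 => E.appCtx.plug
      ![(E.varCtx x n).plug (fun j => .hole j.castSucc), .hole (Fin.last n)]

/-- The encoding respects the type `Tb` of addresses, the variables having the type `Tv`: its
defining contexts, and hence all encodings of terms, are of type `Tb → ◇` whenever the variables are
assigned the type `Tv` and the holes stand for agents of type `Tb → ◇`. -/
structure Respects (E : Encoding V) (Tv Tb : Ty 0) : Prop where
  var : ∀ (X : Finset ℕ) (x : V), ↑X ⊆ V → (x : ℕ) ∈ X →
    (E.varAgent x).Typed Fin.elim0 Fin.elim0 (Env.const X Tv) Tb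
  lam : ∀ (X : Finset ℕ) (x : V), ↑X ⊆ V → (x : ℕ) ∉ X →
    (E.lamCtx x).Typed Fin.elim0 (fun _ => (Env.const (insert (x : ℕ) X) Tv, Tb))
      (Env.const X Tv) Tb
  app : ∀ X : Finset ℕ, ↑X ⊆ V →
    E.appCtx.Typed Fin.elim0 (fun _ => (Env.const X Tv, Tb)) (Env.const X Tv) Tb

/-- `⟦M⟧ ≍ ⟦N⟧`, in the environment that assigns `Tv` to the variables in `X`, at type `Tb → ◇`. -/
def Rel (E : Encoding V) (Tv Tb : Ty 0) (eqv : TypedRel) (X : Finset ℕ) (M N : Lam V 0) : Prop :=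
  eqv (Env.const X Tv) (.abs Tb) (.abs (E.enc M)) (.abs (E.enc N))

/-- `X` is a finite set of variables that contains those free in `M`. -/
def Covers (X : Finset ℕ) (M : Lam V 0) : Prop := ↑X ⊆ V ∧ M.fv ⊆ X

/-- The encoding and `≥` validate rule `β`. -/
def ValidatesBeta (E : Encoding V) (le : Agent → Agent → Prop) : Prop :=
  ∀ (x : V) (M N : Lam V 0),
    le (.abs (E.enc (M.substVar x N))) (.abs (E.enc (.app (.abs x M) N)))

/-- `C` has an inverse with respect to `≥`. The context `C` has `n` holes; it is used under `Γ` with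
the holes being filled by encodings of terms with free variables in `Y`, and has then type
`Tb → ◇`. The inverse contexts `D` and the fresh names may depend on the hole, but not on the
agents in the holes. -/
def HasInverse (E : Encoding V) (Tv Tb : Ty 0) (le : Agent → Agent → Prop) {n : ℕ}
    (C : ACtx (Fin 0) (Fin n)) (X Y : Finset ℕ) : Prop :=
  ∀ i : Fin n, ∃ (D : PCtx (Fin 0) (Fin 1)) (Γ : Env) (bs cs : List (ℕ × Ty 0)) (a b z : ℕ),
    a ∉ Y ∧ b ∉ Y ∧ z ∉ Y ∧
    RendezvousTyping Γ bs cs a b z Tb (Env.const Y Tv) ∧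
    D.Typed Fin.elim0 (fun _ => (Env.const X Tv, Tb)) Γ ∧
    ∀ Ms : Fin n → Lam V 0, (∀ j, Covers Y (Ms j)) →
      le (.proc (rendezvous bs cs a b z (.app (E.enc (Ms i)) (.fr z))))
        (.proc (D.fill Fin.elim0 ![C.fill Fin.elim0 fun j => E.enc (Ms j)]))

/-- The completeness conditions for Boehm trees. -/
structure CompletenessConditions (E : Encoding V) (Tv Tb : Ty 0) (eqv : TypedRel)
    (le : Agent → Agent → Prop) : Prop where
  congruence : IsTypedCongruence eqv
  contains : ContainsConverse eqv le
  expansion : IsExpansion fun P Q => le (.proc P) (.proc Q)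
  precongruence : IsPrecongruence le
  plain : IsPlain le
  upTo : ValidatesUpTo eqv le
  guarded : ∀ x n, (E.varCtx x n).Guarded
  beta : E.ValidatesBeta le
  unsolvable_zero : ∀ M X, Covers X M → M.UnsolvableOfOrder 0 → E.Rel Tv Tb eqv X M .omegaTerm
  unsolvable_infinite : ∀ M X, Covers X M → M.UnsolvableInfinite → E.Rel Tv Tb eqv X M .omegaTerm

/-- The soundness conditions for Boehm trees. -/
structure SoundnessConditions (E : Encoding V) (Tv Tb : Ty 0) (eqv : TypedRel)
    (le : Agent → Agent → Prop) : Prop where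
  congruence : IsTypedCongruence eqv
  precongruence : IsPrecongruence le
  plain : IsPlain le
  contains : ContainsConverse eqv le
  cancellation : RendezvousCancellation eqv
  beta : E.ValidatesBeta le
  unsolvable_zero : ∀ M X, Covers X M → M.UnsolvableOfOrder 0 → E.Rel Tv Tb eqv X M .omegaTerm
  omega_var : ∀ (x : V) (Ms : List (Lam V 0)) (X : Finset ℕ), Covers X (.apps (.fvar x) Ms) →
    ¬ E.Rel Tv Tb eqv X .omegaTerm (.apps (.fvar x) Ms)
  var_length : ∀ (x : V) (Ms Ms' : List (Lam V 0)) (X : Finset ℕ),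
    Covers X (.apps (.fvar x) Ms) → Covers X (.apps (.fvar x) Ms') → Ms.length ≠ Ms'.length →
    ¬ E.Rel Tv Tb eqv X (.apps (.fvar x) Ms) (.apps (.fvar x) Ms')
  var_var : ∀ (x y : V) (Ms Ms' : List (Lam V 0)) (X : Finset ℕ),
    Covers X (.apps (.fvar x) Ms) → Covers X (.apps (.fvar y) Ms') → x ≠ y →
    ¬ E.Rel Tv Tb eqv X (.apps (.fvar x) Ms) (.apps (.fvar y) Ms')
  inverse_lam : ∀ (x : V) (X : Finset ℕ), ↑X ⊆ V → (x : ℕ) ∉ X →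
    E.HasInverse Tv Tb le (E.lamCtx x) X (insert (x : ℕ) X)
  inverse_var : ∀ (x : V) (n : ℕ) (X : Finset ℕ), ↑X ⊆ V → (x : ℕ) ∈ X →
    E.HasInverse Tv Tb le (E.varCtx x n) X X
  unsolvable_infinite : ∀ M X, Covers X M → M.UnsolvableInfinite → E.Rel Tv Tb eqv X M .omegaTerm
  solvable_omega : ∀ (x : V) (M : Lam V 0) (X : Finset ℕ), Covers X (.abs x M) → M.Solvable →
    ¬ E.Rel Tv Tb eqv X (.abs x M) .omegaTerm
  solvable_var : ∀ (x y : V) (M : Lam V 0) (Ms : List (Lam V 0)) (X : Finset ℕ),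
    Covers X (.abs x M) → Covers X (.apps (.fvar y) Ms) → M.Solvable →
    ¬ E.Rel Tv Tb eqv X (.abs x M) (.apps (.fvar y) Ms)

/-- Soundness for Boehm trees. -/
def SoundForBT (E : Encoding V) (Tv Tb : Ty 0) (eqv : TypedRel) : Prop :=
  ∀ (M N : Lam V 0) (X : Finset ℕ), Covers X M → Covers X N →
    E.Rel Tv Tb eqv X M N → M.bohmTree = N.bohmTree

/-- Completeness for Boehm trees. -/
def CompleteForBT (E : Encoding V) (Tv Tb : Ty 0) (eqv : TypedRel) : Prop :=
  ∀ (M N : Lam V 0) (X : Finset ℕ), Covers X M → Covers X N →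
    M.bohmTree = N.bohmTree → E.Rel Tv Tb eqv X M N

def FullyAbstractForBT (E : Encoding V) (Tv Tb : Ty 0) (eqv : TypedRel) : Prop :=
  E.SoundForBT Tv Tb eqv ∧ E.CompleteForBT Tv Tb eqv

end Encoding

end

/-! ## Substitution and equality of recursive types -/

namespace Lam

/-! Both directions follow Böhm trees and share a common core. By rule β and the precongruence laws,
the encoding of a term is above (for ≥) the encoding of each of its head reducts; as ≍ contains ≥,
terms may be replaced by their head normal forms. Moreover every unsolvable term is related to Ω
(`rel_omega`). The orders 0 and ∞ are given. For the other orders it suffices that λx.Ω ≍ Ω, and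
this holds because a term Ξ that reduces to λx.Ξ has order ∞, so that λx.Ω ≍ λx.Ξ ≍ Ξ ≍ Ω.

Completeness is coinductive. `BTRel` relates the encodings of solvable terms with the same tree,
applied to a name and under any typed substitution. Such terms have head normal forms with the same
abstractions and head variable, so up to ≥ their encodings differ only in the arguments, which lie
beneath prefixes because the variable contexts are guarded. What lies beneath a prefix has no
influence on the next transition. Hence both sides make the same transition, after which the
arguments may have been moved, duplicated or instantiated but are still related in pairs
(`Clo.step`). The derivatives are thus a common context filled with pairs of `BTRel` or, for
unsolvable arguments, of ≍, which is what the up-to technique asks for. The expansion property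
carries transitions from the given processes to the head normal forms and back.

The technical weight lies in the typing: the common context must be typed under an environment that
remains after the transition. "Same structure up to related leaves" is therefore defined as a typing
derivation for two processes at once (`Clo`), and the matching of transitions is at the same time a
subject reduction theorem. It rests on inversion of the equality of recursive types (`Eqv.head`), on
the laws of the partial monoid of environments (`Join.assoc`, `Join.exchange`), on the fact that
typed substitutions split along with their source (`IsSubst.split`), on closure of `Clo` under them
(`Clo.subst`), and on the analysis of a communication (`Join.communication`, `Deriv.communication`).
Closure of ≥ and of ≍ under substitutions is not assumed; it comes from plainness.

Soundness is an induction on positions of the tree. Related terms are both solvable or both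
unsolvable, and the separation conditions force their head normal forms to agree in the number of
abstractions, the head variable and the number of arguments. An inverse context turns the encoding
into a rendez-vous whose continuation is a chosen hole, so cancellation yields that the bodies, or
the arguments, are related again (`rel_of_hasInverse`). -/

theorem liftFin_castSucc {n m : ℕ} (f : Fin n → Fin m) (i : Fin n) :
    liftFin f i.castSucc = (f i).castSucc := by
  simp [liftFin]

theorem liftFin_last {n m : ℕ} (f : Fin n → Fin m) : liftFin f (Fin.last n) = Fin.last m := by
  simp [liftFin]

theorem liftFin_comp {n m k : ℕ} (f : Fin n → Fin m) (g : Fin m → Fin k) :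
    liftFin (g ∘ f) = liftFin g ∘ liftFin f := by
  funext i
  refine Fin.lastCases ?_ (fun i => ?_) i <;> simp [liftFin_castSucc, liftFin_last]

end Lam

namespace Ty

open Lam (liftFin liftFin_castSucc liftFin_last liftFin_comp)

/-- The substitution `f` underneath a binder. -/
abbrev liftSubst {n m : ℕ} (f : Fin n → Ty m) : Fin (n + 1) → Ty (m + 1) :=
  Fin.snoc (α := fun _ => Ty (m + 1)) (fun i => (f i).rename Fin.castSucc) (tvar (Fin.last m))

theorem rename_rename {n m k : ℕ} (T : Ty n) (f : Fin n → Fin m) (g : Fin m → Fin k) :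
    (T.rename f).rename g = T.rename (g ∘ f) := by
  induction T generalizing m k with
  | unit => rfl
  | ch c T ih => simp [rename, ih]
  | prod j T ih => simp [rename, ih]
  | tvar i => rfl
  | mu T ih => simp [rename, ih, liftFin_comp]

theorem subst_rename {n m k : ℕ} (T : Ty n) (f : Fin n → Fin m) (g : Fin m → Ty k) :
    (T.rename f).subst g = T.subst (g ∘ f) := by
  induction T generalizing m k with
  | unit => rfl
  | ch c T ih => simp [rename, subst, ih]
  | prod j T ih => simp [rename, subst, ih]
  | tvar i => rfl
  | mu T ih =>
    simp only [rename, subst, ih]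
    congr 2
    funext i
    refine Fin.lastCases ?_ (fun i => ?_) i <;> simp [liftFin_castSucc, liftFin_last]

theorem rename_subst {n m k : ℕ} (T : Ty n) (f : Fin n → Ty m) (g : Fin m → Fin k) :
    (T.subst f).rename g = T.subst (fun i => (f i).rename g) := by
  induction T generalizing m k with
  | unit => rfl
  | ch c T ih => simp [rename, subst, ih]
  | prod j T ih => simp [rename, subst, ih]
  | tvar i => rfl
  | mu T ih =>
    simp only [rename, subst, ih]
    congr 2
    funext i
    refine Fin.lastCases ?_ (fun i => ?_) i
    · simp [rename, liftFin_last]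
    · simp only [Fin.snoc_castSucc, rename_rename]
      congr 1
      funext j
      simp [liftFin_castSucc]

theorem subst_subst {n m k : ℕ} (T : Ty n) (f : Fin n → Ty m) (g : Fin m → Ty k) :
    (T.subst f).subst g = T.subst (fun i => (f i).subst g) := by
  induction T generalizing m k with
  | unit => rfl
  | ch c T ih => simp [subst, ih]
  | prod j T ih => simp [subst, ih]
  | tvar i => rfl
  | mu T ih =>
    simp only [subst, ih]
    congr 2
    funext i
    refine Fin.lastCases ?_ (fun i => ?_) i
    · simp [subst]
    · simp only [Fin.snoc_castSucc, subst_rename, rename_subst]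
      congr 1
      funext j
      simp

theorem subst_tvar {n : ℕ} (T : Ty n) : T.subst tvar = T := by
  induction T with
  | unit => rfl
  | ch c T ih => simp [subst, ih]
  | prod j T ih => simp [subst, ih]
  | tvar i => rfl
  | mu T ih =>
    simp only [subst]
    congr 1
    conv_rhs => rw [← ih]
    congr 1
    funext i
    refine Fin.lastCases ?_ (fun i => ?_) i <;> simp [rename]

/-- Both sides are a single substitution of `T`, by `subst_subst`. This settles the one case of
`Eqv.subst` that is not structural. -/
theorem unfold_subst {n m : ℕ} (T : Ty (n + 1)) (f : Fin n → Ty m) :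
    (unfold T).subst f = unfold (T.subst (liftSubst f)) := by
  simp only [unfold, subst_subst]
  congr 1
  funext i
  refine Fin.lastCases ?_ (fun i => ?_) i
  · simp [subst]
  · simp only [Fin.snoc_castSucc, subst, subst_rename]
    conv_lhs => rw [← subst_tvar (f i)]
    congr 1
    funext j
    simp

theorem Eqv.subst {n m : ℕ} {S T : Ty n} (h : Eqv S T) (f : Fin n → Ty m) :
    Eqv (S.subst f) (T.subst f) := by
  induction h generalizing m with
  | refl => exact .refl _
  | symm _ ih => exact (ih f).symm
  | trans _ _ ih₁ ih₂ => exact (ih₁ f).trans (ih₂ f)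
  | ch c _ ih => exact .ch c (ih f)
  | prod _ ih => exact .prod fun i => ih i f
  | mu _ ih => exact .mu (ih _)
  | unfold T =>
    rw [unfold_subst]
    exact .unfold _

theorem Eqv.rename {n m : ℕ} {S T : Ty n} (h : Eqv S T) (f : Fin n → Fin m) :
    Eqv (S.rename f) (T.rename f) := by
  have key : ∀ U : Ty n, U.rename f = U.subst (fun i => tvar (f i)) := fun U => by
    rw [← subst_tvar (U.rename f), subst_rename]
    rfl
  rw [key, key]
  exact h.subst _

theorem Eqv.subst_congr {n m : ℕ} (T : Ty n) {f g : Fin n → Ty m} (h : ∀ i, Eqv (f i) (g i)) :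
    Eqv (T.subst f) (T.subst g) := by
  induction T generalizing m with
  | unit => exact .refl _
  | ch c T ih => exact .ch c (ih h)
  | prod j T ih => exact .prod fun i => ih i h
  | tvar i => exact h i
  | mu T ih =>
    refine .mu (ih fun i => ?_)
    refine Fin.lastCases ?_ (fun i => ?_) i
    · simpa using Eqv.refl _
    · simpa using (h i).rename _

/-! ### Outermost constructors of recursive types -/

/-- `HeadIn k T R`: unfolding the outermost recursions of `T`, `k` times, leads to `R`, which is not
a recursive type. -/
inductive HeadIn {n : ℕ} : ℕ → Ty n → Ty n → Prop
  | unit : HeadIn 0 unit unit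
  | ch (c : Cap) (T : Ty n) : HeadIn 0 (ch c T) (ch c T)
  | prod (k : ℕ) (T : Fin (k + 2) → Ty n) : HeadIn 0 (prod k T) (prod k T)
  | tvar (i : Fin n) : HeadIn 0 (tvar i) (tvar i)
  | mu {k : ℕ} {T : Ty (n + 1)} {R : Ty n} : HeadIn k (unfold T) R → HeadIn (k + 1) (mu T) R

/-- The same outermost constructor, with equal components. -/
inductive SameHead {n : ℕ} : Ty n → Ty n → Prop
  | unit : SameHead unit unit
  | ch (c : Cap) {S T : Ty n} : Eqv S T → SameHead (ch c S) (ch c T)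
  | prod {k : ℕ} {S T : Fin (k + 2) → Ty n} : (∀ i, Eqv (S i) (T i)) →
      SameHead (prod k S) (prod k T)
  | tvar (i : Fin n) : SameHead (tvar i) (tvar i)

theorem SameHead.trans {n : ℕ} {S T U : Ty n} (h : SameHead S T) (h' : SameHead T U) :
    SameHead S U := by
  cases h with
  | unit => exact h'
  | ch c h => cases h' with | ch _ h' => exact .ch c (h.trans h')
  | prod h => cases h' with | prod h' => exact .prod fun i => (h i).trans (h' i)
  | tvar i => exact h'

theorem HeadIn.sameHead_self {n k : ℕ} {T R : Ty n} (h : HeadIn k T R) : SameHead R R := by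
  induction h with
  | unit => exact .unit
  | ch c T => exact .ch c (.refl _)
  | prod k T => exact .prod fun _ => .refl _
  | tvar i => exact .tvar i
  | mu _ ih => exact ih

theorem HeadIn.subst {n m k j : ℕ} {T R : Ty n} (h : HeadIn k T R) {f : Fin n → Ty m} {R' : Ty m}
    (h' : HeadIn j (R.subst f) R') : HeadIn (k + j) (T.subst f) R' := by
  induction h with
  | mu _ ih =>
    have := ih h'
    rw [unfold_subst] at this
    have := HeadIn.mu this
    rwa [show ∀ a : ℕ, a + j + 1 = a + 1 + j by intro a; omega] at this
  | _ => simpa using h'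

/-- Converse of `HeadIn.subst`. Unfolding an instance of `T` unfolds `T` itself until a constructor
or a variable is exposed, and only in the latter case goes on inside the substituted type. The
equation `i + j = k` is what makes the induction of `head_mu` decrease. -/
theorem HeadIn.of_subst {m k : ℕ} {X R' : Ty m} (h : HeadIn k X R') :
    ∀ {n : ℕ} {T : Ty n} {f : Fin n → Ty m}, X = T.subst f →
    ∃ i j R, i + j = k ∧ HeadIn i T R ∧ HeadIn j (R.subst f) R' := by
  induction h with
  | unit =>
    intro n T f hX
    cases T with
    | unit => exact ⟨0, 0, _, rfl, .unit, .unit⟩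
    | tvar i => exact ⟨0, 0, _, rfl, .tvar i, hX ▸ .unit⟩
    | _ => simp [Ty.subst] at hX
  | ch c T' =>
    intro n T f hX
    cases T with
    | ch c T => exact ⟨0, 0, _, rfl, .ch _ _, hX ▸ .ch _ _⟩
    | tvar i => exact ⟨0, 0, _, rfl, .tvar i, hX ▸ .ch _ _⟩
    | _ => simp [Ty.subst] at hX
  | prod j T' =>
    intro n T f hX
    cases T with
    | prod j T => exact ⟨0, 0, _, rfl, .prod _ _, hX ▸ .prod _ _⟩
    | tvar i => exact ⟨0, 0, _, rfl, .tvar i, hX ▸ .prod _ _⟩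
    | _ => simp [Ty.subst] at hX
  | tvar i =>
    intro n T f hX
    cases T with
    | tvar i => exact ⟨0, 0, _, rfl, .tvar i, hX ▸ .tvar _⟩
    | _ => simp [Ty.subst] at hX
  | @mu k T' R' h ih =>
    intro n T f hX
    cases T with
    | mu T =>
      simp only [Ty.subst, Ty.mu.injEq] at hX
      subst hX
      obtain ⟨i, j, R, hij, h₁, h₂⟩ := ih (unfold_subst T f).symm
      exact ⟨i + 1, j, R, by omega, .mu h₁, h₂⟩
    | tvar i => exact ⟨0, k + 1, _, by omega, .tvar i, hX ▸ .mu h⟩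
    | _ => simp [Ty.subst] at hX

/-- The unfoldings of `mu S` first pass through `S`, where `ih` applies. If they end at a
constructor, the components agree up to the replacement of `mu S` by `mu T`. If they end at the
bound variable, the rest is an unfolding of `mu S` in strictly fewer steps; whence the strong
induction on `k`. -/
theorem head_mu {n : ℕ} {S T : Ty (n + 1)} (hST : Eqv S T)
    (ih : ∀ k R, HeadIn k S R → ∃ j R', HeadIn j T R' ∧ SameHead R R') :
    ∀ k R, HeadIn k (mu S) R → ∃ j R', HeadIn j (mu T) R' ∧ SameHead R R' := by
  intro k
  induction k using Nat.strong_induction_on with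
  | _ k ihk =>
  intro R h
  cases h with
  | @mu k _ _ h =>
  obtain ⟨i, j, R₀, hij, h₁, h₂⟩ := h.of_subst rfl
  obtain ⟨i', R₁, h₃, hs⟩ := ih i R₀ h₁
  have hsub : ∀ U V : Ty (n + 1), Eqv U V →
      Eqv (U.subst (Fin.snoc (α := fun _ => Ty n) Ty.tvar (Ty.mu S)))
        (V.subst (Fin.snoc (α := fun _ => Ty n) Ty.tvar (Ty.mu T))) := by
    intro U V hUV
    refine (hUV.subst _).trans (Eqv.subst_congr V fun i => ?_)
    refine Fin.lastCases ?_ (fun i => ?_) i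
    · simpa using Eqv.mu hST
    · simpa using Eqv.refl _
  cases hs with
  | unit =>
    cases h₂
    exact ⟨_, _, .mu (h₃.subst .unit), .unit⟩
  | ch c hU =>
    cases h₂
    exact ⟨_, _, .mu (h₃.subst (.ch _ _)), .ch _ (hsub _ _ hU)⟩
  | prod hU =>
    cases h₂
    exact ⟨_, _, .mu (h₃.subst (.prod _ _)), .prod fun i => hsub _ _ (hU i)⟩
  | tvar l =>
    revert h₁ h₂ h₃
    refine Fin.lastCases ?_ (fun l => ?_) l
    · intro h₁ h₂ h₃
      simp only [Ty.subst, Fin.snoc_last] at h₂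
      obtain ⟨j', R', h₄, hs⟩ := ihk j (by omega) _ h₂
      refine ⟨_, _, .mu (h₃.subst (j := j') (R' := R') ?_), hs⟩
      simpa [Ty.subst] using h₄
    · intro h₁ h₂ h₃
      simp only [Ty.subst, Fin.snoc_castSucc] at h₂
      cases h₂
      refine ⟨_, _, .mu (h₃.subst (j := 0) (R' := Ty.tvar l) ?_), .tvar _⟩
      simpa [Ty.subst] using HeadIn.tvar l

/-- Symmetry of `Eqv` forces both directions to be proved together. A type such as `μX.X` has no
head, so the existence of a head is transferred rather than assumed. -/
theorem Eqv.head {n : ℕ} {S T : Ty n} (h : Eqv S T) :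
    (∀ k R, HeadIn k S R → ∃ j R', HeadIn j T R' ∧ SameHead R R') ∧
    (∀ k R, HeadIn k T R → ∃ j R', HeadIn j S R' ∧ SameHead R R') := by
  induction h with
  | refl T => exact ⟨fun k R h => ⟨k, R, h, h.sameHead_self⟩, fun k R h => ⟨k, R, h, h.sameHead_self⟩⟩
  | symm _ ih => exact ih.symm
  | trans _ _ ih₁ ih₂ =>
    constructor
    · intro k R h
      obtain ⟨j, R', h', hs⟩ := ih₁.1 k R h
      obtain ⟨j', R'', h'', hs'⟩ := ih₂.1 j R' h'
      exact ⟨j', R'', h'', hs.trans hs'⟩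
    · intro k R h
      obtain ⟨j, R', h', hs⟩ := ih₂.2 k R h
      obtain ⟨j', R'', h'', hs'⟩ := ih₁.2 j R' h'
      exact ⟨j', R'', h'', hs.trans hs'⟩
  | ch c h _ =>
    constructor
    · intro k R h'
      cases h'
      exact ⟨0, _, .ch _ _, .ch _ h⟩
    · intro k R h'
      cases h'
      exact ⟨0, _, .ch _ _, .ch _ h.symm⟩
  | prod h _ =>
    constructor
    · intro k R h'
      cases h'
      exact ⟨0, _, .prod _ _, .prod h⟩
    · intro k R h'
      cases h'
      exact ⟨0, _, .prod _ _, .prod fun i => (h i).symm⟩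
  | mu h ih => exact ⟨head_mu h ih.1, head_mu h.symm ih.2⟩
  | unfold T =>
    constructor
    · intro k R h
      cases h with
      | mu h => exact ⟨_, _, h, h.sameHead_self⟩
    · intro k R h
      exact ⟨_, _, .mu h, h.sameHead_self⟩

theorem Eqv.ch_inj {n : ℕ} {c c' : Cap} {S T : Ty n} (h : Eqv (.ch c S) (.ch c' T)) :
    c = c' ∧ Eqv S T := by
  obtain ⟨j, R, hR, hs⟩ := h.head.1 0 _ (.ch _ _)
  cases hR
  cases hs with
  | ch _ h => exact ⟨rfl, h⟩

theorem Eqv.not_ch_prod {n k : ℕ} {c : Cap} {S : Ty n} {T : Fin (k + 2) → Ty n} :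
    ¬ Eqv (.ch c S) (.prod k T) := by
  intro h
  obtain ⟨j, R, hR, hs⟩ := h.head.1 0 _ (.ch _ _)
  cases hR
  cases hs

theorem Eqv.prod_inj {n k : ℕ} {S T : Fin (k + 2) → Ty n} (h : Eqv (.prod k S) (.prod k T)) :
    ∀ i, Eqv (S i) (T i) := by
  obtain ⟨j, R, hR, hs⟩ := h.head.1 0 _ (.prod _ _)
  cases hR
  cases hs with
  | prod h => exact h

theorem Eqv.prod_arity {n k k' : ℕ} {S : Fin (k + 2) → Ty n} {T : Fin (k' + 2) → Ty n}
    (h : Eqv (.prod k S) (.prod k' T)) : k = k' := by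
  obtain ⟨j, R, hR, hs⟩ := h.head.1 0 _ (.prod _ _)
  cases hR
  cases hs
  rfl

/-! ### Subtyping modulo type equality -/

/-- The preorder generated by subtyping and type equality. -/
def Le : Ty 0 → Ty 0 → Prop := Relation.ReflTransGen fun S T => Sub S T ∨ Eqv S T

theorem Le.refl (T : Ty 0) : Le T T := Relation.ReflTransGen.refl

theorem Le.trans {S T U : Ty 0} (h : Le S T) (h' : Le T U) : Le S U :=
  Relation.ReflTransGen.trans h h'

theorem Le.of_sub {S T : Ty 0} (h : Sub S T) : Le S T := Relation.ReflTransGen.single (.inl h)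

theorem Le.of_eqv {S T : Ty 0} (h : Eqv S T) : Le S T := Relation.ReflTransGen.single (.inr h)

/-- Induction along `Le` from the larger type down to the smaller one. -/
theorem Le.backward {S T : Ty 0} (h : Le S T) {p : Ty 0 → Prop} (hT : p T)
    (hs : ∀ X Y, Sub X Y → p Y → p X) (he : ∀ X Y, Eqv X Y → p Y → p X) : p S := by
  induction h using Relation.ReflTransGen.head_induction_on with
  | refl => exact hT
  | head h _ ih => exact h.elim (fun h => hs _ _ h ih) fun h => he _ _ h ih

theorem Le.forward {S T : Ty 0} (h : Le S T) {p : Ty 0 → Prop} (hS : p S)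
    (hs : ∀ X Y, Sub X Y → p X → p Y) (he : ∀ X Y, Eqv X Y → p X → p Y) : p T := by
  induction h with
  | refl => exact hS
  | tail _ h ih => exact h.elim (fun h => hs _ _ h ih) fun h => he _ _ h ih

/-- The induction runs from the larger type down, because the shape is known there. At each
subtyping step `Eqv.ch_inj` excludes all capabilities but input and connection. -/
theorem Le.inp_inv {W T : Ty 0} (h : Le W (.ch .inp T)) :
    ∃ U, (Eqv W (.ch .inp U) ∨ Eqv W (.ch .conn U)) ∧ Le U T := by
  refine h.backward (p := fun W => ∃ U, (Eqv W (.ch .inp U) ∨ Eqv W (.ch .conn U)) ∧ Le U T)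
    ⟨T, .inl (.refl _), .refl _⟩ ?_ ?_
  · intro X Y hXY
    induction hXY with
    | refl => exact id
    | trans _ _ ih₁ ih₂ => exact ih₁ ∘ ih₂
    | connInp T' =>
      rintro ⟨U, h | h, hU⟩
      · exact ⟨T', .inr (.refl _), (Le.of_eqv h.ch_inj.2).trans hU⟩
      · cases h.ch_inj.1
    | connOut T' => rintro ⟨U, h | h, hU⟩ <;> cases h.ch_inj.1
    | inp hs _ =>
      rintro ⟨U, h | h, hU⟩
      · exact ⟨_, .inl (.refl _), ((Le.of_sub hs).trans (Le.of_eqv h.ch_inj.2)).trans hU⟩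
      · cases h.ch_inj.1
    | out hs _ => rintro ⟨U, h | h, hU⟩ <;> cases h.ch_inj.1
    | prod hs _ => rintro ⟨U, h | h, hU⟩ <;> exact absurd h.symm Eqv.not_ch_prod
    | conn hs _ _ _ =>
      rintro ⟨U, h | h, hU⟩
      · cases h.ch_inj.1
      · exact ⟨_, .inr (.refl _), ((Le.of_sub hs).trans (Le.of_eqv h.ch_inj.2)).trans hU⟩
  · rintro X Y hXY ⟨U, h, hU⟩
    exact ⟨U, h.imp hXY.trans hXY.trans, hU⟩

theorem Le.out_inv {W T : Ty 0} (h : Le W (.ch .out T)) :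
    ∃ U, (Eqv W (.ch .out U) ∨ Eqv W (.ch .conn U)) ∧ Le T U := by
  refine h.backward (p := fun W => ∃ U, (Eqv W (.ch .out U) ∨ Eqv W (.ch .conn U)) ∧ Le T U)
    ⟨T, .inl (.refl _), .refl _⟩ ?_ ?_
  · intro X Y hXY
    induction hXY with
    | refl => exact id
    | trans _ _ ih₁ ih₂ => exact ih₁ ∘ ih₂
    | connOut T' =>
      rintro ⟨U, h | h, hU⟩
      · exact ⟨T', .inr (.refl _), hU.trans (Le.of_eqv h.ch_inj.2.symm)⟩
      · cases h.ch_inj.1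
    | connInp T' => rintro ⟨U, h | h, hU⟩ <;> cases h.ch_inj.1
    | out hs _ =>
      rintro ⟨U, h | h, hU⟩
      · exact ⟨_, .inl (.refl _), hU.trans ((Le.of_eqv h.ch_inj.2.symm).trans (Le.of_sub hs))⟩
      · cases h.ch_inj.1
    | inp hs _ => rintro ⟨U, h | h, hU⟩ <;> cases h.ch_inj.1
    | prod hs _ => rintro ⟨U, h | h, hU⟩ <;> exact absurd h.symm Eqv.not_ch_prod
    | conn _ hs _ _ =>
      rintro ⟨U, h | h, hU⟩
      · cases h.ch_inj.1
      · exact ⟨_, .inr (.refl _), hU.trans ((Le.of_eqv h.ch_inj.2.symm).trans (Le.of_sub hs))⟩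
  · rintro X Y hXY ⟨U, h, hU⟩
    exact ⟨U, h.imp hXY.trans hXY.trans, hU⟩

/-- Only a connection lies below both an input and an output type, and the type it carries lies
between the two. This is the subtyping behind a communication on a non-linear channel. -/
theorem Le.inp_out {W T T' : Ty 0} (h : Le W (.ch .inp T)) (h' : Le W (.ch .out T')) :
    Le T' T := by
  obtain ⟨U, hU | hU, hUT⟩ := h.inp_inv <;> obtain ⟨U', hU' | hU', hUT'⟩ := h'.out_inv
  · cases (hU.symm.trans hU').ch_inj.1
  · cases (hU.symm.trans hU').ch_inj.1
  · cases (hU.symm.trans hU').ch_inj.1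
  · exact (hUT'.trans (.of_eqv (hU'.symm.trans hU).ch_inj.2)).trans hUT

/-- Apart from reflexivity and transitivity, no rule of subtyping concerns types with a linear
capability at the top. -/
theorem sub_linear {X Y : Ty 0} (h : Sub X Y) {c : Cap} (hc : c.IsLinear) (T : Ty 0) :
    Eqv X (.ch c T) ↔ Eqv Y (.ch c T) := by
  induction h with
  | refl => rfl
  | trans _ _ ih₁ ih₂ => exact ih₁.trans ih₂
  | prod _ _ =>
    exact ⟨fun h => absurd h.symm Eqv.not_ch_prod, fun h => absurd h.symm Eqv.not_ch_prod⟩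
  | _ => constructor <;> intro h <;> rw [← h.ch_inj.1] at hc <;> exact hc.elim

theorem Le.linear_right {W T T' : Ty 0} {c : Cap} (hc : c.IsLinear) (h : Le W T) :
    Eqv W (.ch c T') ↔ Eqv T (.ch c T') :=
  ⟨fun hW => h.forward (p := fun X => Eqv X (.ch c T')) hW
      (fun _ _ hs => (sub_linear hs hc _).1) fun _ _ he hX => he.symm.trans hX,
    fun hT => h.backward (p := fun X => Eqv X (.ch c T')) hT
      (fun _ _ hs => (sub_linear hs hc _).2) fun _ _ he hX => he.trans hX⟩

theorem Le.linear_iff {S T : Ty 0} (h : Le S T) : S.Linear ↔ T.Linear :=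
  ⟨fun ⟨c, U, hc, hU⟩ => ⟨c, U, hc, (h.linear_right hc).1 hU⟩,
    fun ⟨c, U, hc, hU⟩ => ⟨c, U, hc, (h.linear_right hc).2 hU⟩⟩

theorem linear_ch {c : Cap} (hc : c.IsLinear) (T : Ty 0) : (ch c T).Linear := ⟨c, T, hc, .refl _⟩

theorem not_linear_ch {c : Cap} (hc : ¬ c.IsLinear) (T : Ty 0) : ¬ (ch c T).Linear := by
  rintro ⟨c', U, hc', hU⟩
  rw [hU.ch_inj.1] at hc
  exact hc hc'

theorem Le.prod_inv {k : ℕ} {W : Ty 0} {T : Fin (k + 2) → Ty 0} (h : Le W (.prod k T)) :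
    ∃ S, Eqv W (.prod k S) ∧ ∀ i, Le (S i) (T i) := by
  refine h.backward (p := fun W => ∃ S, Eqv W (.prod k S) ∧ ∀ i, Le (S i) (T i))
    ⟨T, .refl _, fun _ => .refl _⟩ ?_ ?_
  · intro X Y hXY
    induction hXY with
    | refl => exact id
    | trans _ _ ih₁ ih₂ => exact ih₁ ∘ ih₂
    | @prod k' S' T' hs _ =>
      rintro ⟨S, h, hS⟩
      obtain rfl := h.prod_arity
      exact ⟨_, .refl _, fun i => ((Le.of_sub (hs i)).trans (.of_eqv (h.prod_inj i))).trans (hS i)⟩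
    | _ => rintro ⟨S, h, hS⟩; exact absurd h Eqv.not_ch_prod
  · rintro X Y hXY ⟨S, h, hS⟩
    exact ⟨S, hXY.trans h, hS⟩

/-- The lengths have to be known to agree: a channel for a single name of product type carries the
same type as a channel for a tuple. -/
theorem Le.carried {ls lt : List (Ty 0)} {S T : Ty 0} (hS : Carried ls S) (hT : Carried lt T)
    (hl : ls.length = lt.length) (h : Le S T) : List.Forall₂ Le ls lt := by
  cases hS with
  | one =>
    cases hT with
    | one => exact .cons h .nil
    | tuple T => simp at hl
  | tuple S =>
    cases hT with
    | one => simp at hl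
    | tuple T =>
      simp only [List.length_ofFn, Nat.add_right_cancel_iff] at hl
      subst hl
      obtain ⟨S', hS', hle⟩ := h.prod_inv
      rw [List.forall₂_iff_get]
      refine ⟨by simp, fun i h₁ h₂ => ?_⟩
      simp only [List.get_eq_getElem, List.getElem_ofFn]
      exact (Le.of_eqv (hS'.prod_inj _)).trans (hle _)

end Ty

/-! ## Combination of type environments and typed substitutions -/

namespace Ty

theorem Comb.symm {S T U : Ty 0} (h : Comb S T U) : Comb T S U := by
  cases h with
  | inpOut h₁ h₂ h₃ => exact .outInp h₂ h₁ h₃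
  | outInp h₁ h₂ h₃ => exact .inpOut h₂ h₁ h₃
  | same h => exact .same h

/-- The dichotomy behind all arguments about `⊎`: either a non-linear type is shared, or a linear
connection is divided into its two ends. -/
theorem Comb.linConn_or_same {S T U : Ty 0} (h : Comb S T U) :
    (¬ U.Linear ∧ S = U ∧ T = U) ∨ S.Linear ∧ T.Linear ∧ ∃ W, Eqv U (.ch .linConn W) := by
  cases h with
  | inpOut h₁ h₂ h₃ => exact .inr ⟨⟨_, _, by trivial, h₁⟩, ⟨_, _, by trivial, h₂⟩, _, h₃⟩
  | outInp h₁ h₂ h₃ => exact .inr ⟨⟨_, _, by trivial, h₁⟩, ⟨_, _, by trivial, h₂⟩, _, h₃⟩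
  | same h => exact .inl ⟨h, rfl, rfl⟩

/-- A linear connection already owns both ends, so nothing is left to combine it with. -/
theorem Comb.left_not_linConn {S T U W : Ty 0} (h : Comb S T U) : ¬ Eqv S (.ch .linConn W) := by
  intro hS
  cases h with
  | inpOut h₁ h₂ h₃ => cases (h₁.symm.trans hS).ch_inj.1
  | outInp h₁ h₂ h₃ => cases (h₁.symm.trans hS).ch_inj.1
  | same h => exact h ⟨_, _, by trivial, hS⟩

end Ty

/-! ### Finite environments as partial functions -/

namespace Env

theorem lookup_insert_eq (Γ : Env) (x : ℕ) (T : Ty 0) (y : ℕ) :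
    Finmap.lookup y (Γ.insert x T) = if y = x then some T else Γ.lookup y := by
  split_ifs with h
  · subst h
    exact Finmap.lookup_insert _
  · exact Finmap.lookup_insert_of_ne _ h

theorem lookup_erase_eq (Γ : Env) (x y : ℕ) :
    Finmap.lookup y (Γ.erase x) = if y = x then none else Γ.lookup y := by
  split_ifs with h
  · subst h
    exact Finmap.lookup_erase _ _
  · exact Finmap.lookup_erase_ne h

theorem lookup_singleton (x : ℕ) (T : Ty 0) (y : ℕ) :
    Finmap.lookup y (Finmap.singleton x T : Env) = if y = x then some T else none := by
  split_ifs with h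
  · subst h
    exact Finmap.lookup_singleton_eq
  · rw [Finmap.lookup_eq_none, Finmap.mem_singleton]
    exact h

theorem insert_erase {Γ : Env} {x : ℕ} {T : Ty 0} (h : Γ.lookup x = some T) :
    (Γ.erase x).insert x T = Γ := by
  refine Finmap.ext_lookup fun y => ?_
  simp only [lookup_insert_eq, lookup_erase_eq]
  split_ifs with hy
  · rw [hy, h]
  · rfl

theorem insert_erase_self (Γ : Env) (x : ℕ) (T : Ty 0) :
    (Γ.erase x).insert x T = Γ.insert x T := by
  refine Finmap.ext_lookup fun y => ?_
  simp only [lookup_insert_eq, lookup_erase_eq]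
  split_ifs <;> rfl

theorem erase_insert {Γ : Env} {x : ℕ} (T : Ty 0) (h : Γ.lookup x = none) :
    (Γ.insert x T).erase x = Γ := by
  refine Finmap.ext_lookup fun y => ?_
  simp only [lookup_insert_eq, lookup_erase_eq]
  split_ifs with hy
  · rw [hy, h]
  · rfl

theorem erase_of_lookup {Γ : Env} {x : ℕ} (h : Γ.lookup x = none) : Γ.erase x = Γ := by
  refine Finmap.ext_lookup fun y => ?_
  simp only [lookup_erase_eq]
  split_ifs with hy
  · rw [hy, h]
  · rfl

theorem exists_env (s : Finset ℕ) (f : ℕ → Option (Ty 0)) :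
    ∃ Γ : Env, ∀ x, Γ.lookup x = if x ∈ s then f x else none := by
  induction s using Finset.induction_on with
  | empty => exact ⟨∅, fun x => by simp⟩
  | insert a s ha ih =>
    obtain ⟨Γ, hΓ⟩ := ih
    cases hf : f a with
    | none =>
      refine ⟨Γ, fun x => ?_⟩
      by_cases hx : x = a
      · subst hx
        simp [hΓ, hf]
      · simp [hΓ, hx]
    | some T =>
      refine ⟨Γ.insert a T, fun x => ?_⟩
      by_cases hx : x = a
      · subst hx
        simp [hf]
      · simp [hΓ, hx]

/-- Environments are finite, so pointwise choices form an environment only if outside some finite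
set the missing assignment is admissible. -/
theorem exists_env_of_forall (s : Finset ℕ) {r : ℕ → Option (Ty 0) → Prop} (h : ∀ x, ∃ o, r x o)
    (hs : ∀ x, x ∉ s → r x none) : ∃ Γ : Env, ∀ x, r x (Γ.lookup x) := by
  choose f hf using h
  obtain ⟨Γ, hΓ⟩ := exists_env s f
  refine ⟨Γ, fun x => ?_⟩
  rw [hΓ]
  split_ifs with hx
  · exact hf x
  · exact hs x hx

theorem lookup_of_notMem_keys {Γ : Env} {x : ℕ} (h : x ∉ Γ.keys) : Γ.lookup x = none := by
  rwa [Finmap.lookup_eq_none, ← Finmap.mem_keys]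

theorem mem_keys_iff {Γ : Env} {x : ℕ} : x ∈ Γ.keys ↔ Γ.lookup x ≠ none := by
  rw [Ne, Finmap.lookup_eq_none, not_not, Finmap.mem_keys]

@[elab_as_elim]
theorem induction {p : Env → Prop} (Γ : Env) (empty : p ∅)
    (insert : ∀ (Γ : Env) x T, Γ.lookup x = none → p Γ → p (Γ.insert x T)) : p Γ := by
  induction hn : Γ.keys.card generalizing Γ with
  | zero =>
    have : Γ = ∅ := by
      refine Finmap.ext_lookup fun x => ?_
      rw [Finmap.lookup_empty]
      refine lookup_of_notMem_keys ?_
      rw [Finset.card_eq_zero.1 hn]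
      simp
    exact this ▸ empty
  | succ n ih =>
    obtain ⟨x, hx⟩ : Γ.keys.Nonempty := by
      rw [← Finset.card_pos]
      omega
    obtain ⟨T, hT⟩ := Finmap.mem_iff.1 (Finmap.mem_keys.1 hx)
    rw [← insert_erase hT]
    refine insert _ _ _ (Finmap.lookup_erase _ _) (ih _ ?_)
    rw [Finmap.keys_erase, Finset.card_erase_of_mem hx, hn]
    rfl

/-! ### Combination -/

theorem JoinAt.symm {a b c : Option (Ty 0)} (h : JoinAt a b c) : JoinAt b a c := by
  cases h with
  | none => exact .none
  | left => exact .right _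
  | right => exact .left _
  | both h => exact .both h.symm

theorem joinAt_none_left (a : Option (Ty 0)) : JoinAt none a a := by
  cases a with
  | none => exact .none
  | some T => exact .right T

theorem JoinAt.eq_of_none_left {a b : Option (Ty 0)} (h : JoinAt .none a b) : b = a := by
  cases h <;> rfl

theorem JoinAt.none_left_of_none {a b : Option (Ty 0)} (h : JoinAt a b .none) : a = .none := by
  cases h; rfl

/-- If all three parts mention the name, the type is not linear and all parts are equal: a linear
connection made of `a` and `b` would leave no room for `c`. -/
theorem JoinAt.assoc {a b c d e : Option (Ty 0)} (h : JoinAt a b d) (h' : JoinAt d c e) :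
    ∃ f, JoinAt b c f ∧ JoinAt a f e := by
  cases h with
  | none => exact ⟨e, h', joinAt_none_left _⟩
  | left T => exact ⟨c, joinAt_none_left _, h'⟩
  | right T => exact ⟨e, h', joinAt_none_left _⟩
  | both h =>
    cases h' with
    | left => exact ⟨_, .left _, .both h⟩
    | both h' =>
      obtain ⟨hl, rfl, rfl⟩ | ⟨-, -, W, hW⟩ := h.linConn_or_same
      · exact ⟨_, .both h', by
          obtain ⟨hl', rfl, rfl⟩ | ⟨hl', -⟩ := h'.linConn_or_same
          · exact .both (.same hl)
          · exact absurd hl' hl⟩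
      · exact absurd hW h'.left_not_linConn

theorem Join.symm {A B C : Env} (h : Join A B C) : Join B A C := fun x => (h x).symm

theorem Join.lookup_none {A B C : Env} (h : Join A B C) {x : ℕ} (hC : C.lookup x = none) :
    A.lookup x = none ∧ B.lookup x = none := by
  have := h x
  rw [hC] at this
  exact ⟨this.none_left_of_none, this.symm.none_left_of_none⟩

theorem Join.assoc {A B C D E : Env} (h : Join A B D) (h' : Join D C E) :
    ∃ F, Join B C F ∧ Join A F E := by
  obtain ⟨F, hF⟩ := exists_env_of_forall (B.keys ∪ C.keys)
    (r := fun x f => JoinAt (B.lookup x) (C.lookup x) f ∧ JoinAt (A.lookup x) f (E.lookup x))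
    (fun x => (h x).assoc (h' x)) (fun x hx => by
      rw [Finset.mem_union, not_or] at hx
      have h₁ := h x
      have h₂ := h' x
      rw [lookup_of_notMem_keys hx.1] at h₁
      rw [lookup_of_notMem_keys hx.2] at h₂
      rw [lookup_of_notMem_keys hx.1, lookup_of_notMem_keys hx.2]
      rw [h₁.symm.eq_of_none_left] at h₂
      exact ⟨.none, h₂⟩)
  exact ⟨F, fun x => (hF x).1, fun x => (hF x).2⟩

theorem Join.assoc' {A B C D E : Env} (h : Join B C D) (h' : Join A D E) :
    ∃ F, Join A B F ∧ Join F C E := by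
  obtain ⟨F, h₁, h₂⟩ := h.symm.assoc h'.symm
  exact ⟨F, h₁.symm, h₂.symm⟩

/-- The interchange law of a commutative partial monoid. In a communication it brings together the
two shares of the subject, and separately all the rest. -/
theorem Join.exchange {A B C D E F G : Env} (h₁ : Join A B E) (h₂ : Join C D F)
    (h : Join E F G) : ∃ H K, Join A C H ∧ Join B D K ∧ Join H K G := by
  obtain ⟨X, hX, hA⟩ := h₁.assoc h
  obtain ⟨Y, hY, hY'⟩ := h₂.assoc' hX
  obtain ⟨Z, hZ, hZ'⟩ := hY.symm.assoc hY'
  obtain ⟨H, hH, hH'⟩ := hZ'.assoc' hA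
  exact ⟨H, Z, hH, hZ, hH'⟩

theorem join_empty_left (A : Env) : Join ∅ A A := fun x => by
  rw [Finmap.lookup_empty]
  exact joinAt_none_left _

theorem Join.eq_of_empty_left {A B : Env} (h : Join ∅ A B) : B = A := by
  refine Finmap.ext_lookup fun x => ?_
  have := h x
  rw [Finmap.lookup_empty] at this
  exact this.eq_of_none_left

theorem unrestricted_empty : Unrestricted ∅ := by
  rintro x ⟨T, hT, -⟩
  simp at hT

theorem Unrestricted.join_self {A : Env} (h : A.Unrestricted) : Join A A A := fun x => by
  cases hx : A.lookup x with
  | none => exact .none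
  | some T => exact .both (.same fun hT => h x ⟨T, hx, hT⟩)

theorem Join.linearAt {A B C : Env} (h : Join A B C) {x : ℕ} (hC : C.LinearAt x) :
    A.LinearAt x ∨ B.LinearAt x := by
  obtain ⟨T, hT, hl⟩ := hC
  have := h x
  rw [hT] at this
  generalize hA : A.lookup x = a at this
  generalize hB : B.lookup x = b at this
  cases this with
  | left => exact .inl ⟨_, hA, hl⟩
  | right => exact .inr ⟨_, hB, hl⟩
  | both h =>
    obtain ⟨hl', rfl, rfl⟩ | ⟨hl', -⟩ := h.linConn_or_same
    · exact absurd hl hl'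
    · exact .inl ⟨_, hA, hl'⟩

theorem Join.unrestricted {A B C : Env} (h : Join A B C) (hA : A.Unrestricted)
    (hB : B.Unrestricted) : C.Unrestricted :=
  fun x hx => (h.linearAt hx).elim (hA x) (hB x)

theorem Join.lookup_left {A B C : Env} (h : Join A B C) {x : ℕ} {T : Ty 0}
    (hA : A.lookup x = some T) (hT : ¬ T.Linear) : C.lookup x = some T := by
  have := h x
  rw [hA] at this
  generalize C.lookup x = c at this
  generalize B.lookup x = b at this
  cases this with
  | left => rfl
  | both h =>
    obtain ⟨-, rfl, rfl⟩ | ⟨hl', -⟩ := h.linConn_or_same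
    · rfl
    · exact absurd hl' hT

theorem Join.lookup_ne_none_left {A B C : Env} (h : Join A B C) {x : ℕ} (hA : A.lookup x ≠ none) :
    C.lookup x ≠ none := fun hC => hA (h.lookup_none hC).1

/-- A part without linear names may be enlarged to the unrestricted names of the whole. -/
theorem Join.absorb {A B C : Env} (h : Join A B C) (hA : A.Unrestricted) (hB : B.Unrestricted) :
    Join A C C := by
  obtain ⟨F, hF, hF'⟩ := hA.join_self.symm.assoc h
  intro x
  have h₁ := h x
  have hC := h.unrestricted hA hB
  cases hA' : A.lookup x with
  | none => exact joinAt_none_left _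
  | some T =>
    have hT : ¬ T.Linear := fun hl => hA x ⟨T, hA', hl⟩
    rw [h.lookup_left hA' hT]
    exact .both (.same hT)

theorem Join.insert_left {A B C : Env} (h : Join A B C) {x : ℕ} (T : Ty 0)
    (hB : B.lookup x = none) : Join (A.insert x T) B (C.insert x T) := fun y => by
  simp only [lookup_insert_eq]
  split_ifs with hy
  · rw [hy, hB]
    exact .left T
  · exact h y

theorem Join.erase {A B C : Env} (h : Join A B C) (x : ℕ) :
    Join (A.erase x) (B.erase x) (C.erase x) := fun y => by
  simp only [lookup_erase_eq]
  split_ifs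
  · exact .none
  · exact h y

theorem join_singleton {Γ : Env} {x : ℕ} (T : Ty 0) (h : Γ.lookup x = none) :
    Join (Finmap.singleton x T) Γ (Γ.insert x T) := fun y => by
  simp only [lookup_insert_eq, lookup_singleton]
  split_ifs with hy
  · rw [hy, h]
    exact .left T
  · exact joinAt_none_left _

theorem join_singleton_erase {Γ : Env} {x : ℕ} {T : Ty 0} (h : Γ.lookup x = some T) :
    Join (Finmap.singleton x T) (Γ.erase x) Γ := by
  have := join_singleton (Γ := Γ.erase x) T (Finmap.lookup_erase _ _)
  rwa [insert_erase h] at this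

theorem linearAt_insert {Γ : Env} {x y : ℕ} {T : Ty 0} :
    LinearAt (Γ.insert x T) y ↔ if y = x then T.Linear else Γ.LinearAt y := by
  simp only [LinearAt, lookup_insert_eq]
  split_ifs <;> simp

theorem linearAt_erase {Γ : Env} {x y : ℕ} : LinearAt (Γ.erase x) y ↔ y ≠ x ∧ Γ.LinearAt y := by
  simp only [LinearAt, lookup_erase_eq]
  split_ifs with h <;> simp [h]

theorem linearAt_singleton {x y : ℕ} {T : Ty 0} :
    LinearAt (Finmap.singleton x T) y ↔ y = x ∧ T.Linear := by
  simp only [LinearAt, lookup_singleton]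
  split_ifs with h <;> simp [h]

theorem Unrestricted.erase {Γ : Env} (h : Γ.Unrestricted) (x : ℕ) :
    Unrestricted (Γ.erase x) := fun y hy => h y (linearAt_erase.1 hy).2

theorem not_linearAt_of_lookup {Γ : Env} {x : ℕ} (h : Γ.lookup x = none) : ¬ Γ.LinearAt x := by
  rintro ⟨T, hT, -⟩
  rw [h] at hT
  cases hT

/-! ### Extension -/

theorem extend_cons (Γ : Env) (x : ℕ) (T : Ty 0) (l : List (ℕ × Ty 0)) :
    Γ.extend ((x, T) :: l) = (Γ.extend l).insert x T := rfl

theorem extend_nil (Γ : Env) : Γ.extend [] = Γ := rfl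

theorem lookup_extend_of_notMem {Γ : Env} {l : List (ℕ × Ty 0)} {x : ℕ}
    (h : x ∉ l.map Prod.fst) : (Γ.extend l).lookup x = Γ.lookup x := by
  induction l with
  | nil => rfl
  | cons p l ih =>
    obtain ⟨y, T⟩ := p
    simp only [List.map_cons, List.mem_cons, not_or] at h
    rw [extend_cons, lookup_insert_eq, if_neg h.1, ih h.2]

theorem lookup_extend_congr {Γ Δ : Env} {x : ℕ} (h : Γ.lookup x = Δ.lookup x)
    (l : List (ℕ × Ty 0)) : (Γ.extend l).lookup x = (Δ.extend l).lookup x := by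
  induction l with
  | nil => exact h
  | cons p l ih => rw [extend_cons, extend_cons, lookup_insert_eq, lookup_insert_eq, ih]

theorem extend_insert (Γ : Env) {x : ℕ} (T : Ty 0) {l : List (ℕ × Ty 0)}
    (h : x ∉ l.map Prod.fst) : Env.extend (Γ.insert x T) l = (Γ.extend l).insert x T := by
  induction l with
  | nil => rfl
  | cons p l ih =>
    obtain ⟨y, S⟩ := p
    simp only [List.map_cons, List.mem_cons, not_or] at h
    rw [extend_cons, extend_cons, ih h.2, Finmap.insert_insert_of_ne _ h.1]

theorem extend_erase (Γ : Env) {x : ℕ} {l : List (ℕ × Ty 0)}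
    (h : x ∉ l.map Prod.fst) : Env.extend (Γ.erase x) l = (Γ.extend l).erase x := by
  refine Finmap.ext_lookup fun y => ?_
  rw [lookup_erase_eq]
  split_ifs with hy
  · rw [hy, lookup_extend_of_notMem h, Finmap.lookup_erase]
  · exact lookup_extend_congr (by rw [lookup_erase_eq, if_neg hy]) l

theorem Join.extend_left {A B C : Env} (h : Join A B C) {l : List (ℕ × Ty 0)}
    (hB : ∀ x ∈ l.map Prod.fst, B.lookup x = none) : Join (A.extend l) B (C.extend l) := by
  induction l with
  | nil => exact h
  | cons p l ih =>
    obtain ⟨y, T⟩ := p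
    exact (ih fun x hx => hB x (List.mem_cons_of_mem _ hx)).insert_left T (hB y (by simp))

/-! ### Types of names -/

/-- Subsumption and type equality are collected in one step that starts from the assigned type,
which makes the judgement invertible. -/
theorem hasTy_iff {Γ : Env} {x : ℕ} {T : Ty 0} :
    Γ.HasTy x T ↔ ∃ S, Γ.lookup x = some S ∧ (∀ y, y ≠ x → ¬ Γ.LinearAt y) ∧ Ty.Le S T := by
  constructor
  · intro h
    induction h with
    | name h h' => exact ⟨_, h, h', .refl _⟩
    | sub _ hs ih =>
      obtain ⟨S, h₁, h₂, h₃⟩ := ih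
      exact ⟨S, h₁, h₂, h₃.trans (.of_sub hs)⟩
    | eqv _ hs ih =>
      obtain ⟨S, h₁, h₂, h₃⟩ := ih
      exact ⟨S, h₁, h₂, h₃.trans (.of_eqv hs)⟩
  · rintro ⟨S, h₁, h₂, h₃⟩
    exact h₃.forward (p := fun T => Γ.HasTy x T) (.name h₁ h₂) (fun _ _ h h' => .sub h' h)
      fun _ _ h h' => .eqv h' h

theorem HasTy.le {Γ : Env} {x : ℕ} {S T : Ty 0} (h : Γ.HasTy x S) (hle : Ty.Le S T) :
    Γ.HasTy x T := by
  obtain ⟨U, h₁, h₂, h₃⟩ := hasTy_iff.1 h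
  exact hasTy_iff.2 ⟨U, h₁, h₂, h₃.trans hle⟩

theorem HasTy.unrestricted {Γ : Env} {x : ℕ} {T : Ty 0} (h : Γ.HasTy x T) (hT : ¬ T.Linear) :
    Γ.Unrestricted := by
  obtain ⟨U, h₁, h₂, h₃⟩ := hasTy_iff.1 h
  rintro y ⟨V, hV, hl⟩
  by_cases hy : y = x
  · subst hy
    rw [h₁, Option.some.injEq] at hV
    subst hV
    exact hT (h₃.linear_iff.1 hl)
  · exact h₂ y hy ⟨V, hV, hl⟩

/-- Were the type of `x` altered by the combination with `B`, then `B` would hold the other end of a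
linear connection. -/
theorem HasTy.weaken {A B C : Env} {x : ℕ} {T : Ty 0} (h : A.HasTy x T) (hj : Join A B C)
    (hB : B.Unrestricted) : C.HasTy x T := by
  obtain ⟨U, h₁, h₂, h₃⟩ := hasTy_iff.1 h
  refine hasTy_iff.2 ⟨U, ?_, fun y hy hC => (hj.linearAt hC).elim (h₂ y hy) (hB y), h₃⟩
  by_cases hU : U.Linear
  · have := hj x
    rw [h₁] at this
    generalize C.lookup x = c at this
    generalize hb : B.lookup x = b at this
    cases this with
    | left => rfl
    | both h =>
      obtain ⟨hl, rfl, rfl⟩ | ⟨-, hl, -⟩ := h.linConn_or_same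
      · rfl
      · exact absurd ⟨_, hb, hl⟩ (hB x)
  · exact hj.lookup_left h₁ hU

theorem hasTy_singleton (x : ℕ) (T : Ty 0) : HasTy (Finmap.singleton x T) x T :=
  .name (by simp) fun y hy h => hy (linearAt_singleton.1 h).1

theorem HasTy.lookup_ne_none {Γ : Env} {x : ℕ} {T : Ty 0} (h : Γ.HasTy x T) :
    Γ.lookup x ≠ none := by
  obtain ⟨U, h₁, -⟩ := hasTy_iff.1 h
  simp [h₁]

theorem HasTys.lookup_ne_none {Γ : Env} {l : List (ℕ × Ty 0)} (h : Γ.HasTys l) :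
    ∀ x ∈ l.map Prod.fst, Γ.lookup x ≠ none := by
  induction h with
  | nil => simp
  | cons h₁ _ hj ih =>
    intro y hy
    simp only [List.map_cons, List.mem_cons] at hy
    obtain rfl | hy := hy
    · exact hj.lookup_ne_none_left h₁.lookup_ne_none
    · exact hj.symm.lookup_ne_none_left (ih y hy)

/-! ### Typed substitutions -/

theorem IsSubst.congr {σ τ : ℕ → ℕ} {Δ Θ : Env} (h : IsSubst σ Δ Θ)
    (hστ : ∀ x, Δ.lookup x ≠ none → σ x = τ x) : IsSubst τ Δ Θ := by
  induction h with
  | nil h => exact .nil h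
  | @cons Δ Γ₁ Γ₂ Γ x T hx h₁ _ hj ih =>
    refine .cons hx ?_ (ih fun y hy => hστ y ?_) hj
    · rwa [← hστ x (by simp)]
    · rw [lookup_insert_eq]
      split_ifs <;> simp [hy]

theorem IsSubst.weaken {σ : ℕ → ℕ} {Δ Θ B C : Env} (h : IsSubst σ Δ Θ) (hj : Join Θ B C)
    (hB : B.Unrestricted) : IsSubst σ Δ C := by
  induction h generalizing C with
  | nil h => exact .nil (hj.unrestricted h hB)
  | cons hx h₁ _ hj' ih =>
    obtain ⟨F, hF, hF'⟩ := hj'.assoc hj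
    exact .cons hx h₁ (ih hF) hF'

theorem IsSubst.unrestricted {σ : ℕ → ℕ} {Δ Θ : Env} (h : IsSubst σ Δ Θ) (hΔ : Δ.Unrestricted) :
    Θ.Unrestricted := by
  induction h with
  | nil h => exact h
  | @cons Δ Γ₁ Γ₂ Γ x T hx h₁ _ hj ih =>
    refine hj.unrestricted (h₁.unrestricted fun hT => hΔ x ?_) (ih fun y hy => hΔ y ?_)
    · simpa [linearAt_insert] using hT
    · rw [linearAt_insert]
      split_ifs with h
      · exact absurd hy (not_linearAt_of_lookup (h ▸ hx))
      · exact hy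

theorem isSubst_id (Γ : Env) : IsSubst id Γ Γ := by
  induction Γ using Env.induction with
  | empty => exact .nil unrestricted_empty
  | insert Γ x T hx ih => exact .cons hx (hasTy_singleton x T) ih (join_singleton T hx)

/-- Adding non-linear names and lowering assigned types is an instance of substitution, by the
identity; hence it needs no induction on derivations of its own. -/
theorem Extends.isSubst {Θ Δ : Env} (h : Θ.Extends Δ) : IsSubst id Δ Θ := by
  induction Δ using Env.induction generalizing Θ with
  | empty => exact .nil fun x => h.2 x (Finmap.lookup_empty _)
  | insert Δ x T hx ih =>
    obtain ⟨S, hS, hT⟩ := h.1 x T (Finmap.lookup_insert _)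
    refine .cons hx hT (ih ⟨fun y U hy => ?_, fun y hy => ?_⟩) (join_singleton_erase hS)
    · have hne : y ≠ x := fun h => by rw [h, hx] at hy; cases hy
      rw [lookup_erase_eq, if_neg hne]
      exact h.1 y U (by rw [lookup_insert_eq, if_neg hne, hy])
    · rw [linearAt_erase]
      rintro ⟨hne, hl⟩
      exact h.2 y (by rw [lookup_insert_eq, if_neg hne, hy]) hl

theorem extends_refl (Γ : Env) : Γ.Extends Γ :=
  ⟨fun x T hx => ⟨T, hx, hasTy_singleton x T⟩, fun _ hx => not_linearAt_of_lookup hx⟩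

/-- As `x` is the only linear name of `Γ`, the rest of `Γ` can be given to both parts and only the
connection at `x` is divided. -/
theorem HasTy.split_linear {Γ : Env} {x : ℕ} {S T U : Ty 0} (h : Γ.HasTy x U)
    (hc : Ty.Comb S T U) (hU : U.Linear) :
    ∃ Γ₁ Γ₂, Join Γ₁ Γ₂ Γ ∧ Γ₁.HasTy x S ∧ Γ₂.HasTy x T := by
  obtain ⟨V, h₁, h₂, h₃⟩ := hasTy_iff.1 h
  have hV : ∀ W, Ty.Eqv U (.ch .linConn W) → Ty.Eqv V (.ch .linConn W) := fun W hW =>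
    (h₃.linear_right (by trivial)).2 hW
  have hc' : Ty.Comb S T V := by
    cases hc with
    | inpOut e₁ e₂ e₃ => exact .inpOut e₁ e₂ (hV _ e₃)
    | outInp e₁ e₂ e₃ => exact .outInp e₁ e₂ (hV _ e₃)
    | same hn => exact absurd hU hn
  have hunr : Unrestricted (Γ.erase x) := fun y hy => h₂ y (linearAt_erase.1 hy).1
    (linearAt_erase.1 hy).2
  refine ⟨(Γ.erase x).insert x S, (Γ.erase x).insert x T, ?_,
    .name (Finmap.lookup_insert _) ?_, .name (Finmap.lookup_insert _) ?_⟩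
  · intro y
    simp only [lookup_insert_eq]
    split_ifs with hy
    · rw [hy, h₁]
      exact .both hc'
    · have := hunr.join_self y
      simpa only [lookup_erase_eq, if_neg hy] using this
  · intro y hy hl
    rw [linearAt_insert, if_neg hy] at hl
    exact hunr y hl
  · intro y hy hl
    rw [linearAt_insert, if_neg hy] at hl
    exact hunr y hl

theorem Join.of_insert {A B Δ : Env} {x : ℕ} {T : Ty 0} (h : Join A B (Δ.insert x T))
    (hx : Δ.lookup x = none) : Join (A.erase x) (B.erase x) Δ := by
  have := h.erase x
  rwa [erase_insert T hx] at this

/-- Every typing rule with several premises is transported along a substitution by this lemma: a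
division of the source induces one of the target. -/
theorem IsSubst.split {σ : ℕ → ℕ} {Δ Θ : Env} (h : IsSubst σ Δ Θ) :
    ∀ {Δ₁ Δ₂ : Env}, Join Δ₁ Δ₂ Δ → ∃ Θ₁ Θ₂, Join Θ₁ Θ₂ Θ ∧ IsSubst σ Δ₁ Θ₁ ∧ IsSubst σ Δ₂ Θ₂ := by
  induction h with
  | nil h =>
    intro Δ₁ Δ₂ hj
    have h₁ : Δ₁ = ∅ := Finmap.ext_lookup fun x => (hj.lookup_none (Finmap.lookup_empty x)).1
    have h₂ : Δ₂ = ∅ := Finmap.ext_lookup fun x => (hj.lookup_none (Finmap.lookup_empty x)).2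
    subst h₁ h₂
    exact ⟨_, _, h.join_self, .nil h, .nil h⟩
  | @cons Δ Γ₁ Γ₂ Γ x T hx h₁ _ hj ih =>
    intro Δ₁ Δ₂ hj'
    obtain ⟨Θ₁, Θ₂, hΘ, hs₁, hs₂⟩ := ih (hj'.of_insert hx)
    have hjx := hj' x
    rw [lookup_insert_eq, if_pos rfl] at hjx
    have hjoin : ∀ A B, Join A B Γ₁ → ∃ H K, Join A Θ₁ H ∧ Join B Θ₂ K ∧ Join H K Γ :=
      fun A B hAB => hAB.exchange hΘ hj
    generalize e₁ : Δ₁.lookup x = o₁ at hjx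
    generalize e₂ : Δ₂.lookup x = o₂ at hjx
    have heq₁ : ∀ {S}, o₁ = some S → Δ₁ = (Δ₁.erase x).insert x S := fun h =>
      (insert_erase (e₁.trans h)).symm
    have heq₂ : ∀ {S}, o₂ = some S → Δ₂ = (Δ₂.erase x).insert x S := fun h =>
      (insert_erase (e₂.trans h)).symm
    cases hjx with
    | left =>
      obtain ⟨F, hF, hF'⟩ := hΘ.assoc' hj
      rw [heq₁ rfl]
      rw [erase_of_lookup e₂] at hs₂
      exact ⟨F, Θ₂, hF', .cons (Finmap.lookup_erase _ _) h₁ hs₁ hF, hs₂⟩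
    | right =>
      obtain ⟨F, hF, hF'⟩ := hΘ.symm.assoc' hj
      rw [heq₂ rfl]
      rw [erase_of_lookup e₁] at hs₁
      exact ⟨Θ₁, F, hF'.symm, hs₁, .cons (Finmap.lookup_erase _ _) h₁ hs₂ hF⟩
    | both hc =>
      rw [heq₁ rfl, heq₂ rfl]
      -- At a name shared by both parts, a linear connection is divided in the target as well,
      -- whereas the target of a non-linear name is unrestricted and serves both parts.
      by_cases hT : T.Linear
      · obtain ⟨A, B, hAB, hA, hB⟩ := h₁.split_linear hc hT
        obtain ⟨H, K, hH, hK, hHK⟩ := hjoin A B hAB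
        exact ⟨H, K, hHK, .cons (Finmap.lookup_erase _ _) hA hs₁ hH,
          .cons (Finmap.lookup_erase _ _) hB hs₂ hK⟩
      · obtain ⟨-, rfl, rfl⟩ | ⟨-, -, W, hW⟩ := hc.linConn_or_same
        · obtain ⟨H, K, hH, hK, hHK⟩ := hjoin _ _ (h₁.unrestricted hT).join_self
          exact ⟨H, K, hHK, .cons (Finmap.lookup_erase _ _) h₁ hs₁ hH,
            .cons (Finmap.lookup_erase _ _) h₁ hs₂ hK⟩
        · exact absurd ⟨_, _, by trivial, hW⟩ hT

/-- All names of `Δ` other than `x` are non-linear, so the parts of `Θ` that serve them are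
unrestricted and are absorbed by weakening. -/
theorem IsSubst.hasTy {σ : ℕ → ℕ} {Δ Θ : Env} (h : IsSubst σ Δ Θ) {x : ℕ} {T : Ty 0}
    (hx : Δ.HasTy x T) : Θ.HasTy (σ x) T := by
  obtain ⟨S, h₁, h₂, h₃⟩ := hasTy_iff.1 hx
  refine HasTy.le ?_ h₃
  clear hx h₃
  induction h with
  | nil h => simp at h₁
  | @cons Δ Γ₁ Γ₂ Γ y U hy hU hs hj ih =>
    rw [lookup_insert_eq] at h₁
    split_ifs at h₁ with hxy
    · subst hxy
      cases h₁
      refine hU.weaken hj (hs.unrestricted fun z hz => ?_)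
      have hzx : z ≠ x := fun h => not_linearAt_of_lookup hy (h ▸ hz)
      refine h₂ z hzx ?_
      rwa [linearAt_insert, if_neg hzx]
    · have hUl : ¬ U.Linear := fun hl => h₂ y (Ne.symm hxy) (by simpa [linearAt_insert] using hl)
      refine (ih h₁ fun z hz hl => h₂ z hz ?_).weaken hj.symm (hU.unrestricted hUl)
      rw [linearAt_insert]
      split_ifs with hzy
      · exact absurd (hzy ▸ hl) (not_linearAt_of_lookup hy)
      · exact hl

theorem IsSubst.hasTys {σ : ℕ → ℕ} {Δ Θ : Env} (h : IsSubst σ Δ Θ) {l : List (ℕ × Ty 0)}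
    (hl : Δ.HasTys l) : Θ.HasTys (l.map fun p => (σ p.1, p.2)) := by
  induction hl generalizing Θ with
  | nil hu => exact .nil (h.unrestricted hu)
  | cons h₁ _ hj ih =>
    obtain ⟨Θ₁, Θ₂, hΘ, hs₁, hs₂⟩ := h.split hj
    exact .cons (hs₁.hasTy h₁) (ih hs₂) hΘ

theorem IsSubst.comp {σ τ : ℕ → ℕ} {Δ Θ Ξ : Env} (h : IsSubst σ Δ Θ) (h' : IsSubst τ Θ Ξ) :
    IsSubst (τ ∘ σ) Δ Ξ := by
  induction h generalizing Ξ with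
  | nil hu => exact .nil (h'.unrestricted hu)
  | cons hx h₁ _ hj ih =>
    obtain ⟨Θ₁, Θ₂, hΘ, hs₁, hs₂⟩ := h'.split hj
    exact .cons hx (hs₁.hasTy h₁) (ih hs₂) hΘ

theorem IsSubst.extract {σ : ℕ → ℕ} {Δ Θ : Env} (h : IsSubst σ Δ Θ) {x : ℕ} {T : Ty 0}
    (hx : Δ.lookup x = some T) :
    ∃ Θ₁ Θ₂, Join Θ₁ Θ₂ Θ ∧ Θ₁.HasTy (σ x) T ∧ IsSubst σ (Δ.erase x) Θ₂ := by
  obtain ⟨Θ₁, Θ₂, hΘ, hs₁, hs₂⟩ := h.split (join_singleton_erase hx)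
  exact ⟨Θ₁, Θ₂, hΘ, hs₁.hasTy (hasTy_singleton x T), hs₂⟩

theorem IsSubst.erase {σ : ℕ → ℕ} {Δ Θ : Env} (h : IsSubst σ Δ Θ) {x : ℕ}
    (hx : ¬ Δ.LinearAt x) : IsSubst σ (Δ.erase x) Θ := by
  cases hT : Δ.lookup x with
  | none => rwa [erase_of_lookup hT]
  | some T =>
    obtain ⟨Θ₁, Θ₂, hΘ, h₁, h₂⟩ := h.extract hT
    exact h₂.weaken hΘ.symm (h₁.unrestricted fun hl => hx ⟨T, hT, hl⟩)

/-- A previous assignment of `x` is dropped before the new one is made, which loses nothing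
essential because it is not linear. -/
theorem IsSubst.update {σ : ℕ → ℕ} {Δ Θ : Env} (h : IsSubst σ Δ Θ) {x y : ℕ} (T : Ty 0)
    (hx : ¬ Δ.LinearAt x) (hy : Θ.lookup y = none) :
    IsSubst (Function.update σ x y) (Δ.insert x T) (Θ.insert y T) := by
  rw [← insert_erase_self]
  refine .cons (Finmap.lookup_erase _ _) ?_ ((h.erase hx).congr fun z hz => ?_)
    (join_singleton T hy)
  · rw [Function.update_self]
    exact hasTy_singleton y T
  · rw [Function.update_of_ne]
    rintro rfl
    exact hz (Finmap.lookup_erase _ _)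

theorem IsSubst.lookup_ne_none {σ : ℕ → ℕ} {Δ Θ : Env} (h : IsSubst σ Δ Θ) {x : ℕ}
    (hx : Δ.lookup x ≠ none) : Θ.lookup (σ x) ≠ none := by
  obtain ⟨T, hT⟩ := Option.ne_none_iff_exists'.1 hx
  obtain ⟨Θ₁, Θ₂, hΘ, h₁, -⟩ := h.extract hT
  exact hΘ.lookup_ne_none_left h₁.lookup_ne_none

end Env

/-! ### Replacement of tuples of names -/

/-- The substitution that maps the names `xs` to `ys` and agrees with `σ` elsewhere. -/
def overwrite (σ : ℕ → ℕ) (xs ys : List ℕ) (z : ℕ) : ℕ :=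
  if z ∈ xs then ys.getD (xs.idxOf z) z else σ z

theorem overwrite_id (xs ys : List ℕ) : overwrite id xs ys = substOf xs ys := rfl

theorem overwrite_nil (σ : ℕ → ℕ) (ys : List ℕ) : overwrite σ [] ys = σ := by
  funext z
  simp [overwrite]

theorem overwrite_cons (σ : ℕ → ℕ) (x y : ℕ) (xs ys : List ℕ) :
    overwrite σ (x :: xs) (y :: ys) = Function.update (overwrite σ xs ys) x y := by
  funext z
  by_cases h : z = x
  · subst h
    simp [overwrite]
  · have h' : x ≠ z := fun e => h e.symm
    simp [overwrite, h, List.idxOf_cons_ne _ h']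

theorem overwrite_of_notMem {σ : ℕ → ℕ} {xs ys : List ℕ} {z : ℕ} (h : z ∉ xs) :
    overwrite σ xs ys z = σ z := by
  simp [overwrite, h]

theorem map_overwrite (σ : ℕ → ℕ) {xs ys : List ℕ} (hl : xs.length = ys.length)
    (hn : xs.Nodup) : xs.map (overwrite σ xs ys) = ys := by
  induction xs generalizing ys with
  | nil => simpa using hl.symm
  | cons x xs ih =>
    cases ys with
    | nil => simp at hl
    | cons y ys =>
      rw [List.nodup_cons] at hn
      simp only [List.length_cons, Nat.add_right_cancel_iff] at hl
      rw [overwrite_cons, List.map_cons, Function.update_self]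
      congr 1
      conv_rhs => rw [← ih hl hn.2]
      refine List.map_congr_left fun z hz => Function.update_of_ne ?_ _ _
      rintro rfl
      exact hn.1 hz

namespace Env

/-- Carries a substitution underneath a binder of several names. In the source the binder may shadow
names of `Δ`, as contexts are allowed to do; in the target the names are fresh. -/
theorem IsSubst.overwrite {σ : ℕ → ℕ} {Δ Θ : Env} (h : IsSubst σ Δ Θ)
    {l l' : List (ℕ × Ty 0)} (hll : l.map Prod.snd = l'.map Prod.snd)
    (hn : (l.map Prod.fst).Nodup) (hl : ∀ x ∈ l.map Prod.fst, ¬ Δ.LinearAt x)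
    (hn' : (l'.map Prod.fst).Nodup) (hl' : ∀ x ∈ l'.map Prod.fst, Θ.lookup x = none) :
    IsSubst (overwrite σ (l.map Prod.fst) (l'.map Prod.fst)) (Δ.extend l) (Θ.extend l') := by
  induction l generalizing l' with
  | nil =>
    obtain rfl : l' = [] := by simpa using hll.symm
    rwa [List.map_nil, overwrite_nil]
  | cons p l ih =>
    obtain _ | ⟨p', l'⟩ := l'
    · simp at hll
    obtain ⟨x, T⟩ := p
    obtain ⟨y, T'⟩ := p'
    simp only [List.map_cons, List.cons.injEq, List.nodup_cons, List.mem_cons,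
      forall_eq_or_imp] at hll hn hl hn' hl'
    obtain ⟨rfl, hll⟩ := hll
    rw [List.map_cons, List.map_cons, overwrite_cons, extend_cons, extend_cons]
    refine (ih hll hn.2 hl.2 hn'.2 hl'.2).update T ?_ ?_
    · rw [LinearAt, lookup_extend_of_notMem hn.1]
      exact hl.1
    · rw [lookup_extend_of_notMem hn'.1]
      exact hl'.1

/-- The substitution of a tuple that is received. -/
theorem HasTys.isSubst {A B C : Env} {l l' : List (ℕ × Ty 0)} (h : B.HasTys l')
    (hle : List.Forall₂ Ty.Le (l'.map Prod.snd) (l.map Prod.snd)) (hn : (l.map Prod.fst).Nodup)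
    (hl : ∀ x ∈ l.map Prod.fst, A.lookup x = none) (hj : Join A B C) :
    IsSubst (substOf (l.map Prod.fst) (l'.map Prod.fst)) (A.extend l) C := by
  rw [← overwrite_id]
  induction h generalizing l C with
  | nil hu =>
    obtain rfl : l = [] := by simpa using hle
    rw [List.map_nil, overwrite_nil]
    exact (isSubst_id A).weaken hj hu
  | @cons Γ₁ Γ₂ Γ y S l' h₁ _ hj' ih =>
    obtain _ | ⟨⟨x, T⟩, l⟩ := l
    · simp at hle
    simp only [List.map_cons, List.forall₂_cons, List.nodup_cons, List.mem_cons,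
      forall_eq_or_imp] at hle hn hl
    obtain ⟨F, hF, hF'⟩ := hj'.symm.assoc' hj
    have := ih hle.2 hn.2 hl.2 hF
    rw [List.map_cons, List.map_cons, overwrite_cons, extend_cons]
    have hx : (A.extend l).lookup x = none := by
      rw [lookup_extend_of_notMem hn.1]
      exact hl.1
    refine .cons hx ?_ (this.congr fun z hz => ?_) hF'.symm
    · rw [Function.update_self]
      exact h₁.le hle.1
    · rw [Function.update_of_ne]
      rintro rfl
      exact hz hx

end Env

/-! ## Names of processes -/

namespace Nm

theorem lift_weaken {n m : ℕ} (k : ℕ) (f : Nm n → Nm m) (a : Nm n) :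
    Nm.lift k f (a.weaken k) = (f a).weaken k := by
  cases a with
  | fr x => rfl
  | bd i => simp [weaken, lift]

theorem lift_comp {n m j : ℕ} (k : ℕ) (f : Nm n → Nm m) (g : Nm m → Nm j) :
    Nm.lift k (g ∘ f) = Nm.lift k g ∘ Nm.lift k f := by
  funext a
  cases a with
  | fr x => exact (lift_weaken k g (f (fr x))).symm
  | bd i =>
    refine Fin.addCases (fun i => ?_) (fun i => ?_) i
    · have := lift_weaken k g (f (bd i))
      simp only [lift, Function.comp, Fin.addCases_left] at this ⊢
      exact this.symm
    · simp only [lift, Function.comp, Fin.addCases_right]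

theorem lift_id {n : ℕ} (k : ℕ) : Nm.lift k (id : Nm n → Nm n) = id := by
  funext a
  cases a with
  | fr x => rfl
  | bd i => refine Fin.addCases (fun i => ?_) (fun i => ?_) i <;> simp [lift, weaken]

theorem lift_bd_congr {n m k : ℕ} {f g : Nm n → Nm m} (h : ∀ i, f (bd i) = g (bd i))
    (i : Fin (n + k)) : Nm.lift k f (bd i) = Nm.lift k g (bd i) := by
  refine Fin.addCases (fun i => ?_) (fun i => ?_) i <;> simp [lift, h]

theorem fn_weaken {n : ℕ} (k : ℕ) (a : Nm n) : (a.weaken k).fn = a.fn := by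
  cases a <;> rfl

theorem fn_lift_fr {n m : ℕ} (k : ℕ) (f : Nm n → Nm m) (x : ℕ) :
    (Nm.lift k f (fr x)).fn = (f (fr x)).fn := by
  simp [lift, fn_weaken]

theorem fn_lift_bd {n m : ℕ} (k : ℕ) (f : Nm n → Nm m) (i : Fin (n + k)) {s : Finset ℕ}
    (h : ∀ i, (f (bd i)).fn ⊆ s) : (Nm.lift k f (bd i)).fn ⊆ s := by
  refine Fin.addCases (fun i => ?_) (fun i => ?_) i
  · simpa [lift, fn_weaken] using h i
  · simp [lift, fn]

end Nm

namespace Proc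

theorem mem_foldr_fn {n : ℕ} {bs : List (Nm n)} {x : ℕ} :
    x ∈ bs.foldr (fun b X => b.fn ∪ X) ∅ ↔ ∃ b ∈ bs, x ∈ b.fn := by
  induction bs with
  | nil => simp
  | cons b bs ih => simp [ih]

theorem map_map {n m j : ℕ} (P : Proc n) (f : Nm n → Nm m) (g : Nm m → Nm j) :
    (P.map f).map g = P.map (g ∘ f) := by
  induction P generalizing m j with
  | nil => rfl
  | wrong => rfl
  | inp a k P ih => simp [map, ih, Nm.lift_comp]
  | out a bs => simp [map]
  | par P Q ih₁ ih₂ => simp [map, ih₁, ih₂]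
  | res L P ih => simp [map, ih, Nm.lift_comp]
  | rep a k P ih => simp [map, ih, Nm.lift_comp]
  | app P b ih => simp [map, ih, Nm.lift_comp]

theorem map_id {n : ℕ} (P : Proc n) : P.map id = P := by
  induction P with
  | nil => rfl
  | wrong => rfl
  | inp a k P ih => simp [map, ih, Nm.lift_id]
  | out a bs => simp [map]
  | par P Q ih₁ ih₂ => simp [map, ih₁, ih₂]
  | res L P ih => simp [map, ih, Nm.lift_id]
  | rep a k P ih => simp [map, ih, Nm.lift_id]
  | app P b ih => simp [map, ih, Nm.lift_id]

theorem nm_congr {n m : ℕ} {f g : Nm n → Nm m} (a : Nm n)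
    (h : ∀ x ∈ a.fn, f (.fr x) = g (.fr x)) (h' : ∀ i, f (.bd i) = g (.bd i)) : f a = g a := by
  cases a with
  | fr x => exact h x (by simp [Nm.fn])
  | bd i => exact h' i

theorem lift_fr_congr {n m k : ℕ} {f g : Nm n → Nm m} {s : Finset ℕ}
    (h : ∀ x ∈ s, f (.fr x) = g (.fr x)) :
    ∀ x ∈ s, Nm.lift k f (.fr x) = Nm.lift k g (.fr x) := by
  intro x hx
  simp only [Nm.lift, h x hx]

theorem map_congr {n m : ℕ} (P : Proc n) {f g : Nm n → Nm m}
    (h : ∀ x ∈ P.fn, f (.fr x) = g (.fr x)) (h' : ∀ i, f (.bd i) = g (.bd i)) :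
    P.map f = P.map g := by
  induction P generalizing m with
  | nil => rfl
  | wrong => rfl
  | inp a k P ih =>
    simp only [fn, Finset.mem_union] at h
    simp only [map]
    rw [nm_congr a (fun x hx => h x (.inl hx)) h',
      ih (lift_fr_congr fun x hx => h x (.inr hx)) (Nm.lift_bd_congr h')]
  | out a bs =>
    simp only [fn, Finset.mem_union, mem_foldr_fn] at h
    simp only [map]
    rw [nm_congr a (fun x hx => h x (.inl hx)) h',
      List.map_congr_left fun b hb => nm_congr b (fun x hx => h x (.inr ⟨b, hb, hx⟩)) h']
  | par P Q ih₁ ih₂ =>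
    simp only [fn, Finset.mem_union] at h
    simp only [map]
    rw [ih₁ (fun x hx => h x (.inl hx)) h', ih₂ (fun x hx => h x (.inr hx)) h']
  | res L P ih =>
    simp only [fn] at h
    simp only [map]
    rw [ih (lift_fr_congr h) (Nm.lift_bd_congr h')]
  | rep a k P ih =>
    simp only [fn, Finset.mem_union] at h
    simp only [map]
    rw [nm_congr a (fun x hx => h x (.inl hx)) h',
      ih (lift_fr_congr fun x hx => h x (.inr hx)) (Nm.lift_bd_congr h')]
  | app P b ih =>
    simp only [fn, Finset.mem_union] at h
    simp only [map]
    rw [nm_congr b (fun x hx => h x (.inr hx)) h',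
      ih (lift_fr_congr fun x hx => h x (.inl hx)) (Nm.lift_bd_congr h')]

theorem nm_fn_subset {n m : ℕ} {f : Nm n → Nm m} {s : Finset ℕ} (a : Nm n)
    (h : ∀ x ∈ a.fn, (f (.fr x)).fn ⊆ s) (h' : ∀ i, (f (.bd i)).fn ⊆ s) : (f a).fn ⊆ s := by
  cases a with
  | fr x => exact h x (by simp [Nm.fn])
  | bd i => exact h' i

theorem fn_map_subset {n m : ℕ} (P : Proc n) {f : Nm n → Nm m} {s : Finset ℕ}
    (h : ∀ x ∈ P.fn, (f (.fr x)).fn ⊆ s) (h' : ∀ i, (f (.bd i)).fn ⊆ s) : (P.map f).fn ⊆ s := by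
  induction P generalizing m with
  | nil => simp [map, fn]
  | wrong => simp [map, fn]
  | inp a k P ih =>
    simp only [fn, Finset.mem_union] at h
    exact Finset.union_subset (nm_fn_subset a (fun x hx => h x (.inl hx)) h')
      (ih (fun x hx => by rw [Nm.fn_lift_fr]; exact h x (.inr hx)) fun i => Nm.fn_lift_bd k f i h')
  | out a bs =>
    simp only [fn, Finset.mem_union, mem_foldr_fn] at h
    refine Finset.union_subset (nm_fn_subset a (fun x hx => h x (.inl hx)) h') fun z hz => ?_
    obtain ⟨b, hb, hz⟩ := mem_foldr_fn.1 hz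
    obtain ⟨b, hb', rfl⟩ := List.mem_map.1 hb
    exact nm_fn_subset b (fun x hx => h x (.inr ⟨b, hb', hx⟩)) h' hz
  | par P Q ih₁ ih₂ =>
    simp only [fn, Finset.mem_union] at h
    exact Finset.union_subset (ih₁ (fun x hx => h x (.inl hx)) h')
      (ih₂ (fun x hx => h x (.inr hx)) h')
  | res L P ih =>
    exact ih (fun x hx => by rw [Nm.fn_lift_fr]; exact h x hx) fun i => Nm.fn_lift_bd 1 f i h'
  | rep a k P ih =>
    simp only [fn, Finset.mem_union] at h
    exact Finset.union_subset (nm_fn_subset a (fun x hx => h x (.inl hx)) h')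
      (ih (fun x hx => by rw [Nm.fn_lift_fr]; exact h x (.inr hx)) fun i => Nm.fn_lift_bd k f i h')
  | app P b ih =>
    simp only [fn, Finset.mem_union] at h
    exact Finset.union_subset
      (ih (fun x hx => by rw [Nm.fn_lift_fr]; exact h x (.inl hx)) fun i => Nm.fn_lift_bd 1 f i h')
      (nm_fn_subset b (fun x hx => h x (.inr hx)) h')

theorem nm_subset_fn {n m : ℕ} (f : Nm n → Nm m) {a : Nm n} {x : ℕ} (h : x ∈ a.fn) :
    (f (.fr x)).fn ⊆ (f a).fn := by
  cases a with
  | fr y =>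
    obtain rfl : x = y := by simpa [Nm.fn] using h
    exact subset_rfl
  | bd i => simp [Nm.fn] at h

theorem subset_fn_map {n m : ℕ} (P : Proc n) (f : Nm n → Nm m) {x : ℕ} (h : x ∈ P.fn) :
    (f (.fr x)).fn ⊆ (P.map f).fn := by
  induction P generalizing m with
  | nil => simp [fn] at h
  | wrong => simp [fn] at h
  | inp a k P ih =>
    simp only [fn, Finset.mem_union] at h
    obtain h | h := h
    · exact (nm_subset_fn f h).trans Finset.subset_union_left
    · rw [← Nm.fn_lift_fr k]
      exact (ih (Nm.lift k f) h).trans Finset.subset_union_right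
  | out a bs =>
    simp only [fn, Finset.mem_union, mem_foldr_fn] at h
    obtain h | ⟨b, hb, h⟩ := h
    · exact (nm_subset_fn f h).trans Finset.subset_union_left
    · refine fun z hz => Finset.mem_union_right _ (mem_foldr_fn.2 ⟨f b, ?_, nm_subset_fn f h hz⟩)
      exact List.mem_map_of_mem hb
  | par P Q ih₁ ih₂ =>
    simp only [fn, Finset.mem_union] at h
    obtain h | h := h
    · exact (ih₁ f h).trans Finset.subset_union_left
    · exact (ih₂ f h).trans Finset.subset_union_right
  | res L P ih =>
    rw [← Nm.fn_lift_fr 1]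
    exact ih (Nm.lift 1 f) h
  | rep a k P ih =>
    simp only [fn, Finset.mem_union] at h
    obtain h | h := h
    · exact (nm_subset_fn f h).trans Finset.subset_union_left
    · rw [← Nm.fn_lift_fr k]
      exact (ih (Nm.lift k f) h).trans Finset.subset_union_right
  | app P b ih =>
    simp only [fn, Finset.mem_union] at h
    obtain h | h := h
    · rw [← Nm.fn_lift_fr 1]
      exact (ih (Nm.lift 1 f) h).trans Finset.subset_union_left
    · exact (nm_subset_fn f h).trans Finset.subset_union_right

/-! ### Substitution of names -/

theorem lift_subst {n k : ℕ} (σ : ℕ → ℕ) :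
    Nm.lift k (Nm.subst σ : Nm n → Nm n) = Nm.subst σ := by
  funext a
  cases a with
  | fr x => rfl
  | bd i =>
    refine Fin.addCases (fun i => ?_) (fun i => ?_) i <;> simp [Nm.lift, Nm.subst, Nm.weaken]

theorem subst_inp {n : ℕ} (σ : ℕ → ℕ) (a : Nm n) (k : ℕ) (P : Proc (n + k)) :
    (inp a k P).subst σ = inp (a.subst σ) k (P.subst σ) := by
  simp [subst, map, lift_subst]

theorem subst_rep {n : ℕ} (σ : ℕ → ℕ) (a : Nm n) (k : ℕ) (P : Proc (n + k)) :
    (rep a k P).subst σ = rep (a.subst σ) k (P.subst σ) := by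
  simp [subst, map, lift_subst]

theorem subst_res {n : ℕ} (σ : ℕ → ℕ) (L : Ty 0) (P : Proc (n + 1)) :
    (res L P).subst σ = res L (P.subst σ) := by
  simp [subst, map, lift_subst]

theorem subst_app {n : ℕ} (σ : ℕ → ℕ) (P : Proc (n + 1)) (b : Nm n) :
    (app P b).subst σ = app (P.subst σ) (b.subst σ) := by
  simp [subst, map, lift_subst]

theorem subst_par {n : ℕ} (σ : ℕ → ℕ) (P Q : Proc n) :
    (par P Q).subst σ = par (P.subst σ) (Q.subst σ) := rfl

theorem subst_out {n : ℕ} (σ : ℕ → ℕ) (a : Nm n) (bs : List (Nm n)) :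
    (out a bs).subst σ = out (a.subst σ) (bs.map (Nm.subst σ)) := rfl

theorem subst_out_fr (σ : ℕ → ℕ) (a : ℕ) (bs : List ℕ) :
    (out (.fr a) (bs.map .fr) : Proc 0).subst σ = out (.fr (σ a)) ((bs.map σ).map .fr) := by
  rw [subst_out, List.map_map, List.map_map]
  rfl

theorem subst_congr {n : ℕ} (P : Proc n) {σ τ : ℕ → ℕ} (h : ∀ x ∈ P.fn, σ x = τ x) :
    P.subst σ = P.subst τ :=
  map_congr P (fun x hx => by simp [Nm.subst, h x hx]) fun _ => rfl

theorem subst_subst {n : ℕ} (P : Proc n) (σ τ : ℕ → ℕ) :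
    (P.subst σ).subst τ = P.subst (τ ∘ σ) := by
  rw [subst, subst, map_map, subst]
  congr 1
  funext a
  cases a <;> rfl

theorem subst_id {n : ℕ} (P : Proc n) : P.subst id = P := by
  conv_rhs => rw [← map_id P]
  rw [subst]
  congr 1
  funext a
  cases a <;> rfl

theorem subst_of_fixed {n : ℕ} (P : Proc n) {σ : ℕ → ℕ} (h : ∀ x ∈ P.fn, σ x = x) :
    P.subst σ = P := by
  rw [subst_congr P (τ := id) h, subst_id]

theorem mem_fn_subst {n : ℕ} {P : Proc n} {σ : ℕ → ℕ} {y : ℕ} :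
    y ∈ (P.subst σ).fn ↔ ∃ x ∈ P.fn, σ x = y := by
  constructor
  · intro h
    have : (P.subst σ).fn ⊆ P.fn.image σ := fn_map_subset P
      (fun x hx => by simpa [Nm.subst, Nm.fn] using ⟨x, hx, rfl⟩) fun i => by simp [Nm.subst, Nm.fn]
    simpa using this h
  · rintro ⟨x, hx, rfl⟩
    exact subset_fn_map P (Nm.subst σ) hx (by simp [Nm.subst, Nm.fn])

theorem inst_subst {n k : ℕ} (P : Proc (n + k)) {xs : List ℕ} (hx : xs.length = k) (σ : ℕ → ℕ) :
    (P.inst xs).subst σ = (P.subst σ).inst (xs.map σ) := by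
  rw [subst, inst, map_map, subst, inst, map_map]
  congr 1
  funext a
  cases a with
  | fr x => rfl
  | bd i =>
    refine Fin.addCases (fun i => ?_) (fun i => ?_) i
    · simp [Nm.subst, Nm.inst]
    · simp only [Nm.subst, Nm.inst, Function.comp, Fin.addCases_right, Nm.fr.injEq]
      rw [List.getD_eq_getElem _ _ (by simp [hx]), List.getD_eq_getElem _ _ (by simp [hx])]
      simp

/-- The identity behind changes of bound names: `τ` acts as `σ` on the body and takes the chosen
names `xs` to the new choice `ys`. -/
theorem inst_subst_of {n k : ℕ} (P : Proc (n + k)) {xs ys : List ℕ} (hx : xs.length = k)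
    {σ τ : ℕ → ℕ} (hxy : xs.map τ = ys) (h : ∀ x ∈ P.fn, τ x = σ x) :
    (P.inst xs).subst τ = (P.subst σ).inst ys := by
  rw [inst_subst P hx, hxy, subst_congr P h]

theorem inst1_subst_of {n : ℕ} (P : Proc (n + 1)) {x y : ℕ} {σ τ : ℕ → ℕ} (hxy : τ x = y)
    (h : ∀ x ∈ P.fn, τ x = σ x) : (P.inst1 x).subst τ = (P.subst σ).inst1 y :=
  inst_subst_of (k := 1) P rfl (by simp [hxy]) h

theorem fn_inst_subset {n k : ℕ} (P : Proc (n + k)) {xs : List ℕ} (hx : xs.length = k) :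
    (P.inst xs).fn ⊆ P.fn ∪ xs.toFinset := by
  refine fn_map_subset P (fun x hx => ?_) fun i => ?_
  · simp [Nm.inst, Nm.fn, hx]
  · refine Fin.addCases (fun i => ?_) (fun i => ?_) i
    · simp [Nm.inst, Nm.fn]
    · simp only [Nm.inst, Fin.addCases_right, Nm.fn, Finset.singleton_subset_iff]
      rw [List.getD_eq_getElem _ _ (by simp [hx])]
      simp

theorem fn_subset_inst {n k : ℕ} (P : Proc (n + k)) (xs : List ℕ) : P.fn ⊆ (P.inst xs).fn :=
  fun x hx => subset_fn_map P (Nm.inst xs) hx (by simp [Nm.inst, Nm.fn])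

theorem fn_inst1_subset {n : ℕ} (P : Proc (n + 1)) (x : ℕ) : (P.inst1 x).fn ⊆ insert x P.fn := by
  refine (fn_inst_subset (k := 1) P rfl).trans ?_
  intro y
  simp

theorem fn_subset_inst1 {n : ℕ} (P : Proc (n + 1)) (x : ℕ) : P.fn ⊆ (P.inst1 x).fn :=
  fn_subset_inst (k := 1) P [x]

theorem mem_fn_bind {n : ℕ} {P : Proc n} {xs : List ℕ} {y : ℕ} :
    y ∈ (P.bind xs).fn ↔ y ∈ P.fn ∧ y ∉ xs := by
  constructor
  · intro h
    have : (P.bind xs).fn ⊆ P.fn \ xs.toFinset := fn_map_subset P (fun x hx => by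
      simp only [Nm.bind]
      split_ifs with hxs
      · simp [Nm.fn]
      · simp [Nm.fn, hx, hxs]) fun i => by simp [Nm.bind, Nm.fn]
    simpa using this h
  · rintro ⟨h, hy⟩
    exact subset_fn_map P (Nm.bind xs) h (by simp [Nm.bind, Nm.fn, hy])

theorem mem_fn_bind1 {n : ℕ} {P : Proc n} {x y : ℕ} :
    y ∈ (P.bind1 x).fn ↔ y ∈ P.fn ∧ y ≠ x := by
  refine (mem_fn_bind (xs := [x])).trans ?_
  simp

theorem bind_inst {n : ℕ} (P : Proc n) {xs ys : List ℕ} (hl : xs.length = ys.length) :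
    (P.bind xs).inst ys = P.subst (substOf xs ys) := by
  rw [bind, inst, map_map, subst]
  congr 1
  funext a
  cases a with
  | fr x =>
    simp only [Function.comp, Nm.bind, Nm.subst, substOf]
    split_ifs with hx
    · have : xs.idxOf x < ys.length := hl ▸ List.idxOf_lt_length_of_mem hx
      have e := Fin.addCases_right (motive := fun _ => Nm n) (left := Nm.bd)
        (right := fun j : Fin xs.length => Nm.fr (ys.getD j 0))
        ⟨xs.idxOf x, List.idxOf_lt_length_of_mem hx⟩
      rw [Nm.inst, e, List.getD_eq_getElem _ _ this, List.getD_eq_getElem _ _ this]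
    · simp [Nm.inst]
  | bd i => simp [Nm.bind, Nm.inst, Nm.subst]

theorem substOf_singleton (x y : ℕ) : substOf [x] [y] = Function.update id x y := by
  rw [← overwrite_id, overwrite_cons, overwrite_nil]

theorem bind1_inst1 {n : ℕ} (P : Proc n) (x y : ℕ) :
    (P.bind1 x).inst1 y = P.subst (Function.update id x y) := by
  rw [← substOf_singleton]
  exact bind_inst (xs := [x]) P rfl

theorem bind1_inst1_self {n : ℕ} (P : Proc n) (x : ℕ) : (P.bind1 x).inst1 x = P := by
  rw [bind1_inst1]
  exact subst_of_fixed P fun y _ => by by_cases h : y = x <;> simp [h]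

theorem inst_bind {n : ℕ} {xs : List ℕ} (P : Proc (n + xs.length)) (hn : xs.Nodup)
    (hx : ∀ x ∈ xs, x ∉ P.fn) : (P.inst xs).bind xs = P := by
  conv_rhs => rw [← map_id P]
  rw [inst, bind, map_map]
  refine map_congr P (fun x hxP => ?_) fun i => ?_
  · have : x ∉ xs := fun h => hx x h hxP
    simp [Nm.inst, Nm.bind, this]
  · refine Fin.addCases (fun i => ?_) (fun i => ?_) i
    · simp [Nm.inst, Nm.bind]
    · simp [Nm.inst, Nm.bind, hn.idxOf_getElem]

theorem inst1_bind1 {n : ℕ} (P : Proc (n + 1)) {x : ℕ} (hx : x ∉ P.fn) :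
    (P.inst1 x).bind1 x = P :=
  inst_bind (xs := [x]) P (by simp) (by simpa using hx)

/-- Since `y` is fresh for the left-hand side, it suffices to compare the instances at `y`; the
hypothesis `hy` excludes capture. -/
theorem bind1_subst_of {n : ℕ} (P : Proc n) {x y : ℕ} {σ τ : ℕ → ℕ} (hxy : τ x = y)
    (h : ∀ z ∈ P.fn, z ≠ x → τ z = σ z) (hy : ∀ z ∈ P.fn, z ≠ x → σ z ≠ y) :
    (P.bind1 x).subst σ = (P.subst τ).bind1 y := by
  have hfr : y ∉ ((P.bind1 x).subst σ).fn := by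
    rw [mem_fn_subst]
    rintro ⟨z, hz, hzy⟩
    rw [mem_fn_bind1] at hz
    exact hy z hz.1 hz.2 hzy
  rw [← inst1_bind1 _ hfr]
  congr 1
  rw [← inst1_subst_of (τ := Function.update σ x y) (x := x) _ (Function.update_self ..)
    (fun z hz => Function.update_of_ne (mem_fn_bind1.1 hz).2 _ _), bind1_inst1_self]
  refine subst_congr P fun z hz => ?_
  by_cases hzx : z = x
  · rw [hzx, Function.update_self, hxy]
  · rw [Function.update_of_ne hzx, h z hz hzx]

theorem resList_cons (x : ℕ) (L : Ty 0) (d : List (ℕ × Ty 0)) (P : Proc 0) :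
    resList ((x, L) :: d) P = res L ((resList d P).bind1 x) := rfl

theorem mem_fn_resList {d : List (ℕ × Ty 0)} {P : Proc 0} {y : ℕ} :
    y ∈ (resList d P).fn ↔ y ∈ P.fn ∧ y ∉ d.map Prod.fst := by
  induction d with
  | nil => simp [resList]
  | cons p d ih =>
    obtain ⟨x, L⟩ := p
    rw [resList_cons]
    simp only [fn, mem_fn_bind1, ih, List.map_cons, List.mem_cons, not_or]
    tauto

/-- Renaming of the private names in a list of restrictions. -/
theorem resList_subst_of (d : List (ℕ × Ty 0)) (P : Proc 0) {σ τ : ℕ → ℕ}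
    (hτ : Function.Injective τ) (h : ∀ z ∈ P.fn, z ∉ d.map Prod.fst → τ z = σ z) :
    (resList d P).subst σ = resList (d.map fun p => (τ p.1, p.2)) (P.subst τ) := by
  induction d generalizing σ with
  | nil => exact subst_congr P fun z hz => (h z hz (by simp)).symm
  | cons p d ih =>
    obtain ⟨x, L⟩ := p
    rw [resList_cons, subst_res, List.map_cons, resList_cons]
    congr 1
    rw [bind1_subst_of (τ := τ) (y := τ x) _ rfl]
    · rw [ih fun z _ _ => rfl]
    · intro z hz hzx
      rw [mem_fn_resList] at hz
      exact h z hz.1 (by simp [hzx, hz.2])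
    · intro z hz hzx
      rw [mem_fn_resList] at hz
      rw [← h z hz.1 (by simp [hzx, hz.2])]
      exact fun e => hzx (hτ e)

theorem fn_out_fr (a : ℕ) (bs : List ℕ) :
    (out (.fr a) (bs.map .fr) : Proc 0).fn = insert a bs.toFinset := by
  ext y
  rw [fn, Finset.mem_union, mem_foldr_fn, Finset.mem_insert, List.mem_toFinset]
  simp [Nm.fn]

end Proc

/-! ### Names of actions and of derivatives -/

namespace Act

/-- Renaming of actions. -/
def rename (π : ℕ → ℕ) : Act → Act
  | tau => tau
  | inp a xs => inp (π a) (xs.map π)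
  | out d a bs => out (d.map fun p => (π p.1, p.2)) (π a) (bs.map π)

theorem rename_congr {π π' : ℕ → ℕ} (μ : Act) (h : ∀ x ∈ μ.names, π x = π' x) :
    μ.rename π = μ.rename π' := by
  cases μ with
  | tau => rfl
  | inp a xs =>
    simp only [names, Finset.mem_union, Finset.mem_singleton, List.mem_toFinset] at h
    simp only [rename, h a (.inl rfl), List.map_congr_left fun x hx => h x (.inr hx)]
  | out d a bs =>
    simp only [names, Finset.mem_union, Finset.mem_singleton, List.mem_toFinset] at h
    simp only [rename]
    rw [h a (.inl (.inl rfl)), List.map_congr_left (l := bs) fun x hx => h x (.inl (.inr hx)),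
      List.map_congr_left (l := d) fun p hp => by
        rw [h p.1 (.inr (List.mem_map_of_mem hp))]]

theorem rename_id (μ : Act) : μ.rename id = μ := by
  cases μ <;> simp [rename]

theorem bn_rename (π : ℕ → ℕ) (μ : Act) : (μ.rename π).bn = μ.bn.image π := by
  cases μ with
  | tau => rfl
  | inp a xs =>
    ext
    simp [rename, bn]
  | out d a bs =>
    ext
    simp [rename, bn]

theorem names_rename (π : ℕ → ℕ) (μ : Act) : (μ.rename π).names = μ.names.image π := by
  cases μ with
  | tau => rfl
  | inp a xs =>
    ext
    simp [rename, names, eq_comm]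
  | out d a bs =>
    ext
    simp only [rename, names, Finset.mem_union, Finset.mem_singleton, List.mem_toFinset,
      List.map_map, List.mem_map, Finset.mem_image, Function.comp]
    aesop

theorem bn_subset_names (μ : Act) : μ.bn ⊆ μ.names := by
  cases μ with
  | tau => simp [bn]
  | inp a xs => exact Finset.subset_union_right
  | out d a bs => exact Finset.subset_union_right

end Act

theorem Step.fn_subset {P P' : Proc 0} {μ : Act} (h : Step P μ P') :
    P'.fn ⊆ P.fn ∪ μ.bn ∧ μ.names ⊆ P.fn ∪ μ.bn := by
  induction h with
  | @inp a k P xs hl hn hx =>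
    refine ⟨(Proc.fn_inst_subset P hl).trans ?_, ?_⟩ <;>
      intro z <;> simp only [Act.bn, Act.names, Proc.fn, Nm.fn, Finset.mem_union] <;> tauto
  | @rep a k P xs hl hn hx =>
    refine ⟨?_, ?_⟩
    · intro z hz
      rw [Proc.fn, Finset.mem_union] at hz
      rcases hz with hz | hz
      · have := Proc.fn_inst_subset P hl hz
        simp only [Act.bn, Proc.fn, Finset.mem_union] at this ⊢
        tauto
      · exact Finset.mem_union_left _ hz
    · intro z
      simp only [Act.bn, Act.names, Proc.fn, Nm.fn, Finset.mem_union]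
      tauto
  | @out a bs =>
    refine ⟨by simp [Proc.fn], ?_⟩
    rw [Proc.fn_out_fr]
    intro z
    simp [Act.names, Act.bn]
  | parL _ hd ih | parR _ hd ih =>
    refine ⟨fun z hz => ?_, fun z hz => ?_⟩
    · have := @ih.1 z
      simp only [Proc.fn, Finset.mem_union] at this hz ⊢
      tauto
    · have := @ih.2 z
      simp only [Proc.fn, Finset.mem_union] at this hz ⊢
      tauto
  | @comL P P' Q Q' a xs bs d _ _ hl hd ih₁ ih₂ | @comR Q Q' P P' a xs bs d _ _ hl hd ih₂ ih₁ =>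
    refine ⟨fun z hz => ?_, by simp [Act.names]⟩
    rw [Proc.mem_fn_resList, Proc.fn, Finset.mem_union] at hz
    obtain ⟨hz, hzd⟩ := hz
    -- Names received in a communication are free in the sender or extruded by it, and the extruded
    -- ones are restricted in the result.
    have hQ : ∀ z, z ∈ Q'.fn ∨ z ∈ bs → z ∉ d.map Prod.fst → z ∈ Q.fn := by
      intro z hz hzd
      have h₁ := @ih₂.1 z
      have h₂ := @ih₂.2 z
      simp only [Act.names, Act.bn, Finset.mem_union, List.mem_toFinset] at h₁ h₂
      tauto
    simp only [Act.bn, Proc.fn, Finset.union_empty, Finset.mem_union]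
    have hP : z ∈ (P'.subst (substOf xs bs)).fn → z ∈ P.fn ∨ z ∈ Q.fn := by
      intro hz
      obtain ⟨w, hw, hwz⟩ := Proc.mem_fn_subst.1 hz
      by_cases hwx : w ∈ xs
      · have hlt : xs.idxOf w < bs.length := hl ▸ List.idxOf_lt_length_of_mem hwx
        rw [substOf, if_pos hwx, List.getD_eq_getElem _ _ hlt] at hwz
        exact .inr (hQ z (.inr (hwz ▸ List.getElem_mem hlt)) hzd)
      · rw [substOf, if_neg hwx] at hwz
        have h₁ := ih₁.1 hw
        simp only [Act.bn, Finset.mem_union, List.mem_toFinset] at h₁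
        exact .inl (hwz ▸ h₁.resolve_right hwx)
    have := hQ z
    tauto
  | @res L P P' μ x hx hμ _ ih =>
    have hbn : ∀ z, z ∈ (P.inst1 x).fn → z ≠ x → z ∈ P.fn := fun z hz hzx => by
      have := Proc.fn_inst1_subset P x hz
      rw [Finset.mem_insert] at this
      exact this.resolve_left hzx
    refine ⟨fun z hz => ?_, fun z hz => ?_⟩
    · rw [Proc.fn, Proc.mem_fn_bind1] at hz
      have h := ih.1 hz.1
      rw [Finset.mem_union] at h ⊢
      exact h.imp_left fun h => hbn z h hz.2
    · have h := ih.2 hz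
      rw [Finset.mem_union] at h ⊢
      exact h.imp_left fun h => hbn z h fun e => hμ (e ▸ hz)
  | @opn L P P' d a bs x hx hxb hxd hax _ ih =>
    have hbn : (P.inst1 x).fn ∪ (Act.out d a bs).bn ⊆
        (Proc.res L P).fn ∪ (Act.out ((x, L) :: d) a bs).bn := by
      intro z hz
      have := @Proc.fn_inst1_subset _ P x z
      simp only [Finset.mem_union, Finset.mem_insert, Act.bn, Proc.fn, List.mem_toFinset,
        List.map_cons, List.mem_cons] at this hz ⊢
      tauto
    refine ⟨ih.1.trans hbn, fun z hz => ?_⟩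
    by_cases hzx : z = x
    · simp [hzx, Act.bn]
    · refine hbn (ih.2 ?_)
      simp only [Act.names, List.map_cons, List.toFinset_cons, Finset.mem_union,
        Finset.mem_insert, hzx, false_or] at hz ⊢
      exact hz
  | @app P b μ P' _ ih =>
    have hbn : (P.inst1 b).fn ∪ μ.bn ⊆ (Proc.app P (.fr b)).fn ∪ μ.bn := by
      intro z hz
      have := @Proc.fn_inst1_subset _ P b z
      simp only [Finset.mem_union, Finset.mem_insert, Proc.fn, Nm.fn,
        Finset.mem_singleton] at this hz ⊢
      tauto
    exact ⟨ih.1.trans hbn, ih.2.trans hbn⟩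

/-- A permutation may be modified so that it maps given names to fresh ones. -/
theorem exists_perm_avoid (π : Equiv.Perm ℕ) (s F : Finset ℕ) :
    ∃ π' : Equiv.Perm ℕ, (∀ x ∈ s, π' x ∉ F) ∧ ∀ z ∈ F, z ∉ s → π' z = π z := by
  induction s using Finset.induction_on with
  | empty => exact ⟨π, by simp, fun _ _ _ => rfl⟩
  | insert x s hx ih =>
    obtain ⟨π', h₁, h₂⟩ := ih
    obtain ⟨y, hy⟩ := Infinite.exists_notMem_finset (F ∪ s.image π' ∪ F.image π')
    simp only [Finset.mem_union, Finset.mem_image, not_or, not_exists, not_and] at hy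
    -- Composition with a transposition keeps the map bijective. The name `y` avoids the values of
    -- `π'` on `s` and on `F`, so those already arranged are left unchanged.
    refine ⟨Equiv.swap (π' x) y * π', ?_, ?_⟩
    · intro z hz
      rw [Equiv.Perm.mul_apply]
      by_cases hzx : z = x
      · rw [hzx, Equiv.swap_apply_left]
        exact hy.1.1
      · have hzs : z ∈ s := (Finset.mem_insert.1 hz).resolve_left hzx
        rw [Equiv.swap_apply_of_ne_of_ne (fun e => hzx (π'.injective e)) (hy.1.2 z hzs)]
        exact h₁ z hzs
    · intro z hz hzs
      rw [Finset.mem_insert, not_or] at hzs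
      rw [Equiv.Perm.mul_apply, Equiv.swap_apply_of_ne_of_ne (fun e => hzs.1 (π'.injective e))
        (hy.2 z hz)]
      exact h₂ z hz hzs.2

/-! ## Typed contextual closures -/

theorem exists_fresh_list {α : Type} (l : List (ℕ × α)) (F : Finset ℕ) :
    ∃ l' : List (ℕ × α), l.map Prod.snd = l'.map Prod.snd ∧ (l'.map Prod.fst).Nodup ∧
      ∀ y ∈ l'.map Prod.fst, y ∉ F := by
  induction l with
  | nil => exact ⟨[], rfl, by simp, by simp⟩
  | cons p l ih =>
    obtain ⟨l', h₁, h₂, h₃⟩ := ih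
    obtain ⟨y, hy⟩ := Infinite.exists_notMem_finset (F ∪ (l'.map Prod.fst).toFinset)
    simp only [Finset.mem_union, List.mem_toFinset, not_or] at hy
    refine ⟨(y, p.2) :: l', by simp [h₁], ?_, ?_⟩
    · rw [List.map_cons, List.nodup_cons]
      exact ⟨hy.2, h₂⟩
    · intro z hz
      rw [List.map_cons, List.mem_cons] at hz
      obtain rfl | hz := hz
      · exact hy.1
      · exact h₃ z hz

theorem exists_list_of_map_snd {l : List (ℕ × Ty 0)} {ys : List ℕ} (h : ys.length = l.length) :
    ∃ l' : List (ℕ × Ty 0), l'.map Prod.fst = ys ∧ l.map Prod.snd = l'.map Prod.snd :=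
  ⟨ys.zip (l.map Prod.snd), List.map_fst_zip (by simp [h]), (List.map_snd_zip (by simp [h])).symm⟩

theorem length_eq_of_map_snd {l l' : List (ℕ × Ty 0)} (h : l.map Prod.snd = l'.map Prod.snd) :
    l.length = l'.length := by
  simpa using congrArg List.length h

theorem Proc.inst1_subst_update {n : ℕ} (P : Proc (n + 1)) {x : ℕ} (hx : x ∉ P.fn) (σ : ℕ → ℕ)
    (y : ℕ) : (P.inst1 x).subst (Function.update σ x y) = (P.subst σ).inst1 y :=
  Proc.inst1_subst_of P (Function.update_self ..) fun z hz =>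
    Function.update_of_ne (by rintro rfl; exact hx hz) _ _

/-- `Clo S fl Γ P Q`: the processes `P` and `Q` are typed under `Γ` and have the same structure,
except for subprocesses that are related by `S`. If `fl = false`, then the latter occur only
underneath prefixes. -/
inductive Clo (S : Env → Proc 0 → Proc 0 → Prop) : Bool → Env → Proc 0 → Proc 0 → Prop
  | leaf {Γ : Env} {P Q : Proc 0} : S Γ P Q → Clo S true Γ P Q
  | nil {fl : Bool} {Γ : Env} : Γ.Unrestricted → Clo S fl Γ .nil .nil
  | inp {fl : Bool} {Γ₁ Γ₂ Γ : Env} {a : ℕ} {k : ℕ} {P Q : Proc (0 + k)} {c : Cap} {T : Ty 0}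
      {l : List (ℕ × Ty 0)} :
      (c = .inp ∨ c = .linInp) → Γ₁.HasTy a (.ch c T) → Ty.Carried (l.map Prod.snd) T →
      l.length = k → (l.map Prod.fst).Nodup →
      (∀ x ∈ l.map Prod.fst, x ∉ P.fn ∧ x ∉ Q.fn ∧ Γ₂.lookup x = none) →
      Clo S true (Γ₂.extend l) (P.inst (l.map Prod.fst)) (Q.inst (l.map Prod.fst)) →
      Env.Join Γ₁ Γ₂ Γ → Clo S fl Γ (.inp (.fr a) k P) (.inp (.fr a) k Q)
  | out {fl : Bool} {Γ₁ Γ₂ Γ : Env} {a : ℕ} {c : Cap} {T : Ty 0} {l : List (ℕ × Ty 0)}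
      {bs : List (Nm 0)} :
      (c = .out ∨ c = .linOut) → Γ₁.HasTy a (.ch c T) → Ty.Carried (l.map Prod.snd) T →
      Γ₂.HasTys l → Env.Join Γ₁ Γ₂ Γ → bs = (l.map Prod.fst).map .fr →
      Clo S fl Γ (.out (.fr a) bs) (.out (.fr a) bs)
  | par {fl : Bool} {Γ₁ Γ₂ Γ : Env} {P P' Q Q' : Proc 0} :
      Clo S fl Γ₁ P Q → Clo S fl Γ₂ P' Q' → Env.Join Γ₁ Γ₂ Γ → Clo S fl Γ (.par P P') (.par Q Q')
  | res {fl : Bool} {Γ : Env} {L : Ty 0} {P Q : Proc 1} {x : ℕ} :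
      x ∉ P.fn → x ∉ Q.fn → Γ.lookup x = none →
      Clo S fl (Γ.insert x L) (P.inst1 x) (Q.inst1 x) → Clo S fl Γ (.res L P) (.res L Q)
  | res' {fl : Bool} {Γ : Env} {L : Ty 0} {P Q : Proc 1} {x : ℕ} :
      x ∉ P.fn → x ∉ Q.fn → Γ.lookup x = none →
      Clo S fl Γ (P.inst1 x) (Q.inst1 x) → Clo S fl Γ (.res L P) (.res L Q)
  | rep {fl : Bool} {Γ₁ Γ₂ Γ : Env} {a : ℕ} {k : ℕ} {P Q : Proc (0 + k)} {T : Ty 0}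
      {l : List (ℕ × Ty 0)} :
      Γ₁.HasTy a (.ch .inp T) → Ty.Carried (l.map Prod.snd) T →
      l.length = k → (l.map Prod.fst).Nodup →
      (∀ x ∈ l.map Prod.fst, x ∉ P.fn ∧ x ∉ Q.fn ∧ Γ₂.lookup x = none) →
      Clo S true (Γ₂.extend l) (P.inst (l.map Prod.fst)) (Q.inst (l.map Prod.fst)) →
      Γ₂.Unrestricted → Env.Join Γ₁ Γ₂ Γ → Clo S fl Γ (.rep (.fr a) k P) (.rep (.fr a) k Q)
  | app {fl : Bool} {Γ₁ Γ₂ Γ : Env} {P Q : Proc 1} {b : ℕ} {T : Ty 0} {x : ℕ} :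
      x ∉ P.fn → x ∉ Q.fn → Γ₁.lookup x = none →
      Clo S fl (Γ₁.insert x T) (P.inst1 x) (Q.inst1 x) →
      Γ₂.HasTy b T → Env.Join Γ₁ Γ₂ Γ → Clo S fl Γ (.app P (.fr b)) (.app Q (.fr b))

/-- The relation `S` respects typing. -/
def WellTyped (S : Env → Proc 0 → Proc 0 → Prop) : Prop :=
  ∀ Γ P Q, S Γ P Q → P.Typed Γ ∧ Q.Typed Γ

/-- The relation `S` is closed under well-typed substitutions. -/
def SubstClosed (S : Env → Proc 0 → Proc 0 → Prop) : Prop :=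
  ∀ Γ P Q, S Γ P Q → ∀ σ Θ, Env.IsSubst σ Γ Θ → S Θ (P.subst σ) (Q.subst σ)

theorem Env.lookup_ne_none_of_extend {Γ : Env} {l : List (ℕ × Ty 0)} {x : ℕ}
    (h : (Γ.extend l).lookup x ≠ none) (hx : x ∉ l.map Prod.fst) : Γ.lookup x ≠ none := by
  rwa [Env.lookup_extend_of_notMem hx] at h

theorem Env.lookup_ne_none_of_insert {Γ : Env} {T : Ty 0} {x y : ℕ}
    (h : Finmap.lookup x (Γ.insert y T) ≠ none) (hx : x ≠ y) : Γ.lookup x ≠ none := by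
  rwa [Env.lookup_insert_eq, if_neg hx] at h

namespace Clo

variable {S : Env → Proc 0 → Proc 0 → Prop}

theorem to_true {fl : Bool} {Γ : Env} {P Q : Proc 0} (h : Clo S fl Γ P Q) : Clo S true Γ P Q := by
  induction h with
  | leaf h => exact .leaf h
  | nil h => exact .nil h
  | inp h₁ h₂ h₃ h₄ h₅ h₆ h₇ h₈ => exact .inp h₁ h₂ h₃ h₄ h₅ h₆ h₇ h₈
  | out h₁ h₂ h₃ h₄ h₅ h₆ => exact .out h₁ h₂ h₃ h₄ h₅ h₆
  | par _ _ h ih₁ ih₂ => exact .par ih₁ ih₂ h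
  | res h₁ h₂ h₃ _ ih => exact .res h₁ h₂ h₃ ih
  | res' h₁ h₂ h₃ _ ih => exact .res' h₁ h₂ h₃ ih
  | rep h₁ h₂ h₃ h₄ h₅ h₆ h₇ h₈ => exact .rep h₁ h₂ h₃ h₄ h₅ h₆ h₇ h₈
  | app h₁ h₂ h₃ _ h₄ h₅ ih => exact .app h₁ h₂ h₃ ih h₄ h₅

theorem typed (hS : WellTyped S) {fl : Bool} {Γ : Env} {P Q : Proc 0} (h : Clo S fl Γ P Q) :
    P.Typed Γ ∧ Q.Typed Γ := by
  induction h with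
  | leaf h => exact hS _ _ _ h
  | nil h => exact ⟨.nil h, .nil h⟩
  | inp h₁ h₂ h₃ h₄ h₅ h₆ _ h₈ ih =>
    exact ⟨.inp h₁ h₂ h₃ h₄ h₅ (fun x hx => ⟨(h₆ x hx).1, (h₆ x hx).2.2⟩) ih.1 h₈,
      .inp h₁ h₂ h₃ h₄ h₅ (fun x hx => (h₆ x hx).2) ih.2 h₈⟩
  | out h₁ h₂ h₃ h₄ h₅ h₆ =>
    rw [List.map_map] at h₆
    subst h₆
    exact ⟨.out h₁ h₂ h₃ h₄ h₅, .out h₁ h₂ h₃ h₄ h₅⟩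
  | par _ _ h ih₁ ih₂ => exact ⟨.par ih₁.1 ih₂.1 h, .par ih₁.2 ih₂.2 h⟩
  | res h₁ h₂ h₃ _ ih => exact ⟨.res h₁ h₃ ih.1, .res h₂ h₃ ih.2⟩
  | res' h₁ h₂ h₃ _ ih => exact ⟨.res' h₁ h₃ ih.1, .res' h₂ h₃ ih.2⟩
  | rep h₁ h₂ h₃ h₄ h₅ _ h₇ h₈ ih =>
    exact ⟨.rep h₁ h₂ h₃ h₄ (fun x hx => ⟨(h₅ x hx).1, (h₅ x hx).2.2⟩) ih.1 h₇ h₈,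
      .rep h₁ h₂ h₃ h₄ (fun x hx => (h₅ x hx).2) ih.2 h₇ h₈⟩
  | app h₁ h₂ h₃ _ h₄ h₅ ih => exact ⟨.app h₁ h₃ ih.1 h₄ h₅, .app h₂ h₃ ih.2 h₄ h₅⟩

/-- On the diagonal no leaf is needed. With the empty relation for `S`, results on `Clo` thereby
become results on typing alone. -/
theorem of_typed (fl : Bool) {Γ : Env} {P : Proc 0} (h : P.Typed Γ) : Clo S fl Γ P P := by
  induction h generalizing fl with
  | nil h => exact .nil h
  | inp h₁ h₂ h₃ h₄ h₅ h₆ _ h₈ ih =>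
    exact .inp h₁ h₂ h₃ h₄ h₅ (fun x hx => ⟨(h₆ x hx).1, h₆ x hx⟩) (ih _) h₈
  | out h₁ h₂ h₃ h₄ h₅ => exact .out h₁ h₂ h₃ h₄ h₅ (by rw [List.map_map]; rfl)
  | par _ _ h ih₁ ih₂ => exact .par (ih₁ _) (ih₂ _) h
  | res h₁ h₂ _ ih => exact .res h₁ h₁ h₂ (ih _)
  | res' h₁ h₂ _ ih => exact .res' h₁ h₁ h₂ (ih _)
  | rep h₁ h₂ h₃ h₄ h₅ _ h₇ h₈ ih =>
    exact .rep h₁ h₂ h₃ h₄ (fun x hx => ⟨(h₅ x hx).1, h₅ x hx⟩) (ih _) h₇ h₈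
  | app h₁ h₂ _ h₃ h₄ ih => exact .app h₁ h₁ h₂ (ih _) h₃ h₄

end Clo

theorem Proc.Typed.lookup_ne_none {Γ : Env} {P : Proc 0} (h : P.Typed Γ) :
    ∀ x ∈ P.fn, Γ.lookup x ≠ none := by
  induction h with
  | nil _ => simp [Proc.fn]
  | inp _ h₂ _ _ _ h₆ _ h₈ ih | rep h₂ _ _ _ h₆ _ _ h₈ ih =>
    intro x hx
    rw [Proc.fn, Finset.mem_union] at hx
    obtain hx | hx := hx
    · obtain rfl : x = _ := by simpa [Nm.fn] using hx
      exact h₈.lookup_ne_none_left h₂.lookup_ne_none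
    · exact h₈.symm.lookup_ne_none_left (Env.lookup_ne_none_of_extend
        (ih x (Proc.fn_subset_inst _ _ hx)) fun h => (h₆ x h).1 hx)
  | @out _ _ _ a _ _ l _ h₂ _ h₄ h₅ =>
    intro x hx
    have e : (l.map fun p => (Nm.fr p.1 : Nm 0)) = (l.map Prod.fst).map .fr := by
      rw [List.map_map]
      rfl
    rw [e, Proc.fn_out_fr, Finset.mem_insert, List.mem_toFinset] at hx
    obtain rfl | hx := hx
    · exact h₅.lookup_ne_none_left h₂.lookup_ne_none
    · exact h₅.symm.lookup_ne_none_left (h₄.lookup_ne_none x hx)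
  | par _ _ h ih₁ ih₂ =>
    intro x hx
    rw [Proc.fn, Finset.mem_union] at hx
    obtain hx | hx := hx
    · exact h.lookup_ne_none_left (ih₁ x hx)
    · exact h.symm.lookup_ne_none_left (ih₂ x hx)
  | res h₁ _ _ ih =>
    intro x hx
    exact Env.lookup_ne_none_of_insert (ih x (Proc.fn_subset_inst1 _ _ hx)) fun e => h₁ (e ▸ hx)
  | res' h₁ _ _ ih => exact fun x hx => ih x (Proc.fn_subset_inst1 _ _ hx)
  | app h₁ _ _ h₃ h₄ ih =>
    intro x hx
    rw [Proc.fn, Finset.mem_union] at hx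
    obtain hx | hx := hx
    · exact h₄.lookup_ne_none_left (Env.lookup_ne_none_of_insert
        (ih x (Proc.fn_subset_inst1 _ _ hx)) fun e => h₁ (e ▸ hx))
    · obtain rfl : x = _ := by simpa [Nm.fn] using hx
      exact h₄.symm.lookup_ne_none_left h₃.lookup_ne_none

namespace Clo

variable {S : Env → Proc 0 → Proc 0 → Prop}

/-- Induction on the common derivation, the environments being divided by `IsSubst.split`. At each
binder new names are chosen, fresh for the target environment and for both bodies, so that nothing
is captured. -/
theorem subst (hS : SubstClosed S) {fl : Bool} {Γ : Env} {P Q : Proc 0} (h : Clo S fl Γ P Q) :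
    ∀ {σ : ℕ → ℕ} {Θ : Env}, Env.IsSubst σ Γ Θ → Clo S fl Θ (P.subst σ) (Q.subst σ) := by
  induction h with
  | leaf h => exact fun hs => .leaf (hS _ _ _ h _ _ hs)
  | nil h => exact fun hs => .nil (hs.unrestricted h)
  | @inp fl Γ₁ Γ₂ Γ a k P Q c T l h₁ h₂ h₃ h₄ h₅ h₆ _ h₈ ih =>
    intro σ Θ hs
    obtain ⟨Θ₁, Θ₂, hΘ, hs₁, hs₂⟩ := hs.split h₈
    obtain ⟨l', e, hn, hl⟩ := exists_fresh_list l (Θ₂.keys ∪ (P.subst σ).fn ∪ (Q.subst σ).fn)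
    simp only [Finset.mem_union, not_or] at hl
    have hΘl : ∀ x ∈ l'.map Prod.fst, Θ₂.lookup x = none := fun x hx =>
      Env.lookup_of_notMem_keys (hl x hx).1.1
    have hlen := length_eq_of_map_snd e
    have hb := ih (hs₂.overwrite e h₅ (fun x hx => Env.not_linearAt_of_lookup (h₆ x hx).2.2) hn hΘl)
    have hmap := map_overwrite σ (xs := l.map Prod.fst) (ys := l'.map Prod.fst) (by simp [hlen]) h₅
    rw [Proc.inst_subst_of P (by simp [h₄]) hmap fun x hx => overwrite_of_notMem fun h =>
        (h₆ x h).1 hx, Proc.inst_subst_of Q (by simp [h₄]) hmap fun x hx =>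
        overwrite_of_notMem fun h => (h₆ x h).2.1 hx] at hb
    rw [Proc.subst_inp, Proc.subst_inp]
    exact .inp h₁ (hs₁.hasTy h₂) (e ▸ h₃) (hlen ▸ h₄) hn
      (fun x hx => ⟨(hl x hx).1.2, (hl x hx).2, hΘl x hx⟩) hb hΘ
  | out h₁ h₂ h₃ h₄ h₅ h₆ =>
    intro σ Θ hs
    obtain ⟨Θ₁, Θ₂, hΘ, hs₁, hs₂⟩ := hs.split h₅
    subst h₆
    rw [Proc.subst_out_fr]
    refine .out h₁ (hs₁.hasTy h₂) ?_ (hs₂.hasTys h₄) hΘ ?_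
    · rw [List.map_map]
      exact h₃
    · simp [Function.comp_def]
  | par _ _ h ih₁ ih₂ =>
    intro σ Θ hs
    obtain ⟨Θ₁, Θ₂, hΘ, hs₁, hs₂⟩ := hs.split h
    exact .par (ih₁ hs₁) (ih₂ hs₂) hΘ
  | @res fl Γ L P Q x h₁ h₂ h₃ _ ih =>
    intro σ Θ hs
    obtain ⟨y, hy⟩ := Infinite.exists_notMem_finset
      (Θ.keys ∪ (P.subst σ).fn ∪ (Q.subst σ).fn)
    simp only [Finset.mem_union, not_or] at hy
    have hΘ := Env.lookup_of_notMem_keys hy.1.1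
    have hb := ih (hs.update L (Env.not_linearAt_of_lookup h₃) hΘ)
    rw [Proc.inst1_subst_update P h₁, Proc.inst1_subst_update Q h₂] at hb
    rw [Proc.subst_res, Proc.subst_res]
    exact .res hy.1.2 hy.2 hΘ hb
  | @res' fl Γ L P Q x h₁ h₂ h₃ _ ih =>
    intro σ Θ hs
    obtain ⟨y, hy⟩ := Infinite.exists_notMem_finset
      (Θ.keys ∪ (P.subst σ).fn ∪ (Q.subst σ).fn)
    simp only [Finset.mem_union, not_or] at hy
    have hΘ := Env.lookup_of_notMem_keys hy.1.1
    -- In this rule the bound name has no assignment, so the substitution may be redirected at `x`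
    -- without affecting its typing.
    have hb := ih (hs.congr (τ := Function.update σ x y) fun z hz =>
      (Function.update_of_ne (by rintro rfl; exact hz h₃) _ _).symm)
    rw [Proc.inst1_subst_update P h₁, Proc.inst1_subst_update Q h₂] at hb
    rw [Proc.subst_res, Proc.subst_res]
    exact .res' hy.1.2 hy.2 hΘ hb
  | @rep fl Γ₁ Γ₂ Γ a k P Q T l h₂ h₃ h₄ h₅ h₆ _ h₇ h₈ ih =>
    intro σ Θ hs
    obtain ⟨Θ₁, Θ₂, hΘ, hs₁, hs₂⟩ := hs.split h₈
    obtain ⟨l', e, hn, hl⟩ := exists_fresh_list l (Θ₂.keys ∪ (P.subst σ).fn ∪ (Q.subst σ).fn)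
    simp only [Finset.mem_union, not_or] at hl
    have hΘl : ∀ x ∈ l'.map Prod.fst, Θ₂.lookup x = none := fun x hx =>
      Env.lookup_of_notMem_keys (hl x hx).1.1
    have hlen := length_eq_of_map_snd e
    have hb := ih (hs₂.overwrite e h₅ (fun x hx => Env.not_linearAt_of_lookup (h₆ x hx).2.2) hn hΘl)
    have hmap := map_overwrite σ (xs := l.map Prod.fst) (ys := l'.map Prod.fst) (by simp [hlen]) h₅
    rw [Proc.inst_subst_of P (by simp [h₄]) hmap fun x hx => overwrite_of_notMem fun h =>
        (h₆ x h).1 hx, Proc.inst_subst_of Q (by simp [h₄]) hmap fun x hx =>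
        overwrite_of_notMem fun h => (h₆ x h).2.1 hx] at hb
    rw [Proc.subst_rep, Proc.subst_rep]
    exact .rep (hs₁.hasTy h₂) (e ▸ h₃) (hlen ▸ h₄) hn
      (fun x hx => ⟨(hl x hx).1.2, (hl x hx).2, hΘl x hx⟩) hb (hs₂.unrestricted h₇) hΘ
  | @app fl Γ₁ Γ₂ Γ P Q b T x h₁ h₂ h₃ _ h₄ h₅ ih =>
    intro σ Θ hs
    obtain ⟨Θ₁, Θ₂, hΘ, hs₁, hs₂⟩ := hs.split h₅
    obtain ⟨y, hy⟩ := Infinite.exists_notMem_finset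
      (Θ₁.keys ∪ (P.subst σ).fn ∪ (Q.subst σ).fn)
    simp only [Finset.mem_union, not_or] at hy
    have hΘ₁ := Env.lookup_of_notMem_keys hy.1.1
    have hb := ih (hs₁.update T (Env.not_linearAt_of_lookup h₃) hΘ₁)
    rw [Proc.inst1_subst_update P h₁, Proc.inst1_subst_update Q h₂] at hb
    rw [Proc.subst_app, Proc.subst_app]
    exact .app hy.1.2 hy.2 hΘ₁ hb (hs₂.hasTy h₄) hΘ

/-- Weakening is substitution by the identity. -/
theorem weaken (hS : SubstClosed S) {fl : Bool} {Γ Δ B : Env} {P Q : Proc 0}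
    (h : Clo S fl Γ P Q) (hj : Env.Join Γ B Δ) (hB : B.Unrestricted) : Clo S fl Δ P Q := by
  have := h.subst hS ((Env.isSubst_id Γ).weaken hj hB)
  rwa [Proc.subst_id, Proc.subst_id] at this

/-- The names that instantiate a binder may be replaced by other fresh ones. -/
theorem rename_inst (hS : SubstClosed S) {fl : Bool} {Γ : Env} {k : ℕ} {P Q : Proc (0 + k)}
    {l l' : List (ℕ × Ty 0)}
    (h : Clo S fl (Γ.extend l) (P.inst (l.map Prod.fst)) (Q.inst (l.map Prod.fst)))
    (hk : l.length = k) (hn : (l.map Prod.fst).Nodup)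
    (hl : ∀ x ∈ l.map Prod.fst, x ∉ P.fn ∧ x ∉ Q.fn ∧ Γ.lookup x = none)
    (e : l.map Prod.snd = l'.map Prod.snd) (hn' : (l'.map Prod.fst).Nodup)
    (hl' : ∀ x ∈ l'.map Prod.fst, Γ.lookup x = none) :
    Clo S fl (Γ.extend l') (P.inst (l'.map Prod.fst)) (Q.inst (l'.map Prod.fst)) := by
  have hb := h.subst hS ((Env.isSubst_id Γ).overwrite e hn
    (fun x hx => Env.not_linearAt_of_lookup (hl x hx).2.2) hn' hl')
  have hmap := map_overwrite id (xs := l.map Prod.fst) (ys := l'.map Prod.fst)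
    (by simp [length_eq_of_map_snd e]) hn
  rwa [Proc.inst_subst_of P (by simp [hk]) hmap fun x hx => overwrite_of_notMem fun h =>
    (hl x h).1 hx, Proc.inst_subst_of Q (by simp [hk]) hmap fun x hx =>
    overwrite_of_notMem fun h => (hl x h).2.1 hx, Proc.subst_id, Proc.subst_id] at hb

theorem rename_inst1 (hS : SubstClosed S) {fl : Bool} {Γ : Env} {P Q : Proc 1} {x y : ℕ}
    {T : Ty 0} (h : Clo S fl (Γ.insert x T) (P.inst1 x) (Q.inst1 x)) (hP : x ∉ P.fn)
    (hQ : x ∉ Q.fn) (hx : Γ.lookup x = none) (hy : Γ.lookup y = none) :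
    Clo S fl (Γ.insert y T) (P.inst1 y) (Q.inst1 y) :=
  rename_inst (k := 1) (l := [(x, T)]) (l' := [(y, T)]) hS h rfl (by simp) (by simp [hP, hQ, hx])
    rfl (by simp) (by simp [hy])

theorem inst1_subst (hS : SubstClosed S) {fl : Bool} {Γ₁ Γ₂ Γ : Env} {P Q : Proc 1} {x b : ℕ}
    {T : Ty 0} (h : Clo S fl (Γ₁.insert x T) (P.inst1 x) (Q.inst1 x)) (hP : x ∉ P.fn)
    (hQ : x ∉ Q.fn) (hx : Γ₁.lookup x = none) (hb : Γ₂.HasTy b T) (hj : Env.Join Γ₁ Γ₂ Γ) :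
    Clo S fl Γ (P.inst1 b) (Q.inst1 b) := by
  have hs : Env.IsSubst (Function.update id x b) (Γ₁.insert x T) Γ := by
    refine .cons hx ?_ ((Env.isSubst_id Γ₁).congr fun z hz => ?_) hj.symm
    · rwa [Function.update_self]
    · rw [Function.update_of_ne]
      rintro rfl
      exact hz hx
  have := h.subst hS hs
  rwa [Proc.inst1_subst_update P hP, Proc.inst1_subst_update Q hQ, Proc.subst_id,
    Proc.subst_id] at this

/-- The two typing rules of restriction account for the two states of `y`: still available at the
type `L`, or no longer assigned. -/
theorem res_bind {fl : Bool} {Δ : Env} {P Q : Proc 0} {y : ℕ} {L : Ty 0} (h : Clo S fl Δ P Q)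
    (hy : Δ.lookup y = none ∨ Δ.lookup y = some L) :
    Clo S fl (Δ.erase y) (.res L (P.bind1 y)) (.res L (Q.bind1 y)) := by
  have hf : ∀ R : Proc 0, y ∉ (R.bind1 y).fn := fun R h => (Proc.mem_fn_bind1.1 h).2 rfl
  obtain hy | hy := hy
  · rw [Env.erase_of_lookup hy]
    refine .res' (hf _) (hf _) hy ?_
    rwa [Proc.bind1_inst1_self, Proc.bind1_inst1_self]
  · refine .res (hf _) (hf _) (Finmap.lookup_erase _ _) ?_
    rwa [Proc.bind1_inst1_self, Proc.bind1_inst1_self, Env.insert_erase hy]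

theorem resList {fl : Bool} {Δ : Env} {P Q : Proc 0} {d : List (ℕ × Ty 0)}
    (h : Clo S fl (Δ.extend d) P Q) (hn : (d.map Prod.fst).Nodup)
    (hd : ∀ x ∈ d.map Prod.fst, Δ.lookup x = none) :
    Clo S fl Δ (Proc.resList d P) (Proc.resList d Q) := by
  induction d generalizing Δ with
  | nil => exact h
  | cons p d ih =>
    obtain ⟨x, L⟩ := p
    simp only [List.map_cons, List.nodup_cons, List.mem_cons, forall_eq_or_imp] at hn hd
    rw [Env.extend_cons, ← Env.extend_insert Δ L hn.1] at h
    have := (ih h hn.2 fun y hy => by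
      rw [Env.lookup_insert_eq, if_neg (by rintro rfl; exact hn.1 hy)]
      exact hd.2 y hy).res_bind (L := L) (y := x) (.inr (Finmap.lookup_insert _))
    rw [Env.erase_insert L hd.1] at this
    exact this

theorem lookup_ne_none_left (hS : WellTyped S) {fl : Bool} {Γ : Env} {P Q : Proc 0}
    (h : Clo S fl Γ P Q) : ∀ x ∈ P.fn, Γ.lookup x ≠ none := (h.typed hS).1.lookup_ne_none

theorem lookup_ne_none_right (hS : WellTyped S) {fl : Bool} {Γ : Env} {P Q : Proc 0}
    (h : Clo S fl Γ P Q) : ∀ x ∈ Q.fn, Γ.lookup x ≠ none := (h.typed hS).2.lookup_ne_none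

end Clo

/-! ### Derivatives -/

/-- `Deriv S Γ μ P Q`: the processes `P` and `Q` are related by the contextual closure of `S` under
an environment that remains of `Γ` after the action `μ`. -/
inductive Deriv (S : Env → Proc 0 → Proc 0 → Prop) (Γ : Env) : Act → Proc 0 → Proc 0 → Prop
  | tau {P Q : Proc 0} : Clo S true Γ P Q → Deriv S Γ .tau P Q
  | tauLin {P Q : Proc 0} {a : ℕ} {T U : Ty 0} : Γ.lookup a = some T →
      Ty.Eqv T (.ch .linConn U) → Clo S true (Γ.erase a) P Q → Deriv S Γ .tau P Q
  | inp {P Q : Proc 0} {Γ₁ Γ₂ : Env} {a : ℕ} {c : Cap} {T : Ty 0} {xs : List ℕ}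
      {l : List (ℕ × Ty 0)} : Env.Join Γ₁ Γ₂ Γ → (c = .inp ∨ c = .linInp) →
      Γ₁.HasTy a (.ch c T) → Ty.Carried (l.map Prod.snd) T → xs = l.map Prod.fst →
      Clo S true (Γ₂.extend l) P Q → Deriv S Γ (.inp a xs) P Q
  | out {P Q : Proc 0} {Γ₁ Γ₂ Γ₃ Γ₂₃ : Env} {a : ℕ} {c : Cap} {T : Ty 0} {bs : List ℕ}
      {d l : List (ℕ × Ty 0)} : Env.Join Γ₂ Γ₃ Γ₂₃ → Env.Join Γ₁ Γ₂₃ (Γ.extend d) →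
      (c = .out ∨ c = .linOut) → Γ₁.HasTy a (.ch c T) → Ty.Carried (l.map Prod.snd) T →
      Γ₂.HasTys l → bs = l.map Prod.fst → Clo S true Γ₃ P Q → Deriv S Γ (.out d a bs) P Q

namespace Env

theorem HasTy.erase {Γ : Env} {x y : ℕ} {T : Ty 0} (h : Γ.HasTy x T) (hxy : x ≠ y) :
    HasTy (Γ.erase y) x T := by
  obtain ⟨S, h₁, h₂, h₃⟩ := hasTy_iff.1 h
  refine hasTy_iff.2 ⟨S, ?_, fun z hz hl => h₂ z hz (linearAt_erase.1 hl).2, h₃⟩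
  rwa [lookup_erase_eq, if_neg hxy]

theorem HasTy.not_linearAt {Γ : Env} {x y : ℕ} {T : Ty 0} (h : Γ.HasTy x T) (hxy : x ≠ y) :
    ¬ Γ.LinearAt y := by
  obtain ⟨S, h₁, h₂, h₃⟩ := hasTy_iff.1 h
  exact h₂ y hxy.symm

theorem HasTys.erase {Γ : Env} {l : List (ℕ × Ty 0)} {y : ℕ} (h : Γ.HasTys l)
    (hy : y ∉ l.map Prod.fst) : HasTys (Γ.erase y) l ∧ ¬ Γ.LinearAt y := by
  induction h with
  | nil hu => exact ⟨.nil (hu.erase y), hu y⟩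
  | cons h₁ _ hj ih =>
    simp only [List.map_cons, List.mem_cons, not_or] at hy
    obtain ⟨ih₁, ih₂⟩ := ih hy.2
    exact ⟨.cons (h₁.erase (Ne.symm hy.1)) ih₁ (hj.erase y), fun hl =>
      (hj.linearAt hl).elim (h₁.not_linearAt (Ne.symm hy.1)) ih₂⟩

/-- A part in which `y` is not linear cannot take one end of a linear connection away, so the other
part has the full type of `y` or none. -/
theorem Join.lookup_of_not_linear {A B C : Env} (h : Join A B C) {y : ℕ} {L : Ty 0}
    (hA : ¬ A.LinearAt y) (hC : C.lookup y = none ∨ C.lookup y = some L) :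
    B.lookup y = none ∨ B.lookup y = some L := by
  obtain hC | hC := hC
  · exact .inl (h.lookup_none hC).2
  · have := h y
    rw [hC] at this
    generalize hA' : A.lookup y = a at this
    generalize B.lookup y = b at this
    cases this with
    | left => exact .inl rfl
    | right => exact .inr rfl
    | both h =>
      obtain ⟨-, rfl, rfl⟩ | ⟨hl, -⟩ := h.linConn_or_same
      · exact .inr rfl
      · exact absurd ⟨_, hA', hl⟩ hA

theorem Join.lookup_linConn {A B C : Env} (h : Join A B C) {a : ℕ} {T U : Ty 0}
    (hA : A.lookup a = some T) (hT : Ty.Eqv T (.ch .linConn U)) :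
    B.lookup a = none ∧ C.lookup a = some T := by
  have := h a
  rw [hA] at this
  generalize C.lookup a = c at this
  generalize B.lookup a = b at this
  cases this with
  | left => exact ⟨rfl, rfl⟩
  | both h => exact absurd hT h.left_not_linConn

/-- The types at which a name is used for input and for output in parallel components. -/
theorem Join.communication {A B C : Env} (h : Join A B C) {a : ℕ} {c c' : Cap} {T T' : Ty 0}
    (hc : c = .inp ∨ c = .linInp) (hc' : c' = .out ∨ c' = .linOut)
    (hA : A.HasTy a (.ch c T)) (hB : B.HasTy a (.ch c' T')) :
    Ty.Le T' T ∧ (C.Unrestricted ∨ ∃ V U, C.lookup a = some V ∧ Ty.Eqv V (.ch .linConn U) ∧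
      Unrestricted (C.erase a)) := by
  obtain ⟨W, hW, hWl, hle⟩ := hasTy_iff.1 hA
  obtain ⟨W', hW', hWl', hle'⟩ := hasTy_iff.1 hB
  have hj := h a
  rw [hW, hW'] at hj
  generalize hC : C.lookup a = o at hj
  have hun : Unrestricted (C.erase a) := fun y hy => by
    obtain ⟨hya, hy⟩ := linearAt_erase.1 hy
    exact (h.linearAt hy).elim (hWl y hya) (hWl' y hya)
  cases hj with
  | @both _ _ V hcomb =>
  -- On a linear channel the two object types are equal; proper subtyping between them is possible
  -- only for a non-linear channel.
  have hlin : W.Linear → W'.Linear → Ty.Le T' T ∧ ∃ U, Ty.Eqv V (.ch .linConn U) := by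
    intro hl hl'
    have hclin : c = .linInp := hc.resolve_left fun e => by
      subst e
      exact Ty.not_linear_ch (c := .inp) (fun h => h) T (hle.linear_iff.1 hl)
    have hclin' : c' = .linOut := hc'.resolve_left fun e => by
      subst e
      exact Ty.not_linear_ch (c := .out) (fun h => h) T' (hle'.linear_iff.1 hl')
    subst hclin hclin'
    have e : Ty.Eqv W (.ch .linInp T) := (hle.linear_right (by trivial)).2 (.refl _)
    have e' : Ty.Eqv W' (.ch .linOut T') := (hle'.linear_right (by trivial)).2 (.refl _)
    cases hcomb with
    | inpOut h₁ h₂ h₃ =>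
      exact ⟨.of_eqv ((e'.symm.trans h₂).ch_inj.2.trans (h₁.symm.trans e).ch_inj.2), _, h₃⟩
    | outInp h₁ h₂ h₃ => cases (e.symm.trans h₁).ch_inj.1
    | same hn => exact absurd hl hn
  obtain ⟨hn, rfl, rfl⟩ | ⟨hl, hl', -⟩ := hcomb.linConn_or_same
  · have e : c = .inp := hc.resolve_right fun e => by
      subst e
      exact hn (hle.linear_iff.2 (Ty.linear_ch (by trivial) T))
    have e' : c' = .out := hc'.resolve_right fun e => by
      subst e
      exact hn (hle'.linear_iff.2 (Ty.linear_ch (by trivial) T'))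
    subst e e'
    refine ⟨hle.inp_out hle', .inl fun y hy => ?_⟩
    by_cases hya : y = a
    · subst hya
      obtain ⟨V, hV, hVl⟩ := hy
      rw [hC, Option.some.injEq] at hV
      exact hn (hV ▸ hVl)
    · exact hun y (linearAt_erase.2 ⟨hya, hy⟩)
  · obtain ⟨h₁, U, h₂⟩ := hlin hl hl'
    exact ⟨h₁, .inr ⟨V, U, rfl, h₂, hun⟩⟩

end Env

namespace Deriv

variable {S : Env → Proc 0 → Proc 0 → Prop}

/-- Derivatives are preserved by operations that add an environment. -/
theorem context {Γ Γ₀ Δ : Env} {μ : Act} {P Q : Proc 0} {f g : Proc 0 → Proc 0}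
    (hfg : ∀ Θ Θ' P Q, Clo S true Θ P Q → Env.Join Θ Γ₀ Θ' → Clo S true Θ' (f P) (g Q))
    (h : Deriv S Γ μ P Q) (hj : Env.Join Γ Γ₀ Δ) (hμ : ∀ x ∈ μ.bn, Δ.lookup x = none) :
    Deriv S Δ μ (f P) (g Q) := by
  cases h with
  | tau h => exact .tau (hfg _ _ _ _ h hj)
  | @tauLin P Q a T U h₁ h₂ h₃ =>
    obtain ⟨h₄, h₅⟩ := hj.lookup_linConn h₁ h₂
    refine .tauLin h₅ h₂ (hfg _ _ _ _ h₃ ?_)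
    have := hj.erase a
    rwa [Env.erase_of_lookup h₄] at this
  | inp h₁ h₂ h₃ h₄ h₅ h₆ =>
    obtain ⟨F, hF, hF'⟩ := h₁.assoc hj
    refine .inp hF' h₂ h₃ h₄ h₅ (hfg _ _ _ _ h₆ (hF.extend_left fun x hx => ?_))
    exact (hj.lookup_none (hμ x (by simpa [Act.bn, h₅] using hx))).2
  | @out _ _ _ _ _ _ _ _ _ _ d _ h₁ h₂ h₃ h₄ h₅ h₆ h₇ h₈ =>
    have hj' := hj.extend_left (l := d) fun x hx =>
      (hj.lookup_none (hμ x (by simpa [Act.bn] using hx))).2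
    obtain ⟨F, hF, hF'⟩ := h₂.assoc hj'
    obtain ⟨G, hG, hG'⟩ := h₁.assoc hF
    exact .out hG' hF' h₃ h₄ h₅ h₆ h₇ (hfg _ _ _ _ h₈ hG)

theorem res {Γ : Env} {μ : Act} {P Q : Proc 0} {y : ℕ} {L : Ty 0}
    (h : Deriv S (Γ.insert y L) μ P Q) (hy : Γ.lookup y = none) (hyμ : y ∉ μ.names) :
    Deriv S Γ μ (.res L (P.bind1 y)) (.res L (Q.bind1 y)) := by
  have hyL : Finmap.lookup y (Γ.insert y L) = some L := Finmap.lookup_insert _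
  cases h with
  | tau h =>
    have := h.res_bind (.inr hyL)
    rw [Env.erase_insert L hy] at this
    exact .tau this
  | @tauLin P Q a T U h₁ h₂ h₃ =>
    -- If the linear connection used up by the step is the restricted name itself, the rule
    -- `Clo.res'`, which ignores the name, types what remains, and outside the restriction no name
    -- is lost.
    by_cases hay : a = y
    · subst hay
      have := h₃.res_bind (L := L) (y := a) (.inl (Finmap.lookup_erase _ _))
      rw [Env.erase_insert L hy, Env.erase_of_lookup hy] at this
      exact .tau this
    · rw [Env.lookup_insert_eq, if_neg hay] at h₁
      have := h₃.res_bind (L := L) (y := y) (.inr (by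
        rw [Env.lookup_erase_eq, if_neg (Ne.symm hay), hyL]))
      refine .tauLin h₁ h₂ ?_
      rwa [Finmap.erase_erase, Env.erase_insert L hy] at this
  | @inp P Q Γ₁ Γ₂ a c T xs l h₁ h₂ h₃ h₄ h₅ h₆ =>
    simp only [Act.names, Finset.mem_union, Finset.mem_singleton, List.mem_toFinset,
      not_or] at hyμ
    have hl : y ∉ l.map Prod.fst := h₅ ▸ hyμ.2
    have := h₆.res_bind (L := L) (y := y) (by
      rw [Env.lookup_extend_of_notMem hl]
      exact h₁.lookup_of_not_linear (h₃.not_linearAt (Ne.symm hyμ.1)) (.inr hyL))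
    rw [← Env.extend_erase _ hl] at this
    have hj := h₁.erase y
    rw [Env.erase_insert L hy] at hj
    exact .inp hj h₂ (h₃.erase (Ne.symm hyμ.1)) h₄ h₅ this
  | @out P Q Γ₁ Γ₂ Γ₃ Γ₂₃ a c T bs d l h₁ h₂ h₃ h₄ h₅ h₆ h₇ h₈ =>
    simp only [Act.names, Finset.mem_union, Finset.mem_singleton, List.mem_toFinset,
      not_or] at hyμ
    have hl : y ∉ l.map Prod.fst := h₇ ▸ hyμ.1.2
    obtain ⟨h₆', h₆''⟩ := h₆.erase hl
    rw [Env.extend_insert Γ L hyμ.2] at h₂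
    have := h₈.res_bind (L := L) (y := y) (h₁.lookup_of_not_linear h₆''
      (h₂.lookup_of_not_linear (h₄.not_linearAt (Ne.symm hyμ.1.1)) (.inr (Finmap.lookup_insert _))))
    have hj := h₂.erase y
    rw [Env.erase_insert L (by rwa [Env.lookup_extend_of_notMem hyμ.2])] at hj
    exact .out (h₁.erase y) hj h₃ (h₄.erase (Ne.symm hyμ.1.1)) h₅ h₆' h₇ this

theorem opn {Γ : Env} {P Q : Proc 0} {x a : ℕ} {L : Ty 0} {d : List (ℕ × Ty 0)} {bs : List ℕ}
    (h : Deriv S (Γ.insert x L) (.out d a bs) P Q) (hx : x ∉ d.map Prod.fst) :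
    Deriv S Γ (.out ((x, L) :: d) a bs) P Q := by
  cases h with
  | out h₁ h₂ h₃ h₄ h₅ h₆ h₇ h₈ =>
    rw [Env.extend_insert Γ L hx] at h₂
    exact .out h₁ h₂ h₃ h₄ h₅ h₆ h₇ h₈

/-- Its purpose is to exclude the extrusion of a name whose restriction is typed by the rule that
does not assign it. -/
theorem lookup_of_out {Γ : Env} {P Q : Proc 0} {x a : ℕ} {d : List (ℕ × Ty 0)} {bs : List ℕ}
    (h : Deriv S Γ (.out d a bs) P Q) (hx : x ∉ d.map Prod.fst) (hb : x ∈ bs) :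
    Γ.lookup x ≠ none := by
  cases h with
  | out h₁ h₂ h₃ h₄ h₅ h₆ h₇ h₈ =>
    rw [← Env.lookup_extend_of_notMem hx]
    exact h₂.symm.lookup_ne_none_left (h₁.lookup_ne_none_left (h₆.lookup_ne_none x (h₇ ▸ hb)))

/-- `Join.exchange` collects the two shares of the subject `a` in `H` and all the rest in `K`. The
types sent are below those expected, so the replacement of the received names is a typed
substitution. If `H` is unrestricted, it is restored by weakening; otherwise `a` is a linear
connection, which disappears from the environment. The operation `f` stands for parallel composition
in either order, so that both communication rules are covered. -/
theorem communication (hS : SubstClosed S) {Γ Γ' Δ : Env} {a : ℕ} {xs bs : List ℕ}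
    {d : List (ℕ × Ty 0)} {P Q P' Q' : Proc 0} {f : Proc 0 → Proc 0 → Proc 0}
    (hf : ∀ Θ Θ' Θ'' P Q P' Q', Clo S true Θ P Q → Clo S true Θ' P' Q' → Env.Join Θ Θ' Θ'' →
      Clo S true Θ'' (f P P') (f Q Q'))
    (h : Deriv S Γ (.inp a xs) P Q) (h' : Deriv S Γ' (.out d a bs) P' Q')
    (hj : Env.Join Γ Γ' Δ) (hn : xs.Nodup) (hxs : ∀ x ∈ xs, Δ.lookup x = none)
    (hnd : (d.map Prod.fst).Nodup) (hd : ∀ x ∈ d.map Prod.fst, Δ.lookup x = none)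
    (hlen : xs.length = bs.length) :
    Deriv S Δ .tau (Proc.resList d (f (P.subst (substOf xs bs)) P'))
      (Proc.resList d (f (Q.subst (substOf xs bs)) Q')) := by
  cases h with
  | @inp _ _ Γ₁ Γ₂ _ c T _ l h₁ h₂ h₃ h₄ h₅ h₆ =>
  cases h' with
  | @out _ _ Γ₁' Γ₂' Γ₃' Γ₂₃' _ c' T' _ _ l' k₁ k₂ k₃ k₄ k₅ k₆ k₇ k₈ =>
  subst h₅ k₇
  have hjd : Env.Join Γ (Γ'.extend d) (Δ.extend d) :=
    (hj.symm.extend_left fun x hx => (hj.lookup_none (hd x hx)).1).symm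
  obtain ⟨H, K, hH, hK, hHK⟩ := h₁.exchange k₂ hjd
  obtain ⟨M, hM, hM'⟩ := k₁.assoc' hK
  obtain ⟨hle, hcase⟩ := hH.communication h₂ k₃ h₃ k₄
  have hsub : Env.IsSubst (substOf (l.map Prod.fst) (l'.map Prod.fst)) (Γ₂.extend l) M := by
    refine k₆.isSubst ?_ hn (fun x hx => ?_) hM
    · exact hle.carried k₅ h₄ (by simpa using hlen.symm)
    · exact (h₁.lookup_none (hj.lookup_none (hxs x hx)).1).2
  have hK : Clo S true K _ _ := hf _ _ _ _ _ _ _ (h₆.subst hS hsub) k₈ hM'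
  obtain hun | ⟨V, U, hV, hVU, hun⟩ := hcase
  · exact .tau ((hK.weaken hS hHK.symm hun).resList hnd hd)
  · obtain ⟨h₅, h₆⟩ := hHK.lookup_linConn hV hVU
    -- The subject is assigned in `Δ` while the extruded names are not, so erasing the subject does
    -- not interfere with the restrictions.
    have ha : a ∉ d.map Prod.fst := fun ha =>
      hj.lookup_ne_none_left (h₁.lookup_ne_none_left h₃.lookup_ne_none) (hd a ha)
    have hHK' := hHK.erase a
    rw [Env.erase_of_lookup h₅, ← Env.extend_erase _ ha] at hHK'
    rw [Env.lookup_extend_of_notMem ha] at h₆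
    refine .tauLin h₆ hVU ((hK.weaken hS hHK'.symm hun).resList hnd fun x hx => ?_)
    rw [Env.lookup_erase_eq, hd x hx, ite_self]

end Deriv

/-! ### Transitions of related processes -/


/-! ## Renaming of transitions -/

theorem substOf_map {xs bs : List ℕ} (hl : xs.length = bs.length) {f : ℕ → ℕ}
    (hf : Function.Injective f) (g : ℕ → ℕ) (z : ℕ) :
    substOf (xs.map f) (bs.map g) (f z) = if z ∈ xs then g (substOf xs bs z) else f z := by
  induction xs generalizing bs with
  | nil => simp [substOf]
  | cons x xs ih =>
    obtain _ | ⟨b, bs⟩ := bs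
    · simp at hl
    simp only [List.length_cons, Nat.add_right_cancel_iff] at hl
    rw [← overwrite_id, ← overwrite_id, List.map_cons, List.map_cons, overwrite_cons,
      overwrite_cons]
    by_cases hz : z = x
    · simp [hz]
    · rw [Function.update_of_ne fun e => hz (hf e), Function.update_of_ne hz, overwrite_id,
        overwrite_id, ih hl]
      simp [hz]

/-- The receiver is renamed by `f` and the sender by `g`; the two need to agree only on the free
names that are not replaced by the communication. -/
theorem Proc.subst_substOf {n : ℕ} (P : Proc n) {xs bs : List ℕ} (hl : xs.length = bs.length)
    {f g : ℕ → ℕ} (hf : Function.Injective f) (h : ∀ z ∈ P.fn, z ∉ xs → g z = f z) :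
    (P.subst (substOf xs bs)).subst g = (P.subst f).subst (substOf (xs.map f) (bs.map g)) := by
  rw [Proc.subst_subst, Proc.subst_subst]
  refine Proc.subst_congr P fun z hz => ?_
  simp only [Function.comp]
  rw [substOf_map hl hf]
  split_ifs with hx
  · rfl
  · rw [substOf, if_neg hx, h z hz hx]

theorem Proc.mem_fn_subst_perm {n : ℕ} {P : Proc n} {π : Equiv.Perm ℕ} {x : ℕ} :
    π x ∈ (P.subst π).fn ↔ x ∈ P.fn := by
  rw [Proc.mem_fn_subst]
  constructor
  · rintro ⟨y, hy, e⟩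
    rwa [← π.injective e]
  · exact fun h => ⟨x, h, rfl⟩

theorem disjoint_bn_rename {n : ℕ} {P : Proc n} {μ : Act} {π : Equiv.Perm ℕ}
    (h : Disjoint μ.bn P.fn) : Disjoint (μ.rename π).bn (P.subst π).fn := by
  rw [Act.bn_rename, Finset.disjoint_left]
  intro x hx
  obtain ⟨y, hy, rfl⟩ := Finset.mem_image.1 hx
  rw [Proc.mem_fn_subst_perm]
  exact Finset.disjoint_left.1 h hy

theorem mem_names_rename {π : Equiv.Perm ℕ} {μ : Act} {x : ℕ} :
    π x ∈ (μ.rename π).names ↔ x ∈ μ.names := by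
  rw [Act.names_rename]
  exact π.injective.mem_finset_image

theorem map_fst_rename (π : ℕ → ℕ) (d : List (ℕ × Ty 0)) :
    (d.map fun p => (π p.1, p.2)).map Prod.fst = (d.map Prod.fst).map π := by
  simp [Function.comp_def]

/-- Transitions are equivariant. Permutations are used, not arbitrary substitutions, because they
preserve and reflect the freshness conditions of all rules. -/
theorem Step.rename {P P' : Proc 0} {μ : Act} (h : Step P μ P') (π : Equiv.Perm ℕ) :
    Step (P.subst π) (μ.rename π) (P'.subst π) := by
  induction h with
  | @inp a k P xs hl hn hx =>
    rw [Proc.subst_inp, Proc.inst_subst P hl]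
    refine .inp (by simpa using hl) (hn.map π.injective) fun y hy => ?_
    obtain ⟨x, hxx, rfl⟩ := List.mem_map.1 hy
    have := hx x hxx
    rwa [← Proc.mem_fn_subst_perm (π := π), Proc.subst_inp] at this
  | @rep a k P xs hl hn hx =>
    rw [Proc.subst_par, Proc.subst_rep, Proc.inst_subst P hl]
    refine .rep (by simpa using hl) (hn.map π.injective) fun y hy => ?_
    obtain ⟨x, hxx, rfl⟩ := List.mem_map.1 hy
    have := hx x hxx
    rwa [← Proc.mem_fn_subst_perm (π := π), Proc.subst_rep] at this
  | @out a bs =>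
    rw [Proc.subst_out_fr]
    exact .out
  | parL _ hd ih => exact .parL ih (disjoint_bn_rename hd)
  | parR _ hd ih => exact .parR ih (disjoint_bn_rename hd)
  | @comL P P' Q Q' a xs bs d _ _ hl hd ih₁ ih₂ =>
    rw [Proc.resList_subst_of _ _ π.injective fun _ _ _ => rfl, Proc.subst_par, Proc.subst_par,
      Proc.subst_substOf _ hl π.injective fun _ _ _ => rfl]
    refine .comL ih₁ ih₂ (by simpa using hl) ?_
    exact disjoint_bn_rename (μ := .out d a bs) hd
  | @comR P P' Q Q' a xs bs d _ _ hl hd ih₁ ih₂ =>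
    rw [Proc.resList_subst_of _ _ π.injective fun _ _ _ => rfl, Proc.subst_par, Proc.subst_par,
      Proc.subst_substOf _ hl π.injective fun _ _ _ => rfl]
    refine .comR ih₁ ih₂ (by simpa using hl) ?_
    exact disjoint_bn_rename (μ := .out d a bs) hd
  | @res L P P' μ x hx hμ _ ih =>
    rw [Proc.subst_res, Proc.subst_res, Proc.bind1_subst_of (τ := π) P' rfl (fun _ _ _ => rfl)
      fun z _ hzx e => hzx (π.injective e)]
    rw [Proc.inst1_subst_of P rfl fun _ _ => rfl] at ih
    exact .res (by rwa [Proc.mem_fn_subst_perm]) (by rwa [mem_names_rename]) ih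
  | @opn L P P' d a bs x hx hb hxd hax _ ih =>
    rw [Proc.subst_res]
    rw [Proc.inst1_subst_of P rfl fun _ _ => rfl] at ih
    refine .opn (by rwa [Proc.mem_fn_subst_perm]) (List.mem_map_of_mem hb) ?_
      (fun e => hax (π.injective e)) ih
    rw [map_fst_rename, List.mem_map_of_injective π.injective]
    exact hxd
  | @app P b μ P' _ ih =>
    rw [Proc.subst_app]
    rw [Proc.inst1_subst_of P rfl fun _ _ => rfl] at ih
    exact .app ih

/-- The subject of a transition is not one of its bound names, which are distinct. -/
theorem Step.subject_bn {P P' : Proc 0} {μ : Act} (h : Step P μ P') :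
    (∀ a xs, μ = .inp a xs → a ∉ xs ∧ xs.Nodup) ∧
      ∀ d a bs, μ = .out d a bs → a ∉ d.map Prod.fst ∧ (d.map Prod.fst).Nodup := by
  induction h with
  | inp hl hn hx | rep hl hn hx =>
    refine ⟨?_, by simp⟩
    rintro a xs ⟨⟩
    exact ⟨fun h => hx _ h (by simp [Proc.fn, Nm.fn]), hn⟩
  | out =>
    refine ⟨by simp, ?_⟩
    rintro d a bs ⟨⟩
    simp
  | parL _ _ ih | parR _ _ ih | res _ _ _ ih | app _ ih => exact ih
  | comL | comR => simp
  | @opn L P P' d a bs x hx hxb hxd hax h ih =>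
    refine ⟨by simp, ?_⟩
    rintro d' a' bs' ⟨⟩
    obtain ⟨h₁, h₂⟩ := ih.2 d a bs rfl
    simp only [List.map_cons, List.mem_cons, List.nodup_cons, not_or]
    exact ⟨⟨hax, h₁⟩, hxd, h₂⟩

/-- The bound names of a transition may be replaced by fresh ones. -/
theorem Step.refresh {P P' : Proc 0} {μ : Act} (h : Step P μ P') (F : Finset ℕ) :
    ∃ τ : Equiv.Perm ℕ, (∀ x ∈ μ.bn, τ x ∉ F) ∧ (∀ z ∈ F, z ∉ μ.bn → τ z = z) ∧
      Step P (μ.rename τ) (P'.subst τ) := by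
  induction h generalizing F with
  | @inp a k P xs hl hn hx =>
    obtain ⟨τ, h₁, h₂⟩ := exists_perm_avoid 1 xs.toFinset (F ∪ (Proc.inp (.fr a) k P).fn)
    simp only [Finset.mem_union, not_or, List.mem_toFinset] at h₁ h₂
    refine ⟨τ, fun x hx => (h₁ x (by simpa [Act.bn] using hx)).1,
      fun z hz hzx => h₂ z (.inl hz) (by simpa [Act.bn] using hzx), ?_⟩
    have ha : τ a = a := h₂ a (.inr (by simp [Proc.fn, Nm.fn])) fun h =>
      hx a h (by simp [Proc.fn, Nm.fn])
    have hP : P.subst τ = P := Proc.subst_of_fixed P fun z hz =>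
      h₂ z (.inr (by simp [Proc.fn, hz])) fun h => hx z h (by simp [Proc.fn, hz])
    rw [Proc.inst_subst P hl, hP, Act.rename, ha]
    refine .inp (by simpa using hl) (hn.map τ.injective) fun y hy => ?_
    obtain ⟨x, hxx, rfl⟩ := List.mem_map.1 hy
    exact (h₁ x hxx).2
  | @rep a k P xs hl hn hx =>
    obtain ⟨τ, h₁, h₂⟩ := exists_perm_avoid 1 xs.toFinset (F ∪ (Proc.rep (.fr a) k P).fn)
    simp only [Finset.mem_union, not_or, List.mem_toFinset] at h₁ h₂
    refine ⟨τ, fun x hx => (h₁ x (by simpa [Act.bn] using hx)).1,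
      fun z hz hzx => h₂ z (.inl hz) (by simpa [Act.bn] using hzx), ?_⟩
    have ha : τ a = a := h₂ a (.inr (by simp [Proc.fn, Nm.fn])) fun h =>
      hx a h (by simp [Proc.fn, Nm.fn])
    have hP : P.subst τ = P := Proc.subst_of_fixed P fun z hz =>
      h₂ z (.inr (by simp [Proc.fn, hz])) fun h => hx z h (by simp [Proc.fn, hz])
    rw [Proc.subst_par, Proc.subst_rep, Proc.inst_subst P hl, hP, Act.rename, ha, Nm.subst, ha]
    refine .rep (by simpa using hl) (hn.map τ.injective) fun y hy => ?_
    obtain ⟨x, hxx, rfl⟩ := List.mem_map.1 hy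
    exact (h₁ x hxx).2
  | out =>
    refine ⟨1, by simp [Act.bn], by simp, ?_⟩
    rw [Equiv.Perm.coe_one, Act.rename_id, Proc.subst_id]
    exact .out
  | @parL P P' Q μ _ hd ih =>
    obtain ⟨τ, h₁, h₂, h₃⟩ := ih (F ∪ Q.fn)
    simp only [Finset.mem_union, not_or] at h₁ h₂
    refine ⟨τ, fun x hx => (h₁ x hx).1, fun z hz => h₂ z (.inl hz), ?_⟩
    rw [Proc.subst_par, Proc.subst_of_fixed Q fun z hz => h₂ z (.inr hz) fun h =>
      Finset.disjoint_left.1 hd h hz]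
    refine .parL h₃ ?_
    rw [Act.bn_rename, Finset.disjoint_left]
    intro y hy
    obtain ⟨x, hx, rfl⟩ := Finset.mem_image.1 hy
    exact (h₁ x hx).2
  | @parR P Q Q' μ _ hd ih =>
    obtain ⟨τ, h₁, h₂, h₃⟩ := ih (F ∪ P.fn)
    simp only [Finset.mem_union, not_or] at h₁ h₂
    refine ⟨τ, fun x hx => (h₁ x hx).1, fun z hz => h₂ z (.inl hz), ?_⟩
    rw [Proc.subst_par, Proc.subst_of_fixed P fun z hz => h₂ z (.inr hz) fun h =>
      Finset.disjoint_left.1 hd h hz]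
    refine .parR h₃ ?_
    rw [Act.bn_rename, Finset.disjoint_left]
    intro y hy
    obtain ⟨x, hx, rfl⟩ := Finset.mem_image.1 hy
    exact (h₁ x hx).2
  | comL h₁ h₂ hl hd =>
    refine ⟨1, by simp [Act.bn], by simp, ?_⟩
    rw [Equiv.Perm.coe_one, Act.rename_id, Proc.subst_id]
    exact .comL h₁ h₂ hl hd
  | comR h₁ h₂ hl hd =>
    refine ⟨1, by simp [Act.bn], by simp, ?_⟩
    rw [Equiv.Perm.coe_one, Act.rename_id, Proc.subst_id]
    exact .comR h₁ h₂ hl hd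
  | @res L P P' μ x hx hμ _ ih =>
    obtain ⟨τ, h₁, h₂, h₃⟩ := ih (insert x F)
    have hτ : τ x = x := h₂ x (Finset.mem_insert_self _ _) fun h => hμ (μ.bn_subset_names h)
    refine ⟨τ, fun y hy h => h₁ y hy (Finset.mem_insert_of_mem h),
      fun z hz => h₂ z (Finset.mem_insert_of_mem hz), ?_⟩
    rw [Proc.subst_res, Proc.bind1_subst_of (τ := τ) P' hτ (fun _ _ _ => rfl)
      fun z _ hzx e => hzx (τ.injective (e.trans hτ.symm))]
    refine .res hx ?_ h₃
    rw [← mem_names_rename (π := τ), hτ] at hμ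
    exact hμ
  | @opn L P P' d a bs x hx hxb hxd hax h ih =>
    obtain ⟨τ, h₁, h₂, h₃⟩ := ih (insert x (insert a F) ∪ P.fn)
    -- The names extruded earlier are refreshed by `τ`, and `x` is then exchanged with a new name
    -- `y`. As `y` is fresh for `P` and differs from the refreshed names, the transposition leaves
    -- both unchanged.
    obtain ⟨y, hy⟩ := Infinite.exists_notMem_finset
      (insert x (insert a F) ∪ P.fn ∪ F.image τ ∪ (d.map Prod.fst).toFinset.image τ)
    simp only [Finset.mem_union, Finset.mem_insert, Finset.mem_image, not_or, not_exists, not_and,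
      List.mem_toFinset] at hy h₁ h₂
    have had := (h.subject_bn.2 d a bs rfl).1
    have hτx : τ x = x := h₂ x (by simp) (by simpa [Act.bn] using hxd)
    have hτa : τ a = a := h₂ a (by simp) (by simpa [Act.bn] using had)
    have hP : P.subst (Equiv.swap x y) = P := Proc.subst_of_fixed P fun z hz =>
      Equiv.swap_apply_of_ne_of_ne (by rintro rfl; exact hx hz) (by rintro rfl; exact hy.1.1.2 hz)
    have h₄ := h₃.rename (Equiv.swap x y)
    rw [Proc.inst1_subst_of P (Equiv.swap_apply_left x y) (fun _ _ => rfl), hP,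
      Proc.subst_subst] at h₄
    have hd : ∀ z ∈ d.map Prod.fst, Equiv.swap x y (τ z) = τ z := by
      intro z hz
      refine Equiv.swap_apply_of_ne_of_ne (fun e => hxd ?_) fun e => hy.2 z hz e
      rwa [← τ.injective (e.trans hτx.symm)]
    refine ⟨Equiv.swap x y * τ, ?_, ?_, ?_⟩
    · intro z hz
      simp only [Act.bn, List.map_cons, List.toFinset_cons, Finset.mem_insert,
        List.mem_toFinset] at hz
      rw [Equiv.Perm.mul_apply]
      obtain rfl | hz := hz
      · rw [hτx, Equiv.swap_apply_left]
        exact fun h => hy.1.1.1.2.2 h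
      · rw [hd z hz]
        exact fun h => h₁ z (by simpa [Act.bn] using hz) |>.1.2.2 h
    · intro z hz hzn
      simp only [Act.bn, List.map_cons, List.toFinset_cons, Finset.mem_insert,
        List.mem_toFinset, not_or] at hzn
      have hτz := h₂ z (by simp [hz]) (by simpa [Act.bn] using hzn.2)
      rw [Equiv.Perm.mul_apply, hτz]
      refine Equiv.swap_apply_of_ne_of_ne hzn.1 ?_
      rintro rfl
      exact hy.1.1.1.2.2 hz
    · have e₁ : (Equiv.swap x y * τ) x = y := by
        rw [Equiv.Perm.mul_apply, hτx, Equiv.swap_apply_left]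
      have e₂ : (Equiv.swap x y * τ) a = a := by
        rw [Equiv.Perm.mul_apply, hτa]
        exact Equiv.swap_apply_of_ne_of_ne hax fun e => hy.1.1.1.2.1 e.symm
      have e₃ : Equiv.swap x y (τ a) = a := e₂
      simp only [Act.rename, List.map_map, e₃, Function.comp_def] at h₄
      simp only [Act.rename, List.map_cons, e₁, e₂]
      refine .opn hy.1.1.2 ?_ ?_ (fun e => hy.1.1.1.2.1 e.symm) h₄
      · exact List.mem_map.2 ⟨x, hxb, e₁⟩
      · simp only [List.mem_map, not_exists, not_and, Prod.exists, Prod.mk.injEq,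
          Equiv.Perm.mul_apply, forall_exists_index, and_imp]
        rintro z T w T' hw hz - rfl
        have hw' : w ∈ d.map Prod.fst := List.mem_map_of_mem hw
        rw [hd w hw'] at hz
        exact hy.2 w hw' hz
  | @app P b μ P' _ ih =>
    obtain ⟨τ, h₁, h₂, h₃⟩ := ih F
    exact ⟨τ, h₁, h₂, .app h₃⟩

/-! ### Matching transitions of processes with guarded related leaves -/

/-- Size of processes. -/
def Proc.size : {n : ℕ} → Proc n → ℕ
  | _, .nil => 0
  | _, .wrong => 0
  | _, .inp _ _ P => P.size + 1
  | _, .out _ _ => 0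
  | _, .par P Q => P.size + Q.size + 1
  | _, .res _ P => P.size + 1
  | _, .rep _ _ P => P.size + 1
  | _, .app P _ => P.size + 1

theorem Proc.size_map {n m : ℕ} (P : Proc n) (f : Nm n → Nm m) : (P.map f).size = P.size := by
  induction P generalizing m <;> simp_all [Proc.map, Proc.size]

namespace Clo

variable {S : Env → Proc 0 → Proc 0 → Prop}

theorem disjoint_of_fresh (hS : WellTyped S) {fl : Bool} {Γ Δ Θ : Env} {P Q : Proc 0}
    (h : Clo S fl Γ P Q) (hj : Env.Join Γ Δ Θ) {s : Finset ℕ} (hs : ∀ x ∈ s, Θ.lookup x = none) :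
    Disjoint s Q.fn :=
  Finset.disjoint_left.2 fun x hx hQ =>
    h.lookup_ne_none_right hS x hQ (hj.lookup_none (hs x hx)).1

/-- The equality behind communications whose bound names are refreshed. -/
theorem resList_refresh {P P' Q' : Proc 0} {a : ℕ} {xs bs : List ℕ} {d : List (ℕ × Ty 0)}
    (hP : Step P (.inp a xs) P') (hl : xs.length = bs.length)
    (hd : Disjoint (d.map Prod.fst).toFinset P.fn) {F : Finset ℕ} {τ τ' : Equiv.Perm ℕ}
    (hτ : ∀ z ∈ F, z ∉ xs → τ z = z) (hτ' : ∀ z ∈ F, z ∉ d.map Prod.fst → τ' z = z)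
    (hF : P'.fn ∪ (P'.subst (substOf xs bs)).fn ∪ Q'.fn ⊆ F)
    {f : Proc 0 → Proc 0 → Proc 0} (hf : ∀ A B, (f A B).fn ⊆ A.fn ∪ B.fn)
    (hfs : ∀ A B (σ : ℕ → ℕ), (f A B).subst σ = f (A.subst σ) (B.subst σ)) :
    Proc.resList d (f (P'.subst (substOf xs bs)) Q') =
      Proc.resList (d.map fun p => (τ' p.1, p.2))
        (f ((P'.subst τ).subst (substOf (xs.map τ) (bs.map τ'))) (Q'.subst τ')) := by
  -- Apart from the input names, the free names of `P'` are free in `P`, hence not extruded by the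
  -- partner; so both refreshings fix them.
  have h₁ : ∀ z ∈ P'.fn, z ∉ xs → τ' z = τ z := by
    intro z hz hzx
    have hzF : z ∈ F := hF (by simp [hz])
    rw [hτ z hzF hzx]
    refine hτ' z hzF fun hzd => ?_
    have := hP.fn_subset.1 hz
    simp only [Act.bn, Finset.mem_union, List.mem_toFinset] at this
    exact Finset.disjoint_left.1 hd (List.mem_toFinset.2 hzd) (this.resolve_right hzx)
  rw [← Proc.subst_substOf P' hl τ.injective h₁, ← hfs, ← Proc.resList_subst_of (σ := id) _ _
    τ'.injective, Proc.subst_id]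
  intro z hz hzd
  refine hτ' z (hF ?_) hzd
  have := hf _ _ hz
  rw [Finset.mem_union] at this ⊢
  exact this.imp_left fun h => Finset.mem_union_right _ h

/-- Both components of a communication, with fresh bound names. -/
theorem communication_step (hS : WellTyped S) (hS' : SubstClosed S) {Γ Γ' Δ : Env}
    {P P' Q Q' R R' : Proc 0} {a : ℕ} {xs bs : List ℕ} {d : List (ℕ × Ty 0)}
    (hP : Step P (.inp a xs) P') (hQ : Step Q (.out d a bs) Q') (hl : xs.length = bs.length)
    (hd : Disjoint (d.map Prod.fst).toFinset P.fn)
    (hR : Clo S false Γ P R) (hj : Env.Join Γ Γ' Δ)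
    (ihP : ∀ {μ : Act} {P' : Proc 0}, Step P μ P' → (∀ x ∈ μ.bn, Γ.lookup x = none) →
      ∃ R₁, Step R μ R₁ ∧ Deriv S Γ μ P' R₁)
    (ihQ : ∀ {μ : Act} {Q' : Proc 0}, Step Q μ Q' → (∀ x ∈ μ.bn, Γ'.lookup x = none) →
      ∃ R₁, Step R' μ R₁ ∧ Deriv S Γ' μ Q' R₁)
    {f : Proc 0 → Proc 0 → Proc 0} (hf : ∀ A B, (f A B).fn ⊆ A.fn ∪ B.fn)
    (hfs : ∀ A B (σ : ℕ → ℕ), (f A B).subst σ = f (A.subst σ) (B.subst σ))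
    (hfc : ∀ Θ Θ' Θ'' P Q P' Q', Clo S true Θ P Q → Clo S true Θ' P' Q' → Env.Join Θ Θ' Θ'' →
      Clo S true Θ'' (f P P') (f Q Q')) :
    ∃ (xs' bs' : List ℕ) (d' : List (ℕ × Ty 0)) (R₁ R₁' : Proc 0),
      Step R (.inp a xs') R₁ ∧ Step R' (.out d' a bs') R₁' ∧ xs'.length = bs'.length ∧
      Disjoint (d'.map Prod.fst).toFinset R.fn ∧
      Deriv S Δ .tau (Proc.resList d (f (P'.subst (substOf xs bs)) Q'))
        (Proc.resList d' (f (R₁.subst (substOf xs' bs')) R₁')) := by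
  -- The refreshed names must be new for `Δ`, so that the induction hypotheses apply, and new for
  -- the derivatives, so that the result is the same up to α-conversion. The subject `a` belongs to
  -- `F` in order to be fixed.
  let F := P'.fn ∪ (P'.subst (substOf xs bs)).fn ∪ Q'.fn ∪ insert a Δ.keys
  obtain ⟨τ, h₁, h₂, h₃⟩ := hP.refresh F
  obtain ⟨τ', k₁, k₂, k₃⟩ := hQ.refresh F
  have haF : a ∈ F := by simp [F]
  have hax := hP.subject_bn.1 a xs rfl
  have had := hQ.subject_bn.2 d a bs rfl
  simp only [Act.bn, List.mem_toFinset] at h₁ h₂ k₁ k₂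
  rw [Act.rename, h₂ a haF hax.1] at h₃
  rw [Act.rename, k₂ a haF had.1] at k₃
  have hxs : ∀ x ∈ xs.map τ, Δ.lookup x = none := by
    intro y hy
    obtain ⟨x, hx, rfl⟩ := List.mem_map.1 hy
    have := h₁ x hx
    simp only [F, Finset.mem_union, Finset.mem_insert, not_or] at this
    exact Env.lookup_of_notMem_keys this.2.2
  have hds : ∀ x ∈ (d.map fun p => (τ' p.1, p.2)).map Prod.fst, Δ.lookup x = none := by
    intro y hy
    rw [map_fst_rename] at hy
    obtain ⟨x, hx, rfl⟩ := List.mem_map.1 hy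
    have := k₁ x hx
    simp only [F, Finset.mem_union, Finset.mem_insert, not_or] at this
    exact Env.lookup_of_notMem_keys this.2.2
  obtain ⟨R₁, hR₁, hD₁⟩ := ihP h₃ fun x hx => (hj.lookup_none (hxs x (by
    simpa only [Act.bn, List.mem_toFinset] using hx))).1
  obtain ⟨R₁', hR₁', hD₁'⟩ := ihQ k₃ fun x hx => (hj.lookup_none (hds x (by
    simpa only [Act.bn, List.mem_toFinset] using hx))).2
  refine ⟨_, _, _, R₁, R₁', hR₁, hR₁', by simpa using hl, ?_, ?_⟩
  · exact hR.disjoint_of_fresh hS hj fun x hx => hds x (List.mem_toFinset.1 hx)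
  · rw [resList_refresh (Q' := Q') hP hl hd h₂ k₂ Finset.subset_union_left hf hfs]
    refine Deriv.communication hS' hfc hD₁ hD₁' hj (hax.2.map τ.injective) hxs ?_ hds
      (by simpa using hl)
    rw [map_fst_rename]
    exact had.2.map τ'.injective

/-- The name `x` is not assigned, so a substitution that moves only `x` is the identity as far as
typing is concerned. -/
theorem rename_free (hS' : SubstClosed S) {fl : Bool} {Γ : Env} {P Q : Proc 1} {x : ℕ}
    (h : Clo S fl Γ (P.inst1 x) (Q.inst1 x)) (hP : x ∉ P.fn) (hQ : x ∉ Q.fn)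
    (hx : Γ.lookup x = none) {y : ℕ} : Clo S fl Γ (P.inst1 y) (Q.inst1 y) := by
  have := h.subst hS' ((Env.isSubst_id Γ).congr (τ := Function.update id x y) fun z hz => by
    rw [Function.update_of_ne]
    rintro rfl
    exact hz hx)
  rwa [Proc.inst1_subst_update P hP, Proc.inst1_subst_update Q hQ, Proc.subst_id,
    Proc.subst_id] at this

end Clo

/-- Counterpart of `Deriv.res` for restrictions whose name is not assigned: it stays unassigned
after the action. -/
theorem Deriv.res' {S : Env → Proc 0 → Proc 0 → Prop} {Γ : Env} {μ : Act} {P Q : Proc 0} {y : ℕ}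
    {L : Ty 0} (h : Deriv S Γ μ P Q) (hy : Γ.lookup y = none) (hyμ : y ∉ μ.names) :
    Deriv S Γ μ (.res L (P.bind1 y)) (.res L (Q.bind1 y)) := by
  have key : ∀ Θ : Env, Clo S true Θ P Q → Θ.lookup y = none →
      Clo S true Θ (.res L (P.bind1 y)) (.res L (Q.bind1 y)) := fun Θ h hΘ => by
    have := h.res_bind (L := L) (.inl hΘ)
    rwa [Env.erase_of_lookup hΘ] at this
  cases h with
  | tau h => exact .tau (key _ h hy)
  | tauLin h₁ h₂ h₃ =>
    exact .tauLin h₁ h₂ (key _ h₃ (by rw [Env.lookup_erase_eq, hy, ite_self]))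
  | inp h₁ h₂ h₃ h₄ h₅ h₆ =>
    simp only [Act.names, Finset.mem_union, List.mem_toFinset, not_or] at hyμ
    refine .inp h₁ h₂ h₃ h₄ h₅ (key _ h₆ ?_)
    rw [Env.lookup_extend_of_notMem (h₅ ▸ hyμ.2)]
    exact (h₁.lookup_none hy).2
  | out h₁ h₂ h₃ h₄ h₅ h₆ h₇ h₈ =>
    simp only [Act.names, Finset.mem_union, List.mem_toFinset, not_or] at hyμ
    refine .out h₁ h₂ h₃ h₄ h₅ h₆ h₇ (key _ h₈ (h₁.lookup_none (h₂.lookup_none ?_).2).2)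
    rwa [Env.lookup_extend_of_notMem hyμ.2]

namespace Clo

/-- Related processes have the same transitions, and their derivatives are related. -/
theorem step (hS : WellTyped S) (hS' : SubstClosed S) (n : ℕ) :
    ∀ {P P' Q : Proc 0} {μ : Act} {Γ : Env}, P.size = n → Step P μ P' → Clo S false Γ P Q →
      (∀ x ∈ μ.bn, Γ.lookup x = none) → ∃ Q', Step Q μ Q' ∧ Deriv S Γ μ P' Q' := by
  -- Bodies of binders are instantiated and their transitions renamed before the induction
  -- hypothesis is used. Size is invariant under this, whereas derivations are replaced by others.
  induction n using Nat.strong_induction_on with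
  | _ n ih =>
  intro P P' Q μ Γ hn h hC hμ
  have hfresh := fun x (hx : x ∈ μ.bn) (hQ : x ∈ Q.fn) =>
    hC.lookup_ne_none_right hS x hQ (hμ x hx)
  cases h with
  | @inp a k P xs hl hxn hx =>
    simp only [Act.bn, List.mem_toFinset] at hμ hfresh
    -- The flag `false` rules out a leaf, so `Q` has the outermost constructor of `P`. The same
    -- happens in all cases below.
    cases hC with
    | @inp _ Γ₁ Γ₂ _ _ _ _ Q c T l h₁ h₂ h₃ h₄ h₅ h₆ h₇ h₈ =>
    obtain ⟨l', rfl, e⟩ := exists_list_of_map_snd (l := l) (ys := xs) (by rw [hl, h₄])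
    refine ⟨Q.inst (l'.map Prod.fst), .inp hl hxn fun x hx hQ => hfresh x hx hQ, ?_⟩
    exact .inp h₈ h₁ h₂ (e ▸ h₃) rfl (h₇.rename_inst hS' h₄ h₅ h₆ e hxn fun x hx =>
      (h₈.lookup_none (hμ x hx)).2)
  | @rep a k P xs hl hxn hx =>
    simp only [Act.bn, List.mem_toFinset] at hμ hfresh
    have hC' := hC.to_true
    cases hC with
    | @rep _ Γ₁ Γ₂ _ _ _ _ Q T l h₂ h₃ h₄ h₅ h₆ h₇ h₉ h₈ =>
    obtain ⟨l', rfl, e⟩ := exists_list_of_map_snd (l := l) (ys := xs) (by rw [hl, h₄])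
    refine ⟨_, .rep hl hxn fun x hx hQ => hfresh x hx hQ, ?_⟩
    -- Neither the subject nor the body of a replication owns a linear name, so the whole of `Γ`
    -- remains available to the copy that stays.
    have hun : Γ₁.Unrestricted := h₂.unrestricted (Ty.not_linear_ch (c := .inp) (fun h => h) T)
    have hb := h₇.rename_inst hS' h₄ h₅ h₆ e hxn fun x hx => (h₈.lookup_none (hμ x hx)).2
    exact .inp (h₈.absorb hun h₉) (.inl rfl) h₂ (e ▸ h₃) rfl
      (.par hb hC' ((h₈.symm.absorb h₉ hun).extend_left hμ))
  | @out a bs =>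
    generalize hbs : bs.map Nm.fr = bs' at hC
    cases hC with
    | @out _ Γ₁ Γ₂ _ _ c T l _ h₁ h₂ h₃ h₄ h₅ h₆ =>
    have hb : bs = l.map Prod.fst := by
      refine List.map_injective_iff.2 (fun x y (e : (Nm.fr x : Nm 0) = Nm.fr y) => ?_)
        (hbs.trans h₆)
      exact Nm.fr.inj e
    subst hbs
    -- An asynchronous output has no continuation: everything besides the subject goes to the
    -- objects, and the empty environment remains.
    exact ⟨_, .out, .out (Env.join_empty_left Γ₂).symm h₅ h₁ h₂ h₃ h₄ hb
      (.nil Env.unrestricted_empty)⟩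
  | @parL P P' Q μ h hd =>
    cases hC with
    | @par _ Γ₁ Γ₂ _ _ _ R R' h₁ h₂ hj =>
    obtain ⟨R₁, hR, hD⟩ := ih _ (by simp only [← hn, Proc.size]; omega) rfl h h₁ fun x hx =>
      (hj.lookup_none (hμ x hx)).1
    exact ⟨_, .parL hR (h₂.disjoint_of_fresh hS hj.symm hμ), hD.context
      (f := fun X => .par X Q) (g := fun X => .par X R')
      (fun Θ Θ' A B hA hj' => .par hA h₂.to_true hj') hj hμ⟩
  | @parR P Q Q' μ h hd =>
    cases hC with
    | @par _ Γ₁ Γ₂ _ _ _ R R' h₁ h₂ hj =>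
    obtain ⟨R₁, hR, hD⟩ := ih _ (by simp only [← hn, Proc.size]; omega) rfl h h₂ fun x hx =>
      (hj.lookup_none (hμ x hx)).2
    exact ⟨_, .parR hR (h₁.disjoint_of_fresh hS hj hμ), hD.context
      (f := fun X => .par P X) (g := fun X => .par R X)
      (fun Θ Θ' A B hA hj' => .par h₁.to_true hA hj'.symm) hj.symm hμ⟩
  | @comL P P' Q Q' a xs bs d hP hQ hl hd =>
    cases hC with
    | @par _ Γ₁ Γ₂ _ _ _ R R' h₁ h₂ hj =>
    obtain ⟨xs', bs', d', R₁, R₁', k₁, k₂, k₃, k₄, k₅⟩ := communication_step hS hS' hP hQ hl hd h₁ hj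
      (fun h => ih _ (by simp only [← hn, Proc.size]; omega) rfl h h₁)
      (fun h => ih _ (by simp only [← hn, Proc.size]; omega) rfl h h₂)
      (f := .par) (fun A B => subset_rfl) (fun A B σ => rfl)
      (fun _ _ _ _ _ _ _ h h' hj => .par h h' hj)
    exact ⟨_, .comL k₁ k₂ k₃ k₄, k₅⟩
  | @comR P P' Q Q' a xs bs d hP hQ hl hd =>
    cases hC with
    | @par _ Γ₁ Γ₂ _ _ _ R R' h₁ h₂ hj =>
    obtain ⟨xs', bs', d', R₁, R₁', k₁, k₂, k₃, k₄, k₅⟩ :=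
      communication_step hS hS' hQ hP hl hd h₂ hj.symm
      (fun h => ih _ (by simp only [← hn, Proc.size]; omega) rfl h h₂)
      (fun h => ih _ (by simp only [← hn, Proc.size]; omega) rfl h h₁)
      (f := fun A B => .par B A) (fun A B => by rw [Proc.fn, Finset.union_comm])
      (fun A B σ => rfl) (fun _ _ _ _ _ _ _ h h' hj => .par h' h hj.symm)
    exact ⟨_, .comR k₂ k₁ k₃ k₄, k₅⟩
  | @res L P P' μ x hx hxμ h =>
    obtain ⟨Q, rfl, y, hy, hyP, hyQ, hyP', hyμ, hbody⟩ : ∃ Q₀ : Proc 1, Q = .res L Q₀ ∧ ∃ y,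
        Γ.lookup y = none ∧ y ∉ P.fn ∧ y ∉ Q₀.fn ∧ y ∉ P'.fn ∧ y ∉ μ.names ∧
        (Clo S false (Γ.insert y L) (P.inst1 y) (Q₀.inst1 y) ∨
          Clo S false Γ (P.inst1 y) (Q₀.inst1 y)) := by
      obtain ⟨y, hy⟩ := Infinite.exists_notMem_finset
        (Γ.keys ∪ P.fn ∪ Q.fn ∪ P'.fn ∪ μ.names)
      simp only [Finset.mem_union, not_or] at hy
      obtain ⟨⟨⟨⟨hyΓ, hyP⟩, hyQ⟩, hyP'⟩, hyμ⟩ := hy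
      have hyΓ := Env.lookup_of_notMem_keys hyΓ
      cases hC with
      | @res _ _ _ _ Q₀ x' h₁ h₂ h₃ h₄ =>
        exact ⟨Q₀, rfl, y, hyΓ, hyP, hyQ, hyP', hyμ, .inl (h₄.rename_inst1 hS' h₁ h₂ h₃ hyΓ)⟩
      | @res' _ _ _ _ Q₀ x' h₁ h₂ h₃ h₄ =>
        exact ⟨Q₀, rfl, y, hyΓ, hyP, hyQ, hyP', hyμ, .inr (h₄.rename_free hS' h₁ h₂ h₃)⟩
    -- The transition instantiates the bound name by `x`, which may clash with `Γ`, and the typing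
    -- by the fresh name `y`. The transposition carries the former to the latter; it changes neither
    -- `P` nor `μ`.
    have hsw : ∀ z, z ≠ x → z ≠ y → Equiv.swap x y z = z := fun z h₁ h₂ =>
      Equiv.swap_apply_of_ne_of_ne h₁ h₂
    have hstep := h.rename (Equiv.swap x y)
    rw [Proc.inst1_subst_of P (Equiv.swap_apply_left x y) (fun _ _ => rfl),
      Proc.subst_of_fixed P fun z hz => hsw z (fun e => hx (e ▸ hz)) fun e => hyP (e ▸ hz),
      Act.rename_congr μ (π' := id) fun z hz =>
        hsw z (fun e => hxμ (e ▸ hz)) fun e => hyμ (e ▸ hz), Act.rename_id] at hstep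
    have hP' : P'.bind1 x = (P'.subst (Equiv.swap x y)).bind1 y := by
      rw [← Proc.bind1_subst_of (σ := id) P' (Equiv.swap_apply_left x y), Proc.subst_id]
      · exact fun z hz hzx => hsw z hzx fun e => hyP' (e ▸ hz)
      · exact fun z hz _ e => hyP' ((show z = y from e) ▸ hz)
    have hsz : (P.inst1 y).size < n := by
      rw [← hn, Proc.inst1, Proc.inst, Proc.size_map]
      exact Nat.lt_succ_self _
    rw [hP']
    obtain hb | hb := hbody
    · obtain ⟨Q₁, hQ₁, hD⟩ := ih _ hsz rfl hstep hb fun z hz => by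
        rw [Env.lookup_insert_eq, if_neg, hμ z hz]
        rintro rfl
        exact hyμ (μ.bn_subset_names hz)
      exact ⟨_, .res hyQ hyμ hQ₁, hD.res hy hyμ⟩
    · obtain ⟨Q₁, hQ₁, hD⟩ := ih _ hsz rfl hstep hb hμ
      exact ⟨_, .res hyQ hyμ hQ₁, hD.res' hy hyμ⟩
  | @opn L P P' d a bs x hx hxb hxd hax h =>
    -- The extruded name is bound in the action and hence fresh for `Γ`, so it may itself serve as
    -- the name under which the body is typed.
    have hxΓ : Γ.lookup x = none := hμ x (by simp [Act.bn])
    have hxQ : x ∉ Q.fn := hfresh x (by simp [Act.bn])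
    have hsz : (P.inst1 x).size < n := by
      rw [← hn, Proc.inst1, Proc.inst, Proc.size_map]
      exact Nat.lt_succ_self _
    have hd : ∀ z ∈ (Act.out d a bs).bn, Γ.lookup z = none := fun z hz =>
      hμ z (by simp only [Act.bn, List.map_cons, List.toFinset_cons]; exact Finset.mem_insert_of_mem hz)
    cases hC with
    | @res _ _ _ _ Q₀ x' h₁ h₂ h₃ h₄ =>
      obtain ⟨Q₁, hQ₁, hD⟩ := ih _ hsz rfl h (h₄.rename_inst1 hS' h₁ h₂ h₃ hxΓ) fun z hz => by
        rw [Env.lookup_insert_eq, if_neg, hd z hz]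
        rintro rfl
        simp only [Act.bn, List.mem_toFinset] at hz
        exact hxd hz
      exact ⟨_, .opn hxQ hxb hxd hax hQ₁, hD.opn hxd⟩
    | @res' _ _ _ _ Q₀ x' h₁ h₂ h₃ h₄ =>
      obtain ⟨Q₁, hQ₁, hD⟩ := ih _ hsz rfl h (h₄.rename_free hS' h₁ h₂ h₃) hd
      -- A name without assignment cannot be sent, so a restriction typed in this way does not
      -- extrude its name.
      exact absurd hxΓ (hD.lookup_of_out hxd hxb)
  | @app P b μ P' h =>
    have hsz : (P.inst1 b).size < n := by
      rw [← hn, Proc.inst1, Proc.inst, Proc.size_map]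
      exact Nat.lt_succ_self _
    cases hC with
    | @app _ Γ₁ Γ₂ _ _ Q _ T x h₁ h₂ h₃ h₄ h₅ h₆ =>
    obtain ⟨Q₁, hQ₁, hD⟩ := ih _ hsz rfl h (h₄.inst1_subst hS' h₁ h₂ h₃ h₅ h₆) hμ
    exact ⟨_, .app hQ₁, hD⟩

end Clo

/-! ## Contexts -/

namespace PCtx

variable {π π' α β : Type}

/-- Renaming of the process holes. -/
def mapHoles (g : π → π') : PCtx π α → PCtx π' α
  | hole i => hole (g i)
  | nil => nil
  | wrong => wrong
  | inp a xs C => inp a xs (C.mapHoles g)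
  | out a bs => out a bs
  | par C D => par (C.mapHoles g) (D.mapHoles g)
  | res x L C => res x L (C.mapHoles g)
  | rep a xs C => rep a xs (C.mapHoles g)
  | app x C b => app x (C.mapHoles g) b
  | appHole j b => appHole j b

theorem fill_mapHoles (g : π → π') (ρ : π' → Proc 0) (φ : α → Proc 1) (C : PCtx π α) :
    (C.mapHoles g).fill ρ φ = C.fill (ρ ∘ g) φ := by
  induction C <;> simp_all [mapHoles, fill]

theorem Typed.mapHoles {g : π → π'} {Δ : π' → Env} {E : α → Env × Ty 0} {Γ : Env} {C : PCtx π α}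
    (h : C.Typed (Δ ∘ g) E Γ) : (C.mapHoles g).Typed Δ E Γ := by
  induction h with
  | hole h => exact .hole h
  | nil h => exact .nil h
  | inp h₁ h₂ h₃ h₄ h₅ _ h₆ ih => exact .inp h₁ h₂ h₃ h₄ h₅ ih h₆
  | out h₁ h₂ h₃ h₄ h₅ => exact .out h₁ h₂ h₃ h₄ h₅
  | par _ _ h ih₁ ih₂ => exact .par ih₁ ih₂ h
  | res h _ ih => exact .res h ih
  | res' h _ ih => exact .res' h ih
  | rep h₁ h₂ h₃ _ h₄ h₅ ih => exact .rep h₁ h₂ h₃ ih h₄ h₅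
  | app h₁ _ h₂ h₃ ih => exact .app h₁ ih h₂ h₃
  | appHole h₁ h₂ h₃ => exact .appHole h₁ h₂ h₃

end PCtx

/-- Processes that are related by the contextual closure of `S` decompose into a well-typed context
and processes that are related by `S`. -/
theorem Clo.exists_context {S : Env → Proc 0 → Proc 0 → Prop} {fl : Bool} {Γ : Env} {P Q : Proc 0}
    (h : Clo S fl Γ P Q) : ∃ (π : Type) (_ : Finite π) (C : PCtx π (Fin 0)) (Ps Qs : π → Proc 0)
      (Δ : π → Env), C.Typed Δ Fin.elim0 Γ ∧ C.fill Ps Fin.elim0 = P ∧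
      C.fill Qs Fin.elim0 = Q ∧ ∀ i, S (Δ i) (Ps i) (Qs i) := by
  induction h with
  | @leaf Γ P Q h =>
    exact ⟨Unit, inferInstance, .hole (), fun _ => P, fun _ => Q, fun _ => Γ,
      .hole (Env.extends_refl Γ), rfl, rfl, fun _ => h⟩
  | nil h => exact ⟨Empty, inferInstance, .nil, nofun, nofun, nofun, .nil h, rfl, rfl, nofun⟩
  | @inp _ Γ₁ Γ₂ Γ a k P Q c T l h₁ h₂ h₃ h₄ h₅ h₆ _ h₈ ih =>
    obtain ⟨π, hπ, C, Ps, Qs, Δ, hC, hP, hQ, hS⟩ := ih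
    obtain rfl : (l.map Prod.fst).length = k := by simpa using h₄
    refine ⟨π, hπ, .inp a (l.map Prod.fst) C, Ps, Qs, Δ, .inp h₁ h₂ h₃ h₅
      (fun x hx => Env.not_linearAt_of_lookup (h₆ x hx).2.2) hC h₈, ?_, ?_, hS⟩
    · rw [PCtx.fill, hP, Proc.inst_bind P h₅ fun x hx => (h₆ x hx).1]
    · rw [PCtx.fill, hQ, Proc.inst_bind Q h₅ fun x hx => (h₆ x hx).2.1]
  | @out _ Γ₁ Γ₂ Γ a c T l bs h₁ h₂ h₃ h₄ h₅ h₆ =>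
    subst h₆
    exact ⟨Empty, inferInstance, .out a (l.map Prod.fst), nofun, nofun, nofun,
      .out h₁ h₂ h₃ h₄ h₅, rfl, rfl, nofun⟩
  | par _ _ h ih₁ ih₂ =>
    obtain ⟨π, hπ, C, Ps, Qs, Δ, hC, hP, hQ, hS⟩ := ih₁
    obtain ⟨π', hπ', C', Ps', Qs', Δ', hC', hP', hQ', hS'⟩ := ih₂
    -- Each leaf gets a hole of its own, with its own environment; hence the disjoint sum of the
    -- index types.
    refine ⟨π ⊕ π', inferInstance, .par (C.mapHoles Sum.inl) (C'.mapHoles Sum.inr),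
      Sum.elim Ps Ps', Sum.elim Qs Qs', Sum.elim Δ Δ',
      .par (.mapHoles hC) (.mapHoles hC') h, ?_, ?_, ?_⟩
    · rw [PCtx.fill, PCtx.fill_mapHoles, PCtx.fill_mapHoles, Sum.elim_comp_inl,
        Sum.elim_comp_inr, hP, hP']
    · rw [PCtx.fill, PCtx.fill_mapHoles, PCtx.fill_mapHoles, Sum.elim_comp_inl,
        Sum.elim_comp_inr, hQ, hQ']
    · rintro (i | i)
      · exact hS i
      · exact hS' i
  | @res _ Γ L P Q x h₁ h₂ h₃ _ ih =>
    obtain ⟨π, hπ, C, Ps, Qs, Δ, hC, hP, hQ, hS⟩ := ih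
    refine ⟨π, hπ, .res x L C, Ps, Qs, Δ, .res (Env.not_linearAt_of_lookup h₃) hC, ?_, ?_, hS⟩
    · rw [PCtx.fill, hP, Proc.inst1_bind1 P h₁]
    · rw [PCtx.fill, hQ, Proc.inst1_bind1 Q h₂]
  | @res' _ Γ L P Q x h₁ h₂ h₃ _ ih =>
    obtain ⟨π, hπ, C, Ps, Qs, Δ, hC, hP, hQ, hS⟩ := ih
    refine ⟨π, hπ, .res x L C, Ps, Qs, Δ, .res' (Env.not_linearAt_of_lookup h₃) ?_, ?_, ?_, hS⟩
    · rwa [Env.erase_of_lookup h₃]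
    · rw [PCtx.fill, hP, Proc.inst1_bind1 P h₁]
    · rw [PCtx.fill, hQ, Proc.inst1_bind1 Q h₂]
  | @rep _ Γ₁ Γ₂ Γ a k P Q T l h₂ h₃ h₄ h₅ h₆ _ h₇ h₈ ih =>
    obtain ⟨π, hπ, C, Ps, Qs, Δ, hC, hP, hQ, hS⟩ := ih
    obtain rfl : (l.map Prod.fst).length = k := by simpa using h₄
    refine ⟨π, hπ, .rep a (l.map Prod.fst) C, Ps, Qs, Δ, .rep h₂ h₃ h₅ hC h₇ h₈, ?_, ?_, hS⟩
    · rw [PCtx.fill, hP, Proc.inst_bind P h₅ fun x hx => (h₆ x hx).1]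
    · rw [PCtx.fill, hQ, Proc.inst_bind Q h₅ fun x hx => (h₆ x hx).2.1]
  | @app _ Γ₁ Γ₂ Γ P Q b T x h₁ h₂ h₃ _ h₄ h₅ ih =>
    obtain ⟨π, hπ, C, Ps, Qs, Δ, hC, hP, hQ, hS⟩ := ih
    refine ⟨π, hπ, .app x C b, Ps, Qs, Δ, .app (Env.not_linearAt_of_lookup h₃) hC h₄ h₅, ?_, ?_,
      hS⟩
    · rw [PCtx.fill, hP, Proc.inst1_bind1 P h₁]
    · rw [PCtx.fill, hQ, Proc.inst1_bind1 Q h₂]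

theorem Clo.exists_context_fin {S : Env → Proc 0 → Proc 0 → Prop} {fl : Bool} {Γ : Env}
    {P Q : Proc 0} (h : Clo S fl Γ P Q) : ∃ (n : ℕ) (C : PCtx (Fin n) (Fin 0))
      (Ps Qs : Fin n → Proc 0) (Δ : Fin n → Env), C.Typed Δ Fin.elim0 Γ ∧
      C.fill Ps Fin.elim0 = P ∧ C.fill Qs Fin.elim0 = Q ∧ ∀ i, S (Δ i) (Ps i) (Qs i) := by
  obtain ⟨π, hπ, C, Ps, Qs, Δ, hC, hP, hQ, hS⟩ := h.exists_context
  obtain ⟨n, ⟨e⟩⟩ := Finite.exists_equiv_fin π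
  refine ⟨n, C.mapHoles e, Ps ∘ e.symm, Qs ∘ e.symm, Δ ∘ e.symm, .mapHoles ?_, ?_, ?_,
    fun i => hS _⟩
  · rwa [Function.comp_assoc, Equiv.symm_comp_self]
  · rwa [PCtx.fill_mapHoles, Function.comp_assoc, Equiv.symm_comp_self]
  · rwa [PCtx.fill_mapHoles, Function.comp_assoc, Equiv.symm_comp_self]

/-! ### Actions up to the presentation of extruded names, and residual environments -/

theorem Act.Same.symm {μ μ' : Act} (h : Act.Same μ μ') : Act.Same μ' μ := by
  cases h with
  | tau => exact .tau
  | inp => exact .inp _ _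
  | out _ _ h => exact .out _ _ h.symm

theorem Act.Same.trans {μ μ' μ'' : Act} (h : Act.Same μ μ') (h' : Act.Same μ' μ'') :
    Act.Same μ μ'' := by
  cases h with
  | tau => exact h'
  | inp => exact h'
  | out _ _ h =>
    cases h' with
    | out _ _ h' => exact .out _ _ (h.trans h')

theorem Act.Same.bn_eq {μ μ' : Act} (h : Act.Same μ μ') : μ.bn = μ'.bn := by
  cases h with
  | tau => rfl
  | inp => rfl
  | out _ _ h => exact List.toFinset_eq_of_perm _ _ h

/-- `Act.Same` may permute the extruded names and change their annotations; `Residual` looks at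
these names only up to permutation and takes their types from a list of its own. -/
theorem Residual.same {Γ Γ' : Env} {μ μ' : Act} (h : Residual Γ μ Γ') (hμ : Act.Same μ μ') :
    Residual Γ μ' Γ' := by
  cases h with
  | tau => cases hμ; exact .tau _
  | tauLin h₁ h₂ => cases hμ; exact .tauLin h₁ h₂
  | inp h₁ h₂ h₃ h₄ h₅ h₆ => cases hμ; exact .inp h₁ h₂ h₃ h₄ h₅ h₆
  | out h₁ h₂ h₃ h₄ h₅ h₆ h₇ h₈ =>
    cases hμ with
    | out _ _ h => exact .out (h.symm.trans h₁) h₂ h₃ h₄ h₅ h₆ h₇ h₈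

theorem Deriv.residual {S : Env → Proc 0 → Proc 0 → Prop} {Γ : Env} {μ : Act} {P P' Q : Proc 0}
    (h : Deriv S Γ μ P' Q) (hstep : Step P μ P') (hμ : ∀ x ∈ μ.bn, Γ.lookup x = none) :
    ∃ Γ', Residual Γ μ Γ' ∧ Clo S true Γ' P' Q := by
  cases h with
  | tau h => exact ⟨_, .tau _, h⟩
  | tauLin h₁ h₂ h₃ => exact ⟨_, .tauLin h₁ h₂, h₃⟩
  | inp h₁ h₂ h₃ h₄ h₅ h₆ =>
    subst h₅
    exact ⟨_, .inp h₁ h₂ h₃ h₄ (hstep.subject_bn.1 _ _ rfl).2 fun x hx =>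
      hμ x (by simpa only [Act.bn, List.mem_toFinset] using hx), h₆⟩
  | out h₁ h₂ h₃ h₄ h₅ h₆ h₇ h₈ =>
    subst h₇
    exact ⟨_, .out (.refl _) (fun x hx => hμ x (by simpa only [Act.bn, List.mem_toFinset] using hx))
      h₁ h₂ h₃ h₄ h₅ h₆, h₈⟩

/-! ### Related abstractions -/

/-- Abstractions whose bodies are related by the contextual closure of `S`. -/
def AbsClo (S : Env → Proc 0 → Proc 0 → Prop) (fl : Bool) (Γ : Env) (T : Ty 0) (F F' : Proc 1) :
    Prop :=
  ∃ x, x ∉ F.fn ∧ x ∉ F'.fn ∧ Γ.lookup x = none ∧ Clo S fl (Γ.insert x T) (F.inst1 x) (F'.inst1 x)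

namespace AbsClo

variable {S : Env → Proc 0 → Proc 0 → Prop} {fl : Bool} {Γ : Env} {T : Ty 0} {F F' : Proc 1}

theorem to_true (h : AbsClo S fl Γ T F F') : AbsClo S true Γ T F F' := by
  obtain ⟨x, h₁, h₂, h₃, h₄⟩ := h
  exact ⟨x, h₁, h₂, h₃, h₄.to_true⟩

theorem of_typed (fl : Bool) (h : (Agent.abs F).Typed Γ (.abs T)) : AbsClo S fl Γ T F F := by
  cases h with
  | @abs _ x _ h₁ h₂ h₃ => exact ⟨x, h₁, h₁, h₂, .of_typed fl h₃⟩

theorem typed (hS : WellTyped S) (h : AbsClo S fl Γ T F F') :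
    (Agent.abs F).Typed Γ (.abs T) ∧ (Agent.abs F').Typed Γ (.abs T) := by
  obtain ⟨x, h₁, h₂, h₃, h₄⟩ := h
  exact ⟨.abs h₁ h₃ (h₄.typed hS).1, .abs h₂ h₃ (h₄.typed hS).2⟩

theorem inst1 (hS : SubstClosed S) (h : AbsClo S fl Γ T F F') {y : ℕ} (hy : Γ.lookup y = none) :
    Clo S fl (Γ.insert y T) (F.inst1 y) (F'.inst1 y) := by
  obtain ⟨x, h₁, h₂, h₃, h₄⟩ := h
  exact h₄.rename_inst1 hS h₁ h₂ h₃ hy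

theorem extend (hS : SubstClosed S) (h : AbsClo S fl Γ T F F') {Θ : Env} (hΘ : Θ.Extends Γ) :
    AbsClo S fl Θ T F F' := by
  obtain ⟨x, h₁, h₂, h₃, h₄⟩ := h
  obtain ⟨y, hy⟩ := Infinite.exists_notMem_finset (Γ.keys ∪ F.fn ∪ F'.fn ∪ Θ.keys)
  simp only [Finset.mem_union, not_or] at hy
  have hyΘ := Env.lookup_of_notMem_keys hy.2
  refine ⟨y, hy.1.1.2, hy.1.2, hyΘ, ?_⟩
  have := h₄.subst hS (hΘ.isSubst.update T (Env.not_linearAt_of_lookup h₃) hyΘ)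
  rwa [Proc.inst1_subst_update F h₁, Proc.inst1_subst_update F' h₂, Proc.subst_id,
    Proc.subst_id] at this

theorem app (h : AbsClo S fl Γ T F F') {Γ₂ Δ : Env} {b : ℕ}
    (hb : Γ₂.HasTy b T) (hj : Env.Join Γ Γ₂ Δ) : Clo S fl Δ (.app F (.fr b)) (.app F' (.fr b)) := by
  obtain ⟨x, h₁, h₂, h₃, h₄⟩ := h
  exact .app h₁ h₂ h₃ h₄ hb hj

end AbsClo

/-- A binder of a context may shadow an assignment, whereas `AbsClo` asks for a name that is fresh;
the body is renamed to bridge the difference. -/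
theorem Clo.bind1 {S : Env → Proc 0 → Proc 0 → Prop} (hS : SubstClosed S) {fl : Bool} {Γ : Env}
    {P Q : Proc 0} {x : ℕ} {T : Ty 0} (h : Clo S fl (Γ.insert x T) P Q) (hx : ¬ Γ.LinearAt x) :
    AbsClo S fl Γ T (P.bind1 x) (Q.bind1 x) := by
  obtain ⟨y, hy⟩ := Infinite.exists_notMem_finset (Γ.keys ∪ P.fn ∪ Q.fn)
  simp only [Finset.mem_union, not_or] at hy
  have hyΓ := Env.lookup_of_notMem_keys hy.1.1
  refine ⟨y, fun h => hy.1.2 (Proc.mem_fn_bind1.1 h).1, fun h => hy.2 (Proc.mem_fn_bind1.1 h).1,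
    hyΓ, ?_⟩
  rw [Proc.bind1_inst1, Proc.bind1_inst1]
  exact h.subst hS ((Env.isSubst_id Γ).update T hx hyΓ)

theorem Clo.bind {S : Env → Proc 0 → Proc 0 → Prop} (hS : SubstClosed S) {fl : Bool} {Γ : Env}
    {P Q : Proc 0} {l : List (ℕ × Ty 0)} (h : Clo S fl (Γ.extend l) P Q)
    (hn : (l.map Prod.fst).Nodup) (hl : ∀ x ∈ l.map Prod.fst, ¬ Γ.LinearAt x) :
    ∃ l' : List (ℕ × Ty 0), l.map Prod.snd = l'.map Prod.snd ∧
      l'.length = (l.map Prod.fst).length ∧ (l'.map Prod.fst).Nodup ∧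
      (∀ x ∈ l'.map Prod.fst, x ∉ (P.bind (l.map Prod.fst)).fn ∧
        x ∉ (Q.bind (l.map Prod.fst)).fn ∧ Γ.lookup x = none) ∧
      Clo S fl (Γ.extend l') ((P.bind (l.map Prod.fst)).inst (l'.map Prod.fst))
        ((Q.bind (l.map Prod.fst)).inst (l'.map Prod.fst)) := by
  obtain ⟨l', h₁, h₂, h₃⟩ := exists_fresh_list l (Γ.keys ∪ P.fn ∪ Q.fn)
  simp only [Finset.mem_union, not_or] at h₃
  have hlen := length_eq_of_map_snd h₁
  refine ⟨l', h₁, by simp [hlen], h₂, fun x hx => ⟨fun h => (h₃ x hx).1.2 (Proc.mem_fn_bind.1 h).1,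
    fun h => (h₃ x hx).2 (Proc.mem_fn_bind.1 h).1, Env.lookup_of_notMem_keys (h₃ x hx).1.1⟩, ?_⟩
  rw [Proc.bind_inst P (by simp [hlen]), Proc.bind_inst Q (by simp [hlen]), ← overwrite_id]
  exact h.subst hS ((Env.isSubst_id Γ).overwrite h₁ hn hl h₂ fun x hx =>
    Env.lookup_of_notMem_keys (h₃ x hx).1.1)

/-! ### Filling of contexts -/

namespace PCtx

variable {π α β : Type}

/-- The abstraction holes outside `G` occur only underneath prefixes. -/
def GuardedOff (G : α → Prop) : PCtx π α → Prop
  | hole _ => False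
  | par C D => C.GuardedOff G ∧ D.GuardedOff G
  | res _ _ C => C.GuardedOff G
  | app _ C _ => C.GuardedOff G
  | appHole j _ => G j
  | _ => True

/-- Guardedness of a composite is decided hole by hole: a hole of the outer context lies beneath a
prefix, or else what is plugged into it is itself guarded. -/
theorem guardedOff_of_plug {f : α → ACtx π β} {C : PCtx π α} (h : (C.plug f).Guarded) :
    C.GuardedOff fun j => (f j).Guarded := by
  induction C with
  | par C D ih₁ ih₂ => exact ⟨ih₁ h.1, ih₂ h.2⟩
  | res x L C ih => exact ih h
  | app x C b ih => exact ih h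
  | appHole j b =>
    simp only [plug] at h
    simp only [GuardedOff]
    generalize f j = D at h ⊢
    cases D with
    | abs x C => exact h
    | hole j => exact h
  | hole => exact h
  | _ => trivial

theorem fill_plug (f : α → ACtx π β) (ρ : π → Proc 0) (φ : β → Proc 1) (C : PCtx π α) :
    (C.plug f).fill ρ φ = C.fill ρ fun j => (f j).fill ρ φ := by
  induction C with
  | appHole j b =>
    simp only [plug, fill]
    generalize f j = D
    cases D <;> rfl
  | _ => simp_all [plug, fill]

/-- Beneath a prefix any related fillings will do, and the flag becomes `true` there. Only the
unguarded holes, all of them in `G`, need fillings whose own leaves are guarded. -/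
theorem Typed.clo [IsEmpty π] {S : Env → Proc 0 → Proc 0 → Prop} (hS : SubstClosed S)
    {Δ : π → Env} {E : α → Env × Ty 0} {G : α → Prop} {ρ ρ' : π → Proc 0} {φ φ' : α → Proc 1}
    (hφ : ∀ j, AbsClo S true (E j).1 (E j).2 (φ j) (φ' j))
    (hG : ∀ j, G j → AbsClo S false (E j).1 (E j).2 (φ j) (φ' j)) {Γ : Env} {C : PCtx π α}
    (h : C.Typed Δ E Γ) : ∀ {fl : Bool}, (fl = false → C.GuardedOff G) →
      Clo S fl Γ (C.fill ρ φ) (C.fill ρ' φ') := by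
  induction h with
  | @hole _ i => exact isEmptyElim i
  | nil h => exact fun _ => .nil h
  | inp h₁ h₂ h₃ h₄ h₅ _ h₆ ih =>
    intro fl _
    obtain ⟨l', k₁, k₂, k₃, k₄, k₅⟩ := (ih (fl := true) nofun).bind hS h₄ h₅
    exact .inp h₁ h₂ (k₁ ▸ h₃) k₂ k₃ k₄ k₅ h₆
  | out h₁ h₂ h₃ h₄ h₅ => exact fun _ => .out h₁ h₂ h₃ h₄ h₅ rfl
  | par _ _ h ih₁ ih₂ => exact fun hg => .par (ih₁ fun e => (hg e).1) (ih₂ fun e => (hg e).2) h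
  | res h _ ih =>
    intro fl hg
    obtain ⟨y, k₁, k₂, k₃, k₄⟩ := (ih hg).bind1 hS h
    exact .res k₁ k₂ k₃ k₄
  | @res' Γ x L C h _ ih =>
    intro fl hg
    obtain ⟨y, hy⟩ := Infinite.exists_notMem_finset
      (Γ.keys ∪ (C.fill ρ φ).fn ∪ (C.fill ρ' φ').fn)
    simp only [Finset.mem_union, not_or] at hy
    refine .res' (x := y) (fun h => hy.1.2 (Proc.mem_fn_bind1.1 h).1)
      (fun h => hy.2 (Proc.mem_fn_bind1.1 h).1) (Env.lookup_of_notMem_keys hy.1.1) ?_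
    rw [Proc.bind1_inst1, Proc.bind1_inst1]
    refine (ih hg).subst hS (((Env.isSubst_id Γ).erase h).congr fun z hz => ?_)
    rw [Function.update_of_ne]
    rintro rfl
    exact hz (Finmap.lookup_erase _ _)
  | rep h₁ h₂ h₃ _ h₄ h₅ ih =>
    intro fl _
    obtain ⟨l', k₁, k₂, k₃, k₄, k₅⟩ := (ih (fl := true) nofun).bind hS h₃ fun x _ => h₄ x
    exact .rep h₁ (k₁ ▸ h₂) k₂ k₃ k₄ k₅ h₄ h₅
  | app h₁ _ h₂ h₃ ih =>
    intro fl hg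
    exact ((ih hg).bind1 hS h₁).app h₂ h₃
  | @appHole Γ₁ Γ₂ Γ j b h₁ h₂ h₃ =>
    intro fl hg
    obtain rfl | rfl := fl.eq_false_or_eq_true
    · exact ((hφ j).extend hS h₁).app h₂ h₃
    · exact ((hG j (hg rfl)).extend hS h₁).app h₂ h₃

end PCtx

namespace ACtx

variable {π α β : Type}

/-- The holes outside `G` occur only underneath prefixes. -/
def GuardedOff (G : α → Prop) : ACtx π α → Prop
  | abs _ C => C.GuardedOff G
  | hole j => G j

theorem guardedOff_of_plug {f : α → ACtx π β} {C : ACtx π α} (h : (C.plug f).Guarded) :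
    C.GuardedOff fun j => (f j).Guarded := by
  cases C with
  | abs x C => exact PCtx.guardedOff_of_plug h
  | hole j => exact h

theorem fill_plug (f : α → ACtx π β) (ρ : π → Proc 0) (φ : β → Proc 1) (C : ACtx π α) :
    (C.plug f).fill ρ φ = C.fill ρ fun j => (f j).fill ρ φ := by
  cases C with
  | abs x C => rw [plug, fill, fill, PCtx.fill_plug]
  | hole j => rfl

theorem Typed.clo [IsEmpty π] {S : Env → Proc 0 → Proc 0 → Prop} (hS : SubstClosed S)
    {Δ : π → Env} {E : α → Env × Ty 0} {G : α → Prop} {ρ ρ' : π → Proc 0} {φ φ' : α → Proc 1}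
    (hφ : ∀ j, AbsClo S true (E j).1 (E j).2 (φ j) (φ' j))
    (hG : ∀ j, G j → AbsClo S false (E j).1 (E j).2 (φ j) (φ' j)) {Γ : Env} {C : ACtx π α} {T : Ty 0}
    (h : C.Typed Δ E Γ T) {fl : Bool} (hg : fl = false → C.GuardedOff G) :
      AbsClo S fl Γ T (C.fill ρ φ) (C.fill ρ' φ') := by
  cases h with
  | abs h₁ h₂ => exact (h₂.clo hS hφ hG hg).bind1 hS h₁
  | @hole j h =>
    obtain rfl | rfl := fl.eq_false_or_eq_true
    · exact (hφ j).extend hS h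
    · exact (hG j (hg rfl)).extend hS h

end ACtx

namespace Lam

variable {V : Set ℕ}

/-! ## Substitution in lambda-terms -/

/-- Substitutions for bound variables, underneath an abstraction. -/
def liftSubst {n m : ℕ} (f : Fin n → Lam V m) : Fin (n + 1) → Lam V (m + 1) :=
  Fin.snoc (α := fun _ => Lam V (m + 1)) (fun i => (f i).weaken) (bvar (Fin.last m))

theorem liftSubst_castSucc {n m : ℕ} (f : Fin n → Lam V m) (i : Fin n) :
    liftSubst f i.castSucc = (f i).weaken := Fin.snoc_castSucc (α := fun _ => Lam V (m + 1)) ..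

theorem liftSubst_last {n m : ℕ} (f : Fin n → Lam V m) :
    liftSubst f (Fin.last n) = bvar (Fin.last m) := Fin.snoc_last (α := fun _ => Lam V (m + 1)) ..

theorem subst_lam {n m : ℕ} (φ : V → Lam V m) (f : Fin n → Lam V m) (M : Lam V (n + 1)) :
    (lam M).subst φ f = lam (M.subst (fun x => (φ x).weaken) (liftSubst f)) := rfl

theorem subst_congr {n m : ℕ} (M : Lam V n) {φ ψ : V → Lam V m} {f g : Fin n → Lam V m}
    (h : ∀ x : V, (x : ℕ) ∈ M.fv → φ x = ψ x) (hfg : ∀ i, f i = g i) :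
    M.subst φ f = M.subst ψ g := by
  obtain rfl := funext hfg
  induction M generalizing m with
  | fvar x => exact h x (by simp [fv])
  | bvar i => rfl
  | app M N ih₁ ih₂ =>
    rw [subst, subst, ih₁ (fun x hx => h x (Finset.mem_union_left _ hx)) fun _ => rfl,
      ih₂ (fun x hx => h x (Finset.mem_union_right _ hx)) fun _ => rfl]
  | lam M ih =>
    rw [subst_lam, subst_lam, ih (fun x hx => by rw [h x hx]) fun _ => rfl]

theorem rename_rename {n m j : ℕ} (M : Lam V n) (φ ψ : V → V) (f : Fin n → Fin m)
    (g : Fin m → Fin j) : (M.rename φ f).rename ψ g = M.rename (ψ ∘ φ) (g ∘ f) := by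
  induction M generalizing m j with
  | fvar x => rfl
  | bvar i => rfl
  | app M N ih₁ ih₂ => rw [rename, rename, rename, ih₁, ih₂]
  | lam M ih =>
    rw [rename, rename, rename, ih]
    congr 2
    funext i
    refine Fin.lastCases ?_ (fun i => ?_) i <;> simp [liftFin_last, liftFin_castSucc]

theorem rename_subst {n m j : ℕ} (M : Lam V n) (φ : V → V) (f : Fin n → Fin m)
    (ψ : V → Lam V j) (g : Fin m → Lam V j) :
    (M.rename φ f).subst ψ g = M.subst (ψ ∘ φ) (g ∘ f) := by
  induction M generalizing m j with
  | fvar x => rfl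
  | bvar i => rfl
  | app M N ih₁ ih₂ => rw [rename, subst, subst, ih₁, ih₂]
  | lam M ih =>
    rw [rename, subst_lam, subst_lam, ih]
    congr 2
    funext i
    refine Fin.lastCases ?_ (fun i => ?_) i <;>
      simp [liftSubst_castSucc, liftSubst_last, liftFin_last, liftFin_castSucc]

theorem weaken_rename {n m : ℕ} (M : Lam V n) (φ : V → V) (f : Fin n → Fin m) :
    M.weaken.rename φ (liftFin f) = (M.rename φ f).weaken := by
  rw [weaken, weaken, rename_rename, rename_rename]
  congr 1
  funext i
  simp [liftFin_castSucc]

theorem subst_rename {n m j : ℕ} (M : Lam V n) (φ : V → Lam V m) (f : Fin n → Lam V m)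
    (ψ : V → V) (g : Fin m → Fin j) :
    (M.subst φ f).rename ψ g =
      M.subst (fun x => (φ x).rename ψ g) (fun i => (f i).rename ψ g) := by
  induction M generalizing m j with
  | fvar x => rfl
  | bvar i => rfl
  | app M N ih₁ ih₂ => rw [subst, rename, subst, ih₁, ih₂]
  | lam M ih =>
    rw [subst_lam, subst_lam, rename, ih]
    congr 1
    refine subst_congr M (fun x _ => weaken_rename _ _ _) fun i => ?_
    refine Fin.lastCases ?_ (fun i => ?_) i
    · simp [liftSubst_last, rename, liftFin_last]
    · rw [liftSubst_castSucc, liftSubst_castSucc, weaken_rename]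

theorem weaken_subst {n m : ℕ} (M : Lam V n) (φ : V → Lam V m) (f : Fin n → Lam V m) :
    M.weaken.subst (fun x => (φ x).weaken) (liftSubst f) = (M.subst φ f).weaken := by
  rw [weaken, weaken, rename_subst, subst_rename]
  exact subst_congr M (fun _ _ => rfl) fun i => liftSubst_castSucc f i

theorem subst_subst {n m j : ℕ} (M : Lam V n) (φ : V → Lam V m) (f : Fin n → Lam V m)
    (ψ : V → Lam V j) (g : Fin m → Lam V j) :
    (M.subst φ f).subst ψ g = M.subst (fun x => (φ x).subst ψ g) (fun i => (f i).subst ψ g) := by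
  induction M generalizing m j with
  | fvar x => rfl
  | bvar i => rfl
  | app M N ih₁ ih₂ => rw [subst, subst, subst, ih₁, ih₂]
  | lam M ih =>
    rw [subst_lam, subst_lam, subst_lam, ih]
    congr 1
    refine subst_congr M (fun x _ => weaken_subst _ _ _) fun i => ?_
    refine Fin.lastCases ?_ (fun i => ?_) i
    · rw [liftSubst_last, liftSubst_last, subst, liftSubst_last]
    · rw [liftSubst_castSucc, liftSubst_castSucc, weaken_subst]

theorem subst_id {n : ℕ} (M : Lam V n) : M.subst fvar bvar = M := by
  induction M with
  | fvar x => rfl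
  | bvar i => rfl
  | app M N ih₁ ih₂ => rw [subst, ih₁, ih₂]
  | lam M ih =>
    rw [subst_lam]
    refine congrArg lam (Eq.trans (subst_congr M (fun _ _ => rfl) fun i => ?_) ih)
    refine Fin.lastCases ?_ (fun i => ?_) i
    · rw [liftSubst_last]
    · rw [liftSubst_castSucc]
      rfl

theorem fv_rename_id {n m : ℕ} (M : Lam V n) (f : Fin n → Fin m) : (M.rename id f).fv = M.fv := by
  induction M generalizing m <;> simp_all [rename, fv]

theorem fv_subst {n m : ℕ} (M : Lam V n) {φ : V → Lam V m} {f : Fin n → Lam V m} {z : ℕ}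
    (h : z ∈ (M.subst φ f).fv) :
    (∃ x : V, (x : ℕ) ∈ M.fv ∧ z ∈ (φ x).fv) ∨ ∃ i, z ∈ (f i).fv := by
  induction M generalizing m with
  | fvar x => exact .inl ⟨x, by simp [fv], h⟩
  | bvar i => exact .inr ⟨i, h⟩
  | app M N ih₁ ih₂ =>
    obtain h | h := Finset.mem_union.1 h
    · exact (ih₁ h).imp_left fun ⟨x, hx, hz⟩ => ⟨x, Finset.mem_union_left _ hx, hz⟩
    · exact (ih₂ h).imp_left fun ⟨x, hx, hz⟩ => ⟨x, Finset.mem_union_right _ hx, hz⟩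
  | lam M ih =>
    obtain ⟨x, hx, hz⟩ | ⟨i, hi⟩ := ih (show z ∈ (M.subst _ (liftSubst f)).fv from h)
    · exact .inl ⟨x, hx, by rwa [weaken, fv_rename_id] at hz⟩
    · revert hi
      refine Fin.lastCases ?_ (fun i hi => ?_) i
      · rw [liftSubst_last]
        simp [fv]
      · rw [liftSubst_castSucc, weaken, fv_rename_id] at hi
        exact .inr ⟨i, hi⟩

theorem apps_append {n : ℕ} (h : Lam V n) (Ms : List (Lam V n)) (N : Lam V n) :
    apps h (Ms ++ [N]) = app (apps h Ms) N := by
  simp [apps]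

theorem mem_fv_apps {n : ℕ} {h : Lam V n} {Ms : List (Lam V n)} {z : ℕ} :
    z ∈ (apps h Ms).fv ↔ z ∈ h.fv ∨ ∃ N ∈ Ms, z ∈ N.fv := by
  induction Ms using List.reverseRecOn with
  | nil => simp [apps]
  | append_singleton Ms N ih =>
    rw [apps_append, fv, Finset.mem_union, ih]
    simp only [List.mem_append, List.mem_singleton, or_and_right, exists_or, exists_eq_left,
      or_assoc]

theorem fv_inst {n : ℕ} {M : Lam V (n + 1)} {N : Lam V n} {z : ℕ} (h : z ∈ (M.inst N).fv) :
    z ∈ M.fv ∨ z ∈ N.fv := by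
  obtain ⟨x, hx, hz⟩ | ⟨i, hi⟩ := fv_subst M h
  · simp only [fv, Finset.mem_singleton] at hz
    exact .inl (hz ▸ hx)
  · revert hi
    refine Fin.lastCases (fun hi => ?_) (fun i hi => ?_) i
    · rw [Fin.snoc_last (α := fun _ => Lam V n)] at hi
      exact .inr hi
    · rw [Fin.snoc_castSucc (α := fun _ => Lam V n)] at hi
      simp [fv] at hi

/-! ### Variables for variables -/

/-- Substitution of variables, free or bound, for variables. -/
def mapVars {n m : ℕ} (g : V ⊕ Fin n → V ⊕ Fin m) (M : Lam V n) : Lam V m :=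
  M.subst (fun x => ofVar (g (.inl x))) fun i => ofVar (g (.inr i))

def liftVars {n m : ℕ} (g : V ⊕ Fin n → V ⊕ Fin m) : V ⊕ Fin (n + 1) → V ⊕ Fin (m + 1)
  | .inl x => (g (.inl x)).map id Fin.castSucc
  | .inr i => Fin.lastCases (motive := fun _ => V ⊕ Fin (m + 1)) (.inr (Fin.last m))
      (fun i => (g (.inr i)).map id Fin.castSucc) i

theorem weaken_ofVar {n : ℕ} (v : V ⊕ Fin n) :
    (ofVar v).weaken = ofVar (v.map id Fin.castSucc) := by
  cases v <;> rfl

theorem mapVars_lam {n m : ℕ} (g : V ⊕ Fin n → V ⊕ Fin m) (M : Lam V (n + 1)) :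
    (lam M).mapVars g = lam (M.mapVars (liftVars g)) := by
  rw [mapVars, subst_lam]
  refine congrArg lam (subst_congr M (fun x _ => weaken_ofVar _) fun i => ?_)
  refine Fin.lastCases ?_ (fun i => ?_) i
  · rw [liftSubst_last, liftVars, Fin.lastCases_last, ofVar]
  · rw [liftSubst_castSucc, liftVars, Fin.lastCases_castSucc, weaken_ofVar]

theorem mapVars_app {n m : ℕ} (g : V ⊕ Fin n → V ⊕ Fin m) (M N : Lam V n) :
    (app M N).mapVars g = app (M.mapVars g) (N.mapVars g) := rfl

theorem mapVars_ofVar {n m : ℕ} (g : V ⊕ Fin n → V ⊕ Fin m) (v : V ⊕ Fin n) :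
    (ofVar v).mapVars g = ofVar (g v) := by
  cases v <;> rfl

theorem mapVars_apps {n m : ℕ} (g : V ⊕ Fin n → V ⊕ Fin m) (h : Lam V n) (Ms : List (Lam V n)) :
    (apps h Ms).mapVars g = apps (h.mapVars g) (Ms.map (mapVars g)) := by
  induction Ms using List.reverseRecOn with
  | nil => rfl
  | append_singleton Ms N ih =>
    rw [apps_append, mapVars_app, ih, List.map_append, List.map_singleton, apps_append]

/-- The commutation that makes head reduction invariant under the replacement of variables by
variables. -/
theorem mapVars_inst {n m : ℕ} (g : V ⊕ Fin n → V ⊕ Fin m) (M : Lam V (n + 1)) (N : Lam V n) :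
    (M.inst N).mapVars g = (M.mapVars (liftVars g)).inst (N.mapVars g) := by
  have key : ∀ v : V ⊕ Fin m, (ofVar (v.map id Fin.castSucc)).subst fvar
      (Fin.snoc (α := fun _ => Lam V m) bvar (N.mapVars g)) = ofVar v := by
    rintro (x | i)
    · rfl
    · exact Fin.snoc_castSucc (α := fun _ => Lam V m) ..
  have e : M.mapVars (liftVars g) = M.subst _ _ := rfl
  rw [inst, inst, e, subst_subst, mapVars, subst_subst]
  refine subst_congr M (fun x _ => (key _).symm) fun i => ?_
  refine Fin.lastCases ?_ (fun i => ?_) i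
  · rw [Fin.snoc_last (α := fun _ => Lam V n), liftVars, Fin.lastCases_last]
    exact (Fin.snoc_last (α := fun _ => Lam V m) ..).symm
  · rw [Fin.snoc_castSucc (α := fun _ => Lam V n), liftVars, Fin.lastCases_castSucc, key]
    rfl

theorem mapVars_mapVars {n m j : ℕ} (g : V ⊕ Fin n → V ⊕ Fin m) (h : V ⊕ Fin m → V ⊕ Fin j)
    (M : Lam V n) : (M.mapVars g).mapVars h = M.mapVars (h ∘ g) := by
  rw [mapVars, mapVars, subst_subst]
  exact subst_congr M (fun x _ => mapVars_ofVar _ _) fun i => mapVars_ofVar _ _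

/-! ### Head reduction -/

theorem SpineStep.mapVars {n m : ℕ} {M M' : Lam V n} (h : SpineStep M M')
    (g : V ⊕ Fin n → V ⊕ Fin m) : SpineStep (M.mapVars g) (M'.mapVars g) := by
  induction h with
  | beta M N =>
    rw [mapVars_app, mapVars_lam, mapVars_inst]
    exact .beta _ _
  | app N _ ih => exact .app _ ih

theorem HeadStep.mapVars {n m : ℕ} {M M' : Lam V n} (h : HeadStep M M')
    (g : V ⊕ Fin n → V ⊕ Fin m) : HeadStep (M.mapVars g) (M'.mapVars g) := by
  induction h generalizing m with
  | spine h => exact .spine (h.mapVars g)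
  | lam _ ih =>
    rw [mapVars_lam, mapVars_lam]
    exact .lam (ih _)

theorem HeadRed.mapVars {n m : ℕ} {M M' : Lam V n} (h : HeadRed M M')
    (g : V ⊕ Fin n → V ⊕ Fin m) : HeadRed (M.mapVars g) (M'.mapVars g) := by
  induction h with
  | refl => exact .refl
  | tail _ h ih => exact ih.tail (h.mapVars g)

theorem SpineStep.deterministic {n : ℕ} {M M' M'' : Lam V n} (h : SpineStep M M')
    (h' : SpineStep M M'') : M' = M'' := by
  induction h generalizing M'' with
  | beta M N =>
    cases h' with
    | beta => rfl
    | app _ h => cases h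
  | app N h ih =>
    cases h' with
    | beta => cases h
    | app _ h' => rw [ih h']

theorem HeadStep.deterministic {n : ℕ} {M M' M'' : Lam V n} (h : HeadStep M M')
    (h' : HeadStep M M'') : M' = M'' := by
  induction h with
  | spine h =>
    cases h' with
    | spine h' => exact h.deterministic h'
    | lam => cases h
  | lam h ih =>
    cases h' with
    | spine h' => cases h'
    | lam h' => rw [ih h']

theorem SpineStep.fv_subset {n : ℕ} {M M' : Lam V n} (h : SpineStep M M') : M'.fv ⊆ M.fv := by
  induction h with
  | beta M N => exact fun z hz => Finset.mem_union.2 (fv_inst hz)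
  | app N _ ih => exact Finset.union_subset_union_left ih

theorem HeadStep.fv_subset {n : ℕ} {M M' : Lam V n} (h : HeadStep M M') : M'.fv ⊆ M.fv := by
  induction h with
  | spine h => exact h.fv_subset
  | lam _ ih => exact ih

theorem HeadRed.fv_subset {n : ℕ} {M M' : Lam V n} (h : HeadRed M M') : M'.fv ⊆ M.fv := by
  induction h with
  | refl => exact subset_rfl
  | tail _ h ih => exact h.fv_subset.trans ih

theorem HeadRed.lam {n : ℕ} {M M' : Lam V (n + 1)} (h : HeadRed M M') :
    HeadRed (Lam.lam M) (Lam.lam M') := by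
  induction h with
  | refl => exact .refl
  | tail _ h ih => exact ih.tail (.lam h)

theorem HeadRed.of_lam {n : ℕ} {M : Lam V (n + 1)} {N : Lam V n} (h : HeadRed (Lam.lam M) N) :
    ∃ M', N = Lam.lam M' ∧ HeadRed M M' := by
  induction h with
  | refl => exact ⟨M, rfl, .refl⟩
  | tail _ h ih =>
    obtain ⟨M', rfl, hM⟩ := ih
    cases h with
    | spine h => cases h
    | lam h => exact ⟨_, rfl, hM.tail h⟩

theorem ofVar_ne_app {n : ℕ} (v : V ⊕ Fin n) (M N : Lam V n) : ofVar v ≠ app M N := by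
  cases v <;> simp [ofVar]

theorem ofVar_ne_lam {n : ℕ} (v : V ⊕ Fin n) (M : Lam V (n + 1)) : ofVar v ≠ lam M := by
  cases v <;> simp [ofVar]

theorem ofVar_injective {n : ℕ} : Function.Injective (ofVar : V ⊕ Fin n → Lam V n) := by
  rintro (x | i) (y | j) h <;> simp_all [ofVar]

/-- A variable put for a variable never produces an abstraction in head position, so every head
redex was present before the replacement. -/
theorem SpineStep.of_mapVars {n m : ℕ} {M : Lam V n} {g : V ⊕ Fin n → V ⊕ Fin m} {N : Lam V m}
    (h : SpineStep (M.mapVars g) N) : ∃ M', SpineStep M M' ∧ N = M'.mapVars g := by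
  induction M generalizing m with
  | fvar x => exact absurd h (by cases hv : g (.inl x) <;> simp [Lam.mapVars, subst, hv, ofVar] <;> nofun)
  | bvar i => exact absurd h (by cases hv : g (.inr i) <;> simp [Lam.mapVars, subst, hv, ofVar] <;> nofun)
  | app A B ih₁ ih₂ =>
    rw [mapVars_app] at h
    generalize hA : A.mapVars g = A' at h
    cases h with
    | beta P Q =>
      cases A with
      | fvar x => exact absurd hA (ofVar_ne_lam _ _)
      | bvar i => exact absurd hA (ofVar_ne_lam _ _)
      | app => exact absurd hA nofun
      | lam A =>
        rw [mapVars_lam, lam.injEq] at hA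
        exact ⟨_, .beta A B, by rw [mapVars_inst, hA]⟩
    | app _ h =>
      subst hA
      obtain ⟨A', h₁, rfl⟩ := ih₁ h
      exact ⟨_, .app B h₁, rfl⟩
  | lam A => rw [mapVars_lam] at h; cases h

theorem HeadStep.of_mapVars {n m : ℕ} {M : Lam V n} {g : V ⊕ Fin n → V ⊕ Fin m} {N : Lam V m}
    (h : HeadStep (M.mapVars g) N) : ∃ M', HeadStep M M' ∧ N = M'.mapVars g := by
  generalize hM : M.mapVars g = M₀ at h
  induction h generalizing n with
  | spine h =>
    subst hM
    obtain ⟨M', h₁, rfl⟩ := h.of_mapVars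
    exact ⟨M', .spine h₁, rfl⟩
  | lam h ih =>
    cases M with
    | fvar x => exact absurd hM (ofVar_ne_lam _ _)
    | bvar i => exact absurd hM (ofVar_ne_lam _ _)
    | app => exact absurd hM nofun
    | lam A =>
      rw [mapVars_lam, lam.injEq] at hM
      obtain ⟨A', h₁, rfl⟩ := ih hM
      exact ⟨_, .lam h₁, (mapVars_lam g A').symm⟩

theorem HeadRed.of_mapVars {n m : ℕ} {M : Lam V n} {g : V ⊕ Fin n → V ⊕ Fin m} {N : Lam V m}
    (h : HeadRed (M.mapVars g) N) : ∃ M', HeadRed M M' ∧ N = M'.mapVars g := by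
  induction h with
  | refl => exact ⟨M, .refl, rfl⟩
  | tail _ h ih =>
    obtain ⟨M', h₁, rfl⟩ := ih
    obtain ⟨M'', h₂, rfl⟩ := h.of_mapVars
    exact ⟨M'', h₁.tail h₂, rfl⟩

end Lam

namespace Lam

variable {V : Set ℕ}

/-! ## Head normal forms and Boehm trees -/

/-- The data of a head normal form below its abstractions: the number of bound variables, the head
variable, and the arguments. -/
abbrev Node (V : Set ℕ) : Type := Σ m : ℕ, (V ⊕ Fin m) × List (Lam V m)

/-- `HeadForm M k d`: the term `M` consists of `k` abstractions and of a variable applied to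
arguments, as given by `d`. -/
inductive HeadForm : {n : ℕ} → Lam V n → ℕ → Node V → Prop
  | spine {n : ℕ} (y : V ⊕ Fin n) (Ms : List (Lam V n)) :
      HeadForm (apps (ofVar y) Ms) 0 ⟨n, y, Ms⟩
  | lam {n k : ℕ} {M : Lam V (n + 1)} {d : Node V} : HeadForm M k d → HeadForm (lam M) (k + 1) d

/-- `M` starts with `k` abstractions. -/
inductive HasLams : {n : ℕ} → ℕ → Lam V n → Prop
  | zero {n : ℕ} (M : Lam V n) : HasLams 0 M
  | succ {n k : ℕ} {M : Lam V (n + 1)} : HasLams k M → HasLams (k + 1) (lam M)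

theorem cast_lam {n m : ℕ} (e : n = m) (e' : n + 1 = m + 1) (P : Lam V (n + 1)) :
    e ▸ lam P = lam (e' ▸ P) := by
  subst e
  rfl

theorem cast_apps {n m : ℕ} (e : n = m) (y : V ⊕ Fin n) (Ms : List (Lam V n)) :
    e ▸ apps (ofVar y) Ms = apps (ofVar (e ▸ y)) (e ▸ Ms) := by
  subst e
  rfl

theorem cast_node {n m : ℕ} (e : n = m) (y : V ⊕ Fin n) (Ms : List (Lam V n)) :
    (⟨n, y, Ms⟩ : Node V) = ⟨m, e ▸ y, e ▸ Ms⟩ := by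
  subst e
  rfl

/-- `lams` adds its abstractions from the inside, so moving the outermost one into the block changes
`n + 1 + k` to `n + (k + 1)` in the type. The transport is confined to this lemma and to
`HeadForm.exists_hnf`, since `Node` hides the index. -/
theorem lam_lams (k : ℕ) {n m : ℕ} (P : Lam V m) (e : m = n + 1 + k) (e' : m = n + (k + 1)) :
    lam (lams k (e ▸ P)) = lams (k + 1) (e' ▸ P) := by
  induction k generalizing m with
  | zero =>
    subst e'
    rfl
  | succ k ih =>
    obtain ⟨m, rfl⟩ : ∃ j, m = j + 1 := ⟨n + 1 + k, e⟩
    have e₁ : m = n + 1 + k := Nat.succ_injective e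
    have e₂ : m = n + (k + 1) := Nat.succ_injective e'
    have := ih (lam P) e₁ e₂
    subst e₁
    rw [lams, lams]
    exact this.trans (congrArg _ (cast_lam e₂ e' P))

theorem headForm_lams {n k j : ℕ} {P : Lam V (n + k)} {d : Node V} (h : HeadForm P j d) :
    HeadForm (lams k P) (j + k) d := by
  induction k generalizing j with
  | zero => exact h
  | succ k ih =>
    have := ih (HeadForm.lam h)
    rwa [Nat.add_assoc, Nat.add_comm 1] at this

theorem headForm_hnf {n k : ℕ} (y : V ⊕ Fin (n + k)) (Ms : List (Lam V (n + k))) :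
    HeadForm (hnf k y Ms) k ⟨n + k, y, Ms⟩ := by
  have := headForm_lams (HeadForm.spine y Ms)
  rwa [Nat.zero_add] at this

theorem HeadForm.exists_hnf {n k : ℕ} {M : Lam V n} {d : Node V} (h : HeadForm M k d) :
    ∃ y Ms, d = ⟨n + k, y, Ms⟩ ∧ M = hnf k y Ms := by
  induction h with
  | spine y Ms => exact ⟨y, Ms, rfl, rfl⟩
  | @lam n k M d _ ih =>
    obtain ⟨y, Ms, rfl, rfl⟩ := ih
    have e : n + 1 + k = n + (k + 1) := by omega
    have key := lam_lams k (apps (ofVar y) Ms) rfl e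
    exact ⟨e ▸ y, e ▸ Ms, cast_node e y Ms, key.trans (congrArg _ (cast_apps e y Ms))⟩

theorem hasLams_lams {n k j : ℕ} {P : Lam V (n + k)} (h : HasLams j P) :
    HasLams (j + k) (lams k P) := by
  induction k generalizing j with
  | zero => exact h
  | succ k ih =>
    have := ih (HasLams.succ h)
    rwa [Nat.add_assoc, Nat.add_comm 1] at this

theorem hasLams_iff {n k : ℕ} {M : Lam V n} :
    HasLams k M ↔ ∃ N : Lam V (n + k), M = lams k N := by
  constructor
  · intro h
    induction h with
    | zero M => exact ⟨M, rfl⟩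
    | @succ n k M _ ih =>
      obtain ⟨N, rfl⟩ := ih
      exact ⟨_, lam_lams k N rfl (by omega)⟩
  · rintro ⟨N, rfl⟩
    have := hasLams_lams (HasLams.zero N)
    rwa [Nat.zero_add] at this

theorem apps_ofVar_ne_lam {n : ℕ} (v : V ⊕ Fin n) (Ms : List (Lam V n)) (M : Lam V (n + 1)) :
    apps (ofVar v) Ms ≠ lam M := by
  induction Ms using List.reverseRecOn with
  | nil => exact ofVar_ne_lam v M
  | append_singleton Ms N => rw [apps_append]; simp

theorem apps_ofVar_inj {n : ℕ} {v w : V ⊕ Fin n} {Ms Ns : List (Lam V n)}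
    (h : apps (ofVar v) Ms = apps (ofVar w) Ns) : v = w ∧ Ms = Ns := by
  induction Ms using List.reverseRecOn generalizing Ns with
  | nil =>
    obtain rfl | ⟨Ns, N, rfl⟩ := Ns.eq_nil_or_concat'
    · exact ⟨ofVar_injective h, rfl⟩
    · rw [apps_append] at h
      exact absurd h (ofVar_ne_app _ _ _)
  | append_singleton Ms M ih =>
    obtain rfl | ⟨Ns, N, rfl⟩ := Ns.eq_nil_or_concat'
    · rw [apps_append] at h
      exact absurd h.symm (ofVar_ne_app _ _ _)
    · rw [apps_append, apps_append, app.injEq] at h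
      obtain ⟨rfl, rfl⟩ := ih h.1
      exact ⟨rfl, by rw [h.2]⟩

theorem not_spineStep_apps {n : ℕ} (v : V ⊕ Fin n) (Ms : List (Lam V n)) {M : Lam V n} :
    ¬ SpineStep (apps (ofVar v) Ms) M := by
  induction Ms using List.reverseRecOn generalizing M with
  | nil => cases v <;> nofun
  | append_singleton Ms N ih =>
    rw [apps_append]
    intro h
    generalize hA : apps (ofVar v) Ms = A at h
    cases h with
    | beta => exact apps_ofVar_ne_lam _ _ _ hA
    | app _ h =>
      subst hA
      exact ih h

theorem HeadForm.not_headStep {n k : ℕ} {M M' : Lam V n} {d : Node V} (h : HeadForm M k d) :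
    ¬ HeadStep M M' := by
  induction h with
  | @spine n y Ms =>
    intro h
    generalize hA : apps (ofVar y) Ms = A at h
    cases h with
    | spine h =>
      subst hA
      exact not_spineStep_apps _ _ h
    | lam => exact apps_ofVar_ne_lam _ _ _ hA
  | lam _ ih =>
    intro h
    cases h with
    | spine h => cases h
    | lam h => exact ih h

theorem headForm_lam {n k : ℕ} {M : Lam V (n + 1)} {d : Node V} (h : HeadForm (lam M) k d) :
    ∃ k', k = k' + 1 ∧ HeadForm M k' d := by
  generalize hA : lam M = A at h
  cases h with
  | spine y Ms => exact absurd hA.symm (apps_ofVar_ne_lam _ _ _)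
  | lam h =>
    cases hA
    exact ⟨_, rfl, h⟩

theorem headForm_apps {n k : ℕ} {v : V ⊕ Fin n} {Ns : List (Lam V n)} {d : Node V}
    (h : HeadForm (apps (ofVar v) Ns) k d) : k = 0 ∧ d = ⟨n, v, Ns⟩ := by
  generalize hA : apps (ofVar v) Ns = A at h
  cases h with
  | spine y Ms =>
    obtain ⟨rfl, rfl⟩ := apps_ofVar_inj hA
    exact ⟨rfl, rfl⟩
  | lam h => exact absurd hA (apps_ofVar_ne_lam _ _ _)

theorem HeadForm.unique {n k k' : ℕ} {M : Lam V n} {d d' : Node V} (h : HeadForm M k d)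
    (h' : HeadForm M k' d') : k = k' ∧ d = d' := by
  induction h generalizing k' with
  | spine y Ms =>
    obtain ⟨rfl, rfl⟩ := headForm_apps h'
    exact ⟨rfl, rfl⟩
  | lam _ ih =>
    obtain ⟨k', rfl, h₂⟩ := headForm_lam h'
    obtain ⟨rfl, rfl⟩ := ih h₂
    exact ⟨rfl, rfl⟩

/-- `M` has the head normal form given by `k` and `d`. -/
def HasHnf {n : ℕ} (M : Lam V n) (k : ℕ) (d : Node V) : Prop :=
  ∃ M', HeadRed M M' ∧ HeadForm M' k d

/-- Head reduction is deterministic and stops at head forms, so of two reduction sequences from `M`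
one extends the other, and the one to the head form is the longer. -/
theorem hasHnf_of_headRed {n k : ℕ} {M M' : Lam V n} {d : Node V} (h : HeadRed M M') :
    HasHnf M k d ↔ HasHnf M' k d := by
  refine ⟨fun ⟨A, hA, hd⟩ => ⟨A, ?_, hd⟩, fun ⟨A, hA, hd⟩ => ⟨A, h.trans hA, hd⟩⟩
  obtain h' | h' := Relation.ReflTransGen.total_of_right_unique
    (fun _ _ _ h h' => h.deterministic h') h hA
  · exact h'
  · obtain rfl | ⟨B, hB, -⟩ := Relation.ReflTransGen.cases_head h'
    · exact .refl
    · exact absurd hB hd.not_headStep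

theorem HasHnf.unique {n k k' : ℕ} {M : Lam V n} {d d' : Node V} (h : HasHnf M k d)
    (h' : HasHnf M k' d') : k = k' ∧ d = d' := by
  obtain ⟨A, hA, hd⟩ := h
  obtain ⟨B, hB, hd'⟩ := (hasHnf_of_headRed hA).1 h'
  obtain rfl | ⟨C, hC, -⟩ := Relation.ReflTransGen.cases_head hB
  · exact hd.unique hd'
  · exact absurd hC hd.not_headStep

theorem hasHnf_lam {n k : ℕ} {M : Lam V (n + 1)} {d : Node V} :
    HasHnf (lam M) k d ↔ ∃ k', k = k' + 1 ∧ HasHnf M k' d := by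
  constructor
  · rintro ⟨A, hA, hd⟩
    obtain ⟨A, rfl, hA'⟩ := hA.of_lam
    obtain ⟨k', rfl, hd'⟩ := headForm_lam hd
    exact ⟨k', rfl, A, hA', hd'⟩
  · rintro ⟨k', rfl, A, hA, hd⟩
    exact ⟨_, hA.lam, hd.lam⟩

theorem hasHnf_apps {n k : ℕ} {v : V ⊕ Fin n} {Ns : List (Lam V n)} {d : Node V} :
    HasHnf (apps (ofVar v) Ns) k d ↔ k = 0 ∧ d = ⟨n, v, Ns⟩ := by
  constructor
  · exact fun h => h.unique ⟨_, .refl, .spine v Ns⟩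
  · rintro ⟨rfl, rfl⟩
    exact ⟨_, .refl, .spine v Ns⟩

theorem solvable_iff {n : ℕ} {M : Lam V n} : Solvable M ↔ ∃ k d, HasHnf M k d := by
  constructor
  · rintro ⟨k, y, Ms, h⟩
    exact ⟨k, _, _, h, headForm_hnf y Ms⟩
  · rintro ⟨k, d, A, hA, hd⟩
    obtain ⟨y, Ms, rfl, rfl⟩ := hd.exists_hnf
    exact ⟨k, y, Ms, hA⟩

theorem solvable_of_headRed {n : ℕ} {M M' : Lam V n} (h : HeadRed M M') :
    Solvable M ↔ Solvable M' := by
  simp only [solvable_iff, hasHnf_of_headRed h]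

theorem solvable_lam {n : ℕ} {M : Lam V (n + 1)} : Solvable (lam M) ↔ Solvable M := by
  simp only [solvable_iff, hasHnf_lam]
  constructor
  · rintro ⟨_, d, k, -, h⟩
    exact ⟨k, d, h⟩
  · rintro ⟨k, d, h⟩
    exact ⟨_, d, k, rfl, h⟩

theorem solvable_apps {n : ℕ} (v : V ⊕ Fin n) (Ns : List (Lam V n)) :
    Solvable (apps (ofVar v) Ns) := solvable_iff.2 ⟨_, _, hasHnf_apps.2 ⟨rfl, rfl⟩⟩

/-- The root label of a Boehm tree. -/
def Node.label (k : ℕ) (d : Node V) : BTLabel V := .head k (d.2.1.map id Fin.val)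

theorem bTAt_nil {n : ℕ} {M : Lam V n} {l : BTLabel V} :
    BTAt M [] l ↔ (¬ Solvable M ∧ l = .bot) ∨ ∃ k d, HasHnf M k d ∧ l = Node.label k d := by
  constructor
  · intro h
    cases h with
    | bot h => exact .inl ⟨h, rfl⟩
    | root h => exact .inr ⟨_, _, ⟨_, h, headForm_hnf _ _⟩, rfl⟩
  · rintro (⟨h, rfl⟩ | ⟨k, d, ⟨A, hA, hd⟩, rfl⟩)
    · exact .bot h
    · obtain ⟨y, Ms, rfl, rfl⟩ := hd.exists_hnf
      exact .root hA

theorem bTAt_cons {n i : ℕ} {M : Lam V n} {p : List ℕ} {l : BTLabel V} :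
    BTAt M (i :: p) l ↔
      ∃ (k : ℕ) (d : Node V) (N : Lam V d.1), HasHnf M k d ∧ d.2.2[i]? = some N ∧ BTAt N p l := by
  constructor
  · intro h
    cases h with
    | child h hN hl => exact ⟨_, _, _, ⟨_, h, headForm_hnf _ _⟩, hN, hl⟩
  · rintro ⟨k, d, N, ⟨A, hA, hd⟩, hN, hl⟩
    obtain ⟨y, Ms, rfl, rfl⟩ := hd.exists_hnf
    exact .child hA hN hl

theorem bTAt_of_headRed {n : ℕ} {M M' : Lam V n} (h : HeadRed M M') {p : List ℕ}
    {l : BTLabel V} : BTAt M p l ↔ BTAt M' p l := by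
  cases p with
  | nil => simp only [bTAt_nil, solvable_of_headRed h, hasHnf_of_headRed h]
  | cons i p => simp only [bTAt_cons, hasHnf_of_headRed h]

/-- The label obtained by adding an abstraction. -/
def BTLabel.succ : BTLabel V → BTLabel V
  | bot => bot
  | head k y => head (k + 1) y

theorem BTLabel.succ_injective : Function.Injective (BTLabel.succ : BTLabel V → BTLabel V) := by
  rintro (_ | ⟨k, y⟩) (_ | ⟨k', y'⟩) h <;> simp_all [succ]

theorem bTAt_lam_nil {n : ℕ} {M : Lam V (n + 1)} {l : BTLabel V} :
    BTAt (lam M) [] l ↔ ∃ l', BTAt M [] l' ∧ l = l'.succ := by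
  simp only [bTAt_nil, solvable_lam, hasHnf_lam]
  constructor
  · rintro (⟨h, rfl⟩ | ⟨_, d, ⟨k, rfl, h⟩, rfl⟩)
    · exact ⟨.bot, .inl ⟨h, rfl⟩, rfl⟩
    · exact ⟨_, .inr ⟨k, d, h, rfl⟩, rfl⟩
  · rintro ⟨_, ⟨h, rfl⟩ | ⟨k, d, h, rfl⟩, rfl⟩
    · exact .inl ⟨h, rfl⟩
    · exact .inr ⟨_, d, ⟨k, rfl, h⟩, rfl⟩

theorem bTAt_lam_cons {n i : ℕ} {M : Lam V (n + 1)} {p : List ℕ} {l : BTLabel V} :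
    BTAt (lam M) (i :: p) l ↔ BTAt M (i :: p) l := by
  simp only [bTAt_cons, hasHnf_lam]
  constructor
  · rintro ⟨_, d, N, ⟨k, rfl, h⟩, h'⟩
    exact ⟨k, d, N, h, h'⟩
  · rintro ⟨k, d, N, h, h'⟩
    exact ⟨_, d, N, ⟨k, rfl, h⟩, h'⟩

/-- An outer abstraction changes only the root label, and injectively; bound variables are levels,
so the labels further down are not shifted. -/
theorem bTAt_lam_mono {n : ℕ} {M N : Lam V (n + 1)} {p : List ℕ} :
    (∀ l, BTAt (lam M) p l → BTAt (lam N) p l) ↔ ∀ l, BTAt M p l → BTAt N p l := by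
  cases p with
  | nil =>
    simp only [bTAt_lam_nil]
    constructor
    · intro h l hl
      obtain ⟨l', h', e⟩ := h _ ⟨l, hl, rfl⟩
      rwa [BTLabel.succ_injective e]
    · rintro h _ ⟨l, hl, rfl⟩
      exact ⟨l, h l hl, rfl⟩
  | cons i p => simp only [bTAt_lam_cons]

theorem exists_bTAt_nil {n : ℕ} (M : Lam V n) : ∃ l, BTAt M [] l := by
  by_cases h : Solvable M
  · obtain ⟨k, d, h⟩ := solvable_iff.1 h
    exact ⟨_, bTAt_nil.2 (.inr ⟨k, d, h, rfl⟩)⟩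
  · exact ⟨_, .bot h⟩

theorem bTAt_apps_nil {n : ℕ} {v : V ⊕ Fin n} {Ns : List (Lam V n)} {l : BTLabel V} :
    BTAt (apps (ofVar v) Ns) [] l ↔ l = .head 0 (v.map id Fin.val) := by
  simp only [bTAt_nil, hasHnf_apps, solvable_apps, not_true_eq_false, false_and, false_or]
  constructor
  · rintro ⟨k, d, ⟨rfl, rfl⟩, rfl⟩
    rfl
  · rintro rfl
    exact ⟨_, _, ⟨rfl, rfl⟩, rfl⟩

theorem bTAt_apps_cons {n i : ℕ} {v : V ⊕ Fin n} {Ns : List (Lam V n)} {p : List ℕ}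
    {l : BTLabel V} :
    BTAt (apps (ofVar v) Ns) (i :: p) l ↔ ∃ N, Ns[i]? = some N ∧ BTAt N p l := by
  simp only [bTAt_cons, hasHnf_apps]
  constructor
  · rintro ⟨k, d, N, ⟨rfl, rfl⟩, h⟩
    exact ⟨N, h⟩
  · rintro ⟨N, h⟩
    exact ⟨0, ⟨n, v, Ns⟩, N, ⟨rfl, rfl⟩, h⟩

/-- Head reduction creates no free variables. This keeps a fresh variable out of the labels in
`bTAt_open_mono`. -/
theorem BTAt.mem_fv {n : ℕ} {M : Lam V n} {p : List ℕ} {l : BTLabel V} (h : BTAt M p l) :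
    ∀ {k x}, l = .head k (.inl x) → (x : ℕ) ∈ M.fv := by
  have key : ∀ {n k : ℕ} {M : Lam V n} {d : Node V}, HasHnf M k d → ∀ z,
      (z ∈ (ofVar d.2.1).fv ∨ ∃ N ∈ d.2.2, z ∈ N.fv) → z ∈ M.fv := by
    rintro n k M d ⟨A, hA, hd⟩ z hz
    refine hA.fv_subset ?_
    clear hA M
    induction hd with
    | spine y Ms => exact mem_fv_apps.2 hz
    | lam _ ih => exact ih hz
  induction p generalizing n with
  | nil =>
    rintro k x rfl
    obtain ⟨-, h₀⟩ | ⟨k', ⟨m, y, Ms⟩, h₀, e⟩ := bTAt_nil.1 h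
    · cases h₀
    · obtain y | i := y
      · cases e
        exact key h₀ _ (.inl (Finset.mem_singleton_self _))
      · cases e
  | cons i p ih =>
    rintro k x rfl
    obtain ⟨k', d, N, h, hN, hl⟩ := bTAt_cons.1 h
    exact key h _ (.inr ⟨N, List.mem_of_getElem? hN, ih hl rfl⟩)

/-! ### Boehm trees and substitution of variables -/

/-- The substitution `g` acts on labels as `φ`. -/
def Compat (φ : V ⊕ ℕ → V ⊕ ℕ) {n m : ℕ} (g : V ⊕ Fin n → V ⊕ Fin m) : Prop :=
  (∀ v, (g v).map id Fin.val = φ (v.map id Fin.val)) ∧ ∀ k, φ (.inr (n + k)) = .inr (m + k)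

/-- The second clause of `Compat` prescribes the action on levels not bound so far, so the same `φ`
works underneath further binders and hence on the whole tree. -/
theorem Compat.liftVars {φ : V ⊕ ℕ → V ⊕ ℕ} {n m : ℕ} {g : V ⊕ Fin n → V ⊕ Fin m}
    (h : Compat φ g) : Compat φ (liftVars g) := by
  have hw : ∀ v : V ⊕ Fin m, (v.map id Fin.castSucc).map id Fin.val = v.map id Fin.val := by
    rintro (x | i) <;> rfl
  refine ⟨?_, fun k => ?_⟩
  · rintro (x | i)
    · rw [Lam.liftVars, hw, h.1]
      rfl
    · refine Fin.lastCases ?_ (fun i => ?_) i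
      · rw [Lam.liftVars, Fin.lastCases_last]
        exact (h.2 0).symm
      · rw [Lam.liftVars, Fin.lastCases_castSucc, hw, h.1]
        rfl
  · rw [Nat.add_assoc, Nat.add_assoc]
    exact h.2 _

theorem HeadForm.mapVars {φ : V ⊕ ℕ → V ⊕ ℕ} {n n' k : ℕ} {M : Lam V n} {d : Node V}
    (h : HeadForm M k d) {g : V ⊕ Fin n → V ⊕ Fin n'} (hg : Compat φ g) :
    ∃ (m : ℕ) (g' : V ⊕ Fin d.1 → V ⊕ Fin m), Compat φ g' ∧
      HeadForm (M.mapVars g) k ⟨m, g' d.2.1, d.2.2.map (Lam.mapVars g')⟩ := by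
  induction h generalizing n' with
  | spine y Ms =>
    refine ⟨_, g, hg, ?_⟩
    rw [mapVars_apps, mapVars_ofVar]
    exact .spine _ _
  | lam _ ih =>
    obtain ⟨m, g', hg', h⟩ := ih hg.liftVars
    refine ⟨m, g', hg', ?_⟩
    rw [mapVars_lam]
    exact .lam h

theorem HasHnf.mapVars {φ : V ⊕ ℕ → V ⊕ ℕ} {n n' k : ℕ} {M : Lam V n} {d : Node V}
    (h : HasHnf M k d) {g : V ⊕ Fin n → V ⊕ Fin n'} (hg : Compat φ g) :
    ∃ (m : ℕ) (g' : V ⊕ Fin d.1 → V ⊕ Fin m), Compat φ g' ∧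
      HasHnf (M.mapVars g) k ⟨m, g' d.2.1, d.2.2.map (Lam.mapVars g')⟩ := by
  obtain ⟨A, hA, hd⟩ := h
  obtain ⟨m, g', hg', h⟩ := hd.mapVars hg
  exact ⟨m, g', hg', _, hA.mapVars g, h⟩

theorem exists_apps_of_mapVars {n m : ℕ} {M : Lam V n} {g : V ⊕ Fin n → V ⊕ Fin m}
    {v : V ⊕ Fin m} {Ns : List (Lam V m)} (h : M.mapVars g = apps (ofVar v) Ns) :
    ∃ w Ms, M = apps (ofVar w) Ms := by
  induction Ns using List.reverseRecOn generalizing M with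
  | nil =>
    cases M with
    | fvar x => exact ⟨.inl x, [], rfl⟩
    | bvar i => exact ⟨.inr i, [], rfl⟩
    | app A B => exact absurd h.symm (ofVar_ne_app _ _ _)
    | lam A => exact absurd h.symm (ofVar_ne_lam _ _)
  | append_singleton Ns N ih =>
    rw [apps_append] at h
    cases M with
    | fvar x => exact absurd h (ofVar_ne_app _ _ _)
    | bvar i => exact absurd h (ofVar_ne_app _ _ _)
    | app A B =>
      rw [mapVars_app, app.injEq] at h
      obtain ⟨w, Ms, rfl⟩ := ih h.1
      exact ⟨w, Ms ++ [B], (apps_append _ _ _).symm⟩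
    | lam A => exact absurd h (by rw [mapVars_lam]; nofun)

theorem HeadForm.of_mapVars {n m k : ℕ} {M : Lam V n} {g : V ⊕ Fin n → V ⊕ Fin m} {d : Node V}
    (h : HeadForm (M.mapVars g) k d) : ∃ d', HeadForm M k d' := by
  generalize hA : M.mapVars g = A at h
  induction h generalizing n with
  | spine y Ms =>
    obtain ⟨w, Ms, rfl⟩ := exists_apps_of_mapVars hA
    exact ⟨_, .spine w Ms⟩
  | lam _ ih =>
    cases M with
    | fvar x => exact absurd hA (ofVar_ne_lam _ _)
    | bvar i => exact absurd hA (ofVar_ne_lam _ _)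
    | app => exact absurd hA nofun
    | lam A =>
      rw [mapVars_lam, lam.injEq] at hA
      obtain ⟨d', h⟩ := ih hA
      exact ⟨d', .lam h⟩

theorem Solvable.of_mapVars {n m : ℕ} {M : Lam V n} {g : V ⊕ Fin n → V ⊕ Fin m}
    (h : Solvable (M.mapVars g)) : Solvable M := by
  obtain ⟨k, d, A, hA, hd⟩ := solvable_iff.1 h
  obtain ⟨B, hB, rfl⟩ := hA.of_mapVars
  obtain ⟨d', hd'⟩ := hd.of_mapVars
  exact solvable_iff.2 ⟨k, d', B, hB, hd'⟩

/-- Renaming of the variable in a label. -/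
def BTLabel.map (φ : V ⊕ ℕ → V ⊕ ℕ) : BTLabel V → BTLabel V
  | bot => bot
  | head k y => head k (φ y)

theorem BTAt.mapVars {φ : V ⊕ ℕ → V ⊕ ℕ} {n m : ℕ} {M : Lam V n} {p : List ℕ} {l : BTLabel V}
    (h : BTAt M p l) {g : V ⊕ Fin n → V ⊕ Fin m} (hg : Compat φ g) :
    BTAt (M.mapVars g) p (l.map φ) := by
  induction p generalizing n m with
  | nil =>
    obtain ⟨h₀, rfl⟩ | ⟨k, d, h₀, rfl⟩ := bTAt_nil.1 h
    · exact .bot fun h' => h₀ h'.of_mapVars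
    · obtain ⟨m', g', hg', h'⟩ := h₀.mapVars hg
      refine bTAt_nil.2 (.inr ⟨k, _, h', ?_⟩)
      rw [Node.label, Node.label, BTLabel.map, hg'.1]
  | cons i p ih =>
    obtain ⟨k, d, N, h, hN, hl⟩ := bTAt_cons.1 h
    obtain ⟨m', g', hg', h'⟩ := h.mapVars hg
    exact bTAt_cons.2 ⟨k, _, N.mapVars g', h', by simp [hN], ih hl hg'⟩

/-- Replace the outermost bound variable by `x`. -/
def openWith (x : V) (M : Lam V 1) : Lam V 0 :=
  M.mapVars (Sum.elim Sum.inl fun _ => Sum.inl x)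

/-- Bind the variable `x`. -/
def closeVars (x : V) : V ⊕ Fin 0 → V ⊕ Fin 1 :=
  open scoped Classical in Sum.elim (fun z => if z = x then .inr 0 else .inl z) Fin.elim0

theorem abs_eq (x : V) (M : Lam V 0) : abs x M = lam (M.mapVars (closeVars x)) := by
  refine congrArg lam (subst_congr M (fun z _ => ?_) fun i => i.elim0)
  by_cases h : z = x <;> simp [closeVars, h, ofVar]

theorem close_open {x : V} {M : Lam V 1} (hx : (x : ℕ) ∉ M.fv) :
    (M.openWith x).mapVars (closeVars x) = M := by
  rw [openWith, mapVars_mapVars]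
  refine Eq.trans (subst_congr M (fun z hz => ?_) fun i => ?_) (subst_id M)
  · have : z ≠ x := by
      rintro rfl
      exact hx hz
    simp [closeVars, this, ofVar]
  · obtain rfl := Subsingleton.elim i 0
    simp [closeVars, ofVar]

/-- The passage from nameless abstractions to the named ones in terms of which the conditions on
encodings are stated. -/
theorem abs_open {x : V} {M : Lam V 1} (hx : (x : ℕ) ∉ M.fv) : abs x (M.openWith x) = lam M := by
  rw [abs_eq, close_open hx]

theorem fv_open {x : V} {M : Lam V 1} : (M.openWith x).fv ⊆ insert (x : ℕ) M.fv := by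
  intro z hz
  obtain ⟨y, hy, h⟩ | ⟨i, h⟩ := fv_subst M hz
  · simp only [Sum.elim_inl, ofVar, fv, Finset.mem_singleton] at h
    exact Finset.mem_insert_of_mem (h ▸ hy)
  · simp only [Sum.elim_inr, ofVar, fv, Finset.mem_singleton] at h
    exact h ▸ Finset.mem_insert_self _ _

theorem open_substVar {x : V} {M : Lam V 1} (hx : (x : ℕ) ∉ M.fv) (N : Lam V 0) :
    (M.openWith x).substVar x N = M.inst N := by
  rw [openWith, mapVars, substVar, subst_subst, inst]
  refine subst_congr M (fun z hz => ?_) fun i => ?_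
  · have : z ≠ x := by
      rintro rfl
      exact hx hz
    simp [this, ofVar, subst]
  · obtain rfl := Subsingleton.elim i (Fin.last 0)
    rw [Fin.snoc_last (α := fun _ => Lam V 0)]
    simp [ofVar, subst]

/-- The action on labels of the replacement of the outermost bound variable by `x`. -/
def openLabel (x : V) : V ⊕ ℕ → V ⊕ ℕ :=
  Sum.elim Sum.inl fun i => if i = 0 then .inl x else .inr (i - 1)

theorem compat_open (x : V) :
    Compat (openLabel x) (Sum.elim Sum.inl fun _ : Fin 1 => (Sum.inl x : V ⊕ Fin 0)) := by
  refine ⟨?_, fun k => ?_⟩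
  · rintro (z | i)
    · rfl
    · simp [openLabel]
  · have : 1 + k ≠ 0 := by omega
    simp [openLabel]

theorem HasHnf.openWith {k : ℕ} {M : Lam V 1} {d : Node V} (h : HasHnf M k d) (x : V) :
    ∃ d', HasHnf (M.openWith x) k d' := by
  obtain ⟨m, g', -, h'⟩ := h.mapVars (compat_open x)
  exact ⟨_, h'⟩

/-- Closing undoes opening, and on labels `ψ` undoes `openLabel x` except where `x` itself is named.
As `x` is fresh for `M`, no label of its tree names `x`. -/
theorem bTAt_open_mono {x : V} {M N : Lam V 1} {p : List ℕ} (hM : (x : ℕ) ∉ M.fv)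
    (hN : (x : ℕ) ∉ N.fv) :
    (∀ l, BTAt (M.openWith x) p l → BTAt (N.openWith x) p l) ↔ ∀ l, BTAt M p l → BTAt N p l := by
  classical
  let ψ : V ⊕ ℕ → V ⊕ ℕ :=
    Sum.elim (fun z => if z = x then .inr 0 else .inl z) fun i => .inr (i + 1)
  have hφ := compat_open x
  have hψ : Compat ψ (closeVars x) := by
    refine ⟨?_, fun k => ?_⟩
    · rintro (z | i)
      · by_cases h : z = x <;> simp [ψ, closeVars, h]
      · exact i.elim0
    · simp [ψ, Nat.add_comm]
  have hφψ : ∀ l : BTLabel V, (l.map ψ).map (openLabel x) = l := by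
    rintro (_ | ⟨k, z | i⟩)
    · rfl
    · by_cases h : z = x <;> simp [BTLabel.map, openLabel, ψ, h]
    · simp [BTLabel.map, openLabel, ψ]
  have hψφ : ∀ l : BTLabel V, (∀ k, l ≠ .head k (.inl x)) → (l.map (openLabel x)).map ψ = l := by
    rintro (_ | ⟨k, z | i⟩) h
    · rfl
    · have : z ≠ x := by
        rintro rfl
        exact h k rfl
      simp [BTLabel.map, openLabel, ψ, this]
    · by_cases hi : i = 0
      · simp [BTLabel.map, openLabel, ψ, hi]
      · simp only [BTLabel.map, openLabel, ψ, Sum.elim_inr, if_neg hi]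
        congr 2
        omega
  constructor
  · intro h l hl
    have := (h _ (hl.mapVars hφ)).mapVars hψ
    rwa [close_open hN, hψφ] at this
    exact fun k e => hM (hl.mem_fv e)
  · intro h l hl
    have := hl.mapVars hψ
    rw [close_open hM] at this
    have := (h _ this).mapVars hφ
    rwa [hφψ] at this

/-! ### Unsolvable terms -/

theorem uncovers_iff {M : Lam V 0} {k : ℕ} :
    Uncovers M k ↔ ∃ M', HeadRed M M' ∧ HasLams k M' := by
  constructor
  · rintro ⟨N, hN⟩
    exact ⟨_, hN, hasLams_iff.2 ⟨N, rfl⟩⟩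
  · rintro ⟨M', hM, h⟩
    obtain ⟨N, rfl⟩ := hasLams_iff.1 h
    exact ⟨N, hM⟩

theorem HasLams.of_succ {n k : ℕ} {M : Lam V n} (h : HasLams (k + 1) M) : HasLams k M := by
  induction k generalizing n with
  | zero => exact .zero M
  | succ k ih =>
    cases h with
    | succ h => exact .succ (ih h)

theorem HasLams.of_mapVars {n m k : ℕ} {M : Lam V n} {g : V ⊕ Fin n → V ⊕ Fin m}
    (h : HasLams k (M.mapVars g)) : HasLams k M := by
  generalize hA : M.mapVars g = A at h
  induction h generalizing n with
  | zero => exact .zero M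
  | succ _ ih =>
    cases M with
    | fvar x => exact absurd hA (ofVar_ne_lam _ _)
    | bvar i => exact absurd hA (ofVar_ne_lam _ _)
    | app => exact absurd hA nofun
    | lam A =>
      rw [mapVars_lam, lam.injEq] at hA
      exact .succ (ih hA)

theorem Uncovers.of_le {M : Lam V 0} {j k : ℕ} (h : Uncovers M k) (hjk : j ≤ k) :
    Uncovers M j := by
  induction hjk with
  | refl => exact h
  | step _ ih =>
    obtain ⟨M', hM, h⟩ := uncovers_iff.1 h
    exact ih (uncovers_iff.2 ⟨M', hM, h.of_succ⟩)

theorem uncovers_zero (M : Lam V 0) : Uncovers M 0 := ⟨M, .refl⟩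

theorem Uncovers.exists_lam {M : Lam V 0} (h : Uncovers M 1) : ∃ P, HeadRed M (lam P) := by
  obtain ⟨M', hM, h⟩ := uncovers_iff.1 h
  cases h with
  | succ => exact ⟨_, hM⟩

/-- Reductions after the replacement of the bound variable by `x` lift to reductions before it, with
the same abstractions uncovered. -/
theorem Uncovers.of_open {M : Lam V 0} {P : Lam V 1} {x : V} {k : ℕ} (hM : HeadRed M (lam P))
    (h : Uncovers (P.openWith x) k) : Uncovers M (k + 1) := by
  obtain ⟨M', hM', h⟩ := uncovers_iff.1 h
  obtain ⟨P', hP, rfl⟩ := hM'.of_mapVars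
  exact uncovers_iff.2 ⟨_, hM.trans hP.lam, .succ h.of_mapVars⟩

theorem unsolvableOfOrder_zero {M : Lam V 0} (h : ¬ Solvable M) (h' : ¬ Uncovers M 1) :
    M.UnsolvableOfOrder 0 := by
  refine ⟨h, uncovers_zero M, fun j hj => ?_⟩
  by_contra hj'
  exact h' (hj.of_le (by omega))

/-- A term `Ξ` that reduces to `λ x. Ξ`. -/
def ogre (n : ℕ) : Lam V n :=
  app (lam (lam (app (bvar (Fin.last n).castSucc) (bvar (Fin.last n).castSucc))))
    (lam (lam (app (bvar (Fin.last n).castSucc) (bvar (Fin.last n).castSucc))))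

theorem headRed_ogre (n : ℕ) : HeadRed (ogre n : Lam V n) (lam (ogre (n + 1))) := by
  refine .single (.spine ?_)
  have : (lam (ogre (n + 1)) : Lam V n) =
      inst (lam (app (bvar (Fin.last n).castSucc) (bvar (Fin.last n).castSucc)))
        (lam (lam (app (bvar (Fin.last n).castSucc) (bvar (Fin.last n).castSucc)))) := by
    rw [inst, subst_lam]
    simp [subst, liftSubst_castSucc, ogre, weaken, rename, liftFin_castSucc, liftFin_last]
  rw [this]
  exact .beta _ _

theorem fv_ogre (n : ℕ) : (ogre n : Lam V n).fv = ∅ := rfl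

theorem ogre_openWith (x : V) : (ogre 1 : Lam V 1).openWith x = ogre 0 := by
  have h : ∀ g : V ⊕ Fin 1 → V ⊕ Fin 0, liftVars (liftVars g) (.inr (Fin.last 1).castSucc) =
      .inr (Fin.last 0).castSucc := by
    intro g
    rw [liftVars, Fin.lastCases_castSucc, liftVars, Fin.lastCases_last]
    rfl
  simp only [openWith, ogre, mapVars_app, mapVars_lam]
  simp only [mapVars, subst, h, ofVar]

/-- Infinite descent: a head normal form with `k + 1` abstractions would give the next copy one with
`k`, and one with none is impossible. -/
theorem not_solvable_ogre (n : ℕ) : ¬ Solvable (ogre n : Lam V n) := by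
  rw [solvable_iff]
  rintro ⟨k, d, h⟩
  induction k generalizing n with
  | zero =>
    rw [hasHnf_of_headRed (headRed_ogre n), hasHnf_lam] at h
    obtain ⟨k, h, -⟩ := h
    cases h
  | succ k ih =>
    rw [hasHnf_of_headRed (headRed_ogre n), hasHnf_lam] at h
    obtain ⟨k', h, h'⟩ := h
    cases h
    exact ih _ h'

theorem unsolvableInfinite_ogre : (ogre 0 : Lam V 0).UnsolvableInfinite := by
  refine ⟨not_solvable_ogre 0, fun k => uncovers_iff.2 ?_⟩
  suffices ∀ n, ∃ M' : Lam V n, HeadRed (ogre n) M' ∧ HasLams k M' from this 0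
  induction k with
  | zero => exact fun n => ⟨_, .refl, .zero _⟩
  | succ k ih =>
    intro n
    obtain ⟨M', h₁, h₂⟩ := ih (n + 1)
    exact ⟨_, (headRed_ogre n).trans h₁.lam, .succ h₂⟩

end Lam

/-! ## Closure properties of the relations on agents -/

theorem Env.Join.extends {A B C : Env} (h : Env.Join A B C) (hA : A.Unrestricted) :
    C.Extends B := by
  refine ⟨fun x T hx => ⟨T, ?_, Env.hasTy_singleton x T⟩, fun x hx hC => ?_⟩
  · by_cases hT : T.Linear
    · have hj := h x
      rw [hx] at hj
      generalize hA' : A.lookup x = o at hj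
      generalize C.lookup x = c at hj
      cases hj with
      | right => rfl
      | both hc =>
        obtain ⟨-, rfl, rfl⟩ | ⟨hl, -⟩ := hc.linConn_or_same
        · rfl
        · exact absurd ⟨_, hA', hl⟩ (hA x)
    · exact h.symm.lookup_left hx hT
  · exact (h.linearAt hC).elim (hA x) (Env.not_linearAt_of_lookup hx)

/-- The substitution lemma of the type system, read off from `Clo.subst` on the diagonal with no
leaves at all. -/
theorem Proc.Typed.subst {Γ Θ : Env} {P : Proc 0} (h : P.Typed Γ) {σ : ℕ → ℕ}
    (hσ : Env.IsSubst σ Γ Θ) : (P.subst σ).Typed Θ :=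
  (((Clo.of_typed (S := fun _ _ _ => False) true h).subst (fun _ _ _ h => h.elim) hσ).typed
    fun _ _ _ h => h.elim).1

theorem Agent.Typed.inst1 {Γ : Env} {F : Proc 1} {T : Ty 0}
    (h : (Agent.abs F).Typed Γ (.abs T)) {z : ℕ} (hz : Γ.lookup z = none) :
    (F.inst1 z).Typed (Γ.insert z T) :=
  (((AbsClo.of_typed (S := fun _ _ _ => False) true h).inst1 (fun _ _ _ h => h.elim) hz).typed
    fun _ _ _ h => h.elim).1

/-! ### Closure of plain precongruences and of typed congruences under substitutions -/

/-- The substitution that acts as `σ` on the names that satisfy `p`. -/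
noncomputable def restrictSubst (p : ℕ → Prop) (σ : ℕ → ℕ) (x : ℕ) : ℕ :=
  open scoped Classical in if p x then σ x else x

theorem restrictSubst_of {p : ℕ → Prop} {σ : ℕ → ℕ} {x : ℕ} (h : p x) :
    restrictSubst p σ x = σ x := if_pos h

theorem restrictSubst_of_not {p : ℕ → Prop} {σ : ℕ → ℕ} {x : ℕ} (h : ¬ p x) :
    restrictSubst p σ x = x := if_neg h

namespace IsPrecongruence

variable {le : Agent → Agent → Prop}

/-- Application to `b` is a context, and plainness turns it into instantiation. -/
theorem inst1 (h : IsPrecongruence le) (hp : IsPlain le) {F F' : Proc 1}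
    (hF : le (.abs F) (.abs F')) (b : ℕ) : le (.proc (F.inst1 b)) (.proc (F'.inst1 b)) :=
  h.trans _ _ _ (hp F b).1 (h.trans _ _ _
    (h.proc 0 1 (.appHole 0 b) Fin.elim0 Fin.elim0 (fun _ => F) (fun _ => F') nofun fun _ => hF)
    (hp F' b).2)

theorem bind1 (h : IsPrecongruence le) {P Q : Proc 0} (hPQ : le (.proc P) (.proc Q)) (x : ℕ) :
    le (.abs (P.bind1 x)) (.abs (Q.bind1 x)) :=
  h.abs 1 0 (.abs x (.hole 0)) (fun _ => P) (fun _ => Q) Fin.elim0 Fin.elim0 (fun _ => hPQ) nofun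

theorem subst_update (h : IsPrecongruence le) (hp : IsPlain le) {P Q : Proc 0}
    (hPQ : le (.proc P) (.proc Q)) (x y : ℕ) :
    le (.proc (P.subst (Function.update id x y))) (.proc (Q.subst (Function.update id x y))) := by
  have := h.inst1 hp (h.bind1 hPQ x) y
  rwa [Proc.bind1_inst1, Proc.bind1_inst1] at this

/-- As no value lies in `s`, the simultaneous substitution is a sequence of single ones, each
obtained by abstracting a name and instantiating. -/
theorem subst_restrict (h : IsPrecongruence le) (hp : IsPlain le) {P Q : Proc 0}
    (hPQ : le (.proc P) (.proc Q)) {s : Finset ℕ} {σ : ℕ → ℕ} (hσ : ∀ x ∈ s, σ x ∉ s) :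
    le (.proc (P.subst (restrictSubst (· ∈ s) σ))) (.proc (Q.subst (restrictSubst (· ∈ s) σ))) := by
  induction s using Finset.induction_on with
  | empty =>
    have : restrictSubst (· ∈ (∅ : Finset ℕ)) σ = id := funext fun x =>
      restrictSubst_of_not (Finset.notMem_empty x)
    rwa [this, Proc.subst_id, Proc.subst_id]
  | insert x s hx ih =>
    have := h.subst_update hp (ih fun z hz h => hσ z (Finset.mem_insert_of_mem hz)
      (Finset.mem_insert_of_mem h)) x (σ x)
    rw [Proc.subst_subst, Proc.subst_subst] at this
    convert this using 4 <;>
    · funext z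
      rw [Function.comp_apply]
      by_cases hz : z ∈ s
      · have hzx : σ z ≠ x := fun e => hσ z (Finset.mem_insert_of_mem hz)
          (e ▸ Finset.mem_insert_self _ _)
        rw [restrictSubst_of (Finset.mem_insert_of_mem hz), restrictSubst_of hz,
          Function.update_of_ne hzx, id]
      · rw [restrictSubst_of_not (p := (· ∈ s)) hz]
        by_cases hzx : z = x
        · subst hzx
          rw [restrictSubst_of (Finset.mem_insert_self _ _), Function.update_self]
        · rw [restrictSubst_of_not, Function.update_of_ne hzx, id]
          exact fun h => (Finset.mem_insert.1 h).elim hzx hz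

/-- Plain precongruences are closed under substitutions. -/
theorem subst (h : IsPrecongruence le) (hp : IsPlain le) {P Q : Proc 0}
    (hPQ : le (.proc P) (.proc Q)) (σ : ℕ → ℕ) :
    le (.proc (P.subst σ)) (.proc (Q.subst σ)) := by
  set s := P.fn ∪ Q.fn with hs
  -- The substitution is factored through fresh names, so that each factor has its values outside
  -- its domain and can be carried out name by name.
  obtain ⟨τ, hτ, -⟩ := exists_perm_avoid 1 s (s ∪ s.image σ)
  simp only [Finset.mem_union, not_or] at hτ
  have h₁ := h.subst_restrict hp hPQ (s := s) (σ := τ) fun x hx => (hτ x hx).1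
  have h₂ := h.subst_restrict hp h₁ (s := s.image τ) (σ := σ ∘ τ.symm) fun y hy h => by
    obtain ⟨x, hx, rfl⟩ := Finset.mem_image.1 hy
    obtain ⟨w, hw, e⟩ := Finset.mem_image.1 h
    rw [Function.comp_apply, Equiv.symm_apply_apply] at e
    exact (hτ w hw).2 (e ▸ Finset.mem_image_of_mem σ hx)
  rw [Proc.subst_subst, Proc.subst_subst] at h₂
  have key : ∀ z ∈ s, (restrictSubst (· ∈ s.image τ) (σ ∘ τ.symm) ∘ restrictSubst (· ∈ s) τ) z =
      σ z := by
    intro z hz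
    rw [Function.comp_apply, restrictSubst_of hz, restrictSubst_of (Finset.mem_image_of_mem _ hz),
      Function.comp_apply, Equiv.symm_apply_apply]
  rwa [Proc.subst_congr P fun z hz => key z (Finset.mem_union_left _ hz),
    Proc.subst_congr Q fun z hz => key z (Finset.mem_union_right _ hz)] at h₂

end IsPrecongruence

namespace IsTypedCongruence

variable {eqv : TypedRel} {le : Agent → Agent → Prop}

theorem proc_typed (h : IsTypedCongruence eqv) {Γ : Env} {P Q : Proc 0}
    (hPQ : eqv Γ .proc (.proc P) (.proc Q)) : P.Typed Γ ∧ Q.Typed Γ := by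
  obtain ⟨h₁, h₂⟩ := h.typed _ _ _ _ hPQ
  cases h₁ with
  | proc h₁ =>
  cases h₂ with
  | proc h₂ => exact ⟨h₁, h₂⟩

theorem extend (h : IsTypedCongruence eqv) {Γ Θ : Env} {P Q : Proc 0}
    (hPQ : eqv Γ .proc (.proc P) (.proc Q)) (hΘ : Θ.Extends Γ) :
    eqv Θ .proc (.proc P) (.proc Q) :=
  h.proc 1 0 (.hole 0) (fun _ => Γ) Fin.elim0 Θ (fun _ => P) (fun _ => Q) Fin.elim0 Fin.elim0
    (.hole hΘ) (fun _ => hPQ) nofun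

/-- Plainness is a property of `≥`; on typed agents it passes to `≍` by inclusion. -/
theorem plain (h : IsTypedCongruence eqv) (hc : ContainsConverse eqv le) (hp : IsPlain le)
    {Γ : Env} {F F' : Proc 1} {b : ℕ} (hF : (F.inst1 b).Typed Γ) (hF' : (F'.inst1 b).Typed Γ)
    (hFF' : eqv Γ .proc (.proc (.app F (.fr b))) (.proc (.app F' (.fr b)))) :
    eqv Γ .proc (.proc (F.inst1 b)) (.proc (F'.inst1 b)) := by
  obtain ⟨h₁, h₂⟩ := h.proc_typed hFF'
  exact h.trans _ _ _ _ _ (hc _ _ _ _ (.proc hF) (.proc h₁) (hp F b).2)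
    (h.trans _ _ _ _ _ hFF' (hc _ _ _ _ (.proc h₂) (.proc hF') (hp F' b).1))

theorem inst1 (h : IsTypedCongruence eqv) (hc : ContainsConverse eqv le) (hp : IsPlain le)
    {Γ : Env} {F F' : Proc 1} {T : Ty 0} (hF : eqv Γ (.abs T) (.abs F) (.abs F')) {z : ℕ}
    (hz : Γ.lookup z = none) :
    eqv (Γ.insert z T) .proc (.proc (F.inst1 z)) (.proc (F'.inst1 z)) := by
  obtain ⟨h₁, h₂⟩ := h.typed _ _ _ _ hF
  refine h.plain hc hp (h₁.inst1 hz) (h₂.inst1 hz) ?_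
  exact h.proc 0 1 (.appHole 0 z) Fin.elim0 (fun _ => (Γ, T)) _ Fin.elim0 Fin.elim0 (fun _ => F)
    (fun _ => F') (.appHole (Env.extends_refl Γ) (Env.hasTy_singleton z T)
      (Env.join_singleton T hz).symm) nofun fun _ => hF

theorem of_inst1 (h : IsTypedCongruence eqv) {Γ : Env} {F F' : Proc 1} {T : Ty 0} {z : ℕ}
    (hFF' : eqv (Γ.insert z T) .proc (.proc (F.inst1 z)) (.proc (F'.inst1 z)))
    (hz : Γ.lookup z = none) (hF : z ∉ F.fn) (hF' : z ∉ F'.fn) :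
    eqv Γ (.abs T) (.abs F) (.abs F') := by
  have := h.abs 1 0 (.abs z (.hole 0)) (fun _ => Γ.insert z T) Fin.elim0 Γ T (fun _ => F.inst1 z)
    (fun _ => F'.inst1 z) Fin.elim0 Fin.elim0
    (.abs (Env.not_linearAt_of_lookup hz) (.hole (Env.extends_refl _))) (fun _ => hFF') nofun
  simpa only [ACtx.fill, PCtx.fill, Proc.inst1_bind1 _ hF, Proc.inst1_bind1 _ hF'] using this

theorem subst_update (h : IsTypedCongruence eqv) (hc : ContainsConverse eqv le) (hp : IsPlain le)
    {Γ₁ Γ₂ Γ : Env} {P Q : Proc 0} {x b : ℕ} {T : Ty 0}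
    (hPQ : eqv (Γ₁.insert x T) .proc (.proc P) (.proc Q)) (hx : Γ₁.lookup x = none)
    (hb : Γ₂.HasTy b T) (hj : Env.Join Γ₁ Γ₂ Γ) :
    eqv Γ .proc (.proc (P.subst (Function.update id x b)))
      (.proc (Q.subst (Function.update id x b))) := by
  have hs : Env.IsSubst (Function.update id x b) (Γ₁.insert x T) Γ := by
    refine .cons hx ?_ ((Env.isSubst_id Γ₁).congr fun z hz => ?_) hj.symm
    · rwa [Function.update_self]
    · rw [Function.update_of_ne]
      rintro rfl
      exact hz hx
  obtain ⟨h₁, h₂⟩ := h.proc_typed hPQ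
  rw [← Proc.bind1_inst1, ← Proc.bind1_inst1]
  refine h.plain hc hp ?_ ?_ ?_
  · rw [Proc.bind1_inst1]
    exact h₁.subst hs
  · rw [Proc.bind1_inst1]
    exact h₂.subst hs
  · exact h.proc 1 0 (.app x (.hole 0) b) (fun _ => Γ₁.insert x T) Fin.elim0 Γ (fun _ => P)
      (fun _ => Q) Fin.elim0 Fin.elim0
      (.app (Env.not_linearAt_of_lookup hx) (.hole (Env.extends_refl _)) hb hj)
      (fun _ => hPQ) nofun

/-- Typed analogue of `subst_restrict`. The names of `Δ` are replaced one after the other while the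
remainder `Ξ` of the environment stays; the disjointness hypothesis prevents a replaced name from
being replaced again. -/
theorem subst_disjoint (h : IsTypedCongruence eqv) (hc : ContainsConverse eqv le)
    (hp : IsPlain le) {σ : ℕ → ℕ} {Δ Θ : Env} (hσ : Env.IsSubst σ Δ Θ) :
    ∀ {Ξ Φ Ψ : Env} {P Q : Proc 0}, Env.Join Δ Ξ Φ → Env.Join Θ Ξ Ψ →
      (∀ x, Δ.lookup x ≠ none → Θ.lookup x = none ∧ Ξ.lookup x = none) →
      eqv Φ .proc (.proc P) (.proc Q) →
      eqv Ψ .proc (.proc (P.subst (restrictSubst (fun x => Δ.lookup x ≠ none) σ)))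
        (.proc (Q.subst (restrictSubst (fun x => Δ.lookup x ≠ none) σ))) := by
  induction hσ with
  | nil hu =>
    intro Ξ Φ Ψ P Q hΦ hΨ _ hPQ
    have e : restrictSubst (fun x => (∅ : Env).lookup x ≠ none) σ = id := funext fun x =>
      restrictSubst_of_not fun h => h (Finmap.lookup_empty x)
    rw [e, Proc.subst_id, Proc.subst_id]
    rw [hΦ.eq_of_empty_left] at hPQ
    exact h.extend hPQ (hΨ.extends hu)
  | @cons Δ Γ₁ Γ₂ Θ x T hx hT hσ hj ih =>
    intro Ξ Φ Ψ P Q hΦ hΨ hdisj hPQ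
    have hxd := hdisj x (by rw [Finmap.lookup_insert]; simp)
    have hΔd : ∀ y, Δ.lookup y ≠ none → Θ.lookup y = none ∧ Ξ.lookup y = none := fun y hy =>
      hdisj y (by
        rw [Env.lookup_insert_eq]
        split_ifs
        · simp
        · exact hy)
    -- Once `x` has been replaced, the part `Γ₁` that types `σ x` belongs to the remainder.
    obtain ⟨Ξ', hΞ', hΨ'⟩ := hj.symm.assoc hΨ
    have hxΦ : Φ.lookup x = some T := by
      have := hΦ x
      rw [Finmap.lookup_insert, hxd.2] at this
      generalize Φ.lookup x = o at this
      cases this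
      rfl
    have hΦ' := hΦ.erase x
    rw [Env.erase_insert T hx, Env.erase_of_lookup hxd.2] at hΦ'
    obtain ⟨Φ', k₁, k₂⟩ : ∃ Φ', Env.Join Δ Ξ' Φ' ∧ Env.Join (Φ.erase x) Γ₁ Φ' := by
      have hd : ∀ y, Δ.lookup y ≠ none → Ξ'.lookup y = none := fun y hy => by
        have h₁ := hΞ' y
        rw [(hj.lookup_none (hΔd y hy).1).1, (hΔd y hy).2] at h₁
        generalize Ξ'.lookup y = o at h₁
        cases h₁
        rfl
      obtain ⟨Φ', hΦ''⟩ := Env.exists_env_of_forall (Δ.keys ∪ Ξ'.keys)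
        (r := fun y o => Env.JoinAt (Δ.lookup y) (Ξ'.lookup y) o) (fun y => by
          by_cases hy : Δ.lookup y = none
          · rw [hy]
            exact ⟨_, Env.joinAt_none_left _⟩
          · rw [hd y hy]
            exact ⟨_, (Env.joinAt_none_left _).symm⟩) fun y hy => by
          simp only [Finset.mem_union, not_or] at hy
          rw [Env.lookup_of_notMem_keys hy.1, Env.lookup_of_notMem_keys hy.2]
          exact .none
      have hΦ₂ : Env.Join Δ Ξ' Φ' := hΦ''
      obtain ⟨A, hA, hA'⟩ := hΞ'.symm.assoc' hΦ₂
      refine ⟨Φ', hΦ₂, ?_⟩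
      have : A = Φ.erase x := by
        refine Finmap.ext_lookup fun y => ?_
        have e₁ := hA y
        have e₂ := hΦ' y
        by_cases hy : Δ.lookup y = none
        · rw [hy] at e₁ e₂
          rw [e₁.eq_of_none_left, e₂.eq_of_none_left]
        · rw [(hΔd y hy).2] at e₁ e₂
          rw [e₁.symm.eq_of_none_left, e₂.symm.eq_of_none_left]
      rwa [← this]
    have hstep := h.subst_update hc hp (x := x) (b := σ x) (Γ₁ := Φ.erase x)
      (by rwa [Env.insert_erase hxΦ]) (Finmap.lookup_erase _ _) hT k₂
    have hfin := ih k₁ hΨ' (fun y hy => ⟨(hj.lookup_none (hΔd y hy).1).2, ?_⟩) hstep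
    · obtain ⟨hP, hQ⟩ := h.proc_typed hPQ
      have hσx : Δ.lookup (σ x) = none := by
        by_contra hne
        exact hj.lookup_ne_none_left hT.lookup_ne_none (hΔd _ hne).1
      have key : ∀ z, (restrictSubst (fun x => Δ.lookup x ≠ none) σ ∘
          Function.update id x (σ x)) z =
          restrictSubst (fun y => Finmap.lookup y (Δ.insert x T) ≠ none) σ z := by
        intro z
        rw [Function.comp_apply]
        by_cases hz : z = x
        · subst hz
          rw [Function.update_self, restrictSubst_of_not (not_not.2 hσx), restrictSubst_of]
          rw [Finmap.lookup_insert]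
          simp
        · rw [Function.update_of_ne hz, id]
          by_cases hd : Δ.lookup z = none <;> simp [restrictSubst, hz, hd]
      rw [Proc.subst_subst, Proc.subst_subst] at hfin
      rwa [funext key] at hfin
    · have h₁ := hΞ' y
      rw [(hj.lookup_none (hΔd y hy).1).1, (hΔd y hy).2] at h₁
      generalize Ξ'.lookup y = o at h₁
      cases h₁
      rfl

/-- The intermediate environment lives on the names chosen by `τ`. If these are fresh,
`subst_disjoint` applies to each of the two factors. -/
theorem _root_.Env.IsSubst.factor {σ : ℕ → ℕ} {Δ Θ : Env} (h : Env.IsSubst σ Δ Θ)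
    (τ : Equiv.Perm ℕ) : ∃ Δ', (∀ y, Δ'.lookup y ≠ none → Δ.lookup (τ.symm y) ≠ none) ∧
      Env.IsSubst τ Δ Δ' ∧ Env.IsSubst (σ ∘ τ.symm) Δ' Θ := by
  induction h with
  | nil hu => exact ⟨∅, fun y hy => (hy (Finmap.lookup_empty y)).elim,
      .nil Env.unrestricted_empty, .nil hu⟩
  | @cons Δ Γ₁ Γ₂ Γ x T hx hT _ hj ih =>
    obtain ⟨Δ', h₁, h₂, h₃⟩ := ih
    have hτ : Δ'.lookup (τ x) = none := by
      by_contra hne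
      have := h₁ _ hne
      rw [Equiv.symm_apply_apply] at this
      exact this hx
    refine ⟨Δ'.insert (τ x) T, fun y hy => ?_, ?_, ?_⟩
    · rw [Env.lookup_insert_eq] at hy ⊢
      by_cases e : y = τ x
      · rw [if_pos (by rw [e, Equiv.symm_apply_apply])]
        simp
      · rw [if_neg e] at hy
        rw [if_neg (by rintro rfl; exact e (Equiv.apply_symm_apply _ _).symm)]
        exact h₁ y hy
    · exact .cons hx (Env.hasTy_singleton _ T) h₂ (Env.join_singleton T hτ)
    · refine .cons hτ ?_ h₃ hj
      rwa [Function.comp_apply, Equiv.symm_apply_apply]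

/-- Typed congruences that contain the converse of a plain precongruence are closed under
well-typed substitutions. -/
theorem subst (h : IsTypedCongruence eqv) (hc : ContainsConverse eqv le) (hp : IsPlain le)
    {σ : ℕ → ℕ} {Δ Θ : Env} {P Q : Proc 0} (hPQ : eqv Δ .proc (.proc P) (.proc Q))
    (hσ : Env.IsSubst σ Δ Θ) : eqv Θ .proc (.proc (P.subst σ)) (.proc (Q.subst σ)) := by
  obtain ⟨τ, hτ, -⟩ := exists_perm_avoid 1 Δ.keys (Δ.keys ∪ Θ.keys)
  simp only [Finset.mem_union, not_or] at hτ
  obtain ⟨Δ', h₁, h₂, h₃⟩ := hσ.factor τ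
  have hfresh : ∀ y, Δ'.lookup y ≠ none → Δ.lookup y = none ∧ Θ.lookup y = none := fun y hy => by
    have := hτ _ (Env.mem_keys_iff.2 (h₁ y hy))
    rw [Equiv.apply_symm_apply] at this
    exact ⟨Env.lookup_of_notMem_keys this.1, Env.lookup_of_notMem_keys this.2⟩
  have e₁ := h.subst_disjoint hc hp h₂ (Env.join_empty_left Δ).symm (Env.join_empty_left Δ').symm
    (fun x hx => ⟨by_contra fun hne => hx (hfresh x hne).1, Finmap.lookup_empty x⟩) hPQ
  have e₂ := h.subst_disjoint hc hp h₃ (Env.join_empty_left Δ').symm (Env.join_empty_left Θ).symm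
    (fun x hx => ⟨(hfresh x hx).2, Finmap.lookup_empty x⟩) e₁
  rw [Proc.subst_subst, Proc.subst_subst] at e₂
  obtain ⟨hP, hQ⟩ := h.proc_typed hPQ
  have key : ∀ z, Δ.lookup z ≠ none → (restrictSubst (fun x => Δ'.lookup x ≠ none) (σ ∘ τ.symm) ∘
      restrictSubst (fun x => Δ.lookup x ≠ none) τ) z = σ z := by
    intro z hz
    rw [Function.comp_apply, restrictSubst_of (p := fun x => Δ.lookup x ≠ none) hz,
      restrictSubst_of (p := fun x => Δ'.lookup x ≠ none) (h₂.lookup_ne_none hz),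
      Function.comp_apply, Equiv.symm_apply_apply]
  rwa [Proc.subst_congr P fun z hz => key z (hP.lookup_ne_none z hz),
    Proc.subst_congr Q fun z hz => key z (hQ.lookup_ne_none z hz)] at e₂

end IsTypedCongruence

/-! ## Encodings of the lambda-calculus -/

theorem Env.lookup_const (X : Finset ℕ) (T : Ty 0) (x : ℕ) :
    (Env.const X T).lookup x = if x ∈ X then some T else none := by
  have key : ∀ l : List ℕ, Finmap.lookup x (Env.extend ∅ (l.map fun x => (x, T))) =
      if x ∈ l then some T else none := by
    intro l
    induction l with
    | nil => simp [Env.extend_nil]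
    | cons y l ih =>
      rw [List.map_cons, Env.extend_cons, Env.lookup_insert_eq, ih]
      by_cases h : x = y <;> simp [h]
  rw [Env.const, key]
  simp only [Finset.mem_toList]

theorem Env.lookup_const_of_notMem {X : Finset ℕ} (T : Ty 0) {x : ℕ} (h : x ∉ X) :
    (Env.const X T).lookup x = none := by
  rw [Env.lookup_const, if_neg h]

theorem PCtx.guardedOff_true {π α : Type} [IsEmpty π] (C : PCtx π α) :
    C.GuardedOff fun _ => True := by
  induction C with
  | hole i => exact isEmptyElim i
  | par _ _ ih₁ ih₂ => exact ⟨ih₁, ih₂⟩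
  | res _ _ _ ih | app _ _ _ ih => exact ih
  | _ => trivial

theorem ACtx.guardedOff_true {π α : Type} [IsEmpty π] (C : ACtx π α) :
    C.GuardedOff fun _ => True := by
  cases C with
  | abs x C => exact C.guardedOff_true
  | hole => trivial

namespace Lam

variable {V : Set ℕ}

def size : {n : ℕ} → Lam V n → ℕ
  | _, fvar _ => 0
  | _, bvar _ => 0
  | _, app M N => M.size + N.size + 1
  | _, lam M => M.size + 1

theorem size_mapVars {n m : ℕ} (g : V ⊕ Fin n → V ⊕ Fin m) (M : Lam V n) :
    (M.mapVars g).size = M.size := by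
  have key : ∀ v : V ⊕ Fin m, (ofVar v).size = 0 := by rintro (x | i) <;> rfl
  induction M generalizing m with
  | fvar x => exact key _
  | bvar i => exact key _
  | app M N ih₁ ih₂ => rw [mapVars_app, size, size, ih₁ _ key, ih₂ _ key]
  | lam M ih =>
    rw [mapVars_lam, size, size, ih]
    rintro (x | i) <;> rfl

end Lam

namespace Encoding

variable {V : Set ℕ}

/-- The conditions that are common to completeness and soundness. -/
structure CommonConditions (E : Encoding V) (Tv Tb : Ty 0) (eqv : TypedRel)
    (le : Agent → Agent → Prop) : Prop where
  infinite : V.Infinite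
  respects : E.Respects Tv Tb
  congruence : IsTypedCongruence eqv
  contains : ContainsConverse eqv le
  precongruence : IsPrecongruence le
  plain : IsPlain le
  beta : E.ValidatesBeta le
  unsolvable_zero : ∀ M X, Covers X M → M.UnsolvableOfOrder 0 → E.Rel Tv Tb eqv X M .omegaTerm
  unsolvable_infinite : ∀ M X, Covers X M → M.UnsolvableInfinite → E.Rel Tv Tb eqv X M .omegaTerm

theorem Covers.of_headRed {X : Finset ℕ} {M M' : Lam V 0} (h : Covers X M)
    (hM : M.HeadRed M') : Covers X M' := ⟨h.1, hM.fv_subset.trans h.2⟩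

theorem Covers.of_lam {X : Finset ℕ} {P : Lam V 1} (h : Covers X (.lam P)) (x : V) :
    Covers (insert (x : ℕ) X) (P.openWith x) := by
  refine ⟨?_, Lam.fv_open.trans (Finset.insert_subset_insert _ h.2)⟩
  rw [Finset.coe_insert, Set.insert_subset_iff]
  exact ⟨x.2, h.1⟩

theorem Covers.of_apps {X : Finset ℕ} {h : Lam V 0} {Ms : List (Lam V 0)}
    (hM : Covers X (.apps h Ms)) {N : Lam V 0} (hN : N ∈ Ms) : Covers X N :=
  ⟨hM.1, fun _ hz => hM.2 (Lam.mem_fv_apps.2 (.inr ⟨N, hN, hz⟩))⟩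

theorem covers_omega {X : Finset ℕ} (hX : (X : Set ℕ) ⊆ V) :
    Covers X (Lam.omegaTerm : Lam V 0) := ⟨hX, fun _ hz => by simp [Lam.omegaTerm, Lam.fv] at hz⟩

theorem covers_ogre {X : Finset ℕ} (hX : (X : Set ℕ) ⊆ V) :
    Covers X (Lam.ogre 0 : Lam V 0) := ⟨hX, fun _ hz => by simp [Lam.fv_ogre] at hz⟩

theorem _root_.Set.Infinite.exists_subtype_notMem (hV : V.Infinite) (X : Finset ℕ) :
    ∃ x : V, (x : ℕ) ∉ X := by
  obtain ⟨x, hx, hxX⟩ := hV.exists_notMem_finset X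
  exact ⟨⟨x, hx⟩, hxX⟩

theorem notMem_fn {X : Finset ℕ} (E : Encoding V) {M : Lam V 0} (h : Covers X M) {z : ℕ}
    (hz : z ∉ X) : z ∉ (E.enc M).fn := fun h' => hz (h.2 (E.fn_subset M h'))

section Typing

variable {E : Encoding V} {Tv Tb : Ty 0} {S : Env → Proc 0 → Proc 0 → Prop} {X : Finset ℕ}

/-- If the leaves of the body are already guarded, the hole of the abstraction context may be
anywhere; this is the choice of `True` for the admissible holes. No guardedness of abstraction
contexts is needed. -/
theorem Respects.lam_clo (hE : E.Respects Tv Tb) (hS : SubstClosed S) {x : V}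
    (hX : (X : Set ℕ) ⊆ V) (hx : (x : ℕ) ∉ X) {fl : Bool} {F F' : Proc 1}
    (h : AbsClo S fl (Env.const (insert (x : ℕ) X) Tv) Tb F F') :
    AbsClo S fl (Env.const X Tv) Tb ((E.lamCtx x).fill Fin.elim0 ![F])
      ((E.lamCtx x).fill Fin.elim0 ![F']) := by
  have h₁ : ∀ j : Fin 1, ![F] j = F := fun j => by obtain rfl := Subsingleton.elim j 0; rfl
  have h₂ : ∀ j : Fin 1, ![F'] j = F' := fun j => by obtain rfl := Subsingleton.elim j 0; rfl
  obtain rfl | rfl := fl.eq_false_or_eq_true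
  · exact (hE.lam X x hX hx).clo hS (G := fun _ => False) (fun j => by rwa [h₁, h₂])
      (fun _ => False.elim) (fun h => nomatch h)
  · exact (hE.lam X x hX hx).clo hS (G := fun _ => True)
      (fun j => by rw [h₁, h₂]; exact h.to_true) (fun j _ => by rwa [h₁, h₂])
      fun _ => ACtx.guardedOff_true _

theorem Respects.typed (hE : E.Respects Tv Tb) (hV : V.Infinite) {M : Lam V 0}
    (h : Covers X M) : (Agent.abs (E.enc M)).Typed (Env.const X Tv) (.abs Tb) := by
  induction hn : M.size using Nat.strong_induction_on generalizing M X with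
  | _ n ih =>
  have hS : SubstClosed fun _ _ _ => False := fun _ _ _ h => h.elim
  have hS' : WellTyped fun _ _ _ => False := fun _ _ _ h => h.elim
  cases M with
  | fvar x =>
    rw [E.enc_var]
    exact (((hE.var X x h.1 (h.2 (by simp [Lam.fv]))).clo hS (G := fun _ => False)
      (ρ := Fin.elim0) (ρ' := Fin.elim0) (φ := Fin.elim0) (φ' := Fin.elim0) (fl := true)
      (fun j => j.elim0) (fun _ => False.elim) (fun h => nomatch h)).typed hS').1
  | bvar i => exact i.elim0
  | app M N =>
    have hM := ih M.size (by simp only [← hn, Lam.size]; omega)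
      (X := X) ⟨h.1, Finset.union_subset_left h.2⟩ rfl
    have hN := ih N.size (by simp only [← hn, Lam.size]; omega)
      (X := X) ⟨h.1, Finset.union_subset_right h.2⟩ rfl
    rw [E.enc_app]
    refine (((hE.app X h.1).clo hS (G := fun _ => False) (ρ := Fin.elim0) (ρ' := Fin.elim0)
      (φ := ![E.enc M, E.enc N]) (φ' := ![E.enc M, E.enc N]) (fl := true) (fun j => ?_)
      (fun _ => False.elim) (fun h => nomatch h)).typed hS').1
    refine Fin.cases ?_ (fun j => ?_) j
    · exact .of_typed true hM
    · obtain rfl := Subsingleton.elim j 0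
      exact .of_typed true hN
  | lam P =>
    obtain ⟨x, hx⟩ := hV.exists_subtype_notMem X
    have hP := ih (P.openWith x).size (by
      simp only [← hn, Lam.size, Lam.openWith, Lam.size_mapVars]; omega) (h.of_lam x) rfl
    rw [← Lam.abs_open (x := x) fun hxP => hx (h.2 hxP), E.enc_lam]
    exact ((hE.lam_clo hS h.1 hx (AbsClo.of_typed true hP)).typed hS').1

end Typing

namespace CommonConditions

variable {E : Encoding V} {Tv Tb : Ty 0} {eqv : TypedRel} {le : Agent → Agent → Prop}
  {X : Finset ℕ}

theorem le_app (h : E.CommonConditions Tv Tb eqv le) {M M' N : Lam V 0}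
    (hM : le (.abs (E.enc M)) (.abs (E.enc M'))) :
    le (.abs (E.enc (.app M N))) (.abs (E.enc (.app M' N))) := by
  rw [E.enc_app, E.enc_app]
  refine h.precongruence.abs 0 2 _ _ _ _ _ nofun fun j => ?_
  refine Fin.cases hM (fun j => ?_) j
  exact h.precongruence.refl _

theorem le_fill_lam (h : E.CommonConditions Tv Tb eqv le) {F F' : Proc 1}
    (hF : le (.abs F) (.abs F')) (x : V) :
    le (.abs ((E.lamCtx x).fill Fin.elim0 ![F])) (.abs ((E.lamCtx x).fill Fin.elim0 ![F'])) := by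
  refine h.precongruence.abs 0 1 _ _ _ _ _ nofun fun j => ?_
  obtain rfl := Subsingleton.elim j 0
  exact hF

theorem le_abs (h : E.CommonConditions Tv Tb eqv le) {M M' : Lam V 0}
    (hM : le (.abs (E.enc M)) (.abs (E.enc M'))) (x : V) :
    le (.abs (E.enc (.abs x M))) (.abs (E.enc (.abs x M'))) := by
  rw [E.enc_lam, E.enc_lam]
  exact h.le_fill_lam hM x

/-- Rule β speaks of named abstractions, so the redex is opened with a fresh variable; the
surrounding applications are contexts. -/
theorem le_of_spineStep (h : E.CommonConditions Tv Tb eqv le) {M M' : Lam V 0}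
    (hM : M.SpineStep M') : le (.abs (E.enc M')) (.abs (E.enc M)) := by
  induction hM with
  | beta P N =>
    obtain ⟨x, hx⟩ := h.infinite.exists_subtype_notMem P.fv
    rw [← Lam.abs_open hx, ← Lam.open_substVar hx]
    exact h.beta x _ N
  | app N _ ih => exact h.le_app ih

theorem le_of_headStep (h : E.CommonConditions Tv Tb eqv le) {M M' : Lam V 0}
    (hM : M.HeadStep M') : le (.abs (E.enc M')) (.abs (E.enc M)) := by
  -- The body of an abstraction is opened before the induction hypothesis is used, which preserves
  -- its size but does not give a subterm.
  induction hn : M.size using Nat.strong_induction_on generalizing M M' with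
  | _ n ih =>
  cases hM with
  | spine hM => exact h.le_of_spineStep hM
  | @lam _ P P' hP =>
    obtain ⟨x, hx⟩ := h.infinite.exists_subtype_notMem P.fv
    rw [← Lam.abs_open hx, ← Lam.abs_open fun h => hx (hP.fv_subset h)]
    refine h.le_abs (ih (P.openWith x).size ?_ (hP.mapVars _) rfl) x
    rw [← hn, Lam.openWith, Lam.size_mapVars, Lam.size]
    exact Nat.lt_succ_self _

theorem le_of_headRed (h : E.CommonConditions Tv Tb eqv le) {M M' : Lam V 0}
    (hM : M.HeadRed M') : le (.abs (E.enc M')) (.abs (E.enc M)) := by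
  induction hM with
  | refl => exact h.precongruence.refl _
  | tail _ hM ih => exact h.precongruence.trans _ _ _ (h.le_of_headStep hM) ih

theorem typed (h : E.CommonConditions Tv Tb eqv le) {M : Lam V 0} (hM : Covers X M) :
    (Agent.abs (E.enc M)).Typed (Env.const X Tv) (.abs Tb) := h.respects.typed h.infinite hM

theorem rel_of_headRed (h : E.CommonConditions Tv Tb eqv le) {M M' : Lam V 0} (hX : Covers X M)
    (hM : M.HeadRed M') : E.Rel Tv Tb eqv X M M' :=
  h.contains _ _ _ _ (h.typed hX) (h.typed (hX.of_headRed hM)) (h.le_of_headRed hM)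

theorem rel_symm (h : E.CommonConditions Tv Tb eqv le) {M N : Lam V 0}
    (hM : E.Rel Tv Tb eqv X M N) : E.Rel Tv Tb eqv X N M := h.congruence.symm _ _ _ _ hM

theorem rel_trans (h : E.CommonConditions Tv Tb eqv le) {M N L : Lam V 0}
    (hM : E.Rel Tv Tb eqv X M N) (hN : E.Rel Tv Tb eqv X N L) : E.Rel Tv Tb eqv X M L :=
  h.congruence.trans _ _ _ _ _ hM hN

theorem rel_abs (h : E.CommonConditions Tv Tb eqv le) {M N : Lam V 0} {x : V}
    (hX : (X : Set ℕ) ⊆ V) (hx : (x : ℕ) ∉ X) (hM : E.Rel Tv Tb eqv (insert (x : ℕ) X) M N) :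
    E.Rel Tv Tb eqv X (.abs x M) (.abs x N) := by
  rw [Rel, E.enc_lam, E.enc_lam]
  refine h.congruence.abs 0 1 (E.lamCtx x) Fin.elim0 _ _ _ _ _ _ _ (h.respects.lam X x hX hx)
    nofun fun j => ?_
  obtain rfl := Subsingleton.elim j 0
  exact hM

/-- The chain λx.Ω ≍ λx.Ξ ≍ Ξ ≍ Ω for the term Ξ, namely `ogre 0`, which reduces to λx.Ξ and so has
order ∞. -/
theorem rel_abs_omega (h : E.CommonConditions Tv Tb eqv le) {x : V} (hX : (X : Set ℕ) ⊆ V)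
    (hx : (x : ℕ) ∉ X) : E.Rel Tv Tb eqv X (.abs x .omegaTerm) .omegaTerm := by
  have hX' : ((insert (x : ℕ) X : Finset ℕ) : Set ℕ) ⊆ V := by
    rw [Finset.coe_insert, Set.insert_subset_iff]
    exact ⟨x.2, hX⟩
  have h₁ := h.rel_abs hX hx (h.rel_symm
    (h.unsolvable_infinite _ _ (covers_ogre hX') Lam.unsolvableInfinite_ogre))
  rw [← Lam.ogre_openWith x, Lam.abs_open (by simp [Lam.fv_ogre])] at h₁
  exact h.rel_trans h₁ (h.rel_trans
    (h.rel_symm (h.rel_of_headRed (covers_ogre hX) (Lam.headRed_ogre 0)))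
    (h.unsolvable_infinite _ _ (covers_ogre hX) Lam.unsolvableInfinite_ogre))

/-- All unsolvable terms are related to `Ω`. -/
theorem rel_omega (h : E.CommonConditions Tv Tb eqv le) {M : Lam V 0} (hX : Covers X M)
    (hM : ¬ M.Solvable) : E.Rel Tv Tb eqv X M .omegaTerm := by
  -- Induction on a bound for the order. If `M` reduces to an abstraction, its body has a smaller
  -- bound and is related to Ω by induction; `rel_abs_omega` then absorbs the abstraction.
  have key : ∀ (k : ℕ) {X : Finset ℕ} {M : Lam V 0}, Covers X M → ¬ M.Solvable →
      ¬ M.Uncovers (k + 1) → E.Rel Tv Tb eqv X M .omegaTerm := by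
    intro k
    induction k with
    | zero => exact fun hX hM hk => h.unsolvable_zero _ _ hX (Lam.unsolvableOfOrder_zero hM hk)
    | succ k ih =>
      intro X M hX hM hk
      by_cases h₁ : M.Uncovers 1
      · obtain ⟨P, hP⟩ := h₁.exists_lam
        have hXP := hX.of_headRed hP
        obtain ⟨x, hx⟩ := h.infinite.exists_subtype_notMem X
        have hxP : (x : ℕ) ∉ P.fv := fun h => hx (hXP.2 h)
        have := ih (hXP.of_lam x)
          (fun hs => hM ((Lam.solvable_of_headRed hP).2 (Lam.solvable_lam.2 hs.of_mapVars)))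
          fun hu => hk (hu.of_open hP)
        have h₂ := h.rel_abs hX.1 hx this
        rw [Lam.abs_open hxP] at h₂
        exact h.rel_trans (h.rel_of_headRed hX hP) (h.rel_trans h₂ (h.rel_abs_omega hX.1 hx))
      · exact h.unsolvable_zero _ _ hX (Lam.unsolvableOfOrder_zero hM h₁)
  by_cases hk : ∀ k, M.Uncovers k
  · exact h.unsolvable_infinite _ _ hX ⟨hM, hk⟩
  · obtain ⟨k, hk⟩ := not_forall.1 hk
    exact key k hX hM fun h => hk (h.of_le (Nat.le_succ k))

theorem rel_of_unsolvable (h : E.CommonConditions Tv Tb eqv le) {M N : Lam V 0}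
    (hM : Covers X M) (hN : Covers X N) (hM' : ¬ M.Solvable) (hN' : ¬ N.Solvable) :
    E.Rel Tv Tb eqv X M N :=
  h.rel_trans (h.rel_omega hM hM') (h.rel_symm (h.rel_omega hN hN'))

end CommonConditions

end Encoding

/-! ## Completeness -/

namespace Lam

variable {V : Set ℕ}

/-- Equality of Boehm trees. -/
def BTEq {n : ℕ} (M N : Lam V n) : Prop := ∀ p l, BTAt M p l ↔ BTAt N p l

namespace BTEq

variable {n : ℕ}

theorem symm {M N : Lam V n} (h : BTEq M N) : BTEq N M := fun p l => (h p l).symm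

theorem of_headRed {M M' N N' : Lam V n} (h : BTEq M N) (hM : HeadRed M M') (hN : HeadRed N N') :
    BTEq M' N' := fun p l => by rw [← bTAt_of_headRed hM, ← bTAt_of_headRed hN, h p l]

theorem of_lam {M N : Lam V (n + 1)} (h : BTEq (lam M) (lam N)) : BTEq M N := fun p l =>
  ⟨bTAt_lam_mono.1 (fun l => (h p l).1) l, bTAt_lam_mono.1 (fun l => (h p l).2) l⟩

theorem openWith {M N : Lam V 1} (h : BTEq M N) {x : V} (hM : (x : ℕ) ∉ M.fv)
    (hN : (x : ℕ) ∉ N.fv) : BTEq (M.openWith x) (N.openWith x) := fun p l =>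
  ⟨(bTAt_open_mono hM hN).2 (fun l => (h p l).1) l,
    (bTAt_open_mono hN hM).2 (fun l => (h p l).2) l⟩

theorem solvable {M N : Lam V n} (h : BTEq M N) (hM : M.Solvable) : N.Solvable := by
  by_contra hN
  obtain ⟨h', -⟩ | ⟨k, d, -, h'⟩ := bTAt_nil.1 ((h _ _).2 (.bot hN))
  · exact h' hM
  · cases h'

theorem hasHnf {M N : Lam V n} (h : BTEq M N) {k : ℕ} {d : Node V} (hM : HasHnf M k d) :
    ∃ d', HasHnf N k d' := by
  obtain ⟨-, h'⟩ | ⟨k', d', h₁, h₂⟩ := bTAt_nil.1 ((h _ _).1 (bTAt_nil.2 (.inr ⟨k, d, hM, rfl⟩)))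
  · cases h'
  · obtain rfl := (BTLabel.head.inj h₂).1
    exact ⟨d', h₁⟩

/-- Every argument has a root label, so the positions of length one already determine the number of
arguments. -/
theorem of_apps {v w : V ⊕ Fin n} {Ms Ns : List (Lam V n)}
    (h : BTEq (apps (ofVar v) Ms) (apps (ofVar w) Ns)) :
    v.map id Fin.val = w.map id Fin.val ∧ List.Forall₂ BTEq Ms Ns := by
  constructor
  · have := bTAt_apps_nil.1 ((h _ _).1 (bTAt_apps_nil.2 rfl))
    simpa using this
  · have key : ∀ {v w : V ⊕ Fin n} {Ms Ns : List (Lam V n)},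
        BTEq (apps (ofVar v) Ms) (apps (ofVar w) Ns) → Ms.length ≤ Ns.length := by
      intro v w Ms Ns h
      by_contra! hl
      obtain ⟨l, hl'⟩ := exists_bTAt_nil Ms[Ns.length]
      obtain ⟨N, hN, -⟩ := bTAt_apps_cons.1 ((h [Ns.length] l).1
        (bTAt_apps_cons.2 ⟨_, List.getElem?_eq_getElem hl, hl'⟩))
      simp at hN
    refine List.forall₂_iff_get.2 ⟨(key h).antisymm (key h.symm), fun i hi hi' p l => ?_⟩
    have := h (i :: p) l
    simpa [bTAt_apps_cons, hi, hi'] using this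

end BTEq

theorem hasHnf_zero {M : Lam V 0} {d : Node V} (h : HasHnf M 0 d) :
    ∃ x Ms, HeadRed M (apps (fvar x) Ms) := by
  obtain ⟨A, hA, hd⟩ := h
  cases hd with
  | spine y Ms =>
    obtain x | i := y
    · exact ⟨x, Ms, hA⟩
    · exact i.elim0

theorem hasHnf_succ {n k : ℕ} {M : Lam V n} {d : Node V} (h : HasHnf M (k + 1) d) :
    ∃ P, HeadRed M (lam P) ∧ HasHnf P k d := by
  obtain ⟨A, hA, hd⟩ := h
  cases hd with
  | lam hP => exact ⟨_, hA, _, .refl, hP⟩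

end Lam

namespace Encoding

variable {V : Set ℕ}

/-- The encodings of terms with the same Boehm tree, applied to a name and up to well-typed
substitutions. -/
def BTRel (E : Encoding V) (Tv Tb : Ty 0) (Γ : Env) (P Q : Proc 0) : Prop :=
  ∃ (M N : Lam V 0) (X : Finset ℕ) (z : ℕ) (ρ : ℕ → ℕ), M.BTEq N ∧ M.Solvable ∧ Covers X M ∧
    Covers X N ∧ z ∉ X ∧ Env.IsSubst ρ ((Env.const X Tv).insert z Tb) Γ ∧
    P = ((E.enc M).inst1 z).subst ρ ∧ Q = ((E.enc N).inst1 z).subst ρ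

theorem enc_apps (E : Encoding V) (x : V) (n : ℕ) (Ms : Fin n → Lam V 0) :
    E.enc (.apps (.fvar x) (List.ofFn Ms)) =
      (E.varCtx x n).fill Fin.elim0 fun j => E.enc (Ms j) := by
  induction n with
  | zero =>
    rw [List.ofFn_zero]
    refine (E.enc_var x).trans ?_
    rw [varCtx]
    congr 1
    exact funext fun j => j.elim0
  | succ n ih =>
    rw [List.ofFn_succ', List.concat_eq_append, Lam.apps_append, E.enc_app, ih, varCtx,
      ACtx.fill_plug]
    congr 1
    funext j
    refine Fin.cases ?_ (fun j => ?_) j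
    · exact (ACtx.fill_plug (fun j : Fin n => .hole j.castSucc) Fin.elim0 (fun j => E.enc (Ms j))
        (E.varCtx x n)).symm
    · obtain rfl := Subsingleton.elim j 0
      rfl

theorem BTRel.symm {E : Encoding V} {Tv Tb : Ty 0} {Γ : Env} {P Q : Proc 0}
    (h : E.BTRel Tv Tb Γ P Q) : E.BTRel Tv Tb Γ Q P := by
  obtain ⟨M, N, X, z, ρ, h₁, h₂, h₃, h₄, h₅, h₆, h₇, h₈⟩ := h
  exact ⟨N, M, X, z, ρ, h₁.symm, h₁.solvable h₂, h₄, h₃, h₅, h₆, h₈, h₇⟩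

/-- The substitution `ρ` is part of `BTRel` for this purpose: the up-to technique requires closure
under substitutions for holes beneath inputs. -/
theorem substClosed_btRel (E : Encoding V) (Tv Tb : Ty 0) : SubstClosed (E.BTRel Tv Tb) := by
  rintro Γ P Q ⟨M, N, X, z, ρ, h₁, h₂, h₃, h₄, h₅, h₆, rfl, rfl⟩ σ Θ hσ
  exact ⟨M, N, X, z, σ ∘ ρ, h₁, h₂, h₃, h₄, h₅, h₆.comp hσ, by rw [Proc.subst_subst],
    by rw [Proc.subst_subst]⟩

namespace CommonConditions

variable {E : Encoding V} {Tv Tb : Ty 0} {eqv : TypedRel} {le : Agent → Agent → Prop}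
  {X : Finset ℕ}

theorem wellTyped_btRel (h : E.CommonConditions Tv Tb eqv le) : WellTyped (E.BTRel Tv Tb) := by
  rintro Γ P Q ⟨M, N, X, z, ρ, h₁, h₂, h₃, h₄, h₅, h₆, rfl, rfl⟩
  have hz := Env.lookup_const_of_notMem Tv h₅
  exact ⟨((h.typed h₃).inst1 hz).subst h₆, ((h.typed h₄).inst1 hz).subst h₆⟩

/-- Leaves of the contextual closure. -/
abbrev Leaf (E : Encoding V) (Tv Tb : Ty 0) (eqv : TypedRel) (Γ : Env) (P Q : Proc 0) : Prop :=
  eqv Γ .proc (.proc P) (.proc Q) ∨ E.BTRel Tv Tb Γ P Q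

theorem wellTyped_leaf (h : E.CommonConditions Tv Tb eqv le) : WellTyped (Leaf E Tv Tb eqv) :=
  fun _ _ _ hPQ => hPQ.elim h.congruence.proc_typed (h.wellTyped_btRel _ _ _)

theorem substClosed_leaf (h : E.CommonConditions Tv Tb eqv le) : SubstClosed (Leaf E Tv Tb eqv) :=
  fun _ _ _ hPQ _ _ hσ => hPQ.imp (fun h' => h.congruence.subst h.contains h.plain h' hσ)
    fun h' => E.substClosed_btRel Tv Tb _ _ _ h' _ _ hσ

theorem btRel_inst1 {M N : Lam V 0} (hMN : M.BTEq N) (hM : M.Solvable) (hXM : Covers X M)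
    (hXN : Covers X N) {z : ℕ} (hz : z ∉ X) :
    E.BTRel Tv Tb ((Env.const X Tv).insert z Tb) ((E.enc M).inst1 z) ((E.enc N).inst1 z) :=
  ⟨M, N, X, z, id, hMN, hM, hXM, hXN, hz, Env.isSubst_id _, (Proc.subst_id _).symm,
    (Proc.subst_id _).symm⟩

/-- A pair of arguments is one leaf: in `BTRel` if the terms are solvable, and in `≍` otherwise,
both terms then being related to Ω. -/
theorem absClo_leaf (h : E.CommonConditions Tv Tb eqv le) {M N : Lam V 0} (hMN : M.BTEq N)
    (hXM : Covers X M) (hXN : Covers X N) :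
    AbsClo (Leaf E Tv Tb eqv) true (Env.const X Tv) Tb (E.enc M) (E.enc N) := by
  obtain ⟨z, hz⟩ := Infinite.exists_notMem_finset X
  have hz' := Env.lookup_const_of_notMem Tv hz
  refine ⟨z, notMem_fn E hXM hz, notMem_fn E hXN hz, hz', .leaf ?_⟩
  by_cases hM : M.Solvable
  · exact .inr (btRel_inst1 hMN hM hXM hXN hz)
  · exact .inl (h.congruence.inst1 h.contains h.plain
      (h.rel_of_unsolvable hXM hXN hM fun hN => hM (hMN.symm.solvable hN)) hz')

/-- Induction on the number of arguments through the application context. By `guardedOff_of_plug`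
the hole of the last argument lies beneath a prefix, because a bare hole is not guarded; the
function part may be exposed only if its own variable context is guarded, and then its leaves are
guarded by induction. -/
theorem absClo_apps (h : E.CommonConditions Tv Tb eqv le)
    (hg : ∀ x n, (E.varCtx x n).Guarded) {x : V} (hX : (X : Set ℕ) ⊆ V) (hx : (x : ℕ) ∈ X) (n : ℕ)
    {Ms Ns : Fin n → Lam V 0} (hMN : ∀ j, (Ms j).BTEq (Ns j)) (hM : ∀ j, Covers X (Ms j))
    (hN : ∀ j, Covers X (Ns j)) :
    AbsClo (Leaf E Tv Tb eqv) false (Env.const X Tv) Tb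
      (E.enc (.apps (.fvar x) (List.ofFn Ms))) (E.enc (.apps (.fvar x) (List.ofFn Ns))) := by
  induction n with
  | zero =>
    rw [List.ofFn_zero, List.ofFn_zero]
    exact .of_typed false (h.typed ⟨hX, by simpa [Lam.apps, Lam.fv] using hx⟩)
  | succ n ih =>
    have h₁ := ih (fun j => hMN j.castSucc) (fun j => hM j.castSucc) fun j => hN j.castSucc
    have h₂ := h.absClo_leaf (hMN (Fin.last n)) (hM _) (hN _)
    have h₃ := ACtx.guardedOff_of_plug (hg x (n + 1))
    rw [List.ofFn_succ', List.ofFn_succ', List.concat_eq_append, List.concat_eq_append,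
      Lam.apps_append, Lam.apps_append, E.enc_app, E.enc_app]
    refine (h.respects.app X hX).clo h.substClosed_leaf (fun j => ?_) (fun j => ?_) fun _ => h₃
    · refine Fin.cases h₁.to_true (fun j => ?_) j
      obtain rfl := Subsingleton.elim j 0
      exact h₂
    · refine Fin.cases (fun _ => h₁) (fun j hj => ?_) j
      obtain rfl := Subsingleton.elim j 0
      exact hj.elim

/-- Solvable terms with the same Boehm tree expand agents that are related by the contextual
closure, the related leaves being guarded. -/
theorem exists_absClo (h : E.CommonConditions Tv Tb eqv le)
    (hg : ∀ x n, (E.varCtx x n).Guarded) {k : ℕ} {M N : Lam V 0} {d : Lam.Node V}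
    (hM : M.HasHnf k d) (hMN : M.BTEq N) (hXM : Covers X M) (hXN : Covers X N) :
    ∃ F F', le (.abs F) (.abs (E.enc M)) ∧ le (.abs F') (.abs (E.enc N)) ∧
      AbsClo (Leaf E Tv Tb eqv) false (Env.const X Tv) Tb F F' := by
  obtain ⟨d', hN⟩ := hMN.hasHnf hM
  induction k generalizing X M N d d' with
  | zero =>
    obtain ⟨x, Ms, hM⟩ := Lam.hasHnf_zero hM
    obtain ⟨y, Ns, hN⟩ := Lam.hasHnf_zero hN
    obtain ⟨hxy, hs⟩ := Lam.BTEq.of_apps (v := .inl x) (w := .inl y) (hMN.of_headRed hM hN)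
    obtain rfl : x = y := by simpa using hxy
    refine ⟨_, _, h.le_of_headRed hM, h.le_of_headRed hN, ?_⟩
    obtain ⟨hl, hs⟩ := List.forall₂_iff_get.1 hs
    replace hXM := hXM.of_headRed hM
    replace hXN := hXN.of_headRed hN
    obtain ⟨n, Ms, rfl⟩ : ∃ (n : ℕ) (f : Fin n → Lam V 0), Ms = List.ofFn f :=
      ⟨_, Ms.get, (List.ofFn_get Ms).symm⟩
    obtain ⟨n', Ns, rfl⟩ : ∃ (n : ℕ) (f : Fin n → Lam V 0), Ns = List.ofFn f :=
      ⟨_, Ns.get, (List.ofFn_get Ns).symm⟩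
    rw [List.length_ofFn, List.length_ofFn] at hl
    subst hl
    refine h.absClo_apps hg hXM.1 (hXM.2 (Lam.mem_fv_apps.2 (.inl (by simp [Lam.fv])))) n
      (fun j => ?_) (fun j => hXM.of_apps (List.mem_ofFn.2 ⟨j, rfl⟩))
      fun j => hXN.of_apps (List.mem_ofFn.2 ⟨j, rfl⟩)
    simpa using hs j (by simp) (by simp)
  | succ k ih =>
    obtain ⟨P, hM, hP⟩ := Lam.hasHnf_succ hM
    obtain ⟨Q, hN, hQ⟩ := Lam.hasHnf_succ hN
    replace hMN := (hMN.of_headRed hM hN).of_lam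
    have hXP := hXM.of_headRed hM
    have hXQ := hXN.of_headRed hN
    obtain ⟨x, hx⟩ := h.infinite.exists_subtype_notMem X
    have hxP : (x : ℕ) ∉ P.fv := fun h => hx (hXP.2 h)
    have hxQ : (x : ℕ) ∉ Q.fv := fun h => hx (hXQ.2 h)
    obtain ⟨d₁, hP⟩ := hP.openWith x
    obtain ⟨d₂, hQ⟩ := hQ.openWith x
    obtain ⟨F, F', h₁, h₂, h₃⟩ := ih hP (hMN.openWith hxP hxQ) (hXP.of_lam x) (hXQ.of_lam x) _ hQ
    refine ⟨_, _, h.precongruence.trans _ _ _ (h.le_fill_lam h₁ x) ?_,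
      h.precongruence.trans _ _ _ (h.le_fill_lam h₂ x) ?_,
      h.respects.lam_clo h.substClosed_leaf hXM.1 hx h₃⟩
    · rw [← E.enc_lam, Lam.abs_open hxP]
      exact h.le_of_headRed hM
    · rw [← E.enc_lam, Lam.abs_open hxQ]
      exact h.le_of_headRed hN

/-- A plain precongruence is closed under instantiation and substitution, so the comparison of
abstractions passes to the processes of `BTRel`. -/
theorem exists_clo_of_btRel (h : E.CommonConditions Tv Tb eqv le)
    (hg : ∀ x n, (E.varCtx x n).Guarded) {Γ : Env} {P Q : Proc 0} (hPQ : E.BTRel Tv Tb Γ P Q) :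
    ∃ P₀ Q₀, le (.proc P₀) (.proc P) ∧ le (.proc Q₀) (.proc Q) ∧
      Clo (Leaf E Tv Tb eqv) false Γ P₀ Q₀ := by
  obtain ⟨M, N, X, z, ρ, h₁, h₂, h₃, h₄, h₅, h₆, rfl, rfl⟩ := hPQ
  obtain ⟨k, d, hM⟩ := Lam.solvable_iff.1 h₂
  obtain ⟨F, F', k₁, k₂, k₃⟩ := h.exists_absClo hg hM h₁ h₃ h₄
  have hp := h.precongruence
  exact ⟨_, _, hp.subst h.plain (hp.inst1 h.plain k₁ z) ρ, hp.subst h.plain (hp.inst1 h.plain k₂ z) ρ,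
    (k₃.inst1 h.substClosed_leaf (Env.lookup_const_of_notMem Tv h₅)).subst h.substClosed_leaf h₆⟩

end CommonConditions

end Encoding

theorem Weak.weakHat {P P' : Proc 0} {μ : Act} (h : Weak P μ P') : WeakHat P μ P' := by
  by_cases hμ : μ = .tau
  · subst hμ
    obtain ⟨Q, Q', h₁, h₂, h₃⟩ := h
    exact .inl ⟨rfl, (h₁.tail h₂).trans h₃⟩
  · exact .inr ⟨hμ, h⟩

/-- `BTRel` satisfies the clause of the up-to technique by a diagram with three squares: expansion
from `P` to `P₀`, `Clo.step` from `P₀` to `Q₀`, and expansion from `Q₀` to `Q`. -/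
theorem Encoding.CommonConditions.completeForBT {V : Set ℕ} {E : Encoding V} {Tv Tb : Ty 0}
    {eqv : TypedRel} {le : Agent → Agent → Prop} (h : E.CommonConditions Tv Tb eqv le)
    (hexp : IsExpansion fun P Q => le (.proc P) (.proc Q)) (hup : ValidatesUpTo eqv le)
    (hg : ∀ x n, (E.varCtx x n).Guarded) : E.CompleteForBT Tv Tb eqv := by
  have key := hup (E.BTRel Tv Tb) h.wellTyped_btRel (fun _ _ _ => BTRel.symm) ?_
  · intro M N X hXM hXN hMN
    have hMN : M.BTEq N := fun p l => Set.ext_iff.1 hMN (p, l)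
    by_cases hM : M.Solvable
    · obtain ⟨z, hz⟩ := Infinite.exists_notMem_finset X
      exact h.congruence.of_inst1 (key _ _ _ (CommonConditions.btRel_inst1 hMN hM hXM hXN hz))
        (Env.lookup_const_of_notMem Tv hz) (notMem_fn E hXM hz) (notMem_fn E hXN hz)
    · exact h.rel_of_unsolvable hXM hXN hM fun hN => hM (hMN.symm.solvable hN)
  · intro Γ P Q hPQ μ P' hstep hμQ hμΓ
    obtain ⟨P₀, Q₀, hP, hQ, hclo⟩ := h.exists_clo_of_btRel hg hPQ
    have finish : ∀ {P₁ Q₁ Γ'}, Clo (CommonConditions.Leaf E Tv Tb eqv) true Γ' P₁ Q₁ →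
        ∀ {Q'}, le (.proc P₁) (.proc P') → le (.proc Q₁) (.proc Q') → Residual Γ μ Γ' →
        ∃ (n : ℕ) (C : PCtx (Fin n) (Fin 0)) (Ps Qs : Fin n → Proc 0) (Δ : Fin n → Env)
          (Γ' : Env), Residual Γ μ Γ' ∧ C.Typed Δ Fin.elim0 Γ' ∧
          le (.proc (C.fill Ps Fin.elim0)) (.proc P') ∧
          le (.proc (C.fill Qs Fin.elim0)) (.proc Q') ∧
          ∀ i, eqv (Δ i) .proc (.proc (Ps i)) (.proc (Qs i)) ∨
            (E.BTRel Tv Tb (Δ i) (Ps i) (Qs i) ∧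
              (C.OccursUnderInput i → ∀ (σ : ℕ → ℕ) (Θ : Env), Env.IsSubst σ (Δ i) Θ →
                E.BTRel Tv Tb Θ ((Ps i).subst σ) ((Qs i).subst σ))) := by
      intro P₁ Q₁ Γ' hC Q' h₁ h₂ hres
      obtain ⟨n, C, Ps, Qs, Δ, hCt, rfl, rfl, hl⟩ := hC.exists_context_fin
      exact ⟨n, C, Ps, Qs, Δ, Γ', hres, hCt, h₁, h₂, fun i => (hl i).imp_right fun hi =>
        ⟨hi, fun _ σ Θ hσ => E.substClosed_btRel Tv Tb _ _ _ hi σ Θ hσ⟩⟩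
    -- Free names of `P₀` are assigned in `Γ`, for which the bound names of the action are fresh.
    have hμP : Disjoint μ.bn P₀.fn := Finset.disjoint_left.2 fun x hx hxP =>
      hclo.lookup_ne_none_left h.wellTyped_leaf x hxP (hμΓ x hx)
    obtain ⟨μ₁, P₁, hμ₁, hP₁ | ⟨rfl, rfl⟩, hle⟩ := (hexp _ _ hP).2 μ P' hstep hμP
    · have hμ₁Γ : ∀ x ∈ μ₁.bn, Γ.lookup x = none := hμ₁.bn_eq ▸ hμΓ
      obtain ⟨Q₁, hQ₁, hd⟩ := Clo.step h.wellTyped_leaf h.substClosed_leaf _ rfl hP₁ hclo hμ₁Γ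
      obtain ⟨Γ', hres, hC⟩ := hd.residual hP₁ hμ₁Γ
      obtain ⟨μ₂, Q', hμ₂, hw, hle'⟩ := (hexp _ _ hQ).1 μ₁ Q₁ hQ₁ (hμ₁.bn_eq ▸ hμQ)
      exact ⟨μ₂, Q', hμ₁.trans hμ₂, hw.weakHat, finish hC hle hle' (hres.same hμ₁.symm)⟩
    -- Here `P₀` does not move and the action is internal. `Q` stays idle too, and the common
    -- structure of `P₀` and `Q₀` is the context sought.
    · cases hμ₁
      exact ⟨_, Q, .tau, .inl ⟨rfl, .refl⟩, finish hclo.to_true hle hQ (.tau Γ)⟩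

/-! ## Soundness -/

namespace RendezvousTyping

variable {Γ Γ' : Env} {bs cs : List (ℕ × Ty 0)} {a b r : ℕ} {T : Ty 0}

/-- Inclusion of `≥` in `≍` is available only between typed agents, so the rendez-vous itself must
be seen to be typed. -/
theorem typed (h : RendezvousTyping Γ bs cs a b r T Γ') {P : Proc 0}
    (hP : P.Typed (Γ'.insert r T)) : (rendezvous bs cs a b r P).Typed Γ := by
  obtain ⟨Γ₁, Γ₂, Γ₃, Γ₂', Γ₃', c, c', U, hU, -, -, hc', ha, hcs, hb, h₃, h₂, h₁⟩ := h.splits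
  obtain ⟨Γ₁₂, h₁₂, h₃'⟩ := Env.Join.assoc' h₂ h₁
  have hS : WellTyped fun _ _ _ => False := fun _ _ _ h => h.elim
  have key : (Proc.par (.out (.fr a) (cs.map fun p => .fr p.1))
      (.inp (.fr b) 1 (P.bind1 r))).Typed (Γ.extend bs) := by
    refine .par ?_ (.inp (l := [(r, T)]) (.inl rfl) hb (.one T) rfl (by simp) ?_ ?_ h₃) h₃'
    · exact .out hc' ha hU hcs h₁₂
    · simp only [List.map_cons, List.map_nil, List.mem_singleton]
      rintro x rfl
      exact ⟨fun hx => (Proc.mem_fn_bind1.1 hx).2 rfl, h.r_fresh.2.2⟩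
    · change Proc.Typed (Γ'.insert r T) ((P.bind1 r).inst1 r)
      rwa [Proc.bind1_inst1_self]
  exact ((Clo.of_typed (S := fun _ _ _ => False) true key).resList h.nodup h.fresh |>.typed hS).1

theorem b_mem_map (h : RendezvousTyping Γ bs cs a b r T Γ') : b ∈ bs.map Prod.fst :=
  List.mem_map.2 ⟨_, h.b_mem, rfl⟩

end RendezvousTyping

namespace Encoding

namespace CommonConditions

variable {V : Set ℕ} {E : Encoding V} {Tv Tb : Ty 0} {eqv : TypedRel}
  {le : Agent → Agent → Prop} {X Y : Finset ℕ}

/-- Contexts with inverse can be cancelled. -/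
theorem rel_of_hasInverse (h : E.CommonConditions Tv Tb eqv le) (hr : RendezvousCancellation eqv)
    {n : ℕ} {C : ACtx (Fin 0) (Fin n)} (hC : E.HasInverse Tv Tb le C X Y) {Ms Ns : Fin n → Lam V 0}
    (hM : ∀ j, Covers Y (Ms j)) (hN : ∀ j, Covers Y (Ns j))
    (hMN : eqv (Env.const X Tv) (.abs Tb) (.abs (C.fill Fin.elim0 fun j => E.enc (Ms j)))
      (.abs (C.fill Fin.elim0 fun j => E.enc (Ns j)))) (i : Fin n) :
    E.Rel Tv Tb eqv Y (Ms i) (Ns i) := by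
  obtain ⟨D, Γ, bs, cs, a, b, z, ha, hb, hz, hR, hD, hinv⟩ := hC i
  have hz' := Env.lookup_const_of_notMem Tv hz
  have happ : ∀ {M : Lam V 0}, Covers Y M →
      (Proc.app (E.enc M) (.fr z)).Typed ((Env.const Y Tv).insert z Tb) := by
    intro M hM
    cases h.typed hM with
    | abs h₁ h₂ h₃ =>
      exact .app h₁ h₂ h₃ (Env.hasTy_singleton z Tb) (Env.join_singleton Tb hz').symm
  have hfn : ∀ {M : Lam V 0} {x : ℕ}, Covers Y M → x ∉ Y → x ≠ z →
      x ∉ (Proc.app (E.enc M) (.fr z)).fn := by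
    intro M x hM hx hxz
    simp only [Proc.fn, Nm.fn, Finset.mem_union, Finset.mem_singleton, not_or]
    exact ⟨notMem_fn E hM hx, hxz⟩
  -- Both encodings are placed in the inverse context `D`, and `≥` then replaces the two results by
  -- rendez-vous with continuations that encode the chosen arguments.
  have hDMN := h.congruence.proc 0 1 D Fin.elim0 _ Γ Fin.elim0 Fin.elim0
    ![C.fill Fin.elim0 fun j => E.enc (Ms j)] ![C.fill Fin.elim0 fun j => E.enc (Ns j)] hD nofun
    fun j => by obtain rfl := Subsingleton.elim j 0; exact hMN
  obtain ⟨h₁, h₂⟩ := h.congruence.typed _ _ _ _ hDMN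
  have h₃ := h.congruence.trans _ _ _ _ _
    (h.congruence.symm _ _ _ _
      (h.contains _ _ _ _ h₁ (.proc (hR.typed (happ (hM i)))) (hinv Ms hM)))
    (h.congruence.trans _ _ _ _ _ hDMN
      (h.contains _ _ _ _ h₂ (.proc (hR.typed (happ (hN i)))) (hinv Ns hN)))
  -- The continuations mention `z` through the application, so the names of the rendez-vous must
  -- differ from `z` as well as from the variables in `Y`.
  have haz : a ≠ z := hR.r_fresh.1.symm
  have hbz : b ≠ z := fun e => hR.r_fresh.2.1 (e ▸ hR.b_mem_map)
  have h₄ := hr _ _ _ _ _ _ _ _ _ _ hR (hfn (hM i) ha haz) (hfn (hN i) ha haz)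
    (hfn (hM i) hb hbz) (hfn (hN i) hb hbz) (happ (hM i)) (happ (hN i)) h₃
  exact h.congruence.of_inst1 (h.congruence.plain h.contains h.plain ((h.typed (hM i)).inst1 hz')
    ((h.typed (hN i)).inst1 hz') h₄) hz' (notMem_fn E (hM i) hz) (notMem_fn E (hN i) hz)

theorem rel_reduce (h : E.CommonConditions Tv Tb eqv le) {M M' N N' : Lam V 0} (hXM : Covers X M)
    (hXN : Covers X N) (hM : M.HeadRed M') (hN : N.HeadRed N') (hMN : E.Rel Tv Tb eqv X M N) :
    E.Rel Tv Tb eqv X M' N' :=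
  h.rel_trans (h.rel_symm (h.rel_of_headRed hXM hM))
    (h.rel_trans hMN (h.rel_of_headRed hXN hN))

variable (h : E.CommonConditions Tv Tb eqv le) (hS : E.SoundnessConditions Tv Tb eqv le)

include h hS

/-- The abstraction context with a fresh variable has an inverse, so it is cancelled and the bodies
are compared with that variable free. -/
theorem rel_open {P Q : Lam V 1} (hP : Covers X (.lam P)) (hQ : Covers X (.lam Q))
    (hPQ : E.Rel Tv Tb eqv X (.lam P) (.lam Q)) {x : V} (hx : (x : ℕ) ∉ X) :
    E.Rel Tv Tb eqv (insert (x : ℕ) X) (P.openWith x) (Q.openWith x) := by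
  have key : ∀ M : Lam V 0, (fun j : Fin 1 => E.enc (![M] j)) = ![E.enc M] := fun M => by
    funext j
    obtain rfl := Subsingleton.elim j 0
    rfl
  have := h.rel_of_hasInverse hS.cancellation (hS.inverse_lam x X hP.1 hx)
    (Ms := ![P.openWith x]) (Ns := ![Q.openWith x])
    (fun j => by obtain rfl := Subsingleton.elim j 0; exact hP.of_lam x)
    (fun j => by obtain rfl := Subsingleton.elim j 0; exact hQ.of_lam x)
  refine this ?_ 0
  rw [key, key, ← E.enc_lam, ← E.enc_lam, Lam.abs_open fun h => hx (hP.2 h),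
    Lam.abs_open fun h => hx (hQ.2 h)]
  exact hPQ

theorem rel_apps_arg {x : V} {n : ℕ} {Ms Ns : Fin n → Lam V 0}
    (hM : Covers X (.apps (.fvar x) (List.ofFn Ms)))
    (hN : Covers X (.apps (.fvar x) (List.ofFn Ns)))
    (hMN : E.Rel Tv Tb eqv X (.apps (.fvar x) (List.ofFn Ms)) (.apps (.fvar x) (List.ofFn Ns)))
    (j : Fin n) : E.Rel Tv Tb eqv X (Ms j) (Ns j) := by
  rw [Rel, enc_apps, enc_apps] at hMN
  exact h.rel_of_hasInverse hS.cancellation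
    (hS.inverse_var x n X hM.1 (hM.2 (Lam.mem_fv_apps.2 (.inl (by simp [Lam.fv])))))
    (fun j => hM.of_apps (List.mem_ofFn.2 ⟨j, rfl⟩))
    (fun j => hN.of_apps (List.mem_ofFn.2 ⟨j, rfl⟩)) hMN j

theorem not_rel_lam_apps {P : Lam V 1} (hP : Covers X (.lam P)) (hPs : P.Solvable) {y : V}
    {Ms : List (Lam V 0)} (hM : Covers X (.apps (.fvar y) Ms)) :
    ¬ E.Rel Tv Tb eqv X (.lam P) (.apps (.fvar y) Ms) := by
  obtain ⟨x, hx⟩ := h.infinite.exists_subtype_notMem X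
  obtain ⟨k, d, hd⟩ := Lam.solvable_iff.1 hPs
  have hxP : (x : ℕ) ∉ P.fv := fun h => hx (hP.2 h)
  rw [← Lam.abs_open hxP] at hP ⊢
  exact hS.solvable_var x y _ Ms X hP hM (Lam.solvable_iff.2 ⟨k, hd.openWith x⟩)

/-- By reduction to the head normal form: Ω is separated from applied variables, and from
abstractions of solvable terms. -/
theorem not_rel_omega {M : Lam V 0} (hM : Covers X M) (hs : M.Solvable) :
    ¬ E.Rel Tv Tb eqv X M .omegaTerm := by
  intro hr
  obtain ⟨k, d, hd⟩ := Lam.solvable_iff.1 hs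
  cases k with
  | zero =>
    obtain ⟨x, Ms, hx⟩ := Lam.hasHnf_zero hd
    exact hS.omega_var x Ms X (hM.of_headRed hx)
      (h.rel_symm (h.rel_reduce hM (covers_omega hM.1) hx .refl hr))
  | succ k =>
    obtain ⟨P, hP, hd⟩ := Lam.hasHnf_succ hd
    obtain ⟨x, hx⟩ := h.infinite.exists_subtype_notMem X
    have hr' := h.rel_reduce hM (covers_omega hM.1) hP .refl hr
    replace hM := hM.of_headRed hP
    have hxP : (x : ℕ) ∉ P.fv := fun h => hx (hM.2 h)
    rw [← Lam.abs_open hxP] at hM hr'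
    exact hS.solvable_omega x _ X hM (Lam.solvable_iff.2 ⟨k, hd.openWith x⟩) hr'

theorem solvable_of_rel {M N : Lam V 0} (hM : Covers X M) (hN : Covers X N)
    (hMN : E.Rel Tv Tb eqv X M N) (hs : M.Solvable) : N.Solvable := by
  by_contra hN'
  exact h.not_rel_omega hS hM hs (h.rel_trans hMN (h.rel_omega hN hN'))

/-- Outer induction on the length of the position, inner induction on the number of abstractions of
the head normal form. Abstractions are removed by `rel_open` at the same position; arguments are
reached by `rel_apps_arg` at a shorter one. -/
theorem bTAt_of_rel {M N : Lam V 0} (hM : Covers X M) (hN : Covers X N)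
    (hMN : E.Rel Tv Tb eqv X M N) {p : List ℕ} {l : Lam.BTLabel V} (hl : M.BTAt p l) :
    N.BTAt p l := by
  induction hp : p.length using Nat.strong_induction_on generalizing X M N p l with
  | _ m ih =>
  by_cases hs : M.Solvable
  swap
  · have hs' : ¬ N.Solvable := fun h' => hs (h.solvable_of_rel hS hN hM (h.rel_symm hMN) h')
    cases p with
    | nil =>
      obtain ⟨-, rfl⟩ | ⟨k, d, h', -⟩ := Lam.bTAt_nil.1 hl
      · exact .bot hs'
      · exact absurd (Lam.solvable_iff.2 ⟨k, d, h'⟩) hs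
    | cons i p =>
      obtain ⟨k, d, -, h', -⟩ := Lam.bTAt_cons.1 hl
      exact absurd (Lam.solvable_iff.2 ⟨k, d, h'⟩) hs
  obtain ⟨k, d, hd⟩ := Lam.solvable_iff.1 hs
  obtain ⟨k', d', hd'⟩ := Lam.solvable_iff.1 (h.solvable_of_rel hS hM hN hMN hs)
  clear hs
  -- The label has to vary in the inner induction, since removing an abstraction or opening a
  -- variable changes labels.
  revert l
  induction k generalizing X M N d k' d' with
  | zero =>
    intro l hl
    obtain ⟨x, Ms, hx⟩ := Lam.hasHnf_zero hd
    cases k' with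
    | zero =>
      obtain ⟨y, Ns, hy⟩ := Lam.hasHnf_zero hd'
      replace hMN := h.rel_reduce hM hN hx hy hMN
      replace hM := hM.of_headRed hx
      replace hN := hN.of_headRed hy
      rw [Lam.bTAt_of_headRed hx] at hl
      rw [Lam.bTAt_of_headRed hy]
      obtain rfl : x = y := by_contra fun hxy => hS.var_var x y Ms Ns X hM hN hxy hMN
      have hlen : Ms.length = Ns.length :=
        by_contra fun hne => hS.var_length x Ms Ns X hM hN hne hMN
      obtain ⟨n, Ms, rfl⟩ : ∃ (n : ℕ) (f : Fin n → Lam V 0), Ms = List.ofFn f :=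
        ⟨_, Ms.get, (List.ofFn_get Ms).symm⟩
      obtain ⟨n', Ns, rfl⟩ : ∃ (n : ℕ) (f : Fin n → Lam V 0), Ns = List.ofFn f :=
        ⟨_, Ns.get, (List.ofFn_get Ns).symm⟩
      rw [List.length_ofFn, List.length_ofFn] at hlen
      subst hlen
      cases p with
      | nil =>
        exact (Lam.bTAt_apps_nil (v := .inl x)).2 ((Lam.bTAt_apps_nil (v := .inl x)).1 hl)
      | cons i p =>
        obtain ⟨M', hi, hl⟩ := (Lam.bTAt_apps_cons (v := .inl x)).1 hl
        obtain ⟨hi', rfl⟩ := List.getElem?_eq_some_iff.1 hi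
        rw [List.length_ofFn] at hi'
        rw [List.getElem_ofFn] at hl
        refine (Lam.bTAt_apps_cons (v := .inl x)).2 ⟨Ns ⟨i, hi'⟩, by simp [hi'], ?_⟩
        exact ih p.length (by simp [← hp]) (hM.of_apps (List.mem_ofFn.2 ⟨_, rfl⟩))
          (hN.of_apps (List.mem_ofFn.2 ⟨_, rfl⟩)) (h.rel_apps_arg hS hM hN hMN ⟨i, hi'⟩) hl rfl
    | succ k' =>
      obtain ⟨Q, hQ, hd'⟩ := Lam.hasHnf_succ hd'
      -- An abstraction of a solvable term is not related to an applied variable, so the numbers of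
      -- abstractions cannot differ.
      exact absurd (h.rel_symm (h.rel_reduce hM hN hx hQ hMN)) (h.not_rel_lam_apps hS
        (hN.of_headRed hQ) (Lam.solvable_iff.2 ⟨_, _, hd'⟩) (hM.of_headRed hx))
  | succ k ihk =>
    obtain ⟨P, hP, hd⟩ := Lam.hasHnf_succ hd
    cases k' with
    | zero =>
      obtain ⟨y, Ns, hy⟩ := Lam.hasHnf_zero hd'
      exact absurd (h.rel_reduce hM hN hP hy hMN) (h.not_rel_lam_apps hS
        (hM.of_headRed hP) (Lam.solvable_iff.2 ⟨_, _, hd⟩) (hN.of_headRed hy))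
    | succ k' =>
      obtain ⟨Q, hQ, hd'⟩ := Lam.hasHnf_succ hd'
      replace hMN := h.rel_reduce hM hN hP hQ hMN
      replace hM := hM.of_headRed hP
      replace hN := hN.of_headRed hQ
      simp only [Lam.bTAt_of_headRed hP, Lam.bTAt_of_headRed hQ]
      obtain ⟨x, hx⟩ := h.infinite.exists_subtype_notMem X
      obtain ⟨e, hd⟩ := hd.openWith x
      obtain ⟨e', hd'⟩ := hd'.openWith x
      exact Lam.bTAt_lam_mono.2 ((Lam.bTAt_open_mono (fun h => hx (hM.2 h))
        fun h => hx (hN.2 h)).1 fun l hl => ihk (hM.of_lam x) (hN.of_lam x)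
          (h.rel_open hS hM hN hMN hx) e hd k' e' hd' hl)

theorem soundForBT : E.SoundForBT Tv Tb eqv := fun _ _ _ hM hN hMN => Set.ext fun _ =>
  ⟨h.bTAt_of_rel hS hM hN hMN, h.bTAt_of_rel hS hN hM (h.rel_symm hMN)⟩

end CommonConditions

end Encoding

/-! ### Full abstraction -/

theorem mainTheorem8 {V : Set ℕ} (hV : V.Infinite) (E : Encoding V) (Tv Tb : Ty 0)
    (hTv : ¬ Tv.Linear) (hE : E.Respects Tv Tb)
    (eqv : TypedRel) (le : Agent → Agent → Prop)
    (hC : E.CompletenessConditions Tv Tb eqv le) (hS : E.SoundnessConditions Tv Tb eqv le) :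
    E.FullyAbstractForBT Tv Tb eqv := by
  have h : E.CommonConditions Tv Tb eqv le :=
    ⟨hV, hE, hC.congruence, hC.contains, hC.precongruence, hC.plain, hC.beta,
      hC.unsolvable_zero, hC.unsolvable_infinite⟩
  exact ⟨h.soundForBT hS, h.completeForBT hC.expansion hC.upTo hC.guarded⟩
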